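/- **Superrings.** For $k\ge 0$ let $\Omega_k=\mathbb Q[x_1,\dots,x_k]\otimes\bigwedge(s_1,\dots,s_k)$ and $\Omega_{k,k+1}=\mathbb Q[w_1,\dots,w_k,\xi]\otimes\bigwedge(\sigma_1,\dots,\sigma_{k+1})$, graded by $(q\text{-degree},\lambda\text{-degree})\in\mathbb Z\times\mathbb Z$ and parity: $x_i,w_i$ are even of degree $(2i,0)$, $\xi$ is even of degree $(2,0)$, and $s_i,\sigma_i$ are odd of degree $(-2i,2)$. Let $\phi^*\colon\Omega_k\to\Omega_{k,k+1}$, $x_i\mapsto w_i$, $s_i\mapsto\sigma_i+\xi\sigma_{i+1}$, and $\psi^*\colon\Omega_{k+1}\to\Omega_{k,k+1}$, $x_i\mapsto w_i+\xi w_{i-1}$, $s_i\mapsto\sigma_i$ (where $w_0=1$, $w_{k+1}=0$). Through these maps $\Omega_{k,k+1}$ is an $(\Omega_k,\Omega_{k+1})$-superbimodule, and it is written $\Omega_{k+1,k}$ when viewed as an $(\Omega_{k+1},\Omega_k)$-superbimodule. Let $S_k=\Omega_k/(\Omega_k)_+$, where $(\Omega_k)_+$ is generated by the elements of nonzero bidegree.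 $\langle r,s\rangle$ denotes the shift of bidegrees up by $(r,s)$ and $\Pi$ the parity shift. **Categories.** Let $\mathcal M_k$ be the category of bigraded left $\Omega_k$-supermodules $M$ (with degree preserving maps) that have finite-dimensional homogeneous parts and are left bounded, i.e. the bidegrees of $M$ lie in a translate of a cone $\{(i,j): j\ge 0,\ i+cj\ge 0\}$ for some $c\in\mathbb N$ (depending on $M$). Let $\mathcal M_k^\lambda$ be the full subcategory of modules whose $\lambda$-degrees are bounded above and below, and $\mathcal P_k$ the full subcategory of projective objects of $\mathcal M^\lambda_k$. Define $$F_k(M)=\Omega_{k+1,k}\otimes_{\Omega_k}M\,\langle -k,0\rangle,\qquad E_k(M)=\Omega_{k,k+1}\otimes_{\Omega_{k+1}}M\,\langle k+2,-1\rangle,\qquad K_k(M)=M\langle -2k-1,1\rangle ,$$ and let $F,E,K$ be the direct sums over $k\ge0$ of these functors ($E$ is zero on $\mathcal M_0$). **Rings and Grothendieck groups.** Let $R=\mathbb Q[\![q]\!][q^{-1},\lambda^{\pm1}]$, and let $\widehat R$ be the ring of Laurent series in $q,\lambda$ over $\mathbb Q$ with support in a translate of a cone as above. Let $K_0(\mathcal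 M)=\bigoplus_k\boldsymbol K_0(\mathcal P_k)$, $G_0(\mathcal M)=\bigoplus_k\boldsymbol G_0(\mathcal M^\lambda_k)$, $\widehat G_0(\mathcal M)=\bigoplus_k\boldsymbol G_0(\mathcal M_k)$ be the topological Grothendieck groups, with scalars extended to $\mathbb Q$-coefficients and specialised at $\pi=-1$. They are modules over $R$, $R$, $\widehat R$ respectively. Here $\boldsymbol K_0$ is the split Grothendieck group, where a series $p=\sum_{i,j,\varepsilon}k_{i,j,\varepsilon}\pi^\varepsilon q^i\lambda^j$ with $k_{i,j,\varepsilon}\in\mathbb N$ acts by $p[A]=[A^{\oplus p}]$, $A^{\oplus p}=\bigoplus(\Pi^\varepsilon A\langle i,j\rangle)^{\oplus k_{i,j,\varepsilon}}$; and $\boldsymbol G_0$ is the Grothendieck group of short exact sequences with the same action, modulo the differences $[M]-[N]$ of objects having (possibly infinite, locally finite) composition series with the same simple factors with the same multiplicities. **Representations.** $U_q(\mathfrak{sl}_2)$ is the $\mathbb Q(q)$-algebra generated by $E,F,K^{\pm1}$ with $KE=q^2EK$, $KF=q^{-2}FK$, $EF-FE=\frac{K-K^{-1}}{q-q^{-1}}$.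 Put $\mu=\lambda q^{-1}$, $[n]=\frac{q^n-q^{-n}}{q-q^{-1}}$ and $[\mu,n]=\frac{\mu q^n-\mu^{-1}q^{-n}}{q-q^{-1}}$. Let $M=M(\lambda q^{-1})$ be the universal Verma module over $R$: the module induced from the module $Rm_0$ over the subalgebra generated by $E,K^{\pm1}$ with $Em_0=0$, $Km_0=\mu m_0$. Its canonical basis is $m_k=F^km_0/[k]!$. Let $\widehat M$ be the corresponding Verma module over $\widehat R$, with the dual canonical basis $m^k=\langle m_k,m_k\rangle^{-1}m_k$, where $$\langle m_k,m_k\rangle=\frac1{[k]!}\prod_{j=0}^{k-1}\mu q^{-2j-1}[\mu,-j]$$ is the value of the universal Shapovalov form (invertible in $\widehat R$). Let $M^*$ be the free $R$-module on $m^0,m^1,\dots$ with the action $$K^{\pm1}m^k=(\mu q^{-2k})^{\pm1}m^k,\qquad Fm^k=[\mu,-k]\,\mu q^{-2k-1}m^{k+1},\qquad Em^k=[k]\,\mu^{-1}q^{2k-1}m^{k-1}\quad(Em^0=0).$$ **Theorem.** The functors $F,E,K$ preserve the categories above and induce operators on $K_0(\mathcal M)$, $G_0(\mathcal M)$ and $\widehat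 G_0(\mathcal M)$ that define actions of $U_q(\mathfrak{sl}_2)$. With these actions there are $R$-linear isomorphisms of $U_q(\mathfrak{sl}_2)$-representations $$K_0(\mathcal M)\cong M,\qquad G_0(\mathcal M)\cong M^*,$$ and an $\widehat R$-linear isomorphism of $U_q(\mathfrak{sl}_2)$-representations $\widehat G_0(\mathcal M)\cong\widehat M$. The isomorphisms for $K_0$ and $\widehat G_0$ send $[\Omega_k]$ to $m_k$, those for $G_0$ and $\widehat G_0$ send $[S_k]$ to $m^k$. Every indecomposable projective object is isomorphic to some $\Pi^\varepsilon\Omega_k\langle i,j\rangle$ and every simple object to some $\Pi^\varepsilon S_k\langle i,j\rangle$; their classes are sent to $(-1)^\varepsilon q^i\lambda^jm_k$ (for $K_0$, $\widehat G_0$) and $(-1)^\varepsilon q^i\lambda^jm^k$ (for $G_0$, $\widehat G_0$) respectively. -/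

import Mathlib

open scoped TensorProduct DirectSum

noncomputable section

namespace VermaCat

/-! ## Quantum `sl2` over `ℚ(q)` -/

/-- The field `ℚ(q)`. -/
abbrev Kq : Type := RatFunc ℚ

/-- The variable `q`. -/
def q : Kq := RatFunc.X

theorem q_ne_zero : q ≠ 0 := RatFunc.X_ne_zero

theorem q_sub_inv_ne_zero : q - q⁻¹ ≠ 0 := by
  intro h
  have h2 : q ^ 2 = 1 := by
    have h3 := sub_eq_zero.mp h
    calc q ^ 2 = q * q := sq q
      _ = q * q⁻¹ := by rw [← h3]
      _ = 1 := mul_inv_cancel₀ q_ne_zero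
  have h4 : algebraMap (Polynomial ℚ) (RatFunc ℚ) (Polynomial.X ^ 2)
      = algebraMap (Polynomial ℚ) (RatFunc ℚ) 1 := by
    rw [map_pow, RatFunc.algebraMap_X, map_one]; exact h2
  have h5 := RatFunc.algebraMap_injective ℚ h4
  have h6 := congrArg Polynomial.natDegree h5
  simp at h6

/-- The quantum integer `[n] = (q^n - q^{-n}) / (q - q^{-1})`. -/
def qint (n : ℤ) : Kq := (q ^ n - q ^ (-n)) / (q - q⁻¹)

/-- The quantum factorial `[k]! = [1][2]⋯[k]`. -/
def qfact (k : ℕ) : Kq := ∏ i ∈ Finset.range k, qint (i + 1)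

/-- The generators of `U_q(sl2)`. -/
inductive UqGen : Type
  | E | F | K | Kinv

/-- The free generator of the free `ℚ(q)`-algebra attached to `g`. -/
abbrev fgen (g : UqGen) : FreeAlgebra Kq UqGen := FreeAlgebra.ι Kq g

/-- The defining relations of `U_q(sl2)`. -/
inductive UqRel : FreeAlgebra Kq UqGen → FreeAlgebra Kq UqGen → Prop
  | K_Kinv : UqRel (fgen .K * fgen .Kinv) 1
  | Kinv_K : UqRel (fgen .Kinv * fgen .K) 1
  | K_E : UqRel (fgen .K * fgen .E) (q ^ 2 • (fgen .E * fgen .K))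
  | K_F : UqRel (fgen .K * fgen .F) ((q ^ 2)⁻¹ • (fgen .F * fgen .K))
  | E_F : UqRel (fgen .E * fgen .F - fgen .F * fgen .E)
      ((q - q⁻¹)⁻¹ • (fgen .K - fgen .Kinv))

/-- The quantum algebra `U_q(sl2)` over `ℚ(q)`. -/
def Uq : Type := RingQuot UqRel

instance : Ring Uq := inferInstanceAs (Ring (RingQuot UqRel))
instance : Algebra Kq Uq := inferInstanceAs (Algebra Kq (RingQuot UqRel))

/-- The generator `g` of `U_q(sl2)`. -/
def ugen (g : UqGen) : Uq := RingQuot.mkAlgHom Kq UqRel (fgen g)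

/-! ## Verma modules over a commutative `ℚ(q)`-algebra -/

section Verma

variable (R : Type) [CommRing R] [Algebra Kq R]

/-- `U_q(sl2)` with scalars extended to `R`. -/
abbrev UqOver : Type := R ⊗[Kq] Uq

/-- The generator `g` of `U_q(sl2)` with scalars extended to `R`. -/
def rgen (g : UqGen) : UqOver R := 1 ⊗ₜ[Kq] ugen g

/-- The left ideal generated by `E` and `K - μ`. -/
def vermaIdeal (μ : R) : Ideal (UqOver R) :=
  Ideal.span {rgen R .E, rgen R .K - algebraMap R (UqOver R) μ}

/-- The Verma module over `R` of highest weight `μ`: the module induced from the one-dimensional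
module `R v` over the subalgebra generated by `E, K, K⁻¹`, on which `E` acts by `0` and `K` by `μ`.
Inducing is the same as dividing `U_q(sl2)` over `R` by the left ideal generated by the
annihilator of `v` in that subalgebra, that is, by `E` and `K - μ`. -/
abbrev Verma (μ : R) : Type := UqOver R ⧸ vermaIdeal R μ

/-- The canonical basis vector `m_k = F^{(k)} m_0 = F^k m_0 / [k]!`. -/
def canon (μ : R) (k : ℕ) : Verma R μ :=
  Submodule.Quotient.mk (algebraMap Kq (UqOver R) (qfact k)⁻¹ * rgen R .F ^ k)

/-- `q` as a unit of `R`. -/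
def qu : Rˣ := Units.map (algebraMap Kq R).toMonoidHom (Units.mk0 q q_ne_zero)

variable {R}

/-- `(u - u⁻¹) / (q - q⁻¹)`. With `u = q ^ n` this is the quantum integer `[n]`, and with
`u = μ q ^ n` it is `[μ, n]`. -/
def bracket (u : Rˣ) : R :=
  algebraMap Kq R (q - q⁻¹)⁻¹ * ((u : R) - ((u⁻¹ : Rˣ) : R))

/-- The value `⟨m_k, m_k⟩` of the universal Shapovalov form on the `k`-th canonical basis vector of
the Verma module of highest weight `μ`. Writing `μ = λ q⁻¹` it is
`λ^k q^{-k(k+1)} [λ,-1] [λ,-2] ⋯ [λ,-k] / [k]!`. -/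
def shap (μ : Rˣ) (k : ℕ) : R :=
  algebraMap Kq R (qfact k)⁻¹ *
    ∏ j ∈ Finset.range k,
      ((μ * qu R ^ (-2 * (j : ℤ) - 1) : Rˣ) : R) * bracket (μ * qu R ^ (-(j : ℤ)))

/-- The dual canonical basis vector `m^k = m_k / ⟨m_k, m_k⟩`. It is meaningful when
`⟨m_k, m_k⟩` is invertible in `R`; `Ring.inverse` is `0` otherwise. -/
def dualCanon (μ : Rˣ) (k : ℕ) : Verma R (μ : R) := Ring.inverse (shap μ k) • canon R (μ : R) k

/-! ### The twisted module -/

/-- `K^{±1} m^k = (μ q^{-2k})^{±1} m^k`. -/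
def starK (μ : Rˣ) (e : ℤ) : Module.End R (ℕ →₀ R) :=
  Finsupp.linearCombination R fun k =>
    Finsupp.single k (((μ * qu R ^ (-2 * (k : ℤ))) ^ e : Rˣ) : R)

/-- `F m^k = [μ, -k] μ q^{-2k-1} m^{k+1}`. -/
def starF (μ : Rˣ) : Module.End R (ℕ →₀ R) :=
  Finsupp.linearCombination R fun k =>
    Finsupp.single (k + 1)
      (bracket (μ * qu R ^ (-(k : ℤ))) * ((μ * qu R ^ (-2 * (k : ℤ) - 1) : Rˣ) : R))

/-- `E m^k = [k] μ⁻¹ q^{2k-1} m^{k-1}`, and `E m^0 = 0`. -/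
def starE (μ : Rˣ) : Module.End R (ℕ →₀ R) :=
  Finsupp.linearCombination R fun k =>
    if k = 0 then 0 else
      Finsupp.single (k - 1)
        (bracket (qu R ^ (k : ℤ)) * ((μ⁻¹ * qu R ^ (2 * (k : ℤ) - 1) : Rˣ) : R))

/-- The operator by which the generator `g` acts on the twisted module. -/
def starGen (μ : Rˣ) : UqGen → Module.End R (ℕ →₀ R)
  | .E => starE μ
  | .F => starF μ
  | .K => starK μ 1
  | .Kinv => starK μ (-1)

end Verma


section Star

variable {R : Type} [CommRing R] [Algebra Kq R]

theorem bracket_identity (μ p : Rˣ) :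
    bracket (μ * p⁻¹) * bracket (p * qu R) - bracket p * bracket (μ * p⁻¹ * qu R)
      = bracket (μ * p⁻¹ * p⁻¹) := by
  have hd : algebraMap Kq R (q - q⁻¹)⁻¹ * ((qu R : R) - ((qu R)⁻¹ : Rˣ)) = 1 := by
    have h1 : ((qu R : R) - ((qu R)⁻¹ : Rˣ)) = algebraMap Kq R (q - q⁻¹) := by
      simp [qu]
    rw [h1, ← map_mul, inv_mul_cancel₀ q_sub_inv_ne_zero, map_one]
  simp only [bracket, mul_inv, inv_inv, Units.val_mul]
  generalize algebraMap Kq R (q - q⁻¹)⁻¹ = d at *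
  generalize (qu R : R) = x at *
  generalize (((qu R)⁻¹ : Rˣ) : R) = x' at *
  have hp : (p : R) * ((p⁻¹ : Rˣ) : R) = 1 := p.mul_inv
  generalize (p : R) = y at *
  generalize ((p⁻¹ : Rˣ) : R) = y' at *
  generalize (μ : R) = m at *
  generalize ((μ⁻¹ : Rˣ) : R) = m' at *
  linear_combination (d * (m * y' * y' - m' * y * y)) * hd

theorem starK_single (μ : Rˣ) (e : ℤ) (k : ℕ) (r : R) :
    starK μ e (Finsupp.single k r)
      = Finsupp.single k (r * (((μ * qu R ^ (-2 * (k : ℤ))) ^ e : Rˣ) : R)) := by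
  simp [starK, Finsupp.linearCombination_single, Finsupp.smul_single]

theorem starF_single (μ : Rˣ) (k : ℕ) (r : R) :
    starF μ (Finsupp.single k r)
      = Finsupp.single (k + 1) (r * (bracket (μ * qu R ^ (-(k : ℤ))) *
          ((μ * qu R ^ (-2 * (k : ℤ) - 1) : Rˣ) : R))) := by
  simp only [starF, Finsupp.linearCombination_single, Finsupp.smul_single, smul_eq_mul]

theorem starE_single_zero (μ : Rˣ) (r : R) : starE μ (Finsupp.single 0 r) = 0 := by
  simp [starE, Finsupp.linearCombination_single]

theorem starE_single_succ (μ : Rˣ) (k : ℕ) (r : R) :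
    starE μ (Finsupp.single (k + 1) r)
      = Finsupp.single k (r * (bracket (qu R ^ ((k : ℤ) + 1)) *
          ((μ⁻¹ * qu R ^ (2 * (k : ℤ) + 1) : Rˣ) : R))) := by
  have h : (2 * ((k + 1 : ℕ) : ℤ) - 1) = 2 * (k : ℤ) + 1 := by push_cast; ring
  simp only [starE, Finsupp.linearCombination_single, Nat.succ_ne_zero, if_false,
    Finsupp.smul_single, smul_eq_mul, h, Nat.add_sub_cancel]
  push_cast
  rfl

theorem qu_val : (qu R : R) = algebraMap Kq R q := rfl

theorem smul_eq_algebraMap_mul (c : Kq) (r : R) : c • r = algebraMap Kq R c * r :=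
  Algebra.smul_def c r

theorem starEF (μ : Rˣ) :
    starE μ * starF μ - starF μ * starE μ
      = (q - q⁻¹)⁻¹ • (starK μ 1 - starK μ (-1)) := by
  refine Finsupp.lhom_ext fun k r => ?_
  have key := bracket_identity μ (qu R ^ (k : ℤ))
  have h1 : μ * (qu R ^ (k : ℤ))⁻¹ = μ * qu R ^ (-(k : ℤ)) := by rw [zpow_neg]
  have h2 : qu R ^ (k : ℤ) * qu R = qu R ^ ((k : ℤ) + 1) := by rw [zpow_add_one]
  have h3 : μ * qu R ^ (-(k : ℤ)) * (qu R ^ (k : ℤ))⁻¹ = μ * qu R ^ (-2 * (k : ℤ)) := by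
    rw [mul_assoc, ← zpow_neg, ← zpow_add]; congr 2; ring
  rw [h1, h2, h3] at key
  have hrhs : ((q - q⁻¹)⁻¹ • (starK μ 1 - starK μ (-1))) (Finsupp.single k r)
      = Finsupp.single k (r * bracket (μ * qu R ^ (-2 * (k : ℤ)))) := by
    simp only [LinearMap.smul_apply, LinearMap.sub_apply, starK_single, zpow_one, zpow_neg_one,
      ← Finsupp.single_sub, Finsupp.smul_single, smul_eq_algebraMap_mul, bracket]
    congr 1; ring
  rw [hrhs, LinearMap.sub_apply, Module.End.mul_apply, Module.End.mul_apply, starF_single,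
    starE_single_succ]
  have e1 : (((μ * qu R ^ (-2 * (k : ℤ) - 1) : Rˣ) : R)) *
      ((μ⁻¹ * qu R ^ (2 * (k : ℤ) + 1) : Rˣ) : R) = 1 := by
    rw [← Units.val_mul, mul_mul_mul_comm, mul_inv_cancel, one_mul, ← zpow_add]
    have : -2 * (k : ℤ) - 1 + (2 * (k : ℤ) + 1) = 0 := by ring
    rw [this, zpow_zero, Units.val_one]
  cases k with
  | zero =>
    rw [starE_single_zero, map_zero, sub_zero]
    congr 1
    have hb : bracket (qu R ^ ((0 : ℕ) : ℤ)) = 0 := by simp [bracket]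
    rw [hb, zero_mul, sub_zero] at key
    rw [← key]
    linear_combination (r * bracket (μ * qu R ^ (-((0 : ℕ) : ℤ))) *
      bracket (qu R ^ (((0 : ℕ) : ℤ) + 1))) * e1
  | succ n =>
    rw [starE_single_succ, starF_single, ← Finsupp.single_sub]
    congr 1
    have e2 : (((μ * qu R ^ (-2 * (n : ℤ) - 1) : Rˣ) : R)) *
        ((μ⁻¹ * qu R ^ (2 * (n : ℤ) + 1) : Rˣ) : R) = 1 := by
      rw [← Units.val_mul, mul_mul_mul_comm, mul_inv_cancel, one_mul, ← zpow_add]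
      have : -2 * (n : ℤ) - 1 + (2 * (n : ℤ) + 1) = 0 := by ring
      rw [this, zpow_zero, Units.val_one]
    have h4 : μ * qu R ^ (-((n + 1 : ℕ) : ℤ)) * qu R = μ * qu R ^ (-(n : ℤ)) := by
      rw [mul_assoc, ← zpow_add_one]; congr 2; push_cast; ring
    rw [h4] at key
    push_cast at key e1 e2 ⊢
    linear_combination r * key + (r * bracket (μ * qu R ^ (-((n : ℤ) + 1))) *
      bracket (qu R ^ ((n : ℤ) + 1 + 1))) * e1 -
      (r * bracket (qu R ^ ((n : ℤ) + 1)) * bracket (μ * qu R ^ (-(n : ℤ)))) * e2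

theorem starK_mul (μ : Rˣ) (e f : ℤ) (h : e + f = 0) : starK μ e * starK μ f = 1 := by
  refine Finsupp.lhom_ext fun k r => ?_
  rw [Module.End.mul_apply, starK_single, starK_single, mul_assoc, ← Units.val_mul, ← zpow_add,
    add_comm f e, h, zpow_zero, Units.val_one, mul_one, Module.End.one_apply]

theorem starKF (μ : Rˣ) : starK μ 1 * starF μ = (q ^ 2)⁻¹ • (starF μ * starK μ 1) := by
  refine Finsupp.lhom_ext fun k r => ?_
  simp only [Module.End.mul_apply, LinearMap.smul_apply, starK_single, starF_single,
    Finsupp.smul_single, zpow_one, smul_eq_algebraMap_mul]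
  congr 1
  have h : ((μ * qu R ^ (-2 * ((k + 1 : ℕ) : ℤ)) : Rˣ) : R)
      = algebraMap Kq R (q ^ 2)⁻¹ * ((μ * qu R ^ (-2 * (k : ℤ)) : Rˣ) : R) := by
    have h1 : algebraMap Kq R (q ^ 2)⁻¹ = ((qu R ^ (-2 : ℤ) : Rˣ) : R) := by
      rw [qu, ← map_zpow]
      simp only [Units.coe_map, Units.val_zpow_eq_zpow_val, Units.val_mk0]
      rw [zpow_neg]
      rfl
    rw [h1, ← Units.val_mul, mul_left_comm, ← zpow_add]
    congr 3; push_cast; ring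
  rw [h]; ring

theorem starKE (μ : Rˣ) : starK μ 1 * starE μ = q ^ 2 • (starE μ * starK μ 1) := by
  refine Finsupp.lhom_ext fun k r => ?_
  cases k with
  | zero =>
    rw [LinearMap.smul_apply, Module.End.mul_apply, Module.End.mul_apply, starK_single,
      starE_single_zero, starE_single_zero, map_zero, smul_zero]
  | succ n =>
    simp only [Module.End.mul_apply, LinearMap.smul_apply, starK_single, starE_single_succ,
      Finsupp.smul_single, zpow_one, smul_eq_algebraMap_mul]
    congr 1
    have h : ((μ * qu R ^ (-2 * (n : ℤ)) : Rˣ) : R)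
        = algebraMap Kq R (q ^ 2) * ((μ * qu R ^ (-2 * ((n + 1 : ℕ) : ℤ)) : Rˣ) : R) := by
      have h1 : algebraMap Kq R (q ^ 2) = ((qu R ^ (2 : ℤ) : Rˣ) : R) := by
        rw [qu, ← map_zpow]
        simp only [Units.coe_map, Units.val_zpow_eq_zpow_val, Units.val_mk0]
        rfl
      rw [h1, ← Units.val_mul, mul_left_comm, ← zpow_add]
      congr 3; push_cast; ring
    rw [h]; ring

/-- The twisted module as a representation of `U_q(sl2)` over `ℚ(q)`. -/
def starRepQ (μ : Rˣ) : Uq →ₐ[Kq] Module.End R (ℕ →₀ R) :=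
  RingQuot.liftAlgHom Kq ⟨FreeAlgebra.lift Kq (starGen μ), by
    intro x y h
    induction h with
    | K_Kinv => simpa [starGen] using starK_mul μ 1 (-1) (by norm_num)
    | Kinv_K => simpa [starGen] using starK_mul μ (-1) 1 (by norm_num)
    | K_E => simpa [starGen] using starKE μ
    | K_F => simpa [starGen] using starKF μ
    | E_F => simpa [starGen] using starEF μ⟩

/-- The twisted module `M^*` attached to the highest weight `μ`: the free `R`-module on the
vectors `m^k = Finsupp.single k 1`, on which `E, F, K` act by the formulas for their action on the
dual canonical basis. It is given as a representation of `U_q(sl2)` with scalars extended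
to `R`. -/
def starRep (μ : Rˣ) : UqOver R →ₐ[R] Module.End R (ℕ →₀ R) :=
  Algebra.TensorProduct.lift (Algebra.ofId R _) (starRepQ μ)
    (by intro x y; rw [Algebra.ofId_apply]; exact Algebra.commutes x _)

theorem starRep_gen (μ : Rˣ) (g : UqGen) : starRep μ (rgen R g) = starGen μ g := by
  have h : starRepQ μ (ugen g) = starGen μ g := by
    have h2 := RingQuot.liftAlgHom_mkAlgHom_apply Kq (f := FreeAlgebra.lift Kq (starGen μ))
      (s := UqRel)
    simp only [starRepQ, ugen]
    erw [h2]
    simp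
  rw [starRep, rgen, Algebra.TensorProduct.lift_tmul, map_one, one_mul, h]

end Star

/-! ## The coefficient rings -/

/-- The embedding `ℚ(q) → ℚ((q))`. -/
def qSeries : Kq →+* LaurentSeries ℚ :=
  letI := RatFunc.liftAlgebra ℚ (LaurentSeries ℚ)
  algebraMap (RatFunc ℚ) (LaurentSeries ℚ)

theorem qSeries_q : qSeries q = HahnSeries.single 1 1 := RatFunc.coe_X

/-- The ring `ℚ⟦q⟧[q⁻¹, λ^{±1}]` of Laurent polynomials in `λ` over `ℚ((q))`. -/
def LamRing : Type := LaurentPolynomial (LaurentSeries ℚ)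

instance : CommRing LamRing := inferInstanceAs (CommRing (LaurentPolynomial (LaurentSeries ℚ)))

/-- The embedding of `ℚ(q)` in the ring of Laurent polynomials in `λ` over `ℚ((q))`. -/
def qLam : Kq →+* LamRing :=
  RingHom.comp (LaurentPolynomial.C : LaurentSeries ℚ →+* LaurentPolynomial (LaurentSeries ℚ))
    qSeries

instance : Algebra Kq LamRing := qLam.toAlgebra

/-- The parameter `λ` in `LamRing`. -/
def lam : LamRingˣ where
  val := (LaurentPolynomial.T 1 : LaurentPolynomial (LaurentSeries ℚ))
  inv := (LaurentPolynomial.T (-1) : LaurentPolynomial (LaurentSeries ℚ))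
  val_inv := (LaurentPolynomial.T_add (R := LaurentSeries ℚ) 1 (-1)).symm.trans
    LaurentPolynomial.T_zero
  inv_val := (LaurentPolynomial.T_add (R := LaurentSeries ℚ) (-1) 1).symm.trans
    LaurentPolynomial.T_zero

/-- The coefficient of `q^i λ^j`. -/
def lamCoeff (f : LamRing) (i j : ℤ) : ℚ :=
  (AddMonoidAlgebra.coeff (R := LaurentSeries ℚ) (M := ℤ) f j).coeff i

/-- A set of bidegrees `(i, j)` (`i` the `q`-degree, `j` the `λ`-degree) is bounded if the
`q`-degree is bounded below and the `λ`-degree is bounded above and below. -/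
def LamBounded (S : ℤ → ℤ → Prop) : Prop :=
  ∃ m n n' : ℤ, ∀ i j, S i j → m ≤ i ∧ n ≤ j ∧ j ≤ n'

/-- A set of bidegrees `(i, j)` is left bounded if it lies in a translate of one of the cones
`{(i, j) | 0 ≤ j, 0 ≤ i + c j}`, where `c` is a natural number. -/
def ConeBounded (S : ℤ → ℤ → Prop) : Prop :=
  ∃ (c : ℕ) (m n : ℤ), ∀ i j, S i j → n ≤ j ∧ m ≤ i + c * j

theorem ConeBounded.mono {S T : ℤ → ℤ → Prop} (h : ConeBounded T) (hST : ∀ i j, S i j → T i j) :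
    ConeBounded S := by
  obtain ⟨c, m, n, h⟩ := h
  exact ⟨c, m, n, fun i j hs => h i j (hST i j hs)⟩

theorem ConeBounded.common {S T : ℤ → ℤ → Prop} (hS : ConeBounded S) (hT : ConeBounded T) :
    ∃ (c : ℕ) (m n m' n' : ℤ), (∀ i j, S i j → n ≤ j ∧ m ≤ i + c * j) ∧
      (∀ i j, T i j → n' ≤ j ∧ m' ≤ i + c * j) := by
  obtain ⟨c, m, n, hS⟩ := hS
  obtain ⟨c', m', n', hT⟩ := hT
  refine ⟨c + c', m + c' * n, n, m' + c * n', n', fun i j h => ?_, fun i j h => ?_⟩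
  · obtain ⟨h1, h2⟩ := hS i j h
    refine ⟨h1, ?_⟩
    push_cast
    nlinarith [mul_le_mul_of_nonneg_left h1 (Int.natCast_nonneg c')]
  · obtain ⟨h1, h2⟩ := hT i j h
    refine ⟨h1, ?_⟩
    push_cast
    nlinarith [mul_le_mul_of_nonneg_left h1 (Int.natCast_nonneg c)]

theorem ConeBounded.or {S T : ℤ → ℤ → Prop} (hS : ConeBounded S) (hT : ConeBounded T) :
    ConeBounded fun i j => S i j ∨ T i j := by
  obtain ⟨c, m, n, m', n', h, h'⟩ := hS.common hT
  refine ⟨c, min m m', min n n', fun i j hij => ?_⟩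
  rcases hij with hij | hij
  · obtain ⟨h1, h2⟩ := h i j hij
    exact ⟨(min_le_left _ _).trans h1, (min_le_left _ _).trans h2⟩
  · obtain ⟨h1, h2⟩ := h' i j hij
    exact ⟨(min_le_right _ _).trans h1, (min_le_right _ _).trans h2⟩

theorem ConeBounded.add {S T : ℤ → ℤ → Prop} (hS : ConeBounded S) (hT : ConeBounded T) :
    ConeBounded fun i j => ∃ a b a' b', S a b ∧ T a' b' ∧ a + a' = i ∧ b + b' = j := by
  obtain ⟨c, m, n, m', n', h, h'⟩ := hS.common hT
  refine ⟨c, m + m', n + n', ?_⟩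
  rintro i j ⟨a, b, a', b', hs, ht, rfl, rfl⟩
  obtain ⟨h1, h2⟩ := h a b hs
  obtain ⟨h3, h4⟩ := h' a' b' ht
  refine ⟨by linarith, by nlinarith⟩

/-- The coefficient of `q^i λ^j` of a series in `ℚ((q))((λ))`. -/
def serCoeff (f : LaurentSeries (LaurentSeries ℚ)) (i j : ℤ) : ℚ := (f.coeff j).coeff i

theorem serCoeff_add (f g : LaurentSeries (LaurentSeries ℚ)) (i j : ℤ) :
    serCoeff (f + g) i j = serCoeff f i j + serCoeff g i j := by
  simp [serCoeff]

theorem serCoeff_mul_ne_zero {f g : LaurentSeries (LaurentSeries ℚ)} {i j : ℤ}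
    (h : serCoeff (f * g) i j ≠ 0) :
    ∃ a b a' b', serCoeff f a b ≠ 0 ∧ serCoeff g a' b' ≠ 0 ∧ a + a' = i ∧ b + b' = j := by
  rw [serCoeff, HahnSeries.coeff_mul, HahnSeries.coeff_sum] at h
  obtain ⟨x, hx, hx2⟩ := Finset.exists_ne_zero_of_sum_ne_zero h
  rw [HahnSeries.coeff_mul] at hx2
  obtain ⟨y, hy, hy2⟩ := Finset.exists_ne_zero_of_sum_ne_zero hx2
  refine ⟨y.1, x.1, y.2, x.2, left_ne_zero_of_mul hy2, right_ne_zero_of_mul hy2, ?_, ?_⟩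
  · exact (Finset.mem_antidiagonal.mp hy).2.2
  · exact (Finset.mem_antidiagonal.mp hx).2.2

theorem serCoeff_C_ne_zero {a : LaurentSeries ℚ} {i j : ℤ}
    (h : serCoeff (HahnSeries.C a) i j ≠ 0) : a.order ≤ i ∧ j = 0 := by
  have hj : j = 0 := by
    by_contra hj
    apply h
    simp [serCoeff, HahnSeries.coeff_single_of_ne hj]
  subst hj
  refine ⟨HahnSeries.order_le_of_coeff_ne_zero ?_, rfl⟩
  simpa [serCoeff] using h

/-- The completion in `λ` of the ground ring: the Laurent series in `q` and `λ` whose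
support lies in a translate of a cone, as a subring of `ℚ((q))((λ))`. -/
def coneSubring : Subring (LaurentSeries (LaurentSeries ℚ)) where
  carrier := {f | ConeBounded fun i j => serCoeff f i j ≠ 0}
  zero_mem' := ⟨0, 0, 0, fun i j h => absurd (by simp [serCoeff]) h⟩
  one_mem' := ⟨0, 0, 0, fun i j h => by
    rw [← map_one (HahnSeries.C : LaurentSeries ℚ →+* LaurentSeries (LaurentSeries ℚ))] at h
    have h2 := serCoeff_C_ne_zero h
    rw [HahnSeries.order_one] at h2
    exact ⟨h2.2.ge, by simpa using h2.1⟩⟩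
  add_mem' := fun {f g} hf hg => (hf.or hg).mono fun i j h => by
    by_contra h2
    push Not at h2
    exact h (by rw [serCoeff_add, h2.1, h2.2, add_zero])
  neg_mem' := fun {f} hf => hf.mono fun i j h => by
    simpa [serCoeff] using h
  mul_mem' := fun {f g} hf hg => (hf.add hg).mono fun i j h => serCoeff_mul_ne_zero h

/-- The ring of cone-supported Laurent series in `q` and `λ`. -/
def HatRing : Type := coneSubring

instance : CommRing HatRing := inferInstanceAs (CommRing coneSubring)

/-- The embedding of `ℚ(q)` in the ring of cone-supported series. -/
def qHat : Kq →+* HatRing :=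
  ((HahnSeries.C : LaurentSeries ℚ →+* LaurentSeries (LaurentSeries ℚ)).comp qSeries).codRestrict
    coneSubring fun x => ⟨0, (qSeries x).order, 0, fun i j h => by
      have h2 := serCoeff_C_ne_zero h
      exact ⟨h2.2.ge, by simpa using h2.1⟩⟩

instance : Algebra Kq HatRing := qHat.toAlgebra

theorem single_mem_coneSubring (n : ℤ) :
    (HahnSeries.single n 1 : LaurentSeries (LaurentSeries ℚ)) ∈ coneSubring := by
  refine ⟨0, 0, n, fun i j h => ?_⟩
  have hj : j = n := by
    by_contra hj
    exact h (by simp [serCoeff, HahnSeries.coeff_single_of_ne hj])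
  subst hj
  have hi : i = 0 := by
    by_contra hi
    apply h
    rw [serCoeff, HahnSeries.coeff_single_same]
    exact HahnSeries.coeff_single_of_ne hi
  exact ⟨le_rfl, by simp [hi]⟩

/-- The parameter `λ` in `HatRing`. -/
def lamHat : HatRingˣ where
  val := ⟨HahnSeries.single 1 1, single_mem_coneSubring 1⟩
  inv := ⟨HahnSeries.single (-1) 1, single_mem_coneSubring (-1)⟩
  val_inv := by
    apply Subtype.ext
    change (HahnSeries.single _ 1 : LaurentSeries (LaurentSeries ℚ)) * HahnSeries.single _ 1 = 1
    simp [HahnSeries.single_mul_single]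
  inv_val := by
    apply Subtype.ext
    change (HahnSeries.single _ 1 : LaurentSeries (LaurentSeries ℚ)) * HahnSeries.single _ 1 = 1
    simp [HahnSeries.single_mul_single]

/-- The coefficient of `q^i λ^j`. -/
def hatCoeff (f : HatRing) (i j : ℤ) : ℚ := serCoeff f.1 i j


/-! ## Bigraded supermodules -/

/-- Tridegrees: `q`-degree, `λ`-degree and parity. -/
abbrev Deg : Type := ℤ × ℤ × ZMod 2

/-- A left module over a `ℚ`-algebra `A` together with a family of `ℚ`-subspaces indexed by
tridegrees. That the family is a grading compatible with a grading of `A` is the predicate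
`SMod.IsGraded` below. -/
structure SMod (A : Type) [Ring A] [Algebra ℚ A] : Type 1 where
  carrier : Type
  [addCommGroup : AddCommGroup carrier]
  [moduleQ : Module ℚ carrier]
  [moduleA : Module A carrier]
  [tower : IsScalarTower ℚ A carrier]
  deg : Deg → Submodule ℚ carrier

attribute [instance] SMod.addCommGroup SMod.moduleQ SMod.moduleA SMod.tower

namespace SMod

variable {A : Type} [Ring A] [Algebra ℚ A]

/-- `M` is a bigraded supermodule over the bigraded superring `A` with homogeneous parts `𝒜 d`:
it is the internal direct sum of the `M.deg d`, and degrees add under the action. -/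
def IsGraded (𝒜 : Deg → Submodule ℚ A) (M : SMod A) : Prop :=
  DirectSum.IsInternal M.deg ∧
    ∀ d e, ∀ a ∈ 𝒜 d, ∀ m ∈ M.deg e, a • m ∈ M.deg (d + e)

/-- Isomorphism of graded supermodules: an `A`-linear bijection that preserves all degrees. -/
def Iso (M N : SMod A) : Prop :=
  ∃ e : M.carrier ≃ₗ[A] N.carrier, ∀ d x, x ∈ M.deg d ↔ e x ∈ N.deg d

/-- A degree preserving supermodule map. -/
def IsHom (M N : SMod A) (f : M.carrier →ₗ[A] N.carrier) : Prop :=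
  ∀ d, ∀ x ∈ M.deg d, f x ∈ N.deg d

/-- The shift of `M` by `d`: shifting up by `d.1` in the `q`-degree, by `d.2.1` in the `λ`-degree,
and applying the parity shift `Π` if `d.2.2 = 1`. (The action on `ΠM` is not twisted by a
sign here; `m ↦ (-1)^{p(m)} m` is a degree preserving isomorphism onto the twisted form.) -/
def shift (d : Deg) (M : SMod A) : SMod A where
  carrier := M.carrier
  deg e := M.deg (e - d)

/-- The direct sum of a family of graded supermodules. -/
def dsum {ι : Type} (X : ι → SMod A) : SMod A where
  carrier := Π₀ i, (X i).carrier
  deg e :=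
    { carrier := {x | ∀ i, x i ∈ (X i).deg e}
      add_mem' := fun hx hy i => by
        rw [DFinsupp.add_apply]; exact Submodule.add_mem _ (hx i) (hy i)
      zero_mem' := fun i => by
        rw [DFinsupp.zero_apply]; exact Submodule.zero_mem _
      smul_mem' := fun c x hx i => by
        rw [DFinsupp.smul_apply]; exact Submodule.smul_mem _ c (hx i) }

/-- `⨁_j ⨁_d (A_j shifted by d)^{k_j(d)}`, where `j` runs through `0, …, n-1` and `d` through all
tridegrees. -/
def locSum {n : ℕ} (X : Fin n → SMod A) (k : Fin n → Deg → ℕ) : SMod A :=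
  dsum (ι := Σ j : Fin n, Σ d : Deg, Fin (k j d)) fun x => (X x.1).shift x.2.1

/-- The `A`-submodule `N` of `M` is generated by homogeneous elements, so that it is a
sub-supermodule. -/
def IsHomog (M : SMod A) (N : Submodule A M.carrier) : Prop :=
  ∀ x ∈ N, x ∈ Submodule.span ℚ {y : M.carrier | y ∈ N ∧ ∃ d, y ∈ M.deg d}

/-- Simple graded supermodules. -/
def IsSimple (M : SMod A) : Prop :=
  Nontrivial M.carrier ∧ ∀ N : Submodule A M.carrier, M.IsHomog N → N = ⊥ ∨ N = ⊤

/-- The bidegrees in which `M` is nonzero. -/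
def support (M : SMod A) (i j : ℤ) : Prop := ∃ p : ZMod 2, M.deg (i, j, p) ≠ ⊥

/-- Locally finite-dimensional: each homogeneous part is finite-dimensional. -/
def LocFin (M : SMod A) : Prop := ∀ d, FiniteDimensional ℚ (M.deg d)

/-- The category of left bounded, locally finite-dimensional graded supermodules, given by its
class of objects. -/
def Lf (𝒜 : Deg → Submodule ℚ A) (M : SMod A) : Prop :=
  M.IsGraded 𝒜 ∧ M.LocFin ∧ ConeBounded M.support

/-- The full subcategory of the modules whose `λ`-degrees are bounded above and below. -/
def LfLam (𝒜 : Deg → Submodule ℚ A) (M : SMod A) : Prop :=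
  M.IsGraded 𝒜 ∧ M.LocFin ∧ LamBounded M.support

/-- `M` is a projective object of the category `P` of graded supermodules. -/
def IsProj (P : SMod A → Prop) (M : SMod A) : Prop :=
  P M ∧ ∀ N N' : SMod A, P N → P N' →
    ∀ g : N.carrier →ₗ[A] N'.carrier, IsHom N N' g → Function.Surjective g →
      ∀ f : M.carrier →ₗ[A] N'.carrier, IsHom M N' f →
        ∃ h : M.carrier →ₗ[A] N.carrier, IsHom M N h ∧ g ∘ₗ h = f

/-- `M` is nonzero and not the direct sum of two nonzero objects of the category `P`. -/
def IsIndec (P : SMod A → Prop) (M : SMod A) : Prop :=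
  Nontrivial M.carrier ∧ ∀ X : Fin 2 → SMod A, (∀ i, P (X i)) → M.Iso (dsum X) →
    ∃ i, Subsingleton (X i).carrier

/-- The quotient of `F i` by `F (i + 1)` is isomorphic, as a graded supermodule, to `S`. -/
def FactorIso (M : SMod A) (F : ℕ → Submodule A M.carrier) (i : ℕ) (S : SMod A) : Prop :=
  ∃ f : F i →ₗ[A] S.carrier, Function.Surjective f ∧
    (∀ x : F i, f x = 0 ↔ (x : M.carrier) ∈ F (i + 1)) ∧
    ∀ d, ∀ x : F i, (x : M.carrier) ∈ M.deg d → f x ∈ S.deg d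

/-- `F` is a descending sequence of graded submodules of `M` that starts at `M`, has zero
intersection, and whose successive quotients are zero or simple objects of the category `P`. -/
def IsCompSeries (P : SMod A → Prop) (M : SMod A) (F : ℕ → Submodule A M.carrier) : Prop :=
  Antitone F ∧ F 0 = ⊤ ∧ (⨅ i, F i) = ⊥ ∧ (∀ i, M.IsHomog (F i)) ∧
    ∀ i, F i = F (i + 1) ∨ ∃ S, P S ∧ IsSimple S ∧ M.FactorIso F i S

/-- `M` and `N` have composition series in which each simple object of the category `P` (in each
degree) occurs with the same finite multiplicity. -/
def SameFactors (P : SMod A → Prop) (M N : SMod A) : Prop :=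
  ∃ (F : ℕ → Submodule A M.carrier) (G : ℕ → Submodule A N.carrier),
    IsCompSeries P M F ∧ IsCompSeries P N G ∧
      ∀ S, P S → IsSimple S →
        {i | M.FactorIso F i S}.Finite ∧ {i | N.FactorIso G i S}.Finite ∧
          {i | M.FactorIso F i S}.ncard = {i | N.FactorIso G i S}.ncard

/-- `0 → M' → M → M'' → 0` is a short exact sequence of graded supermodules for some maps. -/
def ShortExact (M' M M'' : SMod A) : Prop :=
  ∃ (f : M'.carrier →ₗ[A] M.carrier) (g : M.carrier →ₗ[A] M''.carrier),
    IsHom M' M f ∧ IsHom M M'' g ∧ Function.Injective f ∧ Function.Surjective g ∧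
      Function.Exact f g

/-! ### Topological Grothendieck groups at `π = -1` -/

section Groth

variable {R : Type} [CommRing R] (cf : R → ℤ → ℤ → ℚ) (P : SMod A → Prop)

/-- `p` is the series `∑ k(i,j,ε) q^i λ^j π^ε` at `π = -1`, where `cf p i j` is the coefficient of
`q^i λ^j` in `p`. -/
def IsSeries (p : R) (k : Deg → ℕ) : Prop :=
  ∀ i j, cf p i j = (k (i, j, 0) : ℚ) - (k (i, j, 1) : ℚ)

/-- The relations `[⨁_j A_j^{⊕ p_j}] = ∑_j p_j [A_j]` for locally finite direct sums of shifts of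
finitely many objects. -/
def sumRel : Set ({M // P M} →₀ R) :=
  {r | ∃ (n : ℕ) (M : {M // P M}) (X : Fin n → {M // P M}) (k : Fin n → Deg → ℕ) (p : Fin n → R),
    (∀ j, IsSeries cf (p j) (k j)) ∧ M.1.Iso (locSum (fun j => (X j).1) k) ∧
      r = Finsupp.single M 1 - ∑ j, Finsupp.single (X j) (p j)}

/-- The relations `[M] = [M'] + [M'']` for short exact sequences. -/
def exactRel : Set ({M // P M} →₀ R) :=
  {r | ∃ M' M M'' : {M // P M}, ShortExact M'.1 M.1 M''.1 ∧
    r = Finsupp.single M 1 - Finsupp.single M' 1 - Finsupp.single M'' 1}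

/-- The relations `[M] = [N]` for objects with the same composition factors. -/
def factorRel : Set ({M // P M} →₀ R) :=
  {r | ∃ M N : {M // P M}, SameFactors P M.1 N.1 ∧
    r = Finsupp.single M 1 - Finsupp.single N 1}

/-- The topological split Grothendieck group of the category `P`, with scalars extended to `R` and
`π = -1`: the `R`-module generated by the classes of objects, with the relations
`[A ⊕ B] = [A] + [B]` and `p [A] = [A^{⊕ p}]` that define the split Grothendieck group and its
module structure. Both are contained in `sumRel`, which also contains the relation that
identifies the class of an object with the series formed by its indecomposable summands. -/
def K0 : Type 1 := ({M // P M} →₀ R) ⧸ Submodule.span R (sumRel cf P)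

instance : AddCommGroup (K0 cf P) :=
  inferInstanceAs (AddCommGroup (({M // P M} →₀ R) ⧸ Submodule.span R (sumRel cf P)))
instance : Module R (K0 cf P) :=
  inferInstanceAs (Module R (({M // P M} →₀ R) ⧸ Submodule.span R (sumRel cf P)))

/-- The class of an object in the topological split Grothendieck group. -/
def K0.cls (M : SMod A) (h : P M) : K0 cf P :=
  Submodule.Quotient.mk (Finsupp.single ⟨M, h⟩ 1)

/-- The topological Grothendieck group of the category `P`, with scalars extended to `R` and
`π = -1`: the `R`-module generated by the classes of objects, with the relations given by short
exact sequences, the relations `p [A] = [A^{⊕ p}]` that define the module structure, and the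
relations dividing out the differences of objects with the same composition factors, that is, the
kernel of the map to the free module on the simple objects. -/
def G0 : Type 1 :=
  ({M // P M} →₀ R) ⧸ Submodule.span R (exactRel P ∪ sumRel cf P ∪ factorRel P)

instance : AddCommGroup (G0 cf P) :=
  inferInstanceAs (AddCommGroup
    (({M // P M} →₀ R) ⧸ Submodule.span R (exactRel P ∪ sumRel cf P ∪ factorRel P)))
instance : Module R (G0 cf P) :=
  inferInstanceAs (Module R
    (({M // P M} →₀ R) ⧸ Submodule.span R (exactRel P ∪ sumRel cf P ∪ factorRel P)))

/-- The class of an object in the topological Grothendieck group. -/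
def G0.cls (M : SMod A) (h : P M) : G0 cf P :=
  Submodule.Quotient.mk (Finsupp.single ⟨M, h⟩ 1)

end Groth

/-! ### Induction and restriction -/

section IndRes

variable {B : Type} [Ring B] [Algebra ℚ B]

/-- The `B`-submodule by which `B ⊗_ℚ M` has to be divided to obtain `B ⊗_A M`. -/
def indRel (φ : A →ₐ[ℚ] B) (M : SMod A) : Submodule B (B ⊗[ℚ] M.carrier) :=
  Submodule.span B {z | ∃ (a : A) (m : M.carrier), z = φ a ⊗ₜ[ℚ] m - 1 ⊗ₜ[ℚ] (a • m)}

/-- `B ⊗_A M`, where `B` is a right `A`-module through `φ`, with the tensor product grading. -/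
def ind (φ : A →ₐ[ℚ] B) (ℬ : Deg → Submodule ℚ B) (M : SMod A) : SMod B where
  carrier := (B ⊗[ℚ] M.carrier) ⧸ indRel φ M
  deg e := Submodule.span ℚ {z | ∃ d d' : Deg, d + d' = e ∧ ∃ b ∈ ℬ d, ∃ m ∈ M.deg d',
    z = (indRel φ M).mkQ (b ⊗ₜ[ℚ] m)}

/-- Restriction of scalars along `ψ`. -/
def res (ψ : A →ₐ[ℚ] B) (M : SMod B) : SMod A :=
  letI : Module A M.carrier := Module.compHom M.carrier ψ.toRingHom
  { carrier := M.carrier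
    tower := ⟨fun c a m => by
      change ψ (c • a) • m = c • (ψ a • m)
      rw [map_smul, smul_assoc]⟩
    deg := M.deg }

end IndRes

end SMod

/-! ## The superrings -/

/-- The superring `ℚ[x_a, s_b]` with commuting even variables `x_a` and anticommuting odd variables
`s_b`: a polynomial ring tensored with an exterior algebra. -/
def SPoly (α β : Type) : Type := MvPolynomial α ℚ ⊗[ℚ] ExteriorAlgebra ℚ (β →₀ ℚ)

namespace SPoly

variable {α β α' β' : Type}

instance : Ring (SPoly α β) :=
  inferInstanceAs (Ring (MvPolynomial α ℚ ⊗[ℚ] ExteriorAlgebra ℚ (β →₀ ℚ)))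
instance : Algebra ℚ (SPoly α β) :=
  inferInstanceAs (Algebra ℚ (MvPolynomial α ℚ ⊗[ℚ] ExteriorAlgebra ℚ (β →₀ ℚ)))

/-- The inclusion of the even variables. -/
def ofEven : MvPolynomial α ℚ →ₐ[ℚ] SPoly α β :=
  Algebra.TensorProduct.includeLeft

/-- The inclusion of the odd variables. -/
def ofOdd : ExteriorAlgebra ℚ (β →₀ ℚ) →ₐ[ℚ] SPoly α β :=
  Algebra.TensorProduct.includeRight

/-- The variable `x_a`. -/
def x (a : α) : SPoly α β := ofEven (MvPolynomial.X a)

/-- The linear inclusion of the span of the odd variables. -/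
def odd : (β →₀ ℚ) →ₗ[ℚ] SPoly α β := ofOdd.toLinearMap ∘ₗ ExteriorAlgebra.ι ℚ

/-- The variable `s_b`. -/
def s (b : β) : SPoly α β := odd (Finsupp.single b 1)

theorem ofEven_commute (p : MvPolynomial α ℚ) (z : SPoly α β) : Commute (ofEven p) z := by
  unfold SPoly at z
  change (p ⊗ₜ[ℚ] (1 : ExteriorAlgebra ℚ (β →₀ ℚ)) : MvPolynomial α ℚ ⊗[ℚ] _) * z
    = z * (p ⊗ₜ[ℚ] (1 : ExteriorAlgebra ℚ (β →₀ ℚ)))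
  induction z using TensorProduct.induction_on with
  | zero => simp
  | tmul a b => simp [Algebra.TensorProduct.tmul_mul_tmul, mul_comm]
  | add a b ha hb => rw [mul_add, add_mul, ha, hb]

theorem odd_sq (v : β →₀ ℚ) : (odd v : SPoly α β) * odd v = 0 := by
  change ofOdd (ExteriorAlgebra.ι ℚ v) * ofOdd (ExteriorAlgebra.ι ℚ v) = _
  rw [← map_mul, ExteriorAlgebra.ι_sq_zero, map_zero]

theorem odd_add_swap (v w : β →₀ ℚ) :
    (odd v : SPoly α β) * odd w + odd w * odd v = 0 := by
  change ofOdd (ExteriorAlgebra.ι ℚ v) * ofOdd (ExteriorAlgebra.ι ℚ w) +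
    ofOdd (ExteriorAlgebra.ι ℚ w) * ofOdd (ExteriorAlgebra.ι ℚ v) = _
  rw [← map_mul ofOdd, ← map_mul ofOdd, ← map_add, ExteriorAlgebra.ι_add_mul_swap, map_zero]

/-- The algebra map that is `f` on the even and `g` on the odd variables. -/
def map (f : MvPolynomial α ℚ →ₐ[ℚ] MvPolynomial α' ℚ) (g : (β →₀ ℚ) →ₗ[ℚ] SPoly α' β')
    (hg : ∀ v, g v * g v = 0) : SPoly α β →ₐ[ℚ] SPoly α' β' :=
  Algebra.TensorProduct.lift (ofEven.comp f) (ExteriorAlgebra.lift ℚ ⟨g, hg⟩)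
    fun p _ => ofEven_commute (f p) _

theorem map_x (f : MvPolynomial α ℚ →ₐ[ℚ] MvPolynomial α' ℚ) (g : (β →₀ ℚ) →ₗ[ℚ] SPoly α' β')
    (hg : ∀ v, g v * g v = 0) (a : α) :
    map f g hg (x a) = ofEven (f (MvPolynomial.X a)) := by
  change map f g hg (MvPolynomial.X a ⊗ₜ[ℚ] 1) = _
  refine (Algebra.TensorProduct.lift_tmul _ _ _ _ _).trans ?_
  rw [map_one, mul_one]; rfl

theorem map_odd (f : MvPolynomial α ℚ →ₐ[ℚ] MvPolynomial α' ℚ) (g : (β →₀ ℚ) →ₗ[ℚ] SPoly α' β')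
    (hg : ∀ v, g v * g v = 0) (v : β →₀ ℚ) :
    map f g hg (odd v) = g v := by
  change map f g hg (1 ⊗ₜ[ℚ] ExteriorAlgebra.ι ℚ v) = _
  refine (Algebra.TensorProduct.lift_tmul _ _ _ _ _).trans ?_
  rw [map_one, one_mul, ExteriorAlgebra.lift_ι_apply]

/-- The variables, even and odd. -/
def gen : α ⊕ β → SPoly α β := Sum.elim x s

/-- The homogeneous part of tridegree `d` when the variables have the tridegrees `dg`: the span of
the products of variables whose degrees add up to `d`. -/
def part (dg : α ⊕ β → Deg) (d : Deg) : Submodule ℚ (SPoly α β) :=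
  Submodule.span ℚ {z | ∃ l : List (α ⊕ β), (l.map dg).sum = d ∧ z = (l.map gen).prod}

end SPoly

open SPoly SMod

/-- `Ω_k = ℚ[x_1, …, x_k, s_1, …, s_k]`; the variables with index `i + 1` are `x i` and `s i` for
`i : Fin k`. -/
abbrev Om (k : ℕ) : Type := SPoly (Fin k) (Fin k)

/-- The degrees in `Ω_k`: `x_i` is even of bidegree `(2i, 0)` and `s_i` is odd of bidegree
`(-2i, 2)`. -/
def omDeg (k : ℕ) : Fin k ⊕ Fin k → Deg :=
  Sum.elim (fun i => (2 * ((i : ℤ) + 1), 0, 0)) (fun i => (-2 * ((i : ℤ) + 1), 2, 1))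

/-- The homogeneous parts of `Ω_k`. -/
def omPart (k : ℕ) : Deg → Submodule ℚ (Om k) := part (omDeg k)

/-- `Ω_{k,k+1} = ℚ[w_1, …, w_k, ξ, σ_1, …, σ_{k+1}]`; the even variable with index `some i` is
`w_{i+1}`, the one with index `none` is `ξ`, and `s i` is `σ_{i+1}`. -/
abbrev OmFlag (k : ℕ) : Type := SPoly (Option (Fin k)) (Fin (k + 1))

/-- The degrees in `Ω_{k,k+1}`: `w_i` is even of bidegree `(2i, 0)`, `ξ` is even of bidegree
`(2, 0)`, and `σ_i` is odd of bidegree `(-2i, 2)`. -/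
def flagDeg (k : ℕ) : Option (Fin k) ⊕ Fin (k + 1) → Deg :=
  Sum.elim (fun o => o.elim (2, 0, 0) fun i => (2 * ((i : ℤ) + 1), 0, 0))
    (fun i => (-2 * ((i : ℤ) + 1), 2, 1))

/-- The homogeneous parts of `Ω_{k,k+1}`. -/
def flagPart (k : ℕ) : Deg → Submodule ℚ (OmFlag k) := part (flagDeg k)

/-- `w_n`, with `w_0 = 1` and `w_n = 0` for `n > k`. -/
def wPoly (k : ℕ) : ℕ → MvPolynomial (Option (Fin k)) ℚ
  | 0 => 1
  | n + 1 => if h : n < k then MvPolynomial.X (some ⟨n, h⟩) else 0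

/-- The variable `ξ`. -/
def xi (k : ℕ) : OmFlag k := x none

/-- The map `s_i ↦ σ_i + ξ σ_{i+1}` on linear combinations of the odd variables. -/
def phiOdd (k : ℕ) : (Fin k →₀ ℚ) →ₗ[ℚ] OmFlag k :=
  odd ∘ₗ Finsupp.lmapDomain ℚ ℚ Fin.castSucc +
    LinearMap.mulLeft ℚ (xi k) ∘ₗ odd ∘ₗ Finsupp.lmapDomain ℚ ℚ Fin.succ

theorem phiOdd_sq (k : ℕ) (v : Fin k →₀ ℚ) : phiOdd k v * phiOdd k v = 0 := by
  simp only [phiOdd, LinearMap.add_apply, LinearMap.comp_apply, LinearMap.mulLeft_apply]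
  generalize Finsupp.lmapDomain ℚ ℚ Fin.castSucc v = a
  generalize Finsupp.lmapDomain ℚ ℚ Fin.succ v = b
  have hc : ∀ z : OmFlag k, xi k * z = z * xi k := fun z => ofEven_commute (MvPolynomial.X none) z
  have h1 := odd_sq (α := Option (Fin k)) a
  have h2 := odd_sq (α := Option (Fin k)) b
  have h3 := odd_add_swap (α := Option (Fin k)) a b
  generalize (odd a : OmFlag k) = u at *
  generalize (odd b : OmFlag k) = w at *
  generalize xi k = t at *
  calc (u + t * w) * (u + t * w)
      = u * u + (u * t) * w + t * (w * u) + t * (w * t) * w := by noncomm_ring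
    _ = u * u + t * (u * w + w * u) + t * t * (w * w) := by
        rw [← hc u, ← hc w]; noncomm_ring
    _ = 0 := by rw [h1, h2, h3]; simp

/-- `φ* : Ω_k → Ω_{k,k+1}`, `x_i ↦ w_i`, `s_i ↦ σ_i + ξ σ_{i+1}`. -/
def phi (k : ℕ) : Om k →ₐ[ℚ] OmFlag k :=
  SPoly.map (MvPolynomial.rename some) (phiOdd k) (phiOdd_sq k)

/-- `ψ* : Ω_{k+1} → Ω_{k,k+1}`, `x_i ↦ w_i + ξ w_{i-1}`, `s_i ↦ σ_i`. -/
def psi (k : ℕ) : Om (k + 1) →ₐ[ℚ] OmFlag k :=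
  SPoly.map
    (MvPolynomial.aeval fun i : Fin (k + 1) =>
      wPoly k (i + 1) + MvPolynomial.X none * wPoly k i)
    odd odd_sq

theorem phi_x (k : ℕ) (i : Fin k) : phi k (x i) = x (some i) := by
  rw [phi, SPoly.map_x, MvPolynomial.rename_X]; rfl

theorem phi_s (k : ℕ) (i : Fin k) : phi k (s i) = s i.castSucc + xi k * s i.succ := by
  rw [phi, s, SPoly.map_odd]
  simp [phiOdd, s, Finsupp.mapDomain_single]

theorem psi_x (k : ℕ) (i : Fin (k + 1)) :
    psi k (x i) = ofEven (wPoly k (i + 1)) + xi k * ofEven (wPoly k i) := by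
  rw [psi, SPoly.map_x, MvPolynomial.aeval_X, map_add, map_mul]; rfl

theorem psi_s (k : ℕ) (i : Fin (k + 1)) : psi k (s i) = s i := by
  rw [psi, s, SPoly.map_odd]; rfl

/-! ## The functors and the modules -/

/-- `F_k M = Ω_{k+1,k} ⊗_{Ω_k} M ⟨-k, 0⟩` as a left `Ω_{k+1}`-supermodule. -/
def Ffun (k : ℕ) (M : SMod (Om k)) : SMod (Om (k + 1)) :=
  ((M.ind (phi k) (flagPart k)).res (psi k)).shift (-(k : ℤ), 0, 0)

/-- `E_k M = Ω_{k,k+1} ⊗_{Ω_{k+1}} M ⟨k + 2, -1⟩` as a left `Ω_k`-supermodule. -/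
def Efun (k : ℕ) (M : SMod (Om (k + 1))) : SMod (Om k) :=
  ((M.ind (psi k) (flagPart k)).res (phi k)).shift ((k : ℤ) + 2, -1, 0)

/-- `K_k M = M ⟨-2k-1, 1⟩`. -/
def Kfun (k : ℕ) (M : SMod (Om k)) : SMod (Om k) := M.shift (-2 * (k : ℤ) - 1, 1, 0)

/-- `Ω_k` as a graded supermodule over itself. -/
def omReg (k : ℕ) : SMod (Om k) where
  carrier := Om k
  deg := omPart k

/-- `(Ω_k)_+`, the submodule generated by the elements of nonzero bidegree. -/
def omPlus (k : ℕ) : Submodule (Om k) (Om k) :=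
  Submodule.span (Om k) {a | ∃ (i j : ℤ) (p : ZMod 2), (i, j) ≠ (0, 0) ∧ a ∈ omPart k (i, j, p)}

/-- The simple supermodule `S_k = Ω_k / (Ω_k)_+`. -/
def omSimple (k : ℕ) : SMod (Om k) where
  carrier := Om k ⧸ omPlus k
  deg d := (omPart k d).map ((omPlus k).mkQ.restrictScalars ℚ)

/-- The operators induced on `⨁_k G_k` by the functors `E`, `F`, `K` and `K⁻¹` are the actions
under `ρ` of the generators of `U_q(sl2)`; here `G_k` is a group receiving the classes of the
objects of the category `P k` of graded `Ω_k`-supermodules. That the functors preserve these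
categories is part of the assertion. -/
def IsInducedAction {R : Type} [CommRing R] [Algebra Kq R]
    (P : ∀ k, SMod (Om k) → Prop) (G : ℕ → Type 1) [∀ k, AddCommGroup (G k)]
    [∀ k, Module R (G k)] (cls : ∀ k (M : SMod (Om k)), P k M → G k)
    (ρ : UqOver R →ₐ[R] Module.End R (⨁ k, G k)) : Prop :=
  (∀ k M (h : P k M), ∃ h' : P (k + 1) (Ffun k M),
    ρ (rgen R .F) (DirectSum.lof R ℕ G k (cls k M h))
      = DirectSum.lof R ℕ G (k + 1) (cls (k + 1) (Ffun k M) h')) ∧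
  (∀ M (h : P 0 M), ρ (rgen R .E) (DirectSum.lof R ℕ G 0 (cls 0 M h)) = 0) ∧
  (∀ k M (h : P (k + 1) M), ∃ h' : P k (Efun k M),
    ρ (rgen R .E) (DirectSum.lof R ℕ G (k + 1) (cls (k + 1) M h))
      = DirectSum.lof R ℕ G k (cls k (Efun k M) h')) ∧
  (∀ k M (h : P k M), ∃ h' : P k (Kfun k M),
    ρ (rgen R .K) (DirectSum.lof R ℕ G k (cls k M h))
      = DirectSum.lof R ℕ G k (cls k (Kfun k M) h'))

/-- The objects of `Ω_k-smod_lf`. -/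
def ObjHat (k : ℕ) : SMod (Om k) → Prop := Lf (omPart k)

/-- The objects with `λ`-degrees bounded above and below. -/
def ObjLam (k : ℕ) : SMod (Om k) → Prop := LfLam (omPart k)

/-- The projective objects among those with `λ`-degrees bounded above and below. -/
def ObjProj (k : ℕ) : SMod (Om k) → Prop := IsProj (ObjLam k)

/-- The `k`-th summand of `K_0(M)`. -/
abbrev K0M (k : ℕ) : Type 1 := K0 lamCoeff (ObjProj k)

/-- The `k`-th summand of `G_0(M)`. -/
abbrev G0M (k : ℕ) : Type 1 := G0 lamCoeff (ObjLam k)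

/-- The `k`-th summand of the completed group `Ĝ_0(M)`. -/
abbrev G0Hat (k : ℕ) : Type 1 := G0 hatCoeff (ObjHat k)

/-- The highest weight `λ q⁻¹` in `ℚ⟦q⟧[q⁻¹, λ^{±1}]`. -/
def muLam : LamRingˣ := lam * (qu LamRing)⁻¹

/-- The highest weight `λ q⁻¹` in the completed ring. -/
def muHat : HatRingˣ := lamHat * (qu HatRing)⁻¹

/-- The value `(-1)^ε q^i λ^j` of a monomial at `π = -1`. -/
def mono {R : Type} [CommRing R] [Algebra Kq R] (l : Rˣ) (i j : ℤ) (ε : ZMod 2) : R :=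
  (-1) ^ ε.val * ((qu R ^ i * l ^ j : Rˣ) : R)

end VermaCat

end

open VermaCat VermaCat.SMod

set_option autoImplicit false

noncomputable section

namespace VermaCat

/-! ### Generators, universal property and grading of the superrings -/

namespace SPoly

variable {α β α' β' : Type}

/-! Everything is controlled by one invariant, the graded superdimension `sdim`: the series whose
coefficient at $q^i\lambda^j$ is the even minus the odd dimension in bidegree $(i,j)$. The class
`SerRing` collects what is needed of a coefficient ring (an embedding in $\mathbb Q((q))((\lambda))$
whose image is described by a boundedness condition on supports), so that $R$ with $\lambda$-bounded
modules and $\widehat R$ with cone-bounded modules are treated by the same arguments.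

Modules and their factors. For $c>k$ the weight $i+cj$ is positive on all variables of $\Omega_k$
(`weight_omDeg_pos`), while the weights occurring in an object are bounded below if $c$ is large.
Hence every simple object is a shift of $S_k$, and a homogeneous basis of an object, ordered by
weight, yields a composition series with one shift of $S_k$ for each basis vector
(`exists_compSeries`). Conversely a composition series determines all homogeneous dimensions
(`hdim_eq_ncard`). An object therefore has the same factors as the direct sum of simple objects
prescribed by its dimensions, and $[M]=\mathrm{sdim}(M)\,[S_k]$ in the Grothendieck group; since
`sdim` respects all three kinds of relations, $\boldsymbol G_0$ is free of rank one (`G0.equiv`).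

Projectives. A graded Nakayama argument shows that a projective object has a homogeneous
$\Omega_k$-basis (`exists_hasHomogBasis`). So the split group is generated by $[\Omega_k]$, and it
is free because $\mathrm{sdim}(\Omega_k)$ is a nonzero element of a domain (`K0.equiv`).

Functors. $\Omega_{k,k+1}$ is free over $\Omega_k$ on $\xi^n\sigma_{k+1}^\varepsilon$
(`phi_hasHomogBasis`) and over $\Omega_{k+1}$ on $1,\xi,\dots,\xi^k$ (`psi_hasHomogBasis`). As a
graded vector space an induced module is thus a sum of shifts of the original one (`ind_grIso`), so
$F$ and $E$ multiply `sdim` by $q^{-k}\frac{1-q^{-2k-2}\lambda^2}{1-q^2}$ and by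
$q^{k+2}\lambda^{-1}(1+q^2+\dots+q^{2k})$, the minus sign coming from $\pi=-1$. These are the matrix
coefficients of $F$ and $E$ on $M^*$ (`phi_coef`, `psi_coef`). Computing the superdimension of
$\Omega_{k,k+1}$ over both rings gives a recursion whose solution is the Shapovalov form:
$\mathrm{sdim}(\Omega_k)=\langle m_k,m_k\rangle$ (`sdim_omReg`).

Verma modules. The vector $m^0$ of $M^*$ is a highest weight vector, which gives a homomorphism
$M\to M^*$ with $m_k\mapsto\langle m_k,m_k\rangle m^k$ (`vermaToStar`). It is injective because the
values of the form are nonzero, so the statements about $M$ can be tested in $M^*$, where classes of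
modules become superdimensions. Over $\widehat R$ the values are invertible by a geometric series
supported in a cone (`isUnit_shap_hat`), so $\widehat M\cong M^*$ there and $\widehat G_0$ is a
Verma module. -/

theorem gen_inl (a : α) : (gen (Sum.inl a) : SPoly α β) = x a := rfl

theorem gen_inr (b : β) : (gen (Sum.inr b) : SPoly α β) = s b := rfl

theorem ofEven_mul_ofOdd (p : MvPolynomial α ℚ) (l : ExteriorAlgebra ℚ (β →₀ ℚ)) :
    (ofEven p : SPoly α β) * ofOdd l = (p ⊗ₜ[ℚ] l : MvPolynomial α ℚ ⊗[ℚ] _) := by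
  change (p ⊗ₜ[ℚ] (1 : ExteriorAlgebra ℚ (β →₀ ℚ)) : MvPolynomial α ℚ ⊗[ℚ] _) *
    ((1 : MvPolynomial α ℚ) ⊗ₜ[ℚ] l) = _
  rw [Algebra.TensorProduct.tmul_mul_tmul, mul_one, one_mul]

@[elab_as_elim]
theorem induction_tmul {p : SPoly α β → Prop} (zero : p 0)
    (mul : ∀ a l, p (ofEven a * ofOdd l)) (add : ∀ y z, p y → p z → p (y + z))
    (z : SPoly α β) : p z := by
  unfold SPoly at z
  induction z using TensorProduct.induction_on with
  | zero => exact zero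
  | tmul a l => rw [← ofEven_mul_ofOdd]; exact mul a l
  | add y z hy hz => exact add y z hy hz

theorem odd_mem_adjoin (v : β →₀ ℚ) :
    (odd v : SPoly α β) ∈ Algebra.adjoin ℚ (Set.range (gen : α ⊕ β → SPoly α β)) := by
  induction v using Finsupp.induction_linear with
  | zero => rw [map_zero]; exact Subalgebra.zero_mem _
  | add v w hv hw => rw [map_add]; exact Subalgebra.add_mem _ hv hw
  | single b c =>
    have : (Finsupp.single b c : β →₀ ℚ) = c • Finsupp.single b 1 := by simp
    rw [this, map_smul]
    exact Subalgebra.smul_mem _ (Algebra.subset_adjoin (Set.mem_range_self (Sum.inr b))) c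

theorem adjoin_gen :
    Algebra.adjoin ℚ (Set.range (gen : α ⊕ β → SPoly α β)) = ⊤ := by
  rw [eq_top_iff]
  rintro z -
  induction z using induction_tmul with
  | zero => exact Subalgebra.zero_mem _
  | add y z hy hz => exact Subalgebra.add_mem _ hy hz
  | mul p l =>
    refine Subalgebra.mul_mem _ ?_ ?_
    · induction p using MvPolynomial.induction_on with
      | C c => exact (AlgHom.commutes (ofEven : _ →ₐ[ℚ] SPoly α β) c) ▸ Subalgebra.algebraMap_mem _ c
      | add p p' hp hp' => rw [map_add]; exact Subalgebra.add_mem _ hp hp'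
      | mul_X p a hp =>
        rw [map_mul]
        exact Subalgebra.mul_mem _ hp (Algebra.subset_adjoin (Set.mem_range_self (Sum.inl a)))
    · induction l using ExteriorAlgebra.induction with
      | algebraMap c => exact (AlgHom.commutes (ofOdd : _ →ₐ[ℚ] SPoly α β) c) ▸ Subalgebra.algebraMap_mem _ c
      | ι v => exact odd_mem_adjoin v
      | mul l l' hl hl' => rw [map_mul]; exact Subalgebra.mul_mem _ hl hl'
      | add l l' hl hl' => rw [map_add]; exact Subalgebra.add_mem _ hl hl'

theorem algHom_ext {B : Type*} [Ring B] [Algebra ℚ B] {f g : SPoly α β →ₐ[ℚ] B}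
    (h : ∀ i, f (gen i) = g (gen i)) : f = g := by
  apply AlgHom.ext_of_adjoin_eq_top adjoin_gen
  rintro _ ⟨i, rfl⟩
  exact h i

/-- The product of a list of variables. -/
def word (l : List (α ⊕ β)) : SPoly α β := (l.map gen).prod

theorem word_cons (i : α ⊕ β) (l : List (α ⊕ β)) : word (i :: l) = gen i * word l := by
  simp [word]

theorem word_append (l l' : List (α ⊕ β)) : word (l ++ l') = word l * word l' := by
  simp [word]

theorem span_word : Submodule.span ℚ (Set.range (word : List (α ⊕ β) → SPoly α β)) = ⊤ := by
  rw [eq_top_iff, ← Algebra.top_toSubmodule, ← adjoin_gen, Algebra.adjoin_eq_span]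
  refine Submodule.span_mono ?_
  intro z hz
  obtain ⟨l, hl, rfl⟩ := Submonoid.exists_list_of_mem_closure hz
  clear hz
  induction l with
  | nil => exact ⟨[], rfl⟩
  | cons y l ih =>
    obtain ⟨l', hl'⟩ := ih fun z hz => hl z (List.mem_cons_of_mem _ hz)
    obtain ⟨i, rfl⟩ := hl y List.mem_cons_self
    exact ⟨i :: l', by rw [word_cons, hl', List.prod_cons]⟩

/-- Every element is obtained from the constants by addition and left multiplication
by variables. -/
@[elab_as_elim]
theorem induction_left {p : SPoly α β → Prop} (one : p 1)
    (gen_mul : ∀ i z, p z → p (gen i * z)) (add : ∀ y z, p y → p z → p (y + z))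
    (smul : ∀ (c : ℚ) z, p z → p (c • z)) (z : SPoly α β) : p z := by
  have hz : z ∈ Submodule.span ℚ (Set.range (word : List (α ⊕ β) → SPoly α β)) := by
    rw [span_word]; trivial
  induction hz using Submodule.span_induction with
  | mem z hz =>
    obtain ⟨l, rfl⟩ := hz
    induction l with
    | nil => exact one
    | cons i l ih => rw [word_cons]; exact gen_mul _ _ ih
  | zero => simpa using smul 0 1 one
  | add y z _ _ hy hz => exact add y z hy hz
  | smul c z _ hz => exact smul c z hz

section Lift

variable {B : Type*} [Ring B] [Algebra ℚ B]

/-- Provides the commutation of the two factors that a map out of a tensor product of algebras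
requires, from commutation with the odd variables alone. -/
theorem commute_exterior_lift (b : B) (g : (β →₀ ℚ) →ₗ[ℚ] B) (hg : ∀ v, g v * g v = 0)
    (hc : ∀ v, Commute b (g v)) (l : ExteriorAlgebra ℚ (β →₀ ℚ)) :
    Commute b (ExteriorAlgebra.lift ℚ ⟨g, hg⟩ l) := by
  induction l using ExteriorAlgebra.induction with
  | algebraMap c => rw [AlgHom.commutes]; exact Algebra.commute_algebraMap_right c b
  | ι v => rw [ExteriorAlgebra.lift_ι_apply]; exact hc v
  | mul l l' hl hl' => rw [map_mul]; exact hl.mul_right hl'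
  | add l l' hl hl' => rw [map_add]; exact hl.add_right hl'

/-- The universal property of `SPoly`: an algebra map from a map on the even part and a linear
map on the odd variables. -/
def lift (f : MvPolynomial α ℚ →ₐ[ℚ] B) (g : (β →₀ ℚ) →ₗ[ℚ] B)
    (hg : ∀ v, g v * g v = 0) (hc : ∀ p v, Commute (f p) (g v)) : SPoly α β →ₐ[ℚ] B :=
  Algebra.TensorProduct.lift f (ExteriorAlgebra.lift ℚ ⟨g, hg⟩)
    fun p => commute_exterior_lift (f p) g hg (hc p)

theorem lift_ofEven (f : MvPolynomial α ℚ →ₐ[ℚ] B) (g : (β →₀ ℚ) →ₗ[ℚ] B)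
    (hg : ∀ v, g v * g v = 0) (hc : ∀ p v, Commute (f p) (g v)) (p : MvPolynomial α ℚ) :
    lift f g hg hc (ofEven p) = f p := by
  change lift f g hg hc (p ⊗ₜ[ℚ] 1) = _
  refine (Algebra.TensorProduct.lift_tmul _ _ _ _ _).trans ?_
  rw [map_one, mul_one]

theorem lift_odd (f : MvPolynomial α ℚ →ₐ[ℚ] B) (g : (β →₀ ℚ) →ₗ[ℚ] B)
    (hg : ∀ v, g v * g v = 0) (hc : ∀ p v, Commute (f p) (g v)) (v : β →₀ ℚ) :
    lift f g hg hc (odd v) = g v := by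
  change lift f g hg hc (1 ⊗ₜ[ℚ] ExteriorAlgebra.ι ℚ v) = _
  refine (Algebra.TensorProduct.lift_tmul _ _ _ _ _).trans ?_
  rw [map_one, one_mul, ExteriorAlgebra.lift_ι_apply]

/-- The anticommutator is bilinear, so it vanishes as soon as it does on generators; with equal
arguments it is twice the square, and 2 is invertible in `ℚ`. This is the form in which maps on odd
variables are shown to extend to the exterior algebra. -/
theorem linearCombination_sq_eq_zero (g : β → B) (hg : ∀ b c, g b * g c + g c * g b = 0)
    (v : β →₀ ℚ) :
    Finsupp.linearCombination ℚ g v * Finsupp.linearCombination ℚ g v = 0 := by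
  have key : ∀ v w : β →₀ ℚ,
      Finsupp.linearCombination ℚ g v * Finsupp.linearCombination ℚ g w +
      Finsupp.linearCombination ℚ g w * Finsupp.linearCombination ℚ g v = 0 := by
    intro v w
    induction v using Finsupp.induction_linear with
    | zero => simp
    | add v v' h h' =>
      rw [map_add, add_mul, mul_add, add_add_add_comm, h, h', add_zero]
    | single b c =>
      induction w using Finsupp.induction_linear with
      | zero => simp
      | add v v' h h' =>
        rw [map_add, add_mul, mul_add, add_add_add_comm, h, h', add_zero]
      | single b' c' =>
        simp only [Finsupp.linearCombination_single, smul_mul_smul_comm, mul_comm c' c]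
        rw [← smul_add, hg, smul_zero]
  have h2 := key v v
  rw [← two_nsmul] at h2
  have : (2 : ℚ) • (Finsupp.linearCombination ℚ g v * Finsupp.linearCombination ℚ g v) = 0 := by
    rw [ofNat_smul_eq_nsmul]; exact h2
  exact (smul_eq_zero.mp this).resolve_left two_ne_zero

end Lift

theorem s_anticomm (b c : β) : (s b : SPoly α β) * s c + s c * s b = 0 := odd_add_swap _ _

theorem x_commute (a : α) (z : SPoly α β) : Commute (x a) z := ofEven_commute _ z

theorem map_ofEven (f : MvPolynomial α ℚ →ₐ[ℚ] MvPolynomial α' ℚ)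
    (g : (β →₀ ℚ) →ₗ[ℚ] SPoly α' β') (hg : ∀ v, g v * g v = 0) (p : MvPolynomial α ℚ) :
    map f g hg (ofEven p) = ofEven (f p) :=
  lift_ofEven (ofEven.comp f) g hg (fun p _ => ofEven_commute (f p) _) p

/-! ### The grading -/

/-- The coaction `gen i ↦ gen i ⊗ T^{deg i}`. -/
def coact (dg : α ⊕ β → Deg) :
    SPoly α β →ₐ[ℚ] SPoly α β ⊗[ℚ] AddMonoidAlgebra ℚ Deg :=
  lift ((Algebra.TensorProduct.map (ofEven : MvPolynomial α ℚ →ₐ[ℚ] SPoly α β)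
        (AlgHom.id ℚ (AddMonoidAlgebra ℚ Deg))).comp
      (MvPolynomial.aeval fun a =>
        (MvPolynomial.X a ⊗ₜ[ℚ] AddMonoidAlgebra.single (dg (Sum.inl a)) (1 : ℚ) :
          MvPolynomial α ℚ ⊗[ℚ] AddMonoidAlgebra ℚ Deg)))
    (Finsupp.linearCombination ℚ fun b =>
      (s b ⊗ₜ[ℚ] AddMonoidAlgebra.single (dg (Sum.inr b)) (1 : ℚ) :
        SPoly α β ⊗[ℚ] AddMonoidAlgebra ℚ Deg))
    (linearCombination_sq_eq_zero _ fun b c => by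
      rw [Algebra.TensorProduct.tmul_mul_tmul, Algebra.TensorProduct.tmul_mul_tmul,
        mul_comm (AddMonoidAlgebra.single (dg (Sum.inr c)) (1 : ℚ)), ← TensorProduct.add_tmul,
        s_anticomm, TensorProduct.zero_tmul])
    -- The image of the even part is replaced by an arbitrary tensor whose left factor is an even
    -- polynomial. Such tensors are central, since even polynomials are central and the group
    -- algebra of the degrees is commutative.
    (fun p v => by
      rw [AlgHom.comp_apply]
      generalize (MvPolynomial.aeval fun a =>
        (MvPolynomial.X a ⊗ₜ[ℚ] AddMonoidAlgebra.single (dg (Sum.inl a)) (1 : ℚ) :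
          MvPolynomial α ℚ ⊗[ℚ] AddMonoidAlgebra ℚ Deg)) p = y
      generalize (Finsupp.linearCombination ℚ fun b =>
        (s b ⊗ₜ[ℚ] AddMonoidAlgebra.single (dg (Sum.inr b)) (1 : ℚ) :
          SPoly α β ⊗[ℚ] AddMonoidAlgebra ℚ Deg)) v = z
      induction y using TensorProduct.induction_on with
      | zero => rw [map_zero]; exact Commute.zero_left _
      | add y y' h h' => rw [map_add]; exact h.add_left h'
      | tmul p t =>
        induction z using TensorProduct.induction_on with
        | zero => exact Commute.zero_right _
        | add y y' h h' => exact h.add_right h'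
        | tmul z t' =>
          rw [Algebra.TensorProduct.map_tmul, commute_iff_eq, Algebra.TensorProduct.tmul_mul_tmul,
            Algebra.TensorProduct.tmul_mul_tmul, (ofEven_commute p z).eq, mul_comm t'
              ((AlgHom.id ℚ (AddMonoidAlgebra ℚ Deg)) t)])

theorem coact_gen (dg : α ⊕ β → Deg) (i : α ⊕ β) :
    coact dg (gen i) = gen i ⊗ₜ[ℚ] AddMonoidAlgebra.single (dg i) (1 : ℚ) := by
  cases i with
  | inl a =>
    rw [gen_inl, x, coact, lift_ofEven, AlgHom.comp_apply, MvPolynomial.aeval_X,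
      Algebra.TensorProduct.map_tmul]
    rfl
  | inr b =>
    rw [gen_inr, s, coact, lift_odd, Finsupp.linearCombination_single, one_smul]
    rfl

theorem coact_word (dg : α ⊕ β → Deg) (l : List (α ⊕ β)) :
    coact dg (word l) = word l ⊗ₜ[ℚ] AddMonoidAlgebra.single ((l.map dg).sum) (1 : ℚ) := by
  induction l with
  | nil => exact map_one (coact dg)
  | cons i l ih =>
    rw [word_cons, map_mul, ih, coact_gen, Algebra.TensorProduct.tmul_mul_tmul,
      AddMonoidAlgebra.single_mul_single, one_mul, List.map_cons, List.sum_cons]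

/-- The projection to the homogeneous part of tridegree `d`. -/
def partProj (dg : α ⊕ β → Deg) (d : Deg) : SPoly α β →ₗ[ℚ] SPoly α β :=
  -- The coaction multiplies a word by the monomial of its degree, so the coefficient of the
  -- monomial `d` is the part of degree `d`.
  (TensorProduct.rid ℚ (SPoly α β)).toLinearMap ∘ₗ
    LinearMap.lTensor (SPoly α β)
      (Finsupp.lapply d ∘ₗ (AddMonoidAlgebra.coeffLinearEquiv ℚ).toLinearMap) ∘ₗ
    (coact dg).toLinearMap

theorem word_mem_part (dg : α ⊕ β → Deg) (l : List (α ⊕ β)) :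
    word l ∈ part dg (l.map dg).sum := Submodule.subset_span ⟨l, rfl, rfl⟩

theorem partProj_word (dg : α ⊕ β → Deg) (d : Deg) (l : List (α ⊕ β)) :
    partProj dg d (word l) = if (l.map dg).sum = d then word l else 0 := by
  rw [partProj, LinearMap.comp_apply, LinearMap.comp_apply, AlgHom.toLinearMap_apply, coact_word,
    LinearMap.lTensor_tmul]
  split_ifs with h <;> simp [h]

end SPoly
end VermaCat
end

noncomputable section

namespace VermaCat

/-! ### Graded vector spaces -/

section GradedSpace

variable {V W : Type} [AddCommGroup V] [Module ℚ V] [AddCommGroup W] [Module ℚ W]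
  {D : Deg → Submodule ℚ V} {D' : Deg → Submodule ℚ W}

/-- Composed with the summation map, `p d` becomes the `d`-th component; hence the summation map is
injective. Thus a grading is established by exhibiting candidate projections. -/
theorem isInternal_of_proj (p : Deg → V →ₗ[ℚ] V) (h1 : ∀ d, ∀ x ∈ D d, p d x = x)
    (h2 : ∀ d e, e ≠ d → ∀ x ∈ D e, p d x = 0) (htop : ⨆ d, D d = ⊤) :
    DirectSum.IsInternal D := by
  constructor
  · have key : ∀ d, p d ∘ₗ DirectSum.coeLinearMap D
        = (D d).subtype ∘ₗ DirectSum.component ℚ Deg (fun d => D d) d := by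
      intro d
      refine DirectSum.linearMap_ext _ fun e => LinearMap.ext fun x => ?_
      simp only [LinearMap.comp_apply, DirectSum.coeLinearMap_lof, Submodule.subtype_apply]
      by_cases hed : e = d
      · subst hed
        rw [h1 e x x.2, DirectSum.component.lof_self]
      · rw [h2 d e hed x x.2, DirectSum.component.of, dif_neg hed]
        rfl
    intro f g hfg
    refine DFinsupp.ext fun d => Subtype.ext ?_
    have := LinearMap.congr_fun (key d) f
    have h' := LinearMap.congr_fun (key d) g
    simp only [LinearMap.comp_apply] at this h'
    have hfg' : DirectSum.coeLinearMap D f = DirectSum.coeLinearMap D g := hfg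
    rw [hfg', h'] at this
    exact this.symm
  · intro x
    have : x ∈ LinearMap.range (DirectSum.coeLinearMap D) := by
      rw [DirectSum.range_coeLinearMap, htop]; trivial
    exact this

theorem coeLinearMap_bijective (h : DirectSum.IsInternal D) :
    Function.Bijective (DirectSum.coeLinearMap D) := h

/-- The projection to the homogeneous part of degree `d`. -/
def hproj (h : DirectSum.IsInternal D) (d : Deg) : V →ₗ[ℚ] V :=
  (D d).subtype ∘ₗ DirectSum.component ℚ Deg (fun d => D d) d ∘ₗ
    (LinearEquiv.ofBijective (DirectSum.coeLinearMap D) (coeLinearMap_bijective h)).symm.toLinearMap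

section

variable (h : DirectSum.IsInternal D) (h' : DirectSum.IsInternal D')

theorem hproj_mem (d : Deg) (x : V) : hproj h d x ∈ D d := Subtype.property _

theorem coeEquiv_symm_apply {d : Deg} {x : V} (hx : x ∈ D d) :
    (LinearEquiv.ofBijective (DirectSum.coeLinearMap D) (coeLinearMap_bijective h)).symm x
      = DirectSum.lof ℚ Deg (fun d => D d) d ⟨x, hx⟩ := by
  rw [LinearEquiv.symm_apply_eq, LinearEquiv.ofBijective_apply, DirectSum.coeLinearMap_lof]

theorem hproj_same {d : Deg} {x : V} (hx : x ∈ D d) : hproj h d x = x := by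
  simp only [hproj, LinearMap.comp_apply, LinearEquiv.coe_coe, coeEquiv_symm_apply h hx,
    DirectSum.component.lof_self, Submodule.subtype_apply]

theorem hproj_ne {d e : Deg} (hne : e ≠ d) {x : V} (hx : x ∈ D e) : hproj h d x = 0 := by
  simp only [hproj, LinearMap.comp_apply, LinearEquiv.coe_coe, coeEquiv_symm_apply h hx]
  rw [DirectSum.component.of, dif_neg hne]
  rfl

include h in
@[elab_as_elim]
theorem homogeneous_induction {p : V → Prop} (zero : p 0) (mem : ∀ d, ∀ x ∈ D d, p x)
    (add : ∀ x y, p x → p y → p (x + y)) (x : V) : p x := by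
  have hx : x ∈ ⨆ d, D d := by rw [h.submodule_iSup_eq_top]; trivial
  induction hx using Submodule.iSup_induction' with
  | mem d x hx => exact mem d x hx
  | zero => exact zero
  | add x y _ _ hx hy => exact add x y hx hy

/-- Gives access to the homogeneous components through a finite set of degrees, without unfolding
the direct sum. -/
theorem exists_sum_hproj (x : V) :
    ∃ T : Finset Deg, (∀ d, d ∉ T → hproj h d x = 0) ∧ x = ∑ d ∈ T, hproj h d x := by
  classical
  induction x using homogeneous_induction h with
  | zero => exact ⟨∅, by simp, by simp⟩
  | mem d x hx =>
    refine ⟨{d}, fun e he => hproj_ne h (fun h => he ?_) hx, ?_⟩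
    · simp [h]
    · rw [Finset.sum_singleton, hproj_same h hx]
  | add x y hx hy =>
    obtain ⟨S, hS, hx⟩ := hx
    obtain ⟨T, hT, hy⟩ := hy
    refine ⟨S ∪ T, fun d hd => ?_, ?_⟩
    · rw [Finset.mem_union, not_or] at hd
      rw [map_add, hS d hd.1, hT d hd.2, add_zero]
    · have e1 : x = ∑ d ∈ S ∪ T, hproj h d x :=
        hx.trans (Finset.sum_subset Finset.subset_union_left fun d _ hd => hS d hd)
      have e2 : y = ∑ d ∈ S ∪ T, hproj h d y :=
        hy.trans (Finset.sum_subset Finset.subset_union_right fun d _ hd => hT d hd)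
      simp only [map_add]
      rw [Finset.sum_add_distrib, ← e1, ← e2]

theorem eq_of_hproj {x y : V} (hxy : ∀ d, hproj h d x = hproj h d y) : x = y := by
  rw [← sub_eq_zero]
  obtain ⟨T, -, hT⟩ := exists_sum_hproj h (x - y)
  rw [hT]
  refine Finset.sum_eq_zero fun d _ => ?_
  rw [map_sub, hxy, sub_self]

theorem mem_of_hproj {x : V} {d : Deg} (hx : ∀ e, e ≠ d → hproj h e x = 0) : x ∈ D d := by
  have : x = hproj h d x := by
    refine eq_of_hproj h fun e => ?_
    by_cases hed : e = d
    · subst hed; rw [hproj_same h (hproj_mem h e x)]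
    · rw [hx e hed, hproj_ne h (Ne.symm hed) (hproj_mem h d x)]
  rw [this]
  exact hproj_mem h d x

theorem hproj_map {f : V →ₗ[ℚ] W} (hf : ∀ d, ∀ x ∈ D d, f x ∈ D' d) (d : Deg) (x : V) :
    hproj h' d (f x) = f (hproj h d x) := by
  induction x using homogeneous_induction h with
  | zero => simp
  | add x y hx hy => rw [map_add, map_add, map_add, map_add, hx, hy]
  | mem e x hx =>
    by_cases hed : e = d
    · subst hed; rw [hproj_same h hx, hproj_same h' (hf e x hx)]
    · rw [hproj_ne h hed hx, hproj_ne h' hed (hf e x hx), map_zero]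

-- The projections commute with `f`, so the components of `x` in the other degrees have image zero
-- and vanish by injectivity.
include h h' in
theorem mem_of_map_mem {f : V →ₗ[ℚ] W} (hf : ∀ d, ∀ x ∈ D d, f x ∈ D' d)
    (hinj : Function.Injective f) {d : Deg} {x : V} (hx : f x ∈ D' d) : x ∈ D d := by
  refine mem_of_hproj h fun e he => hinj ?_
  rw [map_zero, ← hproj_map h h' hf, hproj_ne h' he.symm hx]

-- Any preimage may be replaced by its component of degree `d`, because `f` commutes with the
-- projections.
include h h' in
theorem exists_mem_of_surjective {f : V →ₗ[ℚ] W} (hf : ∀ d, ∀ x ∈ D d, f x ∈ D' d)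
    (hsurj : Function.Surjective f) {d : Deg} {y : W} (hy : y ∈ D' d) : ∃ x ∈ D d, f x = y := by
  obtain ⟨x, rfl⟩ := hsurj y
  exact ⟨hproj h d x, hproj_mem h d x, by rw [← hproj_map h h' hf, hproj_same h' hy]⟩

end

/-- Isomorphism of graded vector spaces. -/
def GrIso (D : Deg → Submodule ℚ V) (D' : Deg → Submodule ℚ W) : Prop :=
  ∃ e : V ≃ₗ[ℚ] W, ∀ d x, x ∈ D d ↔ e x ∈ D' d

theorem GrIso.map_eq {e : V ≃ₗ[ℚ] W} (he : ∀ d x, x ∈ D d ↔ e x ∈ D' d) (d : Deg) :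
    (D d).map e.toLinearMap = D' d := by
  ext y
  rw [Submodule.mem_map]
  constructor
  · rintro ⟨x, hx, rfl⟩; exact (he d x).1 hx
  · intro hy
    exact ⟨e.symm y, by rw [he]; simpa using hy, by simp⟩

theorem GrIso.isInternal (hi : GrIso D D') (h : DirectSum.IsInternal D) :
    DirectSum.IsInternal D' := by
  obtain ⟨e, he⟩ := hi
  have hs : ∀ d x, x ∈ D' d → e.symm x ∈ D d := fun d x hx => by
    rw [he, LinearEquiv.apply_symm_apply]; exact hx
  refine isInternal_of_proj (fun d => e.toLinearMap ∘ₗ hproj h d ∘ₗ e.symm.toLinearMap) ?_ ?_ ?_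
  · intro d x hx
    simp [hproj_same h (hs d x hx)]
  · intro d d' hne x hx
    simp [hproj_ne h hne (hs d' x hx)]
  · rw [← LinearEquiv.range e, ← Submodule.map_top, ← h.submodule_iSup_eq_top,
      Submodule.map_iSup]
    exact iSup_congr fun d => (GrIso.map_eq he d).symm

/-- The dimension of the homogeneous part of degree `d`. -/
def hdim (D : Deg → Submodule ℚ V) (d : Deg) : ℕ := Module.finrank ℚ (D d)

/-- The isomorphism of homogeneous parts. -/
def GrIso.partEquiv {e : V ≃ₗ[ℚ] W} (he : ∀ d x, x ∈ D d ↔ e x ∈ D' d) (d : Deg) :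
    D d ≃ₗ[ℚ] D' d :=
  (e.submoduleMap (D d)).trans (LinearEquiv.ofEq _ _ (GrIso.map_eq he d))

theorem GrIso.hdim_eq (hi : GrIso D D') (d : Deg) : hdim D d = hdim D' d := by
  obtain ⟨e, he⟩ := hi
  exact (GrIso.partEquiv he d).finrank_eq

theorem GrIso.finite (hi : GrIso D D') {d : Deg} (h : FiniteDimensional ℚ (D d)) :
    FiniteDimensional ℚ (D' d) := by
  obtain ⟨e, he⟩ := hi
  exact (GrIso.partEquiv he d).finiteDimensional

theorem GrIso.eq_bot_iff (hi : GrIso D D') (d : Deg) : D d = ⊥ ↔ D' d = ⊥ := by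
  obtain ⟨e, he⟩ := hi
  rw [← GrIso.map_eq he d]
  exact (Submodule.map_eq_bot_iff (e := e) (p := D d)).symm

end GradedSpace

/-! ### The grading of `SPoly` -/

namespace SPoly

variable {α β : Type}

/-- The projections `partProj` keep or kill each word according to its degree, and words span. In
particular relations between words cannot mix degrees. -/
theorem part_isInternal (dg : α ⊕ β → Deg) : DirectSum.IsInternal (part dg) := by
  refine isInternal_of_proj (partProj dg) ?_ ?_ ?_
  · intro d z hz
    induction hz using Submodule.span_induction with
    | mem z hz =>
      obtain ⟨l, hl, rfl⟩ := hz
      exact (partProj_word dg d l).trans (if_pos hl)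
    | zero => simp
    | add y z _ _ hy hz => rw [map_add, hy, hz]
    | smul c z _ hz => rw [map_smul, hz]
  · intro d e hne z hz
    induction hz using Submodule.span_induction with
    | mem z hz =>
      obtain ⟨l, hl, rfl⟩ := hz
      exact (partProj_word dg d l).trans (if_neg (hl ▸ hne))
    | zero => simp
    | add y z _ _ hy hz => rw [map_add, hy, hz, add_zero]
    | smul c z _ hz => rw [map_smul, hz, smul_zero]
  · rw [eq_top_iff, ← span_word, Submodule.span_le]
    rintro _ ⟨l, rfl⟩
    exact Submodule.mem_iSup_of_mem _ (word_mem_part dg l)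

theorem one_mem_part (dg : α ⊕ β → Deg) : (1 : SPoly α β) ∈ part dg 0 := word_mem_part dg []

theorem gen_mem_part (dg : α ⊕ β → Deg) (i : α ⊕ β) : gen i ∈ part dg (dg i) := by
  have := word_mem_part dg [i]
  simpa [word] using this

theorem mul_mem_part {dg : α ⊕ β → Deg} {d e : Deg} {y z : SPoly α β} (hy : y ∈ part dg d)
    (hz : z ∈ part dg e) : y * z ∈ part dg (d + e) := by
  induction hy using Submodule.span_induction with
  | mem y hy =>
    obtain ⟨l, rfl, rfl⟩ := hy
    induction hz using Submodule.span_induction with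
    | mem z hz =>
      obtain ⟨l', rfl, rfl⟩ := hz
      have := word_mem_part dg (l ++ l')
      rw [word_append, List.map_append, List.sum_append] at this
      exact this
    | zero => rw [mul_zero]; exact Submodule.zero_mem _
    | add y z _ _ hy hz => rw [mul_add]; exact Submodule.add_mem _ hy hz
    | smul c z _ hz => rw [mul_smul_comm]; exact Submodule.smul_mem _ _ hz
  | zero => rw [zero_mul]; exact Submodule.zero_mem _
  | add y z _ _ hy hz => rw [add_mul]; exact Submodule.add_mem _ hy hz
  | smul c z _ hz => rw [smul_mul_assoc]; exact Submodule.smul_mem _ _ hz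

theorem map_mem_part {α' β' : Type} {dg : α ⊕ β → Deg} {dg' : α' ⊕ β' → Deg}
    {f : SPoly α β →ₐ[ℚ] SPoly α' β'} (hf : ∀ i, f (gen i) ∈ part dg' (dg i)) {d : Deg}
    {z : SPoly α β} (hz : z ∈ part dg d) : f z ∈ part dg' d := by
  induction hz using Submodule.span_induction with
  | mem z hz =>
    obtain ⟨l, rfl, rfl⟩ := hz
    induction l with
    | nil => simpa using one_mem_part dg'
    | cons i l ih =>
      rw [List.map_cons, List.map_cons, List.prod_cons, map_mul, List.sum_cons]
      exact mul_mem_part (hf i) ih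
  | zero => rw [map_zero]; exact Submodule.zero_mem _
  | add y z _ _ hy hz => rw [map_add]; exact Submodule.add_mem _ hy hz
  | smul c z _ hz => rw [map_smul]; exact Submodule.smul_mem _ _ hz

/-- A linear endomorphism commutes with the action as soon as it commutes with the variables. -/
theorem map_smul_of_gen {M N : Type*} [AddCommGroup M] [AddCommGroup N] [Module ℚ M] [Module ℚ N]
    [Module (SPoly α β) M] [Module (SPoly α β) N] [IsScalarTower ℚ (SPoly α β) M]
    [IsScalarTower ℚ (SPoly α β) N] (f : M →ₗ[ℚ] N)
    (hf : ∀ (i : α ⊕ β) m, f ((gen i : SPoly α β) • m) = (gen i : SPoly α β) • f m)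
    (z : SPoly α β) (m : M) : f (z • m) = z • f m := by
  induction z using induction_left with
  | one => rw [one_smul, one_smul]
  | gen_mul i z ih => rw [mul_smul, hf, ih, mul_smul]
  | add y z hy hz => rw [add_smul, map_add, hy, hz, add_smul]
  | smul c z hz => rw [smul_assoc, map_smul, hz, smul_assoc]

theorem smul_mem_of_gen {M : Type*} [AddCommGroup M] [Module ℚ M] [Module (SPoly α β) M]
    [IsScalarTower ℚ (SPoly α β) M] (N : Submodule ℚ M)
    (hN : ∀ (i : α ⊕ β), ∀ m ∈ N, (gen i : SPoly α β) • m ∈ N) (z : SPoly α β) {m : M}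
    (hm : m ∈ N) : z • m ∈ N := by
  induction z using induction_left with
  | one => rwa [one_smul]
  | gen_mul i z ih => rw [mul_smul]; exact hN i _ ih
  | add y z hy hz => rw [add_smul]; exact N.add_mem hy hz
  | smul c z hz => rw [smul_assoc]; exact N.smul_mem c hz

end SPoly

/-! ### Degrees of the maps between the superrings -/

section Rings

open SPoly

variable (k : ℕ)

theorem wPoly_mem_flagPart (n : ℕ) (d : Deg) (hd : d = (2 * (n : ℤ), 0, 0)) :
    (ofEven (wPoly k n) : OmFlag k) ∈ flagPart k d := by
  subst hd
  cases n with
  | zero =>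
    rw [wPoly, map_one]
    exact one_mem_part _
  | succ n =>
    rw [wPoly]
    split_ifs with h
    · rw [Nat.cast_succ]
      exact gen_mem_part (flagDeg k) (Sum.inl (some ⟨n, h⟩))
    · rw [map_zero]; exact Submodule.zero_mem _

theorem xi_mem_flagPart : xi k ∈ flagPart k (2, 0, 0) := gen_mem_part (flagDeg k) (Sum.inl none)

theorem s_mem_flagPart (i : Fin (k + 1)) (d : Deg) (hd : d = (-2 * ((i : ℤ) + 1), 2, 1)) :
    (s i : OmFlag k) ∈ flagPart k d := by
  subst hd
  exact gen_mem_part (flagDeg k) (Sum.inr i)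

theorem phi_mem_flagPart {d : Deg} {a : Om k} (ha : a ∈ omPart k d) : phi k a ∈ flagPart k d := by
  refine map_mem_part (fun i => ?_) ha
  cases i with
  | inl i =>
    rw [gen_inl, phi_x]
    exact gen_mem_part (flagDeg k) (Sum.inl (some i))
  | inr i =>
    rw [gen_inr, phi_s]
    refine Submodule.add_mem _ (s_mem_flagPart k _ _ (by simp [omDeg])) ?_
    have := mul_mem_part (xi_mem_flagPart k) (s_mem_flagPart k i.succ _ rfl)
    convert this using 2
    simp [omDeg]
    ring

theorem psi_mem_flagPart {d : Deg} {a : Om (k + 1)} (ha : a ∈ omPart (k + 1) d) :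
    psi k a ∈ flagPart k d := by
  refine map_mem_part (fun i => ?_) ha
  cases i with
  | inl i =>
    rw [gen_inl, psi_x]
    refine Submodule.add_mem _ (wPoly_mem_flagPart k _ _ (by simp [omDeg])) ?_
    have := mul_mem_part (xi_mem_flagPart k) (wPoly_mem_flagPart k i _ rfl)
    convert this using 2
    simp [omDeg]
    ring
  | inr i =>
    rw [gen_inr, psi_s]
    exact s_mem_flagPart k _ _ rfl

end Rings

end VermaCat
end

noncomputable section

namespace VermaCat

/-! ### Series in `q` and `λ` -/

/-- The field `ℚ((q))((λ))`. -/
abbrev Ser : Type := LaurentSeries (LaurentSeries ℚ)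

theorem serCoeff_ext {f g : Ser} (h : ∀ i j, serCoeff f i j = serCoeff g i j) : f = g :=
  HahnSeries.ext (funext fun j => HahnSeries.ext (funext fun i => h i j))

/-- For fixed `j` the cone condition bounds `i` below by `m - c * j`, so each coefficient of a power
of `λ` is a Laurent series in `q`; the exponents `j` themselves are bounded below by `n`. -/
theorem exists_ser (f : ℤ → ℤ → ℚ) (h : ConeBounded fun i j => f i j ≠ 0) :
    ∃ g : Ser, ∀ i j, serCoeff g i j = f i j := by
  obtain ⟨c, m, n, h⟩ := h
  have h1 : ∀ j, BddBelow (Function.support fun i => f i j) := fun j =>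
    ⟨m - c * j, fun i hi => by linarith [(h i j hi).2]⟩
  have h2 : BddBelow (Function.support fun j => HahnSeries.ofSuppBddBelow _ (h1 j)) :=
    ⟨n, fun j hj => by
      by_contra hlt
      apply hj
      rw [HahnSeries.ofSuppBddBelow_eq_zero]
      funext i
      by_contra hi
      exact hlt (h i j hi).1⟩
  exact ⟨HahnSeries.ofSuppBddBelow _ h2, fun i j => rfl⟩

/-- Only finitely many terms contribute to a coefficient of a product. -/
theorem serCoeff_mul (f g : Ser) (a b : ℤ) (T : Finset (ℤ × ℤ))
    (hT : ∀ i j, serCoeff f i j ≠ 0 → serCoeff g (a - i) (b - j) ≠ 0 → (i, j) ∈ T) :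
    serCoeff (f * g) a b = ∑ x ∈ T, serCoeff f x.1 x.2 * serCoeff g (a - x.1) (b - x.2) := by
  classical
  have e1 : serCoeff (f * g) a b =
      ∑ y ∈ (Finset.antidiagonal f.isPWO_support g.isPWO_support b).sigma fun y =>
          Finset.antidiagonal (f.coeff y.1).isPWO_support (g.coeff y.2).isPWO_support a,
        serCoeff f y.2.1 y.1.1 * serCoeff g y.2.2 y.1.2 := by
    rw [serCoeff, HahnSeries.coeff_mul, HahnSeries.coeff_sum, Finset.sum_sigma]
    refine Finset.sum_congr rfl fun y _ => ?_
    rw [HahnSeries.coeff_mul]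
    rfl
  rw [e1]
  -- A term of the double sum is determined by its exponents `(i, j)` in the first factor, since the
  -- totals are fixed. Only nonzero terms are matched, so `T` may contain superfluous pairs.
  refine Finset.sum_bij_ne_zero (fun y _ _ => (y.2.1, y.1.1)) ?_ ?_ ?_ ?_
  · rintro ⟨⟨j, j'⟩, ⟨i, i'⟩⟩ hy hne
    obtain ⟨h1, h2⟩ := Finset.mem_sigma.mp hy
    have hj : j + j' = b := (Finset.mem_antidiagonal.mp h1).2.2
    have hi : i + i' = a := (Finset.mem_antidiagonal.mp h2).2.2
    refine hT i j (left_ne_zero_of_mul hne) ?_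
    rw [← hi, ← hj, add_sub_cancel_left, add_sub_cancel_left]
    exact right_ne_zero_of_mul hne
  · rintro ⟨⟨j, j'⟩, ⟨i, i'⟩⟩ hy hne ⟨⟨l, l'⟩, ⟨m, m'⟩⟩ hz hne' heq
    obtain ⟨h1, h2⟩ := Finset.mem_sigma.mp hy
    obtain ⟨h3, h4⟩ := Finset.mem_sigma.mp hz
    have hj : j + j' = b := (Finset.mem_antidiagonal.mp h1).2.2
    have hi : i + i' = a := (Finset.mem_antidiagonal.mp h2).2.2
    have hl : l + l' = b := (Finset.mem_antidiagonal.mp h3).2.2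
    have hm : m + m' = a := (Finset.mem_antidiagonal.mp h4).2.2
    simp only [Prod.mk.injEq] at heq
    obtain ⟨rfl, rfl⟩ := heq
    obtain rfl : j' = l' := by linarith
    obtain rfl : i' = m' := by linarith
    rfl
  · rintro ⟨i, j⟩ hij hne
    have h1 := left_ne_zero_of_mul hne
    have h2 := right_ne_zero_of_mul hne
    refine ⟨⟨(j, b - j), (i, a - i)⟩, ?_, hne, rfl⟩
    simp only [Finset.mem_sigma, Finset.mem_antidiagonal]
    refine ⟨⟨?_, ?_, by ring⟩, h1, h2, by ring⟩
    · rw [HahnSeries.mem_support]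
      intro h0
      exact h1 (by simp [serCoeff, h0])
    · rw [HahnSeries.mem_support]
      intro h0
      exact h2 (by simp [serCoeff, h0])
  · rintro ⟨⟨j, j'⟩, ⟨i, i'⟩⟩ hy hne
    obtain ⟨h1, h2⟩ := Finset.mem_sigma.mp hy
    have hj : j + j' = b := (Finset.mem_antidiagonal.mp h1).2.2
    have hi : i + i' = a := (Finset.mem_antidiagonal.mp h2).2.2
    simp only [← hi, ← hj, add_sub_cancel_left]

theorem serCoeff_C_mul (a : LaurentSeries ℚ) (f : Ser) (i j : ℤ) :
    serCoeff (HahnSeries.C a * f) i j = (a * f.coeff j).coeff i := by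
  rw [serCoeff, HahnSeries.C_apply, HahnSeries.coeff_single_zero_mul]

theorem serCoeff_q_mul (f : Ser) (i j : ℤ) :
    serCoeff (HahnSeries.C (HahnSeries.single 1 1) * f) i j = serCoeff f (i - 1) j := by
  rw [serCoeff_C_mul, HahnSeries.coeff_single_mul, one_mul, serCoeff]

theorem serCoeff_lam_mul (f : Ser) (i j : ℤ) :
    serCoeff (HahnSeries.single 1 1 * f) i j = serCoeff f i (j - 1) := by
  rw [serCoeff, HahnSeries.coeff_single_mul, one_mul, serCoeff]

theorem serCoeff_one (i j : ℤ) : serCoeff 1 i j = if i = 0 ∧ j = 0 then 1 else 0 := by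
  rw [serCoeff, HahnSeries.coeff_one]
  by_cases hj : j = 0
  · rw [if_pos hj, HahnSeries.coeff_one]
    simp [hj]
  · simp [hj]

theorem LamBounded.coneBounded {S : ℤ → ℤ → Prop} (h : LamBounded S) : ConeBounded S := by
  obtain ⟨m, n, n', h⟩ := h
  exact ⟨0, m, n, fun i j hs => ⟨(h i j hs).2.1, by simpa using (h i j hs).1⟩⟩

/-- A property of sets of bidegrees that behaves like being bounded. -/
structure IsBoundedness (Bd : (ℤ → ℤ → Prop) → Prop) : Prop where
  cone : ∀ {S}, Bd S → ConeBounded S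
  of_lam : ∀ {S}, LamBounded S → Bd S
  mono : ∀ {S T : ℤ → ℤ → Prop}, Bd T → (∀ i j, S i j → T i j) → Bd S
  or : ∀ {S T : ℤ → ℤ → Prop}, Bd S → Bd T → Bd fun i j => S i j ∨ T i j
  add : ∀ {S T : ℤ → ℤ → Prop}, Bd S → Bd T →
    Bd fun i j => ∃ a b a' b', S a b ∧ T a' b' ∧ a + a' = i ∧ b + b' = j

theorem isBoundedness_coneBounded : IsBoundedness ConeBounded where
  cone h := h
  of_lam h := h.coneBounded
  mono h hST := h.mono hST
  or := ConeBounded.or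
  add := ConeBounded.add

theorem isBoundedness_lamBounded : IsBoundedness LamBounded where
  cone h := h.coneBounded
  of_lam h := h
  mono := fun ⟨m, n, n', h⟩ hST => ⟨m, n, n', fun i j hs => h i j (hST i j hs)⟩
  or := fun ⟨m, n, n', h⟩ ⟨m1, n1, n1', h1⟩ =>
    ⟨min m m1, min n n1, max n' n1', fun i j hij => by
      rcases hij with hij | hij
      · obtain ⟨a, b, c⟩ := h i j hij
        exact ⟨(min_le_left _ _).trans a, (min_le_left _ _).trans b, c.trans (le_max_left _ _)⟩
      · obtain ⟨a, b, c⟩ := h1 i j hij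
        exact ⟨(min_le_right _ _).trans a, (min_le_right _ _).trans b, c.trans (le_max_right _ _)⟩⟩
  add := fun ⟨m, n, n', h⟩ ⟨m1, n1, n1', h1⟩ => ⟨m + m1, n + n1, n' + n1', by
    rintro i j ⟨a, b, a', b', hs, ht, rfl, rfl⟩
    obtain ⟨h2, h3, h4⟩ := h a b hs
    obtain ⟨h5, h6, h7⟩ := h1 a' b' ht
    exact ⟨by linarith, by linarith, by linarith⟩⟩

/-- Each bidegree is in finitely many ways a sum of bidegrees from two bounded sets. -/
theorem ConeBounded.finite_add {S T : ℤ → ℤ → Prop} (hS : ConeBounded S) (hT : ConeBounded T)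
    (a b : ℤ) : {x : ℤ × ℤ | S x.1 x.2 ∧ T (a - x.1) (b - x.2)}.Finite := by
  obtain ⟨c, m, n, m', n', h, h'⟩ := hS.common hT
  refine (((Set.finite_Icc n (b - n')).biUnion fun j _ =>
    (Set.finite_Icc (m - c * j) (a + c * (b - j) - m')).image fun i => (i, j))).subset ?_
  rintro ⟨i, j⟩ ⟨hs, ht⟩
  obtain ⟨h1, h2⟩ := h i j hs
  obtain ⟨h3, h4⟩ := h' (a - i) (b - j) ht
  refine Set.mem_iUnion₂.mpr ⟨j, ⟨h1, by linarith⟩, i, ⟨by linarith, by linarith⟩, rfl⟩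

/-- A ring of bounded Laurent series in `q` and `λ`. -/
class SerRing (R : Type) [CommRing R] [Algebra Kq R] where
  emb : R →+* Ser
  emb_injective : Function.Injective emb
  Bd : (ℤ → ℤ → Prop) → Prop
  isBoundedness : IsBoundedness Bd
  bd_emb : ∀ r, Bd fun i j => serCoeff (emb r) i j ≠ 0
  mem_range : ∀ f, (Bd fun i j => serCoeff f i j ≠ 0) → f ∈ emb.range
  cf : R → ℤ → ℤ → ℚ
  cf_eq : ∀ r i j, cf r i j = serCoeff (emb r) i j
  emb_algebraMap : ∀ x, emb (algebraMap Kq R x) = HahnSeries.C (qSeries x)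
  lm : Rˣ
  emb_lm : emb (lm : R) = HahnSeries.single 1 1

section SerRing

variable {R : Type} [CommRing R] [Algebra Kq R] [SerRing R]

open SerRing

theorem cf_ext {r s : R} (h : ∀ i j, cf r i j = cf s i j) : r = s :=
  emb_injective (serCoeff_ext fun i j => by rw [← cf_eq, ← cf_eq, h])

theorem cf_add (r s : R) (i j : ℤ) : cf (r + s) i j = cf r i j + cf s i j := by
  rw [cf_eq, cf_eq, cf_eq, map_add, serCoeff_add]

variable (R) in
theorem cf_zero (i j : ℤ) : cf (0 : R) i j = 0 := by
  rw [cf_eq, map_zero]; simp [serCoeff]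

theorem cf_neg (r : R) (i j : ℤ) : cf (-r) i j = - cf r i j := by
  rw [eq_neg_iff_add_eq_zero, ← cf_add, neg_add_cancel, cf_zero]

theorem cf_sub (r s : R) (i j : ℤ) : cf (r - s) i j = cf r i j - cf s i j := by
  rw [sub_eq_add_neg, cf_add, cf_neg, sub_eq_add_neg]

theorem cf_sum {ι : Type*} (T : Finset ι) (r : ι → R) (i j : ℤ) :
    cf (∑ t ∈ T, r t) i j = ∑ t ∈ T, cf (r t) i j := by
  classical
  induction T using Finset.induction_on with
  | empty => simp [cf_zero]
  | insert t T ht ih => rw [Finset.sum_insert ht, Finset.sum_insert ht, cf_add, ih]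

variable (R) in
theorem cf_one (i j : ℤ) : cf (1 : R) i j = if i = 0 ∧ j = 0 then 1 else 0 := by
  rw [cf_eq, map_one, serCoeff_one]

theorem exists_cf (f : ℤ → ℤ → ℚ) (h : Bd R fun i j => f i j ≠ 0) :
    ∃ r : R, ∀ i j, cf r i j = f i j := by
  obtain ⟨g, hg⟩ := exists_ser f (isBoundedness.cone h)
  obtain ⟨r, hr⟩ := mem_range (R := R) g (by simpa only [hg] using h)
  exact ⟨r, fun i j => by rw [cf_eq, hr, hg]⟩

theorem cf_mul (r s : R) (a b : ℤ) (T : Finset (ℤ × ℤ))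
    (hT : ∀ i j, cf r i j ≠ 0 → cf s (a - i) (b - j) ≠ 0 → (i, j) ∈ T) :
    cf (r * s) a b = ∑ x ∈ T, cf r x.1 x.2 * cf s (a - x.1) (b - x.2) := by
  simp only [cf_eq] at hT ⊢
  rw [map_mul, serCoeff_mul _ _ a b T hT]

/-- Here `c` is a coefficient function in one of the two variables. Negative powers come from
applying the hypothesis to `u⁻¹ * r`. -/
theorem shift_zpow {S : Type*} [CommRing S] (u : Sˣ) (c : S → ℤ → ℚ)
    (h : ∀ r i, c (u * r) i = c r (i - 1)) (n : ℤ) (r : S) (i : ℤ) :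
    c ((u ^ n : Sˣ) * r) i = c r (i - n) := by
  induction n using Int.induction_on generalizing r i with
  | zero => simp
  | succ n ih =>
    rw [zpow_add_one, Units.val_mul, mul_assoc, ih, h]
    congr 1; ring
  | pred n ih =>
    have h1 := ih (((u⁻¹ : Sˣ) : S) * r) i
    have h2 := h (((u⁻¹ : Sˣ) : S) * r) (i + n + 1)
    rw [Units.mul_inv_cancel_left, add_sub_cancel_right] at h2
    rw [zpow_sub_one, Units.val_mul, mul_assoc, h1, sub_neg_eq_add, ← h2]
    congr 1; ring

theorem cf_qu_mul (r : R) (i j : ℤ) : cf ((qu R : R) * r) i j = cf r (i - 1) j := by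
  rw [cf_eq, cf_eq, map_mul, qu_val, emb_algebraMap, qSeries_q, serCoeff_q_mul]

theorem cf_lm_mul (r : R) (i j : ℤ) : cf (((lm : Rˣ) : R) * r) i j = cf r i (j - 1) := by
  rw [cf_eq, cf_eq, map_mul, emb_lm, serCoeff_lam_mul]

theorem cf_unit_mul (m n : ℤ) (r : R) (i j : ℤ) :
    cf (((qu R ^ m * lm ^ n : Rˣ) : R) * r) i j = cf r (i - m) (j - n) := by
  rw [Units.val_mul, mul_assoc,
    shift_zpow (qu R) (fun r i => cf r i j) (fun r i => cf_qu_mul r i j),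
    shift_zpow (lm : Rˣ) (fun r j => cf r (i - m) j) (fun r j => cf_lm_mul r _ j)]

variable (R) in
theorem SerRing.isDomain : IsDomain R := emb_injective (R := R) |>.isDomain emb

end SerRing

/-! ### The two rings -/

/-- The parameter `λ` as a unit of `ℚ((q))((λ))`. -/
def lamSer : Serˣ := Units.map coneSubring.subtype.toMonoidHom lamHat

theorem lamSer_val : (lamSer : Ser) = HahnSeries.single 1 1 := rfl

theorem serCoeff_lamSer_mul (i : ℤ) (f : Ser) (j : ℤ) :
    serCoeff ((lamSer : Ser) * f) i j = serCoeff f i (j - 1) := by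
  rw [lamSer_val, serCoeff_lam_mul]

theorem serCoeff_lamSer_zpow_mul (n : ℤ) (f : Ser) (i j : ℤ) :
    serCoeff (((lamSer ^ n : Serˣ) : Ser) * f) i j = serCoeff f i (j - n) :=
  shift_zpow lamSer (fun f j => serCoeff f i j) (serCoeff_lamSer_mul i) n f j

/-- The embedding of Laurent polynomials into Laurent series. -/
def embLaurent : LaurentPolynomial (LaurentSeries ℚ) →+* Ser :=
  LaurentPolynomial.eval₂ (HahnSeries.C : LaurentSeries ℚ →+* Ser) lamSer

theorem coeff_embLaurent (r : LaurentPolynomial (LaurentSeries ℚ)) (j : ℤ) :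
    (embLaurent r).coeff j = r.coeff j := by
  induction r using LaurentPolynomial.induction_on' with
  | add p p' hp hp' =>
    rw [map_add, HahnSeries.coeff_add, hp, hp', AddMonoidAlgebra.coeff_add, Finsupp.add_apply]
  | C_mul_T n a =>
    have h1 : embLaurent (LaurentPolynomial.C a * LaurentPolynomial.T n)
        = ((lamSer ^ n : Serˣ) : Ser) * HahnSeries.C a :=
      (LaurentPolynomial.eval₂_C_mul_T (HahnSeries.C : LaurentSeries ℚ →+* Ser) lamSer a n).trans
        (mul_comm _ _)
    refine HahnSeries.ext (funext fun i => ?_)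
    have h2 := serCoeff_lamSer_zpow_mul n (HahnSeries.C a) i j
    rw [← h1] at h2
    refine h2.trans ?_
    rw [← LaurentPolynomial.single_eq_C_mul_T, AddMonoidAlgebra.coeff_single, serCoeff,
      HahnSeries.C_apply, HahnSeries.coeff_single, Finsupp.single_apply]
    simp only [sub_eq_zero, eq_comm]

/-- The embedding of the ring of Laurent polynomials in `λ` into the Laurent series. -/
def embLam : LamRing →+* Ser := embLaurent

theorem lamCoeff_eq (r : LamRing) (i j : ℤ) : lamCoeff r i j = serCoeff (embLam r) i j :=
  congrArg (fun f => HahnSeries.coeff f i) (coeff_embLaurent r j).symm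

theorem embLam_injective : Function.Injective embLam := by
  intro r s h
  have h2 : ∀ i j, lamCoeff r i j = lamCoeff s i j := fun i j => by
    rw [lamCoeff_eq, lamCoeff_eq, h]
  refine AddMonoidAlgebra.coeff_injective (Finsupp.ext fun j => HahnSeries.ext (funext fun i => ?_))
  exact h2 i j

theorem exists_lower_bound (T : Finset ℤ) (f : ℤ → LaurentSeries ℚ) :
    ∃ m, ∀ j ∈ T, ∀ i, (f j).coeff i ≠ 0 → m ≤ i := by
  classical
  induction T using Finset.induction_on with
  | empty => exact ⟨0, by simp⟩
  | insert j T hj ih =>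
    obtain ⟨m, hm⟩ := ih
    refine ⟨min m (f j).order, fun j' hj' i hi => ?_⟩
    rcases Finset.mem_insert.mp hj' with rfl | hj'
    · exact (min_le_right _ _).trans (HahnSeries.order_le_of_coeff_ne_zero hi)
    · exact (min_le_left _ _).trans (hm j' hj' i hi)

instance : SerRing LamRing where
  emb := embLam
  emb_injective := embLam_injective
  Bd := LamBounded
  isBoundedness := isBoundedness_lamBounded
  bd_emb r := by
    simp only [← lamCoeff_eq]
    let c : ℤ →₀ LaurentSeries ℚ := AddMonoidAlgebra.coeff (R := LaurentSeries ℚ) (M := ℤ) r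
    obtain ⟨m, hm⟩ := exists_lower_bound c.support c
    obtain ⟨n, hn⟩ := c.support.bddBelow
    obtain ⟨n', hn'⟩ := c.support.bddAbove
    refine ⟨m, n, n', fun i j h => ?_⟩
    have hj : j ∈ c.support := by
      rw [Finsupp.mem_support_iff]
      intro h0
      apply h
      change (c j).coeff i = 0
      rw [h0, HahnSeries.coeff_zero]
    exact ⟨hm j hj i h, hn hj, hn' hj⟩
  mem_range f h := by
    classical
    obtain ⟨m, n, n', h⟩ := h
    -- The `λ`-exponents lie between `n` and `n'`, so the series has finitely many coefficients and
    -- is a Laurent polynomial in `λ`.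
    let c : ℤ →₀ LaurentSeries ℚ := Finsupp.onFinset (Finset.Icc n n') f.coeff fun j hj => by
      have : ∃ i, (f.coeff j).coeff i ≠ 0 := by
        by_contra hall
        push Not at hall
        exact hj (HahnSeries.ext (funext hall))
      obtain ⟨i, hi⟩ := this
      exact Finset.mem_Icc.mpr (h i j hi).2
    exact ⟨(AddMonoidAlgebra.ofCoeff c : LaurentPolynomial (LaurentSeries ℚ)),
      HahnSeries.ext (funext fun j => coeff_embLaurent _ j)⟩
  cf := lamCoeff
  cf_eq := lamCoeff_eq
  emb_algebraMap x := LaurentPolynomial.eval₂_C _ _ _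
  lm := lam
  emb_lm := by
    have h : embLam (LaurentPolynomial.T 1 : LaurentPolynomial (LaurentSeries ℚ))
        = ((lamSer ^ (1 : ℤ) : Serˣ) : Ser) := by
      have := LaurentPolynomial.eval₂_C_mul_T (HahnSeries.C : LaurentSeries ℚ →+* Ser) lamSer 1 1
      rw [map_one, one_mul, map_one, one_mul] at this
      exact this
    rw [zpow_one] at h
    exact h

instance : SerRing HatRing where
  emb := coneSubring.subtype
  emb_injective := Subtype.val_injective
  Bd := ConeBounded
  isBoundedness := isBoundedness_coneBounded
  bd_emb r := Subtype.property r
  mem_range f h := ⟨⟨f, h⟩, rfl⟩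
  cf := hatCoeff
  cf_eq _ _ _ := rfl
  emb_algebraMap _ := rfl
  lm := lamHat
  emb_lm := rfl

end VermaCat
end

noncomputable section

namespace VermaCat

open SerRing

/-! ### Graded superdimensions -/

section Sdim

variable {V W : Type} [AddCommGroup V] [Module ℚ V] [AddCommGroup W] [Module ℚ W]
  {D : Deg → Submodule ℚ V} {D' : Deg → Submodule ℚ W}

/-- The bidegrees in which a graded vector space is nonzero. -/
def supp (D : Deg → Submodule ℚ V) (i j : ℤ) : Prop := ∃ p : ZMod 2, D (i, j, p) ≠ ⊥

theorem GrIso.supp_iff (h : GrIso D D') (i j : ℤ) : supp D i j ↔ supp D' i j := by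
  simp only [supp, ne_eq, h.eq_bot_iff]

theorem hdim_of_eq_bot {d : Deg} (h : D d = ⊥) : hdim D d = 0 := by
  rw [hdim, h, finrank_bot]

/-- The superdimension in a given bidegree. -/
def sdiff (D : Deg → Submodule ℚ V) (i j : ℤ) : ℚ :=
  (hdim D (i, j, 0) : ℚ) - (hdim D (i, j, 1) : ℚ)

theorem supp_of_sdiff {i j : ℤ} (h : sdiff D i j ≠ 0) : supp D i j := by
  by_contra hs
  simp only [supp, not_exists, not_not] at hs
  exact h (by simp [sdiff, hdim_of_eq_bot (hs 0), hdim_of_eq_bot (hs 1)])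

variable (R : Type) [CommRing R] [Algebra Kq R] [SerRing R]

/-- The graded superdimension as a series. -/
def sdim (D : Deg → Submodule ℚ V) : R :=
  -- The choice depends on `sdiff D` only, so isomorphic spaces have equal values without any
  -- boundedness; the value is arbitrary if no series has these coefficients, which `cf_sdim`
  -- excludes for bounded supports.
  Classical.epsilon fun r => ∀ i j, cf r i j = sdiff D i j

variable {R}

theorem bd_sdiff (h : Bd R (supp D)) : Bd R fun i j => sdiff D i j ≠ 0 :=
  isBoundedness.mono h fun _ _ => supp_of_sdiff

theorem cf_sdim (h : Bd R (supp D)) (i j : ℤ) : cf (sdim R D) i j = sdiff D i j :=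
  Classical.epsilon_spec (exists_cf (R := R) (sdiff D) (bd_sdiff h)) i j

theorem isSeries_sdim (h : Bd R (supp D)) : IsSeries cf (sdim R D) (hdim D) := fun i j =>
  cf_sdim h i j

theorem GrIso.sdim_eq (hi : GrIso D D') : sdim R D = sdim R D' := by
  have : sdiff D = sdiff D' := by
    funext i j
    simp only [sdiff, hi.hdim_eq]
  rw [sdim, sdim, this]

theorem mono_mul_cf (i j : ℤ) (ε : ZMod 2) (r : R) (a b : ℤ) :
    cf (mono lm i j ε * r) a b = (-1) ^ ε.val * cf r (a - i) (b - j) := by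
  rw [mono, mul_assoc]
  rcases Nat.even_or_odd ε.val with h | h
  · rw [h.neg_one_pow, h.neg_one_pow, one_mul, one_mul, cf_unit_mul]
  · rw [h.neg_one_pow, h.neg_one_pow, neg_mul, neg_mul, one_mul, one_mul, cf_neg, cf_unit_mul]

theorem bd_supp_shift (d : Deg) (h : Bd R (supp D)) : Bd R (supp fun e => D (e - d)) := by
  have h1 : Bd R fun i j => i = d.1 ∧ j = d.2.1 :=
    isBoundedness.of_lam ⟨d.1, d.2.1, d.2.1, by rintro i j ⟨rfl, rfl⟩; simp⟩
  refine isBoundedness.mono (isBoundedness.add h h1) ?_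
  rintro i j ⟨p, hp⟩
  exact ⟨i - d.1, j - d.2.1, d.1, d.2.1, ⟨p - d.2.2, hp⟩, ⟨rfl, rfl⟩, by ring, by ring⟩

/-- A parity shift exchanges the two terms of `sdiff`, which is the sign of `mono` at `π = -1`. -/
theorem sdim_shift (i j : ℤ) (ε : ZMod 2) (h : Bd R (supp D)) :
    sdim R (fun e => D (e - (i, j, ε))) = mono lm i j ε * sdim R D := by
  refine cf_ext fun a b => ?_
  rw [cf_sdim (bd_supp_shift (i, j, ε) h), mono_mul_cf, cf_sdim h]
  simp only [sdiff, hdim, Prod.mk_sub_mk]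
  fin_cases ε
  · change (_ : ℚ) - _ = (-1) ^ 0 * _
    rw [pow_zero, one_mul]
    rfl
  · change (_ : ℚ) - _ = (-1) ^ 1 * _
    rw [pow_one, neg_one_mul, neg_sub]
    rfl

end Sdim

/-! ### Objects -/

section Obj

variable {A : Type} [Ring A] [Algebra ℚ A] {𝒜 : Deg → Submodule ℚ A}

/-- The objects of the category attached to a notion of boundedness. -/
def Obj (Bd : (ℤ → ℤ → Prop) → Prop) (𝒜 : Deg → Submodule ℚ A) (M : SMod A) : Prop :=
  M.IsGraded 𝒜 ∧ M.LocFin ∧ Bd M.support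

theorem _root_.VermaCat.SMod.Iso.grIso {M N : SMod A} (h : M.Iso N) : GrIso M.deg N.deg := by
  obtain ⟨e, he⟩ := h
  exact ⟨e.restrictScalars ℚ, he⟩

theorem _root_.VermaCat.SMod.Iso.symm {M N : SMod A} (h : M.Iso N) : N.Iso M := by
  obtain ⟨e, he⟩ := h
  exact ⟨e.symm, fun d x => by rw [he, LinearEquiv.apply_symm_apply]⟩

theorem _root_.VermaCat.SMod.Iso.trans {M N P : SMod A} (h : M.Iso N) (h' : N.Iso P) :
    M.Iso P := by
  obtain ⟨e, he⟩ := h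
  obtain ⟨f, hf⟩ := h'
  exact ⟨e.trans f, fun d x => by rw [he, hf]; rfl⟩

theorem IsGraded.iso {M N : SMod A} (hM : M.IsGraded 𝒜) (h : M.Iso N) : N.IsGraded 𝒜 := by
  refine ⟨h.grIso.isInternal hM.1, fun d e a ha n hn => ?_⟩
  obtain ⟨f, hf⟩ := h
  have h1 := hM.2 d e a ha (f.symm n) (by rw [hf, LinearEquiv.apply_symm_apply]; exact hn)
  rw [hf, map_smul, LinearEquiv.apply_symm_apply] at h1
  exact h1

theorem IsGraded.shift {M : SMod A} (hM : M.IsGraded 𝒜) (d : Deg) : (M.shift d).IsGraded 𝒜 := by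
  refine ⟨isInternal_of_proj (fun e => hproj hM.1 (e - d)) ?_ ?_ ?_, ?_⟩
  · intro e x hx
    exact hproj_same hM.1 hx
  · intro e e' hne x hx
    exact hproj_ne hM.1 (fun h => hne (sub_left_injective h)) hx
  · have h1 := hM.1.submodule_iSup_eq_top
    have h2 : ⨆ e, M.deg (e - d) = ⨆ e, M.deg e := (Equiv.subRight d).iSup_comp (g := M.deg)
    exact h2.trans h1
  · intro e e' a ha m hm
    have := hM.2 e (e' - d) a ha m hm
    rwa [← add_sub_assoc] at this

theorem Obj.shift {Bd : (ℤ → ℤ → Prop) → Prop} (hB : IsBoundedness Bd) {M : SMod A}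
    (hM : Obj Bd 𝒜 M) (d : Deg) : Obj Bd 𝒜 (M.shift d) := by
  refine ⟨IsGraded.shift hM.1 d, fun e => hM.2.1 (e - d), ?_⟩
  have h1 : Bd fun i j => i = d.1 ∧ j = d.2.1 :=
    hB.of_lam ⟨d.1, d.2.1, d.2.1, by rintro i j ⟨rfl, rfl⟩; simp⟩
  refine hB.mono (hB.add hM.2.2 h1) ?_
  rintro i j ⟨p, hp⟩
  exact ⟨i - d.1, j - d.2.1, d.1, d.2.1, ⟨p - d.2.2, hp⟩, ⟨rfl, rfl⟩, by ring, by ring⟩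

theorem Obj.iso {Bd : (ℤ → ℤ → Prop) → Prop} (hB : IsBoundedness Bd) {M N : SMod A}
    (hM : Obj Bd 𝒜 M) (h : M.Iso N) : Obj Bd 𝒜 N :=
  ⟨IsGraded.iso hM.1 h, fun e => h.grIso.finite (hM.2.1 e),
    hB.mono hM.2.2 fun i j => (h.grIso.supp_iff i j).2⟩

/-! ### Direct sums -/

section Dsum

variable {ι : Type} {X : ι → SMod A}

theorem single_mem_dsum [DecidableEq ι] {e : Deg} {i : ι} {x : (X i).carrier}
    (hx : x ∈ (X i).deg e) :
    (DFinsupp.single i x : Π₀ i, (X i).carrier) ∈ (dsum X).deg e := by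
  intro j
  by_cases hij : i = j
  · subst hij
    rwa [DFinsupp.single_eq_same]
  · rw [DFinsupp.single_eq_of_ne (Ne.symm hij)]
    exact Submodule.zero_mem _

theorem dsum_isInternal (h : ∀ i, DirectSum.IsInternal (X i).deg) :
    DirectSum.IsInternal (dsum X).deg := by
  classical
  refine isInternal_of_proj
    (fun e => (DFinsupp.mapRange.linearMap fun i => hproj (h i) e :
      (Π₀ i, (X i).carrier) →ₗ[ℚ] Π₀ i, (X i).carrier)) ?_ ?_ ?_
  · intro e x hx
    refine DFinsupp.ext fun i => ?_
    exact hproj_same (h i) (hx i)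
  · intro e e' hne x hx
    refine DFinsupp.ext fun i => ?_
    exact hproj_ne (h i) hne (hx i)
  · rw [eq_top_iff]
    rintro x -
    change (x : Π₀ i, (X i).carrier) ∈ (⨆ d, (dsum X).deg d : Submodule ℚ (Π₀ i, (X i).carrier))
    induction x using DFinsupp.induction with
    | h0 => exact Submodule.zero_mem _
    | ha i b f _ _ hf =>
      refine Submodule.add_mem _ ?_ hf
      clear * - h
      induction b using homogeneous_induction (h i) with
      | zero => rw [DFinsupp.single_zero]; exact Submodule.zero_mem _
      | mem d x hx => exact Submodule.mem_iSup_of_mem d (single_mem_dsum hx)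
      | add x y hx hy => rw [DFinsupp.single_add]; exact Submodule.add_mem _ hx hy

theorem dsum_isGraded (h : ∀ i, (X i).IsGraded 𝒜) : (dsum X).IsGraded 𝒜 :=
  ⟨dsum_isInternal fun i => (h i).1, fun d e a ha _ hm i => (h i).2 d e a ha _ (hm i)⟩

/-- The homogeneous part of a direct sum when only finitely many summands contribute. -/
theorem exists_dsum_deg_equiv {e : Deg} (T : Finset ι) (hT : ∀ i, i ∉ T → (X i).deg e = ⊥) :
    Nonempty ((dsum X).deg e ≃ₗ[ℚ] ∀ i : T, (X i).deg e) := by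
  classical
  let f : (dsum X).deg e →ₗ[ℚ] ∀ i : T, (X i).deg e :=
    LinearMap.pi fun i =>
      { toFun := fun x => ⟨(show Π₀ i, (X i).carrier from x.1) i, x.2 i⟩
        map_add' := fun x y => rfl
        map_smul' := fun c x => rfl }
  refine ⟨LinearEquiv.ofBijective f ⟨?_, ?_⟩⟩
  · rw [← LinearMap.ker_eq_bot, LinearMap.ker_eq_bot']
    intro x hx
    refine Subtype.ext (DFinsupp.ext fun i => ?_)
    by_cases hi : i ∈ T
    · exact congrArg Subtype.val (congrFun hx ⟨i, hi⟩)
    · have h1 := x.2 i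
      rw [hT i hi] at h1
      exact (Submodule.mem_bot ℚ).mp h1
  · intro y
    refine ⟨⟨(DFinsupp.mk T fun i => (y i : (X i).carrier) : Π₀ i, (X i).carrier), fun i => ?_⟩, ?_⟩
    · by_cases hi : i ∈ T
      · rw [DFinsupp.mk_apply, dif_pos hi]
        exact (y ⟨i, hi⟩).2
      · rw [DFinsupp.mk_apply, dif_neg hi]
        exact Submodule.zero_mem _
    · funext i
      refine Subtype.ext ?_
      change (DFinsupp.mk T fun i => (y i : (X i).carrier) : Π₀ i, (X i).carrier) i = _
      exact dif_pos i.2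

theorem dsum_deg_finite {e : Deg} (T : Finset ι) (hT : ∀ i, i ∉ T → (X i).deg e = ⊥)
    (h : ∀ i, FiniteDimensional ℚ ((X i).deg e)) : FiniteDimensional ℚ ((dsum X).deg e) := by
  obtain ⟨f⟩ := exists_dsum_deg_equiv T hT
  exact f.symm.finiteDimensional

theorem hdim_dsum {e : Deg} (T : Finset ι) (hT : ∀ i, i ∉ T → (X i).deg e = ⊥)
    (h : ∀ i, FiniteDimensional ℚ ((X i).deg e)) :
    hdim (dsum X).deg e = ∑ i ∈ T, hdim (X i).deg e := by
  obtain ⟨f⟩ := exists_dsum_deg_equiv T hT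
  rw [hdim, f.finrank_eq, Module.finrank_pi_fintype]
  exact Finset.sum_coe_sort T fun i => hdim (X i).deg e

/-- Nonzero vectors chosen in different summands are linearly independent. This recovers finiteness
of the contributing summands when only the total sum is known to be locally finite. -/
theorem finite_of_dsum_finite {e : Deg} (h : FiniteDimensional ℚ ((dsum X).deg e)) :
    {i | (X i).deg e ≠ ⊥}.Finite := by
  classical
  have h1 : ∀ i : {i | (X i).deg e ≠ ⊥}, ∃ v ∈ (X i).deg e, v ≠ 0 := fun i =>
    Submodule.exists_mem_ne_zero_of_ne_bot i.2
  choose v hv hv0 using h1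
  have h2 : LinearIndependent ℚ fun i : {i | (X i).deg e ≠ ⊥} =>
      (⟨(DFinsupp.single i.1 (v i) : Π₀ i, (X i).carrier), single_mem_dsum (hv i)⟩ :
        (dsum X).deg e) := by
    rw [linearIndependent_iff']
    intro s g hg i hi
    have h3 : ∑ j ∈ s, g j • (DFinsupp.single j.1 (v j) : Π₀ i, (X i).carrier) = 0 := by
      have := congrArg (Submodule.subtype _) hg
      rw [map_sum] at this
      exact this
    have h4 := congrArg (fun x : Π₀ i, (X i).carrier => x i.1) h3
    simp only [DFinsupp.finsetSum_apply, DFinsupp.smul_apply, DFinsupp.zero_apply] at h4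
    rw [Finset.sum_eq_single i, DFinsupp.single_eq_same] at h4
    · exact (smul_eq_zero.mp h4).resolve_right (hv0 i)
    · intro j _ hji
      rw [DFinsupp.single_eq_of_ne (fun h => hji (Subtype.ext h.symm)), smul_zero]
    · exact fun h => absurd hi h
  have h3 := h2.finite_of_isNoetherian
  exact Set.toFinite _

/-- The direct sum of bounded shifts of an object is an object. -/
theorem Obj.dsum_shift {Bd : (ℤ → ℤ → Prop) → Prop} (hB : IsBoundedness Bd) {M : SMod A}
    (hM : Obj Bd 𝒜 M) (d : ι → Deg) (hfin : ∀ e, {i | d i = e}.Finite)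
    (hbd : Bd fun i j => ∃ (x : ι) (p : ZMod 2), d x = (i, j, p)) :
    Obj Bd 𝒜 (dsum fun i => M.shift (d i)) := by
  refine ⟨dsum_isGraded fun i => IsGraded.shift hM.1 (d i), fun e => ?_, ?_⟩
  -- A bidegree is in finitely many ways the sum of a shift and a bidegree of `M`, and each shift is
  -- used finitely often, so finitely many summands contribute to degree `e`.
  · have h1 := (hB.cone hbd).finite_add (hB.cone hM.2.2) e.1 e.2.1
    have h2 : {i | M.deg (e - d i) ≠ ⊥}.Finite := by
      refine (h1.biUnion fun x _ => (Set.finite_univ (α := ZMod 2)).biUnion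
        fun p _ => hfin (x.1, x.2, p)).subset ?_
      intro i hi
      exact Set.mem_biUnion (x := ((d i).1, (d i).2.1))
        ⟨⟨i, (d i).2.2, rfl⟩, (e - d i).2.2, hi⟩
        (Set.mem_biUnion (Set.mem_univ (d i).2.2) rfl)
    refine dsum_deg_finite h2.toFinset (fun i hi => ?_) fun i => hM.2.1 (e - d i)
    rw [Set.Finite.mem_toFinset] at hi
    exact not_not.mp hi
  · refine hB.mono (hB.add hbd hM.2.2) ?_
    rintro a b ⟨p, hp⟩
    obtain ⟨x, hx, hx0⟩ := Submodule.exists_mem_ne_zero_of_ne_bot hp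
    obtain ⟨i, hi⟩ := DFinsupp.ne_iff.mp (show (show Π₀ i, (M.shift (d i)).carrier from x) ≠ 0
      from hx0)
    refine ⟨(d i).1, (d i).2.1, a - (d i).1, b - (d i).2.1, ⟨i, (d i).2.2, rfl⟩,
      ⟨p - (d i).2.2, ?_⟩, by ring, by ring⟩
    intro h0
    have h1 := hx i
    change (show Π₀ i, (M.shift (d i)).carrier from x) i ∈ M.deg ((a, b, p) - d i) at h1
    have h2 : (a, b, p) - d i = (a - (d i).1, b - (d i).2.1, p - (d i).2.2) := rfl
    rw [h2, h0] at h1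
    exact hi ((Submodule.mem_bot ℚ).mp h1)

end Dsum

/-! ### Additivity of the superdimension -/

section Additivity

variable {R : Type} [CommRing R] [Algebra Kq R] [SerRing R]

/-- Passing to the part of degree `d` keeps the sequence exact: homogeneous elements have
homogeneous preimages under surjections, and injections reflect degrees. The rest is rank-nullity.
-/
theorem hdim_shortExact {M' M M'' : SMod A} (h' : M'.IsGraded 𝒜) (h : M.IsGraded 𝒜)
    (h'' : M''.IsGraded 𝒜) (hfin : M.LocFin) (hex : ShortExact M' M M'') (d : Deg) :
    hdim M.deg d = hdim M'.deg d + hdim M''.deg d := by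
  obtain ⟨f, g, hf, hg, hinj, hsurj, hex⟩ := hex
  let f' := f.restrictScalars ℚ
  let g' := g.restrictScalars ℚ
  let fd : M'.deg d →ₗ[ℚ] M.deg d := f'.restrict (hf d)
  let gd : M.deg d →ₗ[ℚ] M''.deg d := g'.restrict (hg d)
  have := hfin d
  have h1 : Function.Injective fd := fun x y hxy =>
    Subtype.ext (hinj (congrArg Subtype.val hxy))
  have h2 : LinearMap.range gd = ⊤ := by
    rw [LinearMap.range_eq_top]
    rintro ⟨y, hy⟩
    obtain ⟨x, hx, hxy⟩ := exists_mem_of_surjective (f := g') h.1 h''.1 hg hsurj hy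
    exact ⟨⟨x, hx⟩, Subtype.ext hxy⟩
  have h3 : LinearMap.ker gd = LinearMap.range fd := by
    ext ⟨x, hx⟩
    rw [LinearMap.mem_ker, LinearMap.mem_range]
    constructor
    · intro h0
      obtain ⟨y, hy⟩ := (hex x).1 (congrArg Subtype.val h0)
      exact ⟨⟨y, mem_of_map_mem (f := f') h'.1 h.1 hf hinj (by change f y ∈ _; rwa [hy])⟩,
        Subtype.ext hy⟩
    · rintro ⟨y, hy⟩
      refine Subtype.ext ((hex x).2 ⟨y, congrArg Subtype.val hy⟩)
  have h4 := gd.finrank_range_add_finrank_ker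
  rw [h2, finrank_top, h3, LinearMap.finrank_range_of_inj h1] at h4
  rw [hdim, hdim, hdim, ← h4, add_comm]

theorem sdim_shortExact {M' M M'' : SMod A} (h' : Obj (Bd R) 𝒜 M') (h : Obj (Bd R) 𝒜 M)
    (h'' : Obj (Bd R) 𝒜 M'') (hex : ShortExact M' M M'') :
    sdim R M.deg = sdim R M'.deg + sdim R M''.deg := by
  refine cf_ext fun i j => ?_
  rw [cf_add, cf_sdim h.2.2, cf_sdim h'.2.2, cf_sdim h''.2.2]
  simp only [sdiff, hdim_shortExact h'.1 h.1 h''.1 h.2.1 hex]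
  push_cast
  ring

/-- Compared in a fixed bidegree. Local finiteness of `M` leaves finitely many contributing shifts,
and the same finite set serves for the convolution that computes the coefficient of `p j * sdim R (X
j).deg`. A shift of parity `ε` moves dimension between the two parities, so the difference of total
dimensions is the product of the differences. -/
theorem sdim_locSum {n : ℕ} {M : SMod A} (hM : Obj (Bd R) 𝒜 M) (X : Fin n → SMod A)
    (hX : ∀ j, Obj (Bd R) 𝒜 (X j)) (k : Fin n → Deg → ℕ) (p : Fin n → R)
    (hp : ∀ j, IsSeries cf (p j) (k j)) (hi : M.Iso (locSum X k)) :
    sdim R M.deg = ∑ j, p j * sdim R (X j).deg := by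
  classical
  refine cf_ext fun a b => ?_
  have hfin : ∀ e, {x : Σ j : Fin n, Σ d : Deg, Fin (k j d) | (X x.1).deg (e - x.2.1) ≠ ⊥}.Finite :=
    fun e => finite_of_dsum_finite (hi.grIso.finite (hM.2.1 e))
  -- The bidegrees of the shifts that bring something nonzero into `(a, b)` in one of the two
  -- parities.
  let V : Finset (ℤ × ℤ) :=
    ((hfin (a, b, 0)).union (hfin (a, b, 1))).toFinset.image fun x => (x.2.1.1, x.2.1.2.1)
  have hV : ∀ (ε : ZMod 2) (j : Fin n) (d : Deg), k j d ≠ 0 →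
      (X j).deg ((a, b, ε) - d) ≠ ⊥ → (d.1, d.2.1) ∈ V := by
    intro ε j d hk hne
    refine Finset.mem_image.mpr ⟨⟨j, d, ⟨0, Nat.pos_of_ne_zero hk⟩⟩, ?_, rfl⟩
    rw [Set.Finite.mem_toFinset]
    fin_cases ε
    · exact Or.inl hne
    · exact Or.inr hne
  -- Both parities are adjoined to each bidegree of `V`, so that the sum over shifts splits as a sum
  -- over `V` of two terms.
  let U : Finset Deg := (V ×ˢ (Finset.univ : Finset (ZMod 2))).image fun x => (x.1.1, x.1.2, x.2)
  have hU : ∀ f : Deg → ℕ, ∑ d ∈ U, f d = ∑ v ∈ V, (f (v.1, v.2, 0) + f (v.1, v.2, 1)) := by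
    intro f
    rw [Finset.sum_image, Finset.sum_product]
    · refine Finset.sum_congr rfl fun v _ => ?_
      exact Fin.sum_univ_two fun x => f (v.1, v.2, x)
    · rintro ⟨⟨x, y⟩, z⟩ _ ⟨⟨x', y'⟩, z'⟩ _ h
      simp only [Prod.mk.injEq] at h
      obtain ⟨rfl, rfl, rfl⟩ := h
      rfl
  have hdimM : ∀ ε : ZMod 2, hdim M.deg (a, b, ε) =
      ∑ j, ∑ v ∈ V, (k j (v.1, v.2, 0) * hdim (X j).deg (a - v.1, b - v.2, ε) +
        k j (v.1, v.2, 1) * hdim (X j).deg (a - v.1, b - v.2, ε - 1)) := by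
    intro ε
    rw [hi.grIso.hdim_eq, locSum, hdim_dsum
      (Finset.univ.sigma fun j : Fin n => U.sigma fun d => (Finset.univ : Finset (Fin (k j d))))]
    · rw [Finset.sum_sigma]
      refine Finset.sum_congr rfl fun j _ => ?_
      rw [Finset.sum_sigma]
      have h1 : ∀ d ∈ U, ∑ x : Fin (k j d), hdim ((X j).shift d).deg (a, b, ε)
          = k j d * hdim (X j).deg ((a, b, ε) - d) := by
        intro d _
        rw [Finset.sum_const, Finset.card_univ, Fintype.card_fin, smul_eq_mul]
        rfl
      refine (Finset.sum_congr rfl h1).trans ?_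
      rw [hU]
      refine Finset.sum_congr rfl fun v _ => ?_
      simp only [Prod.mk_sub_mk, sub_zero]
    · rintro ⟨j, d, x⟩ hx
      by_contra hne
      refine hx ?_
      simp only [Finset.mem_sigma, Finset.mem_univ, true_and, and_true]
      have h2 := hV ε j d (fun h0 => by rw [h0] at x; exact x.elim0) hne
      exact Finset.mem_image.mpr ⟨((d.1, d.2.1), d.2.2),
        Finset.mem_product.mpr ⟨h2, Finset.mem_univ _⟩, rfl⟩
    · exact fun x => (hX x.1).2.1 _
  rw [cf_sum, cf_sdim hM.2.2, sdiff, hdimM, hdimM]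
  push_cast
  rw [← Finset.sum_sub_distrib]
  refine Finset.sum_congr rfl fun j _ => ?_
  rw [cf_mul _ _ a b V]
  · rw [← Finset.sum_sub_distrib]
    refine Finset.sum_congr rfl fun v _ => ?_
    rw [hp j, cf_sdim (hX j).2.2, sdiff]
    have h3 : (0 : ZMod 2) - 1 = 1 := rfl
    rw [h3, sub_self]
    ring
  · intro i l h1 h2
    rw [cf_sdim (hX j).2.2] at h2
    obtain ⟨p', hp'⟩ := supp_of_sdiff h2
    have : ∃ ε : ZMod 2, k j (i, l, ε) ≠ 0 := by
      by_contra hall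
      push Not at hall
      exact h1 (by rw [hp j, hall 0, hall 1, sub_self])
    obtain ⟨ε, hε⟩ := this
    -- The parity `p' + ε` is the one that becomes `p'` after subtracting the parity of the shift.
    refine hV (p' + ε) j (i, l, ε) hε ?_
    simpa using hp'

end Additivity

end Obj

end VermaCat
end

noncomputable section

namespace VermaCat

open SPoly

/-! ### Weights -/

/-- The linear form `i + c j` on bidegrees. -/
def weight (c : ℕ) (d : Deg) : ℤ := d.1 + c * d.2.1

theorem weight_add (c : ℕ) (d e : Deg) : weight c (d + e) = weight c d + weight c e := by
  simp only [weight, Prod.fst_add, Prod.snd_add]; ring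

/-- For a suitable weight, a bounded set of bidegrees has finitely many elements of weight
at most `w`. -/
theorem ConeBounded.exists_weight {S : ℤ → ℤ → Prop} (h : ConeBounded S) (k : ℕ) :
    ∃ c : ℕ, k < c ∧ (∃ w₀ : ℤ, ∀ i j, S i j → w₀ ≤ i + c * j) ∧
      ∀ w : ℤ, {x : ℤ × ℤ | S x.1 x.2 ∧ x.1 + c * x.2 ≤ w}.Finite := by
  obtain ⟨c, m, n, h⟩ := h
  -- A slope strictly greater than that of the cone is needed: the surplus `(k + 1) * j` bounds `j`
  -- above on a sublevel set, and `i` is then bounded on both sides. Adding `k + 1` also exceeds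
  -- `k`, which makes the variables of `Ω_k` positive.
  refine ⟨c + k + 1, by omega, ⟨m + (k + 1) * n, fun i j hs => ?_⟩, fun w => ?_⟩
  · obtain ⟨h1, h2⟩ := h i j hs
    push_cast
    nlinarith
  · refine (((Set.finite_Icc n (max 0 (w - m))).biUnion fun j _ =>
      (Set.finite_Icc (m - c * j) (w - (c + k + 1) * j)).image fun i => (i, j))).subset ?_
    rintro ⟨i, j⟩ ⟨hs, hw⟩
    obtain ⟨h1, h2⟩ := h i j hs
    push_cast at hw
    refine Set.mem_iUnion₂.mpr ⟨j, ⟨h1, ?_⟩, i, ⟨by linarith, by linarith⟩, rfl⟩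
    rcases le_or_gt j 0 with h0 | h0
    · exact h0.trans (le_max_left _ _)
    · refine le_max_of_le_right ?_
      nlinarith

/-- An odd variable of index `i ≤ k` has weight `2 * c - 2 * i`, which is positive because `c > k`.
That multiplication by variables strictly raises the weight is the source of all inductions on
weight. -/
theorem weight_omDeg_pos {k c : ℕ} (hc : k < c) (i : Fin k ⊕ Fin k) : 0 < weight c (omDeg k i) := by
  rcases i with i | i
  · simp only [weight, omDeg, Sum.elim_inl]
    have := i.2
    positivity
  · simp only [weight, omDeg, Sum.elim_inr]
    have := i.2
    have h1 : (i : ℤ) + 1 ≤ k := by exact_mod_cast this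
    have h2 : (k : ℤ) < c := by exact_mod_cast hc
    linarith

/-! ### The augmentation of Ω_k and the simple supermodules -/

section Om

variable {k : ℕ}

variable (k) in
/-- The augmentation of `Ω_k`. -/
def aug : Om k →ₐ[ℚ] ℚ :=
  SPoly.lift (MvPolynomial.aeval fun _ => 0) 0 (fun _ => by simp) fun _ _ => Commute.all _ _

theorem aug_gen (i : Fin k ⊕ Fin k) : aug k (gen i) = 0 := by
  rcases i with i | i
  · rw [gen_inl, x, aug, lift_ofEven, MvPolynomial.aeval_X]
  · rw [gen_inr, s, aug, lift_odd, LinearMap.zero_apply]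

theorem aug_eq_zero {d : Deg} (hd : d ≠ 0) {a : Om k} (ha : a ∈ omPart k d) : aug k a = 0 := by
  have h1 : omPart k d ≤ LinearMap.ker (aug k).toLinearMap := by
    refine Submodule.span_le.mpr ?_
    rintro _ ⟨l, hl, rfl⟩
    cases l with
    | nil => exact absurd hl.symm hd
    | cons i l =>
      rw [List.map_cons, List.prod_cons]
      change aug k _ = 0
      rw [map_mul, aug_gen, zero_mul]
  exact h1 ha

theorem aug_of_mem_omPlus {a : Om k} (ha : a ∈ omPlus k) : aug k a = 0 := by
  induction ha using Submodule.span_induction with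
  | mem a ha =>
    obtain ⟨i, j, p, hne, ha⟩ := ha
    exact aug_eq_zero (fun h => hne (by
      simp only [Prod.mk_eq_zero] at h; rw [h.1, h.2.1])) ha
  | zero => exact map_zero _
  | add a b _ _ ha hb => rw [map_add, ha, hb, add_zero]
  | smul b a _ ha => rw [smul_eq_mul, map_mul, ha, mul_zero]

theorem gen_mem_omPlus (i : Fin k ⊕ Fin k) : (gen i : Om k) ∈ omPlus k := by
  refine Submodule.subset_span ⟨(omDeg k i).1, (omDeg k i).2.1, (omDeg k i).2.2, fun h => ?_,
    gen_mem_part (omDeg k) i⟩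
  have := weight_omDeg_pos (Nat.lt_succ_self k) i
  simp only [Prod.mk.injEq] at h
  rw [weight, h.1, h.2] at this
  simp at this

theorem sub_aug_mem_omPlus (a : Om k) : a - aug k a • (1 : Om k) ∈ omPlus k := by
  induction a using induction_left with
  | one => rw [map_one, one_smul, sub_self]; exact Submodule.zero_mem _
  | gen_mul i z hz =>
    rw [map_mul, aug_gen, zero_mul, zero_smul, sub_zero]
    -- `omPlus k` is closed under left multiplication only, so the product is written as a left
    -- multiple of an element in it plus a left multiple of a variable.
    have h1 : (gen i : Om k) * z
        = (gen i : Om k) • (z - aug k z • (1 : Om k)) + (aug k z • (1 : Om k)) • gen i := by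
      rw [smul_eq_mul, mul_sub, smul_eq_mul, mul_smul_comm, mul_one, smul_mul_assoc, one_mul,
        sub_add_cancel]
    rw [h1]
    exact Submodule.add_mem _ (Submodule.smul_mem _ _ hz) (Submodule.smul_mem _ _ (gen_mem_omPlus i))
  | add y z hy hz =>
    have h1 : y + z - aug k (y + z) • (1 : Om k)
        = (y - aug k y • (1 : Om k)) + (z - aug k z • (1 : Om k)) := by
      rw [map_add, add_smul]; abel
    rw [h1]
    exact Submodule.add_mem _ hy hz
  | smul c z hz =>
    have h1 : c • z - aug k (c • z) • (1 : Om k) = c • (z - aug k z • (1 : Om k)) := by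
      rw [map_smul, smul_sub, smul_assoc]
    rw [h1, ← algebraMap_smul (Om k) c]
    exact Submodule.smul_mem _ _ hz

/-- Identifies the ideal of elements of nonzero bidegree with the kernel of the augmentation; this
is what makes `S_k` one-dimensional. -/
theorem mem_omPlus_iff {a : Om k} : a ∈ omPlus k ↔ aug k a = 0 := by
  refine ⟨aug_of_mem_omPlus, fun h => ?_⟩
  have := sub_aug_mem_omPlus a
  rwa [h, zero_smul, sub_zero] at this

theorem smul_eq_aug_smul {M : SMod (Om k)} {v : M.carrier}
    (hv : ∀ i : Fin k ⊕ Fin k, (gen i : Om k) • v = 0) (a : Om k) : a • v = aug k a • v := by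
  induction a using induction_left with
  | one => rw [map_one, one_smul, one_smul]
  | gen_mul i z hz => rw [mul_smul, hz, smul_comm, hv, smul_zero, map_mul, aug_gen, zero_mul,
      zero_smul]
  | add y z hy hz => rw [add_smul, map_add, hy, hz, add_smul]
  | smul c z hz => rw [smul_assoc, map_smul, hz, smul_assoc]

theorem omReg_isGraded : (omReg k).IsGraded (omPart k) :=
  ⟨part_isInternal _, fun _ _ _ ha _ hm => mul_mem_part ha hm⟩

/-- The generator of `S_k`. -/
def omSimpleGen (k : ℕ) : (omSimple k).carrier := (omPlus k).mkQ 1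

theorem omSimple_mk (a : Om k) : (omPlus k).mkQ a = aug k a • omSimpleGen k := by
  have h : (omPlus k).mkQ (a - aug k a • (1 : Om k)) = 0 :=
    (Submodule.Quotient.mk_eq_zero _).mpr (sub_aug_mem_omPlus a)
  rw [map_sub, sub_eq_zero] at h
  exact h

theorem omSimple_eq_smul (x : (omSimple k).carrier) : ∃ c : ℚ, x = c • omSimpleGen k := by
  obtain ⟨a, rfl⟩ := (omPlus k).mkQ_surjective x
  exact ⟨_, omSimple_mk a⟩

theorem omSimpleGen_ne_zero : omSimpleGen k ≠ 0 := by
  intro h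
  have h1 : (1 : Om k) ∈ omPlus k := (Submodule.Quotient.mk_eq_zero _).mp h
  rw [mem_omPlus_iff, map_one] at h1
  exact one_ne_zero h1

theorem gen_smul_omSimpleGen (i : Fin k ⊕ Fin k) :
    (gen i : Om k) • omSimpleGen k = 0 := by
  have h1 : (gen i : Om k) • omSimpleGen k = (omPlus k).mkQ (gen i) :=
    ((omPlus k).mkQ.map_smul (gen i) 1).symm.trans
      (congrArg (omPlus k).mkQ (mul_one (gen i : Om k)))
  rw [h1]
  exact (Submodule.Quotient.mk_eq_zero _).mpr (gen_mem_omPlus i)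

theorem omSimple_deg_zero : (omSimple k).deg 0 = ⊤ := by
  rw [eq_top_iff]
  rintro x -
  obtain ⟨c, rfl⟩ := omSimple_eq_smul x
  exact Submodule.smul_mem _ _ ⟨1, one_mem_part _, rfl⟩

theorem omSimple_deg_ne {d : Deg} (hd : d ≠ 0) : (omSimple k).deg d = ⊥ := by
  rw [eq_bot_iff]
  rintro _ ⟨a, ha, rfl⟩
  have h1 := omSimple_mk a
  rw [aug_eq_zero hd ha, zero_smul] at h1
  exact (Submodule.mem_bot ℚ).mpr h1

/-- A basis of `S_k`. -/
def omSimpleBasis (k : ℕ) : Module.Basis Unit ℚ (omSimple k).carrier :=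
  Module.Basis.mk (v := fun _ => omSimpleGen k)
    (LinearIndependent.of_subsingleton () omSimpleGen_ne_zero) (by
      rintro x -
      obtain ⟨c, rfl⟩ := omSimple_eq_smul x
      exact Submodule.smul_mem _ _ (Submodule.subset_span ⟨(), rfl⟩))

theorem omSimple_isGraded : (omSimple k).IsGraded (omPart k) := by
  classical
  refine ⟨isInternal_of_proj (fun d => if d = 0 then LinearMap.id else 0) ?_ ?_ ?_, ?_⟩
  · intro d x hx
    by_cases hd : d = 0
    · simp [hd]
    · rw [omSimple_deg_ne hd] at hx
      simp [(Submodule.mem_bot ℚ).mp hx]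
  · intro d e hne x hx
    by_cases hd : d = 0
    · rw [omSimple_deg_ne (fun h => hne (h.trans hd.symm))] at hx
      simp [(Submodule.mem_bot ℚ).mp hx]
    · simp [hd]
  · rw [eq_top_iff, ← omSimple_deg_zero]
    exact le_iSup _ _
  · rintro d e a ha _ ⟨b, hb, rfl⟩
    exact ⟨a * b, mul_mem_part ha hb, rfl⟩

theorem omSimple_finrank : Module.finrank ℚ (omSimple k).carrier = 1 := by
  rw [Module.finrank_eq_card_basis (omSimpleBasis k), Fintype.card_unit]

theorem omSimple_finite : FiniteDimensional ℚ (omSimple k).carrier :=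
  (omSimpleBasis k).finiteDimensional_of_finite

theorem omSimple_obj {Bd : (ℤ → ℤ → Prop) → Prop} (hB : IsBoundedness Bd) :
    Obj Bd (omPart k) (omSimple k) := by
  have := omSimple_finite (k := k)
  refine ⟨omSimple_isGraded, fun d => inferInstance, hB.of_lam ⟨0, 0, 0, ?_⟩⟩
  rintro i j ⟨p, hp⟩
  by_contra h
  exact hp (omSimple_deg_ne fun h0 => h (by
    simp only [Prod.mk_eq_zero] at h0; simp [h0.1, h0.2.1]))

theorem sdim_omSimple {R : Type} [CommRing R] [Algebra Kq R] [SerRing R] :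
    sdim R (omSimple k).deg = 1 := by
  refine cf_ext fun i j => ?_
  rw [cf_sdim (omSimple_obj SerRing.isBoundedness).2.2, cf_one, sdiff,
    hdim_of_eq_bot (d := (i, j, 1)) (omSimple_deg_ne fun h => by
      simp only [Prod.mk_eq_zero] at h; exact absurd h.2.2 (by decide))]
  split_ifs with h
  · obtain ⟨rfl, rfl⟩ := h
    have : hdim (omSimple k).deg (0, 0, 0) = 1 := by
      have h0 : ((0, 0, 0) : Deg) = 0 := rfl
      rw [hdim, h0, omSimple_deg_zero, finrank_top, omSimple_finrank]
    simp [this]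
  · rw [hdim_of_eq_bot (d := (i, j, 0)) (omSimple_deg_ne fun h0 => h (by
      simp only [Prod.mk_eq_zero] at h0; exact ⟨h0.1, h0.2.1⟩))]
    simp

/-- A graded module spanned by one vector killed by the variables is a shift of `S_k`. -/
theorem iso_omSimple_shift {M : SMod (Om k)} (hM : M.IsGraded (omPart k)) {d : Deg} {v : M.carrier}
    (hv : v ∈ M.deg d) (hv0 : v ≠ 0) (hgen : ∀ i : Fin k ⊕ Fin k, (gen i : Om k) • v = 0)
    (hspan : ∀ x, ∃ c : ℚ, x = c • v) : M.Iso ((omSimple k).shift d) := by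
  have h1 : omPlus k ≤ LinearMap.ker (LinearMap.toSpanSingleton (Om k) M.carrier v) := by
    intro a ha
    rw [LinearMap.mem_ker, LinearMap.toSpanSingleton_apply, smul_eq_aug_smul hgen,
      aug_of_mem_omPlus ha, zero_smul]
  let f : ((omSimple k).shift d).carrier →ₗ[Om k] M.carrier := (omPlus k).liftQ _ h1
  have hf : ∀ a, f ((omPlus k).mkQ a) = a • v := fun a => rfl
  have hinj : Function.Injective f := by
    rw [← LinearMap.ker_eq_bot, LinearMap.ker_eq_bot']
    intro x hx
    obtain ⟨a, rfl⟩ := (omPlus k).mkQ_surjective x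
    rw [hf, smul_eq_aug_smul hgen] at hx
    exact (Submodule.Quotient.mk_eq_zero _).mpr
      (mem_omPlus_iff.mpr ((smul_eq_zero.mp hx).resolve_right hv0))
  have hsurj : Function.Surjective f := by
    intro x
    obtain ⟨c, rfl⟩ := hspan x
    exact ⟨(omPlus k).mkQ (c • 1), by rw [hf, smul_assoc, one_smul]⟩
  have hdeg : ∀ e, ∀ x ∈ ((omSimple k).shift d).deg e, f x ∈ M.deg e := by
    rintro e _ ⟨a, ha, rfl⟩
    have := hM.2 _ _ a ha v hv
    rwa [sub_add_cancel] at this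
  refine SMod.Iso.symm ⟨LinearEquiv.ofBijective f ⟨hinj, hsurj⟩, fun e x => ⟨hdeg e x, ?_⟩⟩
  exact mem_of_map_mem (f := f.restrictScalars ℚ) (IsGraded.shift omSimple_isGraded d).1 hM.1
    hdeg hinj

/-- The `ℚ`-subspaces closed under the variables are submodules. -/
def submoduleOfGen {M : SMod (Om k)} (N : Submodule ℚ M.carrier)
    (hN : ∀ (i : Fin k ⊕ Fin k), ∀ m ∈ N, (gen i : Om k) • m ∈ N) :
    Submodule (Om k) M.carrier where
  carrier := N
  add_mem' := N.add_mem
  zero_mem' := N.zero_mem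
  smul_mem' a _ hm := smul_mem_of_gen N hN a hm

theorem mem_submoduleOfGen {M : SMod (Om k)} {N : Submodule ℚ M.carrier}
    {hN : ∀ (i : Fin k ⊕ Fin k), ∀ m ∈ N, (gen i : Om k) • m ∈ N} {x : M.carrier} :
    x ∈ submoduleOfGen N hN ↔ x ∈ N := Iff.rfl

theorem isSimple_of_iso_omSimple_shift {S : SMod (Om k)} {d : Deg}
    (h : S.Iso ((omSimple k).shift d)) : IsSimple S := by
  obtain ⟨e, -⟩ := h
  let e' : S.carrier ≃ₗ[Om k] (omSimple k).carrier := e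
  have h1 : ∀ x : S.carrier, ∃ c : ℚ, x = c • e'.symm (omSimpleGen k) := fun x => by
    obtain ⟨c, hc⟩ := omSimple_eq_smul (e' x)
    refine ⟨c, e'.injective ?_⟩
    rw [hc, ← algebraMap_smul (Om k) c (e'.symm _), map_smul, LinearEquiv.apply_symm_apply,
      algebraMap_smul]
  refine ⟨⟨e'.symm (omSimpleGen k), 0, fun h0 => omSimpleGen_ne_zero (k := k) ?_⟩,
    fun N _ => ?_⟩
  · rw [← e'.apply_symm_apply (omSimpleGen k), h0, map_zero]
  · by_cases hN : N = ⊥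
    · exact Or.inl hN
    · refine Or.inr (eq_top_iff.mpr fun y _ => ?_)
      obtain ⟨x, hx, hx0⟩ := Submodule.exists_mem_ne_zero_of_ne_bot hN
      obtain ⟨c, rfl⟩ := h1 x
      obtain ⟨b, rfl⟩ := h1 y
      have hc : c ≠ 0 := fun h0 => hx0 (by rw [h0, zero_smul])
      have := N.smul_mem (algebraMap ℚ (Om k) (b * c⁻¹)) hx
      rwa [algebraMap_smul, smul_smul, mul_assoc, inv_mul_cancel₀ hc, mul_one] at this

/-- Every simple object is a shift of `S_k`. -/
theorem exists_iso_omSimple_shift {S : SMod (Om k)} (hS : S.IsGraded (omPart k))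
    (hbd : ConeBounded S.support) (hsimple : IsSimple S) :
    ∃ d, S.Iso ((omSimple k).shift d) := by
  obtain ⟨c, hc, ⟨w₀, hw₀⟩, -⟩ := hbd.exists_weight k
  have hne : ∃ d, S.deg d ≠ ⊥ := by
    by_contra hall
    have h1 := hS.1.submodule_iSup_eq_top
    rw [iSup_eq_bot.mpr fun d => not_not.mp fun h => hall ⟨d, h⟩] at h1
    obtain ⟨x, y, hxy⟩ := hsimple.1
    have h2 : ∀ x : S.carrier, x = 0 := fun x => by
      have : x ∈ (⊤ : Submodule ℚ S.carrier) := trivial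
      rw [← h1] at this
      exact (Submodule.mem_bot ℚ).mp this
    exact hxy (by rw [h2 x, h2 y])
  obtain ⟨w, ⟨d, hd, rfl⟩, hmin⟩ := Int.exists_least_of_bdd
    (P := fun w => ∃ d, S.deg d ≠ ⊥ ∧ weight c d = w)
    ⟨w₀, by rintro _ ⟨d, hd, rfl⟩; exact hw₀ d.1 d.2.1 ⟨d.2.2, hd⟩⟩
    (by obtain ⟨d, hd⟩ := hne; exact ⟨_, d, hd, rfl⟩)
  obtain ⟨v, hv, hv0⟩ := Submodule.exists_mem_ne_zero_of_ne_bot hd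
  -- The homogeneous elements of weight above that of `v` span a graded submodule. The projection to
  -- degree `d` kills it but not `v`, so by simplicity it is zero; hence the variables annihilate
  -- `v`, and the line through `v` is a nonzero graded submodule, therefore all of `S`.
  let Y : Set S.carrier := {y | ∃ e, y ∈ S.deg e ∧ weight c d < weight c e}
  have hY : ∀ (i : Fin k ⊕ Fin k), ∀ m ∈ Submodule.span ℚ Y,
      (gen i : Om k) • m ∈ Submodule.span ℚ Y := by
    intro i m hm
    induction hm using Submodule.span_induction with
    | mem m hm =>
      obtain ⟨e, hm, hw⟩ := hm
      refine Submodule.subset_span ⟨omDeg k i + e, hS.2 _ _ _ (gen_mem_part _ i) _ hm, ?_⟩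
      rw [weight_add]
      linarith [weight_omDeg_pos hc i]
    | zero => rw [smul_zero]; exact Submodule.zero_mem _
    | add x y _ _ hx hy => rw [smul_add]; exact Submodule.add_mem _ hx hy
    | smul a x _ hx => rw [smul_comm]; exact Submodule.smul_mem _ _ hx
  have hN : submoduleOfGen _ hY = ⊥ := by
    refine (hsimple.2 (submoduleOfGen _ hY) fun x hx => ?_).resolve_right fun htop => ?_
    · refine Submodule.span_mono ?_ (mem_submoduleOfGen.mp hx)
      rintro y ⟨e, hy, hw⟩
      exact ⟨Submodule.subset_span ⟨e, hy, hw⟩, e, hy⟩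
    · have h1 : v ∈ submoduleOfGen _ hY := by rw [htop]; trivial
      have h2 : Submodule.span ℚ Y ≤ LinearMap.ker (hproj hS.1 d) := by
        refine Submodule.span_le.mpr ?_
        rintro y ⟨e, hy, hw⟩
        refine hproj_ne hS.1 ?_ hy
        rintro rfl
        exact lt_irrefl _ hw
      have h3 := h2 (mem_submoduleOfGen.mp h1)
      rw [LinearMap.mem_ker, hproj_same hS.1 hv] at h3
      exact hv0 h3
  have hgen : ∀ i : Fin k ⊕ Fin k, (gen i : Om k) • v = 0 := by
    intro i
    have h1 : (gen i : Om k) • v ∈ submoduleOfGen _ hY := by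
      refine mem_submoduleOfGen.mpr (Submodule.subset_span
        ⟨omDeg k i + d, hS.2 _ _ _ (gen_mem_part _ i) _ hv, ?_⟩)
      rw [weight_add]
      linarith [weight_omDeg_pos hc i]
    rw [hN] at h1
    exact (Submodule.mem_bot _).mp h1
  refine ⟨d, iso_omSimple_shift hS hv hv0 hgen ?_⟩
  have hL : ∀ (i : Fin k ⊕ Fin k), ∀ m ∈ Submodule.span ℚ {v},
      (gen i : Om k) • m ∈ Submodule.span ℚ {v} := by
    intro i m hm
    obtain ⟨b, rfl⟩ := Submodule.mem_span_singleton.mp hm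
    rw [smul_comm, hgen, smul_zero]
    exact Submodule.zero_mem _
  have htop : submoduleOfGen _ hL = ⊤ := by
    refine (hsimple.2 (submoduleOfGen _ hL) fun x hx => ?_).resolve_left fun hbot => hv0 ?_
    · refine Submodule.span_mono ?_ (mem_submoduleOfGen.mp hx)
      rintro _ rfl
      exact ⟨Submodule.subset_span rfl, d, hv⟩
    · have h1 : v ∈ submoduleOfGen _ hL := Submodule.subset_span rfl
      rw [hbot] at h1
      exact (Submodule.mem_bot _).mp h1
  intro x
  have hx : x ∈ submoduleOfGen _ hL := by rw [htop]; trivial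
  obtain ⟨b, hb⟩ := Submodule.mem_span_singleton.mp (mem_submoduleOfGen.mp hx)
  exact ⟨b, hb.symm⟩

theorem omSimple_shift_injective {S : SMod (Om k)} {d e : Deg} (h : S.Iso ((omSimple k).shift d))
    (h' : S.Iso ((omSimple k).shift e)) : d = e := by
  by_contra hne
  have h1 := (h.symm.trans h').grIso.eq_bot_iff d
  have h2 : ((omSimple k).shift d).deg d = ⊤ := by
    change (omSimple k).deg (d - d) = ⊤
    rw [sub_self, omSimple_deg_zero]
  have h3 : ((omSimple k).shift e).deg d = ⊥ := omSimple_deg_ne (sub_ne_zero.mpr hne)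
  have h4 := h1.2 h3
  rw [h2] at h4
  have h5 : omSimpleGen k ∈ (⊤ : Submodule ℚ ((omSimple k).shift d).carrier) := trivial
  rw [h4] at h5
  exact omSimpleGen_ne_zero ((Submodule.mem_bot ℚ).mp h5)

end Om

end VermaCat
end

noncomputable section

namespace VermaCat

open SPoly

/-- A weight function with finite sublevel sets can be refined to an injective rank function. -/
theorem exists_rank {I : Type} [Countable I] (W : I → ℤ) (hW : ∀ w, {x | W x ≤ w}.Finite) :
    ∃ r : I → ℕ, Function.Injective r ∧ ∀ x y, W x < W y → r x < r y := by
  obtain ⟨idx, hidx⟩ := Countable.exists_injective_nat I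
  -- The predecessors of `x` in the lexicographic order by weight and then by an enumeration of `I`.
  -- There are finitely many because sublevel sets are finite, and their number is the rank.
  let L : I → Set I := fun x => {y | W y < W x ∨ (W y = W x ∧ idx y < idx x)}
  have hfin : ∀ x, (L x).Finite := fun x => (hW (W x)).subset fun y hy => by
    rcases hy with h | h
    · exact h.le
    · exact h.1.le
  have hlt : ∀ x y, x ∈ L y → (L x).ncard < (L y).ncard := by
    intro x y hxy
    refine Set.ncard_lt_ncard ⟨fun z hz => ?_, fun hsub => ?_⟩ (hfin y)
    · rcases hxy with h | h <;> rcases hz with h' | h'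
      · exact Or.inl (h'.trans h)
      · exact Or.inl (h'.1.trans_lt h)
      · exact Or.inl (h'.trans_eq h.1)
      · exact Or.inr ⟨h'.1.trans h.1, h'.2.trans h.2⟩
    · rcases hsub hxy with h | h
      · exact lt_irrefl _ h
      · exact lt_irrefl _ h.2
  refine ⟨fun x => (L x).ncard, fun x y hxy => ?_, fun x y h => hlt x y (Or.inl h)⟩
  by_contra hne
  rcases lt_trichotomy (W x) (W y) with h | h | h
  · exact (hlt x y (Or.inl h)).ne hxy
  · rcases lt_trichotomy (idx x) (idx y) with h' | h' | h'
    · exact (hlt x y (Or.inr ⟨h, h'⟩)).ne hxy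
    · exact hne (hidx h')
    · exact (hlt y x (Or.inr ⟨h.symm, h'⟩)).ne' hxy
  · exact (hlt y x (Or.inl h)).ne' hxy

/-! ### Composition series from homogeneous bases -/

section Series

variable {k : ℕ} {M : SMod (Om k)} {I : Type} (b : Module.Basis I ℚ M.carrier) (dg : I → Deg)
  (r : I → ℕ)

theorem repr_eq_zero (hM : M.IsGraded (omPart k)) (hb : ∀ x, b x ∈ M.deg (dg x)) {d : Deg}
    {y : M.carrier} (hy : y ∈ M.deg d) {x : I} (hx : dg x ≠ d) : b.repr y x = 0 := by
  have h1 : ∀ z : M.carrier, ∀ e, b.repr (hproj hM.1 e z) x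
      = if dg x = e then b.repr z x else 0 := by
    intro z e
    have h2 : (b.coord x) ∘ₗ hproj hM.1 e = if dg x = e then b.coord x else 0 := by
      refine b.ext fun t => ?_
      rw [LinearMap.comp_apply]
      by_cases ht : dg t = e
      · rw [hproj_same hM.1 (ht ▸ hb t)]
        split_ifs with h
        · rfl
        · rw [LinearMap.zero_apply, Module.Basis.coord_apply, Module.Basis.repr_self,
            Finsupp.single_eq_of_ne]
          rintro rfl
          exact h ht
      · rw [hproj_ne hM.1 ht (hb t), map_zero]
        split_ifs with h
        · rw [Module.Basis.coord_apply, Module.Basis.repr_self, Finsupp.single_eq_of_ne]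
          rintro rfl
          exact ht h
        · rfl
    have h3 := LinearMap.congr_fun h2 z
    rw [LinearMap.comp_apply] at h3
    rw [← Module.Basis.coord_apply, h3]
    split_ifs <;> rfl
  have := h1 y d
  rwa [hproj_same hM.1 hy, if_neg hx] at this

/-- The span of the basis vectors of rank at least `i`. -/
def rankSpan (i : ℕ) : Submodule ℚ M.carrier := Submodule.span ℚ (b '' {x | i ≤ r x})

theorem mem_rankSpan {i : ℕ} {y : M.carrier} :
    y ∈ rankSpan b r i ↔ ∀ x, r x < i → b.repr y x = 0 := by
  rw [rankSpan, b.mem_span_image]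
  constructor
  · intro h x hx
    by_contra h0
    exact absurd (h (Finsupp.mem_support_iff.mpr h0)) (not_le.mpr hx)
  · intro h x hx
    by_contra h0
    exact Finsupp.mem_support_iff.mp hx (h x (not_le.mp h0))

/-- A variable strictly raises the weight and the rank increases strictly with the weight, so only
basis vectors of larger rank occur in the product. Consequently the variables act by zero on the
quotient of consecutive steps. -/
theorem gen_smul_mem_rankSpan {c : ℕ} (hc : k < c) (hM : M.IsGraded (omPart k))
    (hb : ∀ x, b x ∈ M.deg (dg x)) (hr : ∀ x y, weight c (dg x) < weight c (dg y) → r x < r y)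
    (i : ℕ) (g : Fin k ⊕ Fin k) {y : M.carrier} (hy : y ∈ rankSpan b r i) :
    (gen g : Om k) • y ∈ rankSpan b r (i + 1) := by
  induction hy using Submodule.span_induction with
  | mem y hy =>
    obtain ⟨x, hx, rfl⟩ := hy
    rw [mem_rankSpan]
    intro z hz
    refine repr_eq_zero b dg hM hb (hM.2 _ _ _ (gen_mem_part _ g) _ (hb x)) fun h => ?_
    have h1 : weight c (dg x) < weight c (dg z) := by
      rw [h, weight_add]
      linarith [weight_omDeg_pos hc g]
    have h2 := hr x z h1
    have h3 : i ≤ r x := hx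
    omega
  | zero => rw [smul_zero]; exact Submodule.zero_mem _
  | add x y _ _ hx hy => rw [smul_add]; exact Submodule.add_mem _ hx hy
  | smul a x _ hx => rw [smul_comm]; exact Submodule.smul_mem _ _ hx

theorem rankSpan_antitone : Antitone (rankSpan b r) := fun _ _ hij =>
  Submodule.span_mono (Set.image_mono fun _ hx => le_trans hij hx)

/-- A homogeneous basis with a rank function compatible with the weight gives a composition
series, whose factors are the shifts of `S_k` by the degrees of the basis. -/
theorem exists_compSeries {c : ℕ} (hc : k < c) (hM : M.IsGraded (omPart k))
    (hb : ∀ x, b x ∈ M.deg (dg x)) (hr : ∀ x y, weight c (dg x) < weight c (dg y) → r x < r y)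
    (hinj : Function.Injective r) {P : SMod (Om k) → Prop}
    (hP : ∀ d, P ((omSimple k).shift d)) (hPg : ∀ S, P S → S.IsGraded (omPart k)) :
    ∃ F, IsCompSeries P M F ∧ ∀ S, P S → IsSimple S → ∀ i,
      (M.FactorIso F i S ↔ ∃ x, r x = i ∧ S.Iso ((omSimple k).shift (dg x))) := by
  have hsub : ∀ i, ∀ (g : Fin k ⊕ Fin k), ∀ m ∈ rankSpan b r i,
      (gen g : Om k) • m ∈ rankSpan b r i := fun i g m hm =>
    rankSpan_antitone b r (Nat.le_succ i) (gen_smul_mem_rankSpan b dg r hc hM hb hr i g hm)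
  let F : ℕ → Submodule (Om k) M.carrier := fun i => submoduleOfGen _ (hsub i)
  have hF : ∀ i y, y ∈ F i ↔ ∀ x, r x < i → b.repr y x = 0 := fun i y => mem_rankSpan b r
  have key : ∀ S, P S → IsSimple S → ∀ i,
      (M.FactorIso F i S ↔ ∃ x, r x = i ∧ S.Iso ((omSimple k).shift (dg x))) := by
    intro S hS hsimple i
    constructor
    · rintro ⟨f, hsurj, hker, hdeg⟩
      -- If no basis vector had rank `i`, the steps `i` and `i + 1` would agree and `f` would be
      -- zero, although it maps onto a nonzero module.
      obtain ⟨x, rfl⟩ : ∃ x, r x = i := by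
        by_contra hall
        push Not at hall
        have h0 : ∀ y : F i, f y = 0 := fun y => (hker y).2 ((hF _ _).2 fun x hx =>
          (hF i y).1 y.2 x (lt_of_le_of_ne (Nat.lt_succ_iff.mp hx) (hall x)))
        obtain ⟨u, w, huw⟩ := hsimple.1
        obtain ⟨u, rfl⟩ := hsurj u
        obtain ⟨w, rfl⟩ := hsurj w
        exact huw (by rw [h0 u, h0 w])
      refine ⟨x, rfl, ?_⟩
      have hbx : b x ∈ F (r x) := (hF _ _).2 fun z hz => by
        rw [Module.Basis.repr_self, Finsupp.single_eq_of_ne]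
        rintro rfl
        exact lt_irrefl _ hz
      -- By injectivity of the rank, `b x` is the only basis vector of rank `r x`, so it spans the
      -- quotient by the next step.
      have hdiff : ∀ y : F (r x), f y = b.repr y x • f ⟨b x, hbx⟩ := by
        intro y
        have h1 : (y : M.carrier) - b.repr y x • b x ∈ F (r x + 1) := (hF _ _).2 fun z hz => by
          rw [map_sub, map_smul, Module.Basis.repr_self, Finsupp.sub_apply, Finsupp.smul_apply]
          by_cases hzx : z = x
          · subst hzx; simp
          · rw [(hF _ _).1 y.2 z (lt_of_le_of_ne (Nat.lt_succ_iff.mp hz) fun h => hzx (hinj h)),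
              Finsupp.single_eq_of_ne hzx, smul_zero, sub_zero]
        have h2 : f (y - algebraMap ℚ (Om k) (b.repr y x) • ⟨b x, hbx⟩) = 0 := by
          rw [hker]
          change (y : M.carrier) - algebraMap ℚ (Om k) (b.repr y x) • b x ∈ _
          rwa [algebraMap_smul]
        rw [map_sub, sub_eq_zero, map_smul, algebraMap_smul] at h2
        exact h2
      refine iso_omSimple_shift (hPg S hS) (hdeg (dg x) ⟨b x, hbx⟩ (hb x)) ?_ ?_ ?_
      · rw [Ne, hker, hF]
        intro h
        have := h x (Nat.lt_succ_self _)
        rw [Module.Basis.repr_self, Finsupp.single_eq_same] at this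
        exact one_ne_zero this
      · intro g
        rw [← map_smul, hker]
        exact gen_smul_mem_rankSpan b dg r hc hM hb hr _ g hbx
      · intro s
        obtain ⟨y, rfl⟩ := hsurj s
        exact ⟨_, hdiff y⟩
    · rintro ⟨x, rfl, e, he⟩
      let e' : S.carrier ≃ₗ[Om k] (omSimple k).carrier := e
      let v := e'.symm (omSimpleGen k)
      have hv : ∀ g : Fin k ⊕ Fin k, (gen g : Om k) • v = 0 := fun g => by
        rw [← map_smul, gen_smul_omSimpleGen, map_zero]
      have hv0 : v ≠ 0 := fun h => omSimpleGen_ne_zero (k := k) (by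
        rw [← e'.apply_symm_apply (omSimpleGen k)]
        change e' v = 0
        rw [h, map_zero])
      -- The coordinate at `x`, viewed in the line through `v`. It is linear over `Ω_k` since the
      -- variables kill `v` and also send `F (r x)` into the next step, where this coordinate
      -- vanishes.
      let f₀ : F (r x) →ₗ[ℚ] S.carrier :=
        (LinearMap.toSpanSingleton ℚ S.carrier v) ∘ₗ (b.coord x) ∘ₗ
          ((F (r x)).subtype.restrictScalars ℚ)
      have hf₀ : ∀ y : F (r x), f₀ y = b.repr y x • v := fun y => rfl
      let f : F (r x) →ₗ[Om k] S.carrier :=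
        { toFun := f₀
          map_add' := map_add f₀
          map_smul' := fun a y => map_smul_of_gen f₀ (fun g y => by
            have h1 := (mem_rankSpan b r).1
              (gen_smul_mem_rankSpan b dg r hc hM hb hr _ g y.2) x (Nat.lt_succ_self _)
            rw [hf₀, hf₀, smul_comm, hv, smul_zero]
            change b.repr ((gen g : Om k) • (y : M.carrier)) x • v = 0
            rw [h1, zero_smul]) a y }
      have hf : ∀ y : F (r x), f y = b.repr y x • v := fun y => rfl
      refine ⟨f, fun s => ?_, fun y => ?_, fun d y hy => ?_⟩
      · obtain ⟨a, ha⟩ := omSimple_eq_smul (e' s)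
        have hbx : a • b x ∈ F (r x) := (hF _ _).2 fun z hz => by
          rw [map_smul, Module.Basis.repr_self, Finsupp.smul_apply, Finsupp.single_eq_of_ne,
            smul_zero]
          rintro rfl
          exact lt_irrefl _ hz
        refine ⟨⟨a • b x, hbx⟩, e'.injective ?_⟩
        rw [hf, ha]
        change e' (b.repr (a • b x) x • v) = _
        have h1 : b.repr (a • b x) x = a := by
          rw [map_smul, Module.Basis.repr_self, Finsupp.smul_apply, Finsupp.single_eq_same,
            smul_eq_mul, mul_one]
        rw [h1, ← algebraMap_smul (Om k) a v, map_smul, algebraMap_smul]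
        change a • e' (e'.symm _) = _
        rw [e'.apply_symm_apply]
      · rw [hf, smul_eq_zero, or_iff_left hv0, hF]
        constructor
        · intro h z hz
          by_cases hzx : z = x
          · rwa [hzx]
          · exact (hF _ _).1 y.2 z
              (lt_of_le_of_ne (Nat.lt_succ_iff.mp hz) fun h => hzx (hinj h))
        · exact fun h => h x (Nat.lt_succ_self _)
      · rw [hf]
        by_cases hd : dg x = d
        · refine Submodule.smul_mem _ _ ((he d v).2 ?_)
          change e' (e'.symm _) ∈ (omSimple k).deg (d - dg x)
          rw [e'.apply_symm_apply, hd, sub_self, omSimple_deg_zero]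
          trivial
        · rw [repr_eq_zero b dg hM hb hy hd, zero_smul]
          exact Submodule.zero_mem _
  refine ⟨F, ⟨?_, ?_, ?_, ?_, ?_⟩, key⟩
  · exact fun i j hij => rankSpan_antitone b r hij
  · refine eq_top_iff.mpr fun y _ => (hF 0 y).2 fun x hx => absurd hx (Nat.not_lt_zero _)
  · refine eq_bot_iff.mpr fun y hy => ?_
    rw [Submodule.mem_iInf] at hy
    refine (Submodule.mem_bot _).mpr (b.repr.injective (Finsupp.ext fun x => ?_))
    rw [map_zero, (hF _ _).1 (hy (r x + 1)) x (Nat.lt_succ_self _), Finsupp.zero_apply]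
  · intro i y hy
    refine Submodule.span_mono ?_ (mem_submoduleOfGen.mp hy)
    rintro _ ⟨x, hx, rfl⟩
    exact ⟨Submodule.subset_span ⟨x, hx, rfl⟩, dg x, hb x⟩
  · intro i
    by_cases hx : ∃ x, r x = i
    · obtain ⟨x, rfl⟩ := hx
      have h1 : ((omSimple k).shift (dg x)).Iso ((omSimple k).shift (dg x)) :=
        ⟨LinearEquiv.refl _ _, fun _ _ => Iff.rfl⟩
      have h2 := isSimple_of_iso_omSimple_shift h1
      exact Or.inr ⟨_, hP (dg x), h2, (key _ (hP _) h2 _).2 ⟨x, rfl, h1⟩⟩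
    · left
      push Not at hx
      ext y
      rw [hF, hF]
      constructor
      · exact fun h z hz => h z (lt_of_le_of_ne (Nat.lt_succ_iff.mp hz) (hx z))
      · exact fun h z hz => h z (Nat.lt_succ_of_lt hz)

/-- Modules with homogeneous bases in the same degrees have the same composition factors. -/
theorem sameFactors_of_basis {N : SMod (Om k)} (b' : Module.Basis I ℚ N.carrier) {c : ℕ}
    (hc : k < c) (hM : M.IsGraded (omPart k)) (hN : N.IsGraded (omPart k))
    (hb : ∀ x, b x ∈ M.deg (dg x)) (hb' : ∀ x, b' x ∈ N.deg (dg x))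
    (hr : ∀ x y, weight c (dg x) < weight c (dg y) → r x < r y)
    (hinj : Function.Injective r) (hfin : ∀ d, {x | dg x = d}.Finite) {P : SMod (Om k) → Prop}
    (hP : ∀ d, P ((omSimple k).shift d)) (hPg : ∀ S, P S → S.IsGraded (omPart k)) :
    SameFactors P M N := by
  obtain ⟨F, hF, hF'⟩ := exists_compSeries b dg r hc hM hb hr hinj hP hPg
  obtain ⟨G, hG, hG'⟩ := exists_compSeries b' dg r hc hN hb' hr hinj hP hPg
  refine ⟨F, G, hF, hG, fun S hS hsimple => ?_⟩
  have h1 : {i | M.FactorIso F i S} = {i | N.FactorIso G i S} := by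
    ext i
    exact (hF' S hS hsimple i).trans (hG' S hS hsimple i).symm
  have h2 : {i | M.FactorIso F i S}.Finite := by
    have h3 : {x | S.Iso ((omSimple k).shift (dg x))}.Finite := by
      by_cases hne : ∃ x, S.Iso ((omSimple k).shift (dg x))
      · obtain ⟨x, hx⟩ := hne
        exact (hfin (dg x)).subset fun y hy => omSimple_shift_injective hy hx
      · push Not at hne
        have : {x | S.Iso ((omSimple k).shift (dg x))} = ∅ := Set.eq_empty_of_forall_notMem hne
        rw [this]
        exact Set.finite_empty
    refine (h3.image r).subset fun i hi => ?_
    obtain ⟨x, rfl, hx⟩ := (hF' S hS hsimple i).1 hi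
    exact ⟨x, hx, rfl⟩
  exact ⟨h2, h1 ▸ h2, by rw [h1]⟩

end Series

/-! ### Composition factors determine the dimensions -/

section Dimension

variable {k : ℕ} {Bd : (ℤ → ℤ → Prop) → Prop} (hB : IsBoundedness Bd) {M : SMod (Om k)}

/-- The target lives in degree `d` alone and `F i` is spanned by homogeneous elements, so a map that
vanished in degree `d` would vanish altogether. Thus the factor is visible in the part of degree
`d`. -/
theorem exists_factor_ne_zero {F : ℕ → Submodule (Om k) M.carrier} {i : ℕ} {d : Deg}
    (hh : M.IsHomog (F i)) {f : F i →ₗ[Om k] ((omSimple k).shift d).carrier}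
    (hsurj : Function.Surjective f)
    (hdeg : ∀ e, ∀ x : F i, (x : M.carrier) ∈ M.deg e → f x ∈ ((omSimple k).shift d).deg e) :
    ∃ y : F i, (y : M.carrier) ∈ M.deg d ∧ f y ≠ 0 := by
  by_contra hall
  push Not at hall
  have h1 : ∀ y ∈ Submodule.span ℚ {y : M.carrier | y ∈ F i ∧ ∃ e, y ∈ M.deg e},
      ∃ hy : y ∈ F i, f ⟨y, hy⟩ = 0 := by
    intro y hy
    induction hy using Submodule.span_induction with
    | mem y hy =>
      obtain ⟨hy, e, he⟩ := hy
      refine ⟨hy, ?_⟩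
      by_cases hed : e = d
      · subst hed
        exact hall ⟨y, hy⟩ he
      · have h2 := hdeg e ⟨y, hy⟩ he
        have h3 : ((omSimple k).shift d).deg e = ⊥ := omSimple_deg_ne (sub_ne_zero.mpr hed)
        rw [h3] at h2
        exact (Submodule.mem_bot ℚ).mp h2
    | zero => exact ⟨Submodule.zero_mem _, map_zero f⟩
    | add x y _ _ hx hy =>
      obtain ⟨hx, hx0⟩ := hx
      obtain ⟨hy, hy0⟩ := hy
      exact ⟨Submodule.add_mem _ hx hy, by
        have := map_add f ⟨x, hx⟩ ⟨y, hy⟩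
        rw [hx0, hy0, add_zero] at this
        exact this⟩
    | smul a x _ hx =>
      obtain ⟨hx, hx0⟩ := hx
      have h2 : a • x ∈ F i := by
        rw [← algebraMap_smul (Om k) a x]; exact Submodule.smul_mem _ _ hx
      refine ⟨h2, ?_⟩
      have := map_smul f (algebraMap ℚ (Om k) a) ⟨x, hx⟩
      rw [hx0, smul_zero] at this
      rw [← this]
      congr 1
      exact Subtype.ext (algebraMap_smul (Om k) a x).symm
  obtain ⟨y, hy⟩ := hsurj (omSimpleGen k)
  obtain ⟨h2, h3⟩ := h1 y (hh y y.2)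
  exact omSimpleGen_ne_zero (k := k) (hy.symm.trans h3)

-- Intersect the series with the part of degree `d`. The dimension drops by one at each factor
-- isomorphic to the shift of `S_k` by `d` and is unchanged at all other steps, the other simple
-- objects being zero in that degree. A descending chain in a finite-dimensional space with zero
-- intersection reaches zero, so the total drop is the dimension.
include hB in
theorem hdim_eq_ncard (hM : Obj Bd (omPart k) M) {F : ℕ → Submodule (Om k) M.carrier}
    (hF : IsCompSeries (Obj Bd (omPart k)) M F) (d : Deg)
    (hfin : {i | M.FactorIso F i ((omSimple k).shift d)}.Finite) :
    hdim M.deg d = {i | M.FactorIso F i ((omSimple k).shift d)}.ncard := by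
  classical
  obtain ⟨hanti, htop, hinf, hhom, hfac⟩ := hF
  have hMfin := hM.2.1 d
  let G : ℕ → Submodule ℚ (M.deg d) := fun i =>
    ((F i).restrictScalars ℚ).comap (M.deg d).subtype
  have hG : ∀ i (y : M.deg d), y ∈ G i ↔ (y : M.carrier) ∈ F i := fun i y => Iff.rfl
  have hstep : ∀ i, Module.finrank ℚ (G i) = Module.finrank ℚ (G (i + 1)) +
      if M.FactorIso F i ((omSimple k).shift d) then 1 else 0 := by
    intro i
    split_ifs with hi
    · obtain ⟨f, hsurj, hker, hdeg⟩ := hi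
      let g : G i →ₗ[ℚ] (omSimple k).carrier :=
        f.restrictScalars ℚ ∘ₗ LinearMap.codRestrict ((F i).restrictScalars ℚ)
          ((M.deg d).subtype ∘ₗ (G i).subtype) fun y => y.2
      have h1 : LinearMap.range g = ⊤ := by
        obtain ⟨y, hy, hy0⟩ := exists_factor_ne_zero (hhom i) hsurj hdeg
        let u : (omSimple k).carrier := f y
        obtain ⟨a, ha⟩ := omSimple_eq_smul u
        have ha0 : a ≠ 0 := fun h => hy0 (show u = 0 by rw [ha, h, zero_smul])
        rw [eq_top_iff]
        rintro s -
        obtain ⟨a', rfl⟩ := omSimple_eq_smul s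
        refine ⟨(a' * a⁻¹) • ⟨⟨y, hy⟩, y.2⟩, ?_⟩
        rw [map_smul]
        change (a' * a⁻¹) • u = _
        rw [ha, smul_smul, mul_assoc, inv_mul_cancel₀ ha0, mul_one]
      have h2 : LinearMap.ker g = (G (i + 1)).comap (G i).subtype := by
        ext y
        exact hker ⟨y.1, y.2⟩
      have h3 := g.finrank_range_add_finrank_ker
      have h4 : G (i + 1) ≤ G i := fun y hy => hanti (Nat.le_succ i) hy
      rw [h1, finrank_top, omSimple_finrank, h2,
        (Submodule.comapSubtypeEquivOfLe h4).finrank_eq] at h3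
      rw [← h3, add_comm]
    · rw [add_zero]
      have h1 : G i = G (i + 1) := by
        rcases hfac i with h | ⟨S, hS, hsimple, f, hsurj, hker, hdeg⟩
        · ext y
          rw [hG, hG, h]
        · refine le_antisymm (fun y hy => ?_) fun y hy => hanti (Nat.le_succ i) hy
          obtain ⟨e, he⟩ := exists_iso_omSimple_shift hS.1 (hB.cone hS.2.2) hsimple
          have hed : d ≠ e := by
            rintro rfl
            obtain ⟨t, ht⟩ := he
            refine hi ⟨t.toLinearMap ∘ₗ f, t.surjective.comp hsurj, fun x => ?_, fun d x hx => ?_⟩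
            · rw [LinearMap.comp_apply, LinearEquiv.coe_coe, LinearEquiv.map_eq_zero_iff, hker]
            · exact (ht d _).1 (hdeg d x hx)
          have h2 : S.deg d = ⊥ := by
            rw [he.grIso.eq_bot_iff]
            exact omSimple_deg_ne (sub_ne_zero.mpr hed)
          have h3 := hdeg d ⟨y, hy⟩ y.2
          rw [h2] at h3
          exact (hker ⟨y, hy⟩).1 ((Submodule.mem_bot ℚ).mp h3)
      rw [h1]
  have hsum : ∀ n, Module.finrank ℚ (G 0) = Module.finrank ℚ (G n) +
      ((Finset.range n).filter fun i => M.FactorIso F i ((omSimple k).shift d)).card := by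
    intro n
    induction n with
    | zero => simp
    | succ n ih =>
      rw [ih, hstep n, Finset.range_add_one, Finset.filter_insert]
      split_ifs
      · rw [Finset.card_insert_of_notMem (by simp)]
        omega
      · omega
  have hG0 : Module.finrank ℚ (G 0) = hdim M.deg d := by
    have : G 0 = ⊤ := eq_top_iff.mpr fun y _ => by rw [hG, htop]; trivial
    rw [this, finrank_top, hdim]
  -- The chain becomes stationary by the Artinian property, and its stable value lies in the
  -- intersection of all the steps, which is zero.
  have hGn : ∃ n, ∀ m, n ≤ m → G m = ⊥ := by
    obtain ⟨n, hn⟩ := IsArtinian.monotone_stabilizes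
      (⟨fun i => OrderDual.toDual (G i), fun i j hij y hy => hanti hij hy⟩ : ℕ →o (Submodule ℚ (M.deg d))ᵒᵈ)
    have h1 : G n = ⊥ := by
      rw [eq_bot_iff]
      intro y hy
      have h2 : (y : M.carrier) ∈ (⨅ i, F i) := by
        rw [Submodule.mem_iInf]
        intro i
        rcases le_total n i with h | h
        · have h3 : G n = G i := hn i h
          rw [h3] at hy
          exact hy
        · exact hanti h hy
      rw [hinf] at h2
      exact (Submodule.mem_bot ℚ).mpr (Subtype.ext ((Submodule.mem_bot _).mp h2))
    refine ⟨n, fun m hm => ?_⟩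
    have h3 : G n = G m := hn m hm
    rw [← h3, h1]
  obtain ⟨n, hn⟩ := hGn
  obtain ⟨N, hN⟩ := hfin.bddAbove
  -- Beyond `L` the intersected chain is zero, and all indices with a factor of the wanted type are
  -- smaller than `L`.
  let L := max n (N + 1)
  rw [← hG0, hsum L, hn L (le_max_left _ _), finrank_bot, zero_add, ← Set.ncard_coe_finset]
  congr 1
  ext i
  rw [Finset.mem_coe, Finset.mem_filter, Finset.mem_range]
  refine ⟨fun h => h.2, fun h => ⟨?_, h⟩⟩
  exact lt_of_lt_of_le (Nat.lt_succ_of_le (hN h)) (le_max_right _ _)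

include hB in
theorem hdim_eq_of_sameFactors {N : SMod (Om k)} (hM : Obj Bd (omPart k) M)
    (hN : Obj Bd (omPart k) N) (h : SameFactors (Obj Bd (omPart k)) M N) (d : Deg) :
    hdim M.deg d = hdim N.deg d := by
  obtain ⟨F, G, hF, hG, h⟩ := h
  have h1 : ((omSimple k).shift d).Iso ((omSimple k).shift d) :=
    ⟨LinearEquiv.refl _ _, fun _ _ => Iff.rfl⟩
  obtain ⟨h2, h3, h4⟩ := h _ ((omSimple_obj hB).shift hB d) (isSimple_of_iso_omSimple_shift h1)
  rw [hdim_eq_ncard hB hM hF d h2, hdim_eq_ncard hB hN hG d h3, h4]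

end Dimension

end VermaCat
end

noncomputable section

namespace VermaCat

open SPoly SerRing

/-! ### The Grothendieck group of all objects -/

theorem _root_.VermaCat.SMod.Iso.refl {A : Type} [Ring A] [Algebra ℚ A] (M : SMod A) : M.Iso M :=
  ⟨LinearEquiv.refl _ _, fun _ _ => Iff.rfl⟩

theorem exists_dfinsupp_basis {S J : Type} [Ring S] {N : J → Type} [∀ x, AddCommGroup (N x)]
    [∀ x, Module S (N x)] [DecidableEq J] (B : ∀ x, Module.Basis Unit S (N x)) :
    ∃ b : Module.Basis J S (Π₀ x, N x), ∀ x, b x = DFinsupp.single x (B x ()) := by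
  classical
  let e : (Π₀ x, N x) ≃ₗ[S] (J →₀ S) :=
    (DFinsupp.mapRange.linearEquiv fun x =>
      (B x).repr ≪≫ₗ Finsupp.uniqueLinearEquiv S S ()) ≪≫ₗ (finsuppLequivDFinsupp S).symm
  refine ⟨Module.Basis.ofRepr e, fun x => ?_⟩
  rw [Module.Basis.coe_ofRepr, LinearEquiv.symm_apply_eq]
  change _ = (finsuppLequivDFinsupp S).symm
    (DFinsupp.mapRange.linearEquiv (fun x =>
      (B x).repr ≪≫ₗ Finsupp.uniqueLinearEquiv S S ()) (DFinsupp.single x (B x ())))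
  rw [LinearEquiv.eq_symm_apply]
  refine (Finsupp.toDFinsupp_single (M := S) x 1).trans ?_
  refine ((DFinsupp.mapRange_single (hf := fun x => map_zero _)).trans ?_).symm
  congr 1
  simp

/-- An identity between linear maps on a quotient of a free module, checked on generators; with a
suitable value at `g` it turns `f` into a coordinate. -/
theorem eq_smul_of_generates {S : Type} [CommRing S] {T : Type*} (rel : Set (T →₀ S))
    (f : ((T →₀ S) ⧸ Submodule.span S rel) →ₗ[S] S) (g : (T →₀ S) ⧸ Submodule.span S rel)
    (h : ∀ t, (Submodule.span S rel).mkQ (Finsupp.single t 1)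
      = f ((Submodule.span S rel).mkQ (Finsupp.single t 1)) • g)
    (x : (T →₀ S) ⧸ Submodule.span S rel) : x = f x • g := by
  have h1 : LinearMap.id = LinearMap.toSpanSingleton S _ g ∘ₗ f := by
    refine Submodule.linearMap_qext _ (Finsupp.lhom_ext' fun t => LinearMap.ext_ring ?_)
    exact h t
  exact LinearMap.congr_fun h1 x

theorem finite_locIdx {n : ℕ} (m : Fin n → Deg → ℕ) (e : Deg) :
    {x : Σ j : Fin n, Σ d : Deg, Fin (m j d) | x.2.1 = e}.Finite := by
  refine (Set.finite_range fun y : Σ j : Fin n, Fin (m j e) =>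
    (⟨y.1, e, y.2⟩ : Σ j : Fin n, Σ d : Deg, Fin (m j d))).subset ?_
  rintro ⟨j, d, x⟩ (rfl : d = e)
  exact ⟨⟨j, x⟩, rfl⟩

section

variable {R : Type} [CommRing R] [Algebra Kq R] [SerRing R] {k : ℕ}

theorem deg_ne_bot_of_fin {M : SMod (Om k)} {d : Deg} (x : Fin (hdim M.deg d)) : M.deg d ≠ ⊥ := by
  intro h
  rw [hdim_of_eq_bot h] at x
  exact x.elim0

/-- An object has the same composition factors as the direct sum of its simple factors. -/
theorem sameFactors_locSum {Bd : (ℤ → ℤ → Prop) → Prop} (hB : IsBoundedness Bd) {M : SMod (Om k)}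
    (hM : Obj Bd (omPart k) M) :
    Obj Bd (omPart k) (locSum (fun _ : Fin 1 => omSimple k) fun _ => hdim M.deg) ∧
    SameFactors (Obj Bd (omPart k)) M (locSum (fun _ : Fin 1 => omSimple k) fun _ => hdim M.deg) := by
  classical
  let J : Type := Σ _ : Fin 1, Σ d : Deg, Fin (hdim M.deg d)
  let dg : J → Deg := fun x => x.2.1
  have hfin : ∀ e, {x | dg x = e}.Finite := fun e => finite_locIdx (fun _ : Fin 1 => hdim M.deg) e
  have hsupp : ∀ x : J, M.support (dg x).1 (dg x).2.1 := fun x =>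
    ⟨(dg x).2.2, deg_ne_bot_of_fin x.2.2⟩
  have hN : Obj Bd (omPart k) (locSum (fun _ : Fin 1 => omSimple k) fun _ => hdim M.deg) := by
    refine Obj.dsum_shift hB (omSimple_obj hB) dg hfin (hB.mono hM.2.2 ?_)
    rintro i j ⟨x, p, hx⟩
    have := hsupp x
    rwa [hx] at this
  refine ⟨hN, ?_⟩
  obtain ⟨c, hc, -, hcfin⟩ := (hB.cone hM.2.2).exists_weight k
  have : ∀ d, FiniteDimensional ℚ (M.deg d) := hM.2.1
  -- A homogeneous basis of `M` assembled from bases of its parts has one vector for each simple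
  -- summand of the direct sum, in the same degree. Both modules thus have homogeneous bases indexed
  -- by `J` with the same degrees.
  let cb := hM.1.1.collectedBasis fun d => Module.finBasis ℚ (M.deg d)
  let e : (Σ d : Deg, Fin (hdim M.deg d)) ≃ J :=
    { toFun := fun y => ⟨0, y⟩
      invFun := fun x => x.2
      left_inv := fun _ => rfl
      right_inv := fun x => by
        obtain ⟨j, y⟩ := x
        obtain rfl := Subsingleton.elim j 0
        rfl }
  let b : Module.Basis J ℚ M.carrier := cb.reindex e
  obtain ⟨b', hb'⟩ := exists_dfinsupp_basis (N := fun x : J => ((omSimple k).shift (dg x)).carrier)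
    fun _ => omSimpleBasis k
  have hW : ∀ w, {x | weight c (dg x) ≤ w}.Finite := by
    intro w
    refine ((hcfin w).biUnion fun y _ => (Set.finite_univ (α := ZMod 2)).biUnion
      fun p _ => hfin (y.1, y.2, p)).subset fun x hx => ?_
    exact Set.mem_biUnion (x := ((dg x).1, (dg x).2.1)) ⟨hsupp x, hx⟩
      (Set.mem_biUnion (Set.mem_univ (dg x).2.2) rfl)
  obtain ⟨r, hrinj, hr⟩ := exists_rank (fun x : J => weight c (dg x)) hW
  refine sameFactors_of_basis b dg r b' hc hM.1 hN.1 (fun x => ?_) (fun x => ?_) hr hrinj hfin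
    (fun d => (omSimple_obj hB).shift hB d) fun S hS => hS.1
  · have h1 : b x = cb x.2 := cb.reindex_apply e x
    rw [h1]
    exact hM.1.1.collectedBasis_mem _ _
  · have h1 : omSimpleBasis k () ∈ ((omSimple k).shift (dg x)).deg (dg x) := by
      change _ ∈ (omSimple k).deg (dg x - dg x)
      rw [sub_self, omSimple_deg_zero]
      trivial
    have h2 := single_mem_dsum (X := fun x : J => (omSimple k).shift (dg x)) h1
    exact (congrArg (· ∈ (dsum fun x : J => (omSimple k).shift (dg x)).deg (dg x)) (hb' x)).mpr h2

/-- The graded superdimension on the Grothendieck group. -/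
def G0.sdimMap (R : Type) [CommRing R] [Algebra Kq R] [SerRing R] (k : ℕ) :
    G0 (cf : R → ℤ → ℤ → ℚ) (Obj (Bd R) (omPart k)) →ₗ[R] R :=
  Submodule.liftQ _ (Finsupp.linearCombination R fun M => sdim R M.1.deg) (by
    rw [Submodule.span_le]
    rintro r ((⟨M', M, M'', hex, rfl⟩ | ⟨n, M, X, m, p, hp, hi, rfl⟩) | ⟨M, N, h, rfl⟩)
    · change Finsupp.linearCombination R _ _ = 0
      simp only [map_sub, Finsupp.linearCombination_single, one_smul]
      rw [sdim_shortExact M'.2 M.2 M''.2 hex, add_sub_cancel_left, sub_self]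
    · change Finsupp.linearCombination R _ _ = 0
      simp only [map_sub, map_sum, Finsupp.linearCombination_single, one_smul]
      rw [sdim_locSum M.2 (fun j => (X j).1) (fun j => (X j).2) m p hp hi, sub_eq_zero]
      rfl
    · change Finsupp.linearCombination R _ _ = 0
      simp only [map_sub, Finsupp.linearCombination_single, one_smul]
      have : sdim R M.1.deg = sdim R N.1.deg := cf_ext fun i j => by
        rw [cf_sdim M.2.2.2, cf_sdim N.2.2.2]
        simp only [sdiff, hdim_eq_of_sameFactors isBoundedness M.2 N.2 h]
      rw [this, sub_self])

theorem G0.sdimMap_cls (M : SMod (Om k)) (h : Obj (Bd R) (omPart k) M) :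
    G0.sdimMap R k (G0.cls cf _ M h) = sdim R M.deg := by
  refine (Submodule.liftQ_apply _ _ _).trans ?_
  rw [Finsupp.linearCombination_single, one_smul]

/-- The factor relation replaces `M` by the direct sum of its simple factors, and the sum relation
evaluates the class of the latter as a multiple of the class of `S_k`. -/
theorem G0.cls_eq_smul (M : SMod (Om k)) (h : Obj (Bd R) (omPart k) M) :
    G0.cls (cf : R → ℤ → ℤ → ℚ) _ M h
      = sdim R M.deg • G0.cls cf _ (omSimple k) (omSimple_obj isBoundedness) := by
  obtain ⟨hN, hMN⟩ := sameFactors_locSum isBoundedness h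
  have h1 : G0.cls (cf : R → ℤ → ℤ → ℚ) _ M h = G0.cls cf _ _ hN :=
    (Submodule.Quotient.eq _).mpr (Submodule.subset_span (Or.inr ⟨⟨M, h⟩, ⟨_, hN⟩, hMN, rfl⟩))
  rw [h1]
  refine (Submodule.Quotient.eq (p := Submodule.span R (exactRel (Obj (Bd R) (omPart k)) ∪
    sumRel cf (Obj (Bd R) (omPart k)) ∪ factorRel (Obj (Bd R) (omPart k))))
    (y := sdim R M.deg • Finsupp.single ⟨omSimple k, omSimple_obj isBoundedness⟩ 1)).mpr
    (Submodule.subset_span (Or.inl (Or.inr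
      ⟨1, ⟨_, hN⟩, fun _ => ⟨omSimple k, omSimple_obj isBoundedness⟩, fun _ => hdim M.deg,
        fun _ => sdim R M.deg, fun _ => isSeries_sdim h.2.2, Iso.refl _, ?_⟩)))
  rw [Finset.univ_unique, Finset.sum_singleton, Finsupp.smul_single, smul_eq_mul, mul_one]

/-- The Grothendieck group is free of rank one on the class of `S_k`. -/
def G0.equiv (R : Type) [CommRing R] [Algebra Kq R] [SerRing R] (k : ℕ) :
    G0 (cf : R → ℤ → ℤ → ℚ) (Obj (Bd R) (omPart k)) ≃ₗ[R] R :=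
  LinearEquiv.ofBijective (G0.sdimMap R k) (by
    have hgen : ∀ x, x = G0.sdimMap R k x •
        G0.cls (cf : R → ℤ → ℤ → ℚ) (Obj (Bd R) (omPart k)) (omSimple k)
          (omSimple_obj isBoundedness) := by
      refine eq_smul_of_generates _ (G0.sdimMap R k) _ fun M => ?_
      have h1 := G0.cls_eq_smul M.1 M.2
      rw [← G0.sdimMap_cls M.1 M.2] at h1
      exact h1
    constructor
    · intro x y hxy
      rw [hgen x, hgen y, hxy]
    · intro r
      refine ⟨r • G0.cls cf _ (omSimple k) (omSimple_obj isBoundedness), ?_⟩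
      rw [map_smul, G0.sdimMap_cls, sdim_omSimple, smul_eq_mul, mul_one])

theorem G0.equiv_cls (M : SMod (Om k)) (h : Obj (Bd R) (omPart k) M) :
    G0.equiv R k (G0.cls cf _ M h) = sdim R M.deg := G0.sdimMap_cls M h

end

end VermaCat
end

noncomputable section

namespace VermaCat

open SPoly SerRing

/-! ### Free supermodules -/

section HomogBasis

variable {A : Type} [Ring A] [Algebra ℚ A] {𝒜 : Deg → Submodule ℚ A}

/-- `M` has a basis of homogeneous elements of the degrees `d i`. -/
def HasHomogBasis (M : SMod A) {ι : Type} (d : ι → Deg) : Prop :=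
  ∃ b : Module.Basis ι A M.carrier, ∀ i, b i ∈ M.deg (d i)

theorem hproj_smul {M : SMod A} (hM : M.IsGraded 𝒜) {c : Deg} {a : A} (ha : a ∈ 𝒜 c) (e : Deg)
    (y : M.carrier) : hproj hM.1 e (a • y) = a • hproj hM.1 (e - c) y := by
  induction y using homogeneous_induction hM.1 with
  | zero => simp only [smul_zero, map_zero]
  | add y z hy hz => simp only [smul_add, map_add, hy, hz]
  | mem d' y hy =>
    by_cases he : d' = e - c
    · subst he
      have := hM.2 _ _ a ha y hy
      rw [add_sub_cancel] at this
      rw [hproj_same _ this, hproj_same _ hy]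
    · rw [hproj_ne _ he hy, smul_zero]
      exact hproj_ne _ (fun h => he (by rw [← h, add_sub_cancel_left])) (hM.2 _ _ a ha y hy)

/-- A linear map that sends generators to elements of the right degree preserves degrees. -/
theorem isHom_of_generators (h𝒜 : DirectSum.IsInternal 𝒜) {M N : SMod A} (hM : M.IsGraded 𝒜)
    (hN : N.IsGraded 𝒜) {ι : Type} {d : ι → Deg} {v : ι → M.carrier}
    (hv : ∀ i, v i ∈ M.deg (d i)) (hspan : Submodule.span A (Set.range v) = ⊤)
    (f : M.carrier →ₗ[A] N.carrier) (hf : ∀ i, f (v i) ∈ N.deg (d i)) : IsHom M N f := by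
  have key : ∀ x e, hproj hN.1 e (f x) = f (hproj hM.1 e x) := by
    intro x
    have hx : x ∈ Submodule.span A (Set.range v) := hspan ▸ Submodule.mem_top
    induction hx using Submodule.span_induction with
    | mem x hx =>
      obtain ⟨i, rfl⟩ := hx
      intro e
      by_cases he : d i = e
      · subst he
        rw [hproj_same _ (hv i), hproj_same _ (hf i)]
      · rw [hproj_ne _ he (hv i), hproj_ne _ he (hf i), map_zero]
    | zero => intro e; simp only [map_zero]
    | add x y _ _ hx hy => intro e; simp only [map_add, hx, hy]
    | smul a x _ hx =>
      induction a using homogeneous_induction h𝒜 with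
      | zero => intro e; simp only [zero_smul, map_zero]
      | add a b ha hb => intro e; simp only [add_smul, map_add, ha, hb]
      | mem c a ha =>
        intro e
        rw [map_smul, hproj_smul hN ha, hx, hproj_smul hM ha, map_smul]
  intro e x hx
  have := key x e
  rw [hproj_same _ hx] at this
  rw [← this]
  exact hproj_mem _ _ _

/-- The images of the basis vectors lift to homogeneous elements of the same degree, and freeness
extends the choice to a linear map. -/
theorem HasHomogBasis.isProj (h𝒜 : DirectSum.IsInternal 𝒜) {Bd : (ℤ → ℤ → Prop) → Prop}
    {M : SMod A} (hM : Obj Bd 𝒜 M) {ι : Type} {d : ι → Deg} (h : HasHomogBasis M d) :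
    IsProj (Obj Bd 𝒜) M := by
  refine ⟨hM, fun N N' hN hN' g hg hgs f hf => ?_⟩
  obtain ⟨b, hb⟩ := h
  have h1 : ∀ i, ∃ y ∈ N.deg (d i), g y = f (b i) := fun i =>
    exists_mem_of_surjective hN.1.1 hN'.1.1 (f := g.restrictScalars ℚ) hg hgs (hf _ _ (hb i))
  choose y hy hgy using h1
  refine ⟨b.constr ℕ y, isHom_of_generators h𝒜 hM.1 hN.1 hb b.span_eq _ fun i => ?_,
    b.ext fun i => ?_⟩
  · rw [b.constr_basis]; exact hy i
  · rw [LinearMap.comp_apply, b.constr_basis, hgy]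

theorem HasHomogBasis.iso (h𝒜 : DirectSum.IsInternal 𝒜) {M N : SMod A} (hM : M.IsGraded 𝒜)
    (hN : N.IsGraded 𝒜) {ι : Type} {d : ι → Deg} (h : HasHomogBasis M d)
    (h' : HasHomogBasis N d) : M.Iso N := by
  obtain ⟨b, hb⟩ := h
  obtain ⟨b', hb'⟩ := h'
  let e := b.equiv b' (Equiv.refl ι)
  have h1 : IsHom M N e.toLinearMap := isHom_of_generators h𝒜 hM hN hb b.span_eq _ fun i => by
    have : e (b i) = b' i := b.equiv_apply i b' (Equiv.refl ι)
    exact this ▸ hb' i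
  have h2 : IsHom N M e.symm.toLinearMap := isHom_of_generators h𝒜 hN hM hb' b'.span_eq _
    fun i => by
      have : e.symm (b' i) = b i := by
        rw [LinearEquiv.symm_apply_eq]; exact (b.equiv_apply i b' (Equiv.refl ι)).symm
      exact this ▸ hb i
  refine ⟨e, fun d x => ⟨h1 d x, fun hx => ?_⟩⟩
  have := h2 d _ hx
  rwa [LinearEquiv.coe_coe, LinearEquiv.symm_apply_apply] at this

theorem HasHomogBasis.reindex {M : SMod A} {ι ι' : Type} {d : ι → Deg} (h : HasHomogBasis M d)
    (e : ι' ≃ ι) : HasHomogBasis M (d ∘ e) := by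
  obtain ⟨b, hb⟩ := h
  refine ⟨b.reindex e.symm, fun i => ?_⟩
  rw [Module.Basis.reindex_apply]
  exact hb _

theorem HasHomogBasis.of_iso {M N : SMod A} {ι : Type} {d : ι → Deg} (h : HasHomogBasis M d)
    (hi : M.Iso N) : HasHomogBasis N d := by
  obtain ⟨b, hb⟩ := h
  obtain ⟨e, he⟩ := hi
  exact ⟨b.map e, fun i => (he _ _).mp (hb i)⟩

theorem HasHomogBasis.shift {M : SMod A} {ι : Type} {d : ι → Deg} (h : HasHomogBasis M d)
    (c : Deg) : HasHomogBasis (M.shift c) fun i => d i + c := by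
  obtain ⟨b, hb⟩ := h
  refine ⟨b, fun i => ?_⟩
  change b i ∈ M.deg (d i + c - c)
  rw [add_sub_cancel_right]
  exact hb i

theorem HasHomogBasis.dsum {J : Type} {X : J → SMod A} {η : J → Type} {d : ∀ j, η j → Deg}
    (h : ∀ j, HasHomogBasis (X j) (d j)) :
    HasHomogBasis (dsum X) fun x : Σ j, η j => d x.1 x.2 := by
  classical
  choose b hb using h
  let B : Module.Basis (Σ j, η j) A (Π₀ j, (X j).carrier) := DFinsupp.basis b
  refine ⟨B, fun x => ?_⟩
  have h1 : B x = DFinsupp.single x.1 (b x.1 x.2) := by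
    apply B.repr.injective
    rw [B.repr_self]
    refine ((LinearEquiv.symm_apply_eq _).mpr ?_).symm
    refine (DFinsupp.mapRange_single (hf := fun x => map_zero _)).trans ?_
    rw [Module.Basis.repr_self]
    exact (sigmaFinsuppEquivDFinsupp_single x (1 : A)).symm
  exact (congrArg (· ∈ (SMod.dsum X).deg (d x.1 x.2)) h1).mpr (single_mem_dsum (hb x.1 x.2))

theorem finite_of_linearIndependent {M : SMod A} (hM : M.LocFin) {ι : Type} {d : ι → Deg}
    {v : ι → M.carrier} (hv : ∀ i, v i ∈ M.deg (d i)) (hli : LinearIndependent ℚ v) (e : Deg) :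
    {i | d i = e}.Finite := by
  have := hM e
  have hv' : ∀ i, d i = e → v i ∈ M.deg e := by
    rintro i rfl
    exact hv i
  let u : {i | d i = e} → M.deg e := fun i => ⟨v i.1, hv' i.1 i.2⟩
  have hu : LinearIndependent ℚ u := by
    refine LinearIndependent.of_comp (M.deg e).subtype ?_
    exact hli.comp _ Subtype.val_injective
  have := hu.finite
  exact Set.toFinite _

theorem HasHomogBasis.finite [Nontrivial A] {M : SMod A} (hM : M.LocFin) {ι : Type} {d : ι → Deg}
    (h : HasHomogBasis M d) (e : Deg) : {i | d i = e}.Finite := by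
  obtain ⟨b, hb⟩ := h
  exact finite_of_linearIndependent hM hb
    (b.linearIndependent.restrict_scalars (fun x y h => by simpa using h)) e

theorem HasHomogBasis.deg_ne_bot [Nontrivial A] {M : SMod A} {ι : Type} {d : ι → Deg}
    (h : HasHomogBasis M d) (i : ι) : M.deg (d i) ≠ ⊥ := by
  obtain ⟨b, hb⟩ := h
  intro h0
  have := hb i
  rw [h0, Submodule.mem_bot] at this
  exact b.ne_zero i this

end HomogBasis

/-! ### Projective objects -/

section Proj

variable {k : ℕ} {Bd : (ℤ → ℤ → Prop) → Prop}

instance : Nontrivial (Om k) := (aug k).toRingHom.domain_nontrivial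

/-- The span of the images of the variables. -/
def rad (M : SMod (Om k)) : Submodule ℚ M.carrier :=
  Submodule.span ℚ {x | ∃ (i : Fin k ⊕ Fin k) (y : M.carrier), x = (gen i : Om k) • y}

theorem gen_smul_mem_rad {M : SMod (Om k)} (i : Fin k ⊕ Fin k) (y : M.carrier) :
    (gen i : Om k) • y ∈ rad M := Submodule.subset_span ⟨i, y, rfl⟩

theorem smul_sub_aug_mem_rad {M : SMod (Om k)} (a : Om k) (y : M.carrier) :
    a • y - aug k a • y ∈ rad M := by
  induction a using induction_left with
  | one => simp
  | gen_mul i z _ =>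
    rw [map_mul, aug_gen, zero_mul, zero_smul, sub_zero, mul_smul]
    exact gen_smul_mem_rad _ _
  | add a b ha hb =>
    rw [add_smul, map_add, add_smul, add_sub_add_comm]
    exact add_mem ha hb
  | smul c a ha =>
    rw [map_smul, smul_assoc, smul_assoc, ← smul_sub]
    exact Submodule.smul_mem _ _ ha

/-- A homogeneous component of an element of the radical lies in a subspace that contains the
images of the homogeneous elements under the variables. -/
theorem hproj_rad_mem {M : SMod (Om k)} (hM : M.IsGraded (omPart k)) {e : Deg}
    {N : Submodule ℚ M.carrier}
    (hN : ∀ (i : Fin k ⊕ Fin k), ∀ y ∈ M.deg (e - omDeg k i), (gen i : Om k) • y ∈ N)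
    {x : M.carrier} (hx : x ∈ rad M) : hproj hM.1 e x ∈ N := by
  induction hx using Submodule.span_induction with
  | mem x hx =>
    obtain ⟨i, y, rfl⟩ := hx
    rw [hproj_smul hM (gen_mem_part (omDeg k) i)]
    exact hN i _ (hproj_mem _ _ _)
  | zero => rw [map_zero]; exact zero_mem _
  | add x y _ _ hx hy => rw [map_add]; exact add_mem hx hy
  | smul c x _ hx => rw [map_smul]; exact Submodule.smul_mem _ _ hx

/-- There are homogeneous elements that give a basis modulo the radical. -/
theorem exists_basis_mod_rad {M : SMod (Om k)} (hM : M.IsGraded (omPart k)) :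
    ∃ (ι : Type) (d : ι → Deg) (v : ι → M.carrier) (b : Module.Basis ι ℚ (M.carrier ⧸ rad M)),
      (∀ i, v i ∈ M.deg (d i)) ∧ ∀ i, b i = (rad M).mkQ (v i) := by
  let s : Set (M.carrier ⧸ rad M) := {z | ∃ d, ∃ y ∈ M.deg d, z = (rad M).mkQ y}
  have hs : ⊤ ≤ Submodule.span ℚ s := by
    rintro z -
    obtain ⟨x, rfl⟩ := (rad M).mkQ_surjective z
    induction x using homogeneous_induction hM.1 with
    | zero => rw [map_zero]; exact zero_mem _
    | mem d x hx => exact Submodule.subset_span ⟨d, x, hx, rfl⟩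
    | add x y hx hy => rw [map_add]; exact add_mem hx hy
  have h1 := fun i => Module.Basis.ofSpan_subset hs (Set.mem_range_self i)
  choose d v hv hb using h1
  exact ⟨_, d, v, Module.Basis.ofSpan hs, hv, hb⟩

/-- The elements of a basis modulo the radical generate. -/
theorem span_eq_top_of_basis_mod_rad (hB : IsBoundedness Bd) {M : SMod (Om k)}
    (hM : Obj Bd (omPart k) M) {ι : Type} {d : ι → Deg} {v : ι → M.carrier}
    (b : Module.Basis ι ℚ (M.carrier ⧸ rad M)) (hv : ∀ i, v i ∈ M.deg (d i))
    (hb : ∀ i, b i = (rad M).mkQ (v i)) : Submodule.span (Om k) (Set.range v) = ⊤ := by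
  obtain ⟨c, hc, ⟨w₀, hw₀⟩, -⟩ := (hB.cone hM.2.2).exists_weight k
  set N := Submodule.span (Om k) (Set.range v) with hN
  -- Graded Nakayama, by induction on the weight above its lower bound. A homogeneous element is a
  -- combination of the `v i` modulo the radical, and the component of degree `e` of an element of
  -- the radical comes from parts of smaller weight, already in `N`.
  have key : ∀ n : ℕ, ∀ e, weight c e < w₀ + n → M.deg e ≤ N.restrictScalars ℚ := by
    intro n
    induction n with
    | zero =>
      intro e he x hx
      have : M.deg e = ⊥ := by
        by_contra h
        have := hw₀ e.1 e.2.1 ⟨e.2.2, h⟩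
        simp only [weight] at he
        push_cast at he
        linarith
      rw [this, Submodule.mem_bot] at hx
      rw [hx]; exact zero_mem _
    | succ n ih =>
      intro e he x hx
      have h1 : ∃ y, hproj hM.1.1 e y ∈ N.restrictScalars ℚ ∧
          x - y ∈ rad M := by
        have h2 : (rad M).mkQ x ∈ Submodule.span ℚ (Set.range b) := b.span_eq ▸ Submodule.mem_top
        have h3 : Set.range b = (rad M).mkQ '' Set.range v := by
          rw [← Set.range_comp]; exact congrArg Set.range (funext hb)
        rw [h3, Submodule.span_image] at h2
        obtain ⟨y, hy, hyx⟩ := h2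
        refine ⟨y, ?_, ?_⟩
        · clear hyx
          induction hy using Submodule.span_induction with
          | mem y hy =>
            obtain ⟨i, rfl⟩ := hy
            by_cases he : d i = e
            · rw [hproj_same _ (he ▸ hv i)]
              exact Submodule.subset_span ⟨i, rfl⟩
            · rw [hproj_ne _ he (hv i)]
              exact zero_mem _
          | zero => rw [map_zero]; exact zero_mem _
          | add x y _ _ hx hy => rw [map_add]; exact add_mem hx hy
          | smul c x _ hx => rw [map_smul]; exact Submodule.smul_mem _ _ hx
        · rw [← Submodule.ker_mkQ (rad M), LinearMap.mem_ker, map_sub, hyx, sub_self]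
      obtain ⟨y, hy2, hy3⟩ := h1
      have h4 := hproj_rad_mem hM.1 (e := e) (N := N.restrictScalars ℚ) (fun i z hz => by
        refine N.smul_mem _ (ih (e - omDeg k i) ?_ hz)
        have := weight_omDeg_pos hc i
        have h5 := weight_add c (e - omDeg k i) (omDeg k i)
        rw [sub_add_cancel] at h5
        push_cast at he
        linarith) hy3
      rw [map_sub, hproj_same _ hx] at h4
      have := add_mem h4 hy2
      rwa [sub_add_cancel] at this
  rw [eq_top_iff]
  rintro x -
  induction x using homogeneous_induction hM.1.1 with
  | zero => exact zero_mem _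
  | add x y hx hy => exact add_mem hx hy
  | mem e x hx =>
    exact key (weight c e - w₀ + 1).toNat e (by
      have := Int.self_le_toNat (weight c e - w₀ + 1)
      linarith) hx

theorem omReg_hasHomogBasis : HasHomogBasis (omReg k) fun _ : Unit => 0 := by
  refine ⟨Module.Basis.singleton Unit (Om k), fun i => ?_⟩
  have h : Module.Basis.singleton Unit (Om k) i = 1 := Module.Basis.singleton_apply _ _ _
  exact (congrArg (· ∈ omPart k 0) h).mpr (one_mem_part _)

theorem hasHomogBasis_dsum_omReg {ι : Type} (d : ι → Deg) :
    HasHomogBasis (dsum fun i => (omReg k).shift (d i)) d := by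
  have h := (HasHomogBasis.dsum fun i => (omReg_hasHomogBasis (k := k)).shift (d i)).reindex
    (Equiv.sigmaPUnit ι).symm
  have h2 : ((fun x : Σ _ : ι, Unit => 0 + d x.1) ∘ (Equiv.sigmaPUnit ι).symm) = d :=
    funext fun i => zero_add _
  rwa [h2] at h

/-- A projective object has a homogeneous basis. -/
theorem exists_hasHomogBasis (hB : IsBoundedness Bd) (hΩ : Obj Bd (omPart k) (omReg k))
    {P : SMod (Om k)} (hP : IsProj (Obj Bd (omPart k)) P) :
    ∃ (ι : Type) (d : ι → Deg), HasHomogBasis P d := by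
  have hM := hP.1
  obtain ⟨ι, d, v, b, hv, hb⟩ := exists_basis_mod_rad hM.1
  have hspan := span_eq_top_of_basis_mod_rad hB hM b hv hb
  have hli : LinearIndependent ℚ v := by
    refine LinearIndependent.of_comp (rad P).mkQ ?_
    have : (rad P).mkQ ∘ v = b := (funext hb).symm
    rw [this]; exact b.linearIndependent
  -- The free cover on a minimal set of homogeneous generators; the independence of the generators
  -- modulo the radical will force its kernel into the radical of `Z`.
  let Z : SMod (Om k) := dsum fun i => (omReg k).shift (d i)
  have hZ : Obj Bd (omPart k) Z := by
    refine Obj.dsum_shift hB hΩ d (finite_of_linearIndependent hM.2.1 hv hli)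
      (hB.mono hM.2.2 ?_)
    rintro i j ⟨x, p, hx⟩
    refine ⟨p, fun h => ?_⟩
    have := hv x
    rw [hx, h, Submodule.mem_bot] at this
    exact hli.ne_zero x this
  obtain ⟨B, hBZ⟩ := hasHomogBasis_dsum_omReg (k := k) d
  let π : Z.carrier →ₗ[Om k] P.carrier := B.constr ℕ v
  have hπB : ∀ i, π (B i) = v i := fun i => B.constr_basis ℕ v i
  have hπ : IsHom Z P π := isHom_of_generators (part_isInternal _) hZ.1 hM.1 hBZ B.span_eq _
    fun i => (hπB i).symm ▸ hv i
  have hsurj : Function.Surjective π := by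
    rw [← LinearMap.range_eq_top, eq_top_iff, ← hspan, Submodule.span_le]
    rintro _ ⟨i, rfl⟩
    exact ⟨B i, hπB i⟩
  -- Projectivity splits the cover.
  obtain ⟨h, hh, hπh⟩ := hP.2 Z P hZ hM π hπ hsurj LinearMap.id fun _ _ hx => hx
  have hπh' : ∀ x, π (h x) = x := fun x => LinearMap.congr_fun hπh x
  -- the kernel lies in the radical
  have hker : ∀ z, π z = 0 → z ∈ rad Z := by
    have h1 : ∀ z, z - ∑ i ∈ (B.repr z).support, aug k (B.repr z i) • B i ∈ rad Z := by
      intro z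
      have : z = ∑ i ∈ (B.repr z).support, B.repr z i • B i := (B.linearCombination_repr z).symm
      nth_rewrite 1 [this]
      rw [← Finset.sum_sub_distrib]
      exact sum_mem fun i _ => smul_sub_aug_mem_rad _ _
    intro z hz
    have h2 : (rad P).mkQ (π z) = ∑ i ∈ (B.repr z).support, aug k (B.repr z i) • b i := by
      have h3 : π z - ∑ i ∈ (B.repr z).support, aug k (B.repr z i) • v i ∈ rad P := by
        have : π z = ∑ i ∈ (B.repr z).support, B.repr z i • v i := by
          conv_lhs => rw [← B.linearCombination_repr z]
          rw [Finsupp.linearCombination_apply, Finsupp.sum, map_sum]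
          simp only [map_smul, hπB]
        rw [this, ← Finset.sum_sub_distrib]
        exact sum_mem fun i _ => smul_sub_aug_mem_rad _ _
      rw [← Submodule.ker_mkQ (rad P), LinearMap.mem_ker, map_sub, sub_eq_zero] at h3
      rw [h3, map_sum]
      exact Finset.sum_congr rfl fun i _ => by rw [map_smul, hb]
    rw [hz, map_zero] at h2
    have h3 := linearIndependent_iff'.mp b.linearIndependent _ _ h2.symm
    have h4 := h1 z
    rw [Finset.sum_eq_zero fun i hi => by rw [h3 i hi, zero_smul], sub_zero] at h4
    exact h4
  let K : Submodule ℚ Z.carrier := (LinearMap.ker π).restrictScalars ℚ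
  have hKrad : ∀ z ∈ K, z ∈ Submodule.span ℚ
      {x | ∃ (i : Fin k ⊕ Fin k), ∃ y ∈ K, x = (gen i : Om k) • y} := by
    -- The map sending `z` to `z - h (π z)` is an `Ω_k`-linear projection onto the kernel. Applied
    -- to elements of `rad Z` it shows that the kernel is spanned by its own images under the
    -- variables.
    have h1 : ∀ z ∈ rad Z, z - h (π z) ∈ Submodule.span ℚ
        {x | ∃ (i : Fin k ⊕ Fin k), ∃ y ∈ K, x = (gen i : Om k) • y} := by
      intro z hz
      induction hz using Submodule.span_induction with
      | mem z hz =>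
        obtain ⟨i, y, rfl⟩ := hz
        refine Submodule.subset_span ⟨i, y - h (π y), ?_, ?_⟩
        · change π (y - h (π y)) = 0
          rw [map_sub, hπh', sub_self]
        · rw [map_smul, map_smul, smul_sub]
      | zero => simp only [map_zero, sub_zero]; exact zero_mem _
      | add x y _ _ hx hy =>
        rw [map_add, map_add, add_sub_add_comm]; exact add_mem hx hy
      | smul c x _ hx =>
        rw [LinearMap.map_smul_of_tower, LinearMap.map_smul_of_tower, ← smul_sub]
        exact Submodule.smul_mem _ _ hx
    intro z hz
    have h2 := h1 z (hker z hz)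
    rwa [show π z = 0 from hz, map_zero, sub_zero] at h2
  have hKproj : ∀ z ∈ K, ∀ e, hproj hZ.1.1 e z ∈ K := by
    intro z hz e
    change π (hproj hZ.1.1 e z) = 0
    have := hproj_map hZ.1.1 hM.1.1 (f := π.restrictScalars ℚ) hπ e z
    refine Eq.trans this.symm ?_
    change hproj hM.1.1 e (π z) = 0
    rw [show π z = 0 from hz, map_zero]
  obtain ⟨c, hc, ⟨w₀, hw₀⟩, -⟩ := (hB.cone hZ.2.2).exists_weight k
  -- A kernel spanned by its own images under the variables is zero: a component of given weight is
  -- a sum of images of components of smaller weight, and the weights are bounded below.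
  have key : ∀ n : ℕ, ∀ e, weight c e < w₀ + n → ∀ z ∈ K, hproj hZ.1.1 e z = 0 := by
    intro n
    induction n with
    | zero =>
      intro e he z hz
      have : Z.deg e = ⊥ := by
        by_contra h
        have := hw₀ e.1 e.2.1 ⟨e.2.2, h⟩
        simp only [weight] at he
        push_cast at he
        linarith
      have h2 := hproj_mem hZ.1.1 e z
      rwa [this, Submodule.mem_bot] at h2
    | succ n ih =>
      intro e he z hz
      have h1 := hKrad z hz
      clear hz
      induction h1 using Submodule.span_induction with
      | mem z hz =>
        obtain ⟨i, y, hy, rfl⟩ := hz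
        rw [hproj_smul hZ.1 (gen_mem_part (omDeg k) i), ih _ ?_ y hy, smul_zero]
        have := weight_omDeg_pos hc i
        have h5 := weight_add c (e - omDeg k i) (omDeg k i)
        rw [sub_add_cancel] at h5
        push_cast at he
        linarith
      | zero => rw [map_zero]
      | add x y _ _ hx hy => rw [map_add, hx, hy, add_zero]
      | smul a x _ hx => rw [map_smul, hx, smul_zero]
  have hinj : Function.Injective π := by
    rw [injective_iff_map_eq_zero]
    intro z hz
    refine eq_of_hproj hZ.1.1 fun e => ?_
    rw [map_zero]
    exact key (weight c e - w₀ + 1).toNat e (by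
      have := Int.self_le_toNat (weight c e - w₀ + 1)
      linarith) z hz
  refine ⟨ι, d, B.map (LinearEquiv.ofBijective π ⟨hinj, hsurj⟩), fun i => ?_⟩
  rw [Module.Basis.map_apply]
  exact (hπB i).symm ▸ hv i

/-- A family of degrees with finite fibres, indexed by the summands of a locally finite sum. -/
theorem exists_locIdx_equiv {ι : Type} {d : ι → Deg} (hfin : ∀ e, {i | d i = e}.Finite) :
    ∃ e1 : (Σ _ : Fin 1, Σ e : Deg, Fin (Nat.card {i // d i = e})) ≃ ι,
      d ∘ e1 = fun x => x.2.1 := by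
  have hfin' : ∀ e, Finite {i // d i = e} := hfin
  refine ⟨(Equiv.uniqueSigma _).trans ((Equiv.sigmaCongrRight fun e =>
    (Finite.equivFin {i // d i = e}).symm).trans (Equiv.sigmaFiberEquiv d)), funext fun x => ?_⟩
  obtain ⟨j, e, y⟩ := x
  obtain rfl := Subsingleton.elim j default
  exact ((Finite.equivFin {i // d i = e}).symm y).2

theorem HasHomogBasis.iso_locSum {M : SMod (Om k)} (hM : M.IsGraded (omPart k)) (hf : M.LocFin)
    {ι : Type} {d : ι → Deg} (h : HasHomogBasis M d) :
    M.Iso (locSum (fun _ : Fin 1 => omReg k) fun _ e => Nat.card {i // d i = e}) := by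
  obtain ⟨e1, h1⟩ := exists_locIdx_equiv (h.finite hf)
  have h2 := h.reindex e1
  rw [h1] at h2
  exact h2.iso (part_isInternal _) hM (dsum_isGraded fun x => IsGraded.shift omReg_isGraded _)
    (hasHomogBasis_dsum_omReg _)

theorem HasHomogBasis.bd (hB : IsBoundedness Bd) {M : SMod (Om k)} (hM : Obj Bd (omPart k) M)
    {ι : Type} {d : ι → Deg} (h : HasHomogBasis M d) :
    Bd fun i j => ∃ (x : ι) (p : ZMod 2), d x = (i, j, p) := by
  refine hB.mono hM.2.2 ?_
  rintro i j ⟨x, p, hx⟩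
  exact ⟨p, hx ▸ h.deg_ne_bot x⟩

/-- An indecomposable object with a homogeneous basis is a shift of `Ω_k`. -/
theorem HasHomogBasis.iso_omReg_shift (hB : IsBoundedness Bd) (hΩ : Obj Bd (omPart k) (omReg k))
    {P : SMod (Om k)} (hP : Obj Bd (omPart k) P) {ι : Type} {d : ι → Deg}
    (h : HasHomogBasis P d) (hind : IsIndec (Obj Bd (omPart k)) P) :
    ∃ e, P.Iso ((omReg k).shift e) := by
  classical
  obtain ⟨hnt, hdec⟩ := hind
  have hne : Nonempty ι := by
    by_contra h0
    rw [not_nonempty_iff] at h0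
    obtain ⟨b, -⟩ := h
    have : Subsingleton P.carrier := b.repr.toEquiv.subsingleton
    exact not_subsingleton _ this
  obtain ⟨i₀⟩ := hne
  -- One basis vector is split off. Indecomposability makes one of the two summands zero; it must be
  -- the one on the remaining vectors, so there are none.
  let J : Fin 2 → Type := ![Unit, {i // i ≠ i₀}]
  let dJ : ∀ x : Fin 2, J x → Deg
    | 0 => fun _ => d i₀
    | 1 => fun i => d i.1
  let X : Fin 2 → SMod (Om k) := fun x => SMod.dsum fun i : J x => SMod.shift (dJ x i) (omReg k)
  have hinj : ∀ x, ∃ f : J x → ι, Function.Injective f ∧ dJ x = d ∘ f := by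
    intro x
    match x with
    | 0 => exact ⟨fun _ => i₀, fun _ _ _ => rfl, rfl⟩
    | 1 => exact ⟨Subtype.val, Subtype.val_injective, rfl⟩
  have hX : ∀ x, Obj Bd (omPart k) (X x) := by
    intro x
    obtain ⟨f, hf, hdf⟩ := hinj x
    refine Obj.dsum_shift hB hΩ _ (fun e => ?_) (hB.mono (h.bd hB hP) ?_)
    · rw [hdf]
      exact (h.finite hP.2.1 e).preimage hf.injOn
    · rintro i j ⟨y, p, hy⟩
      rw [hdf] at hy
      exact ⟨f y, p, hy⟩
  let e1 : (Σ x, J x) ≃ ι :=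
    { toFun := fun y => match y with
        | ⟨0, _⟩ => i₀
        | ⟨1, i⟩ => i.1
      invFun := fun i => if hi : i = i₀ then ⟨0, ()⟩ else ⟨1, ⟨i, hi⟩⟩
      left_inv := by
        rintro ⟨x, y⟩
        match x, y with
        | 0, () => simp
        | 1, ⟨i, hi⟩ => simp [hi]
      right_inv := fun i => by
        by_cases hi : i = i₀
        · simp [hi]
        · simp [hi] }
  have he1 : d ∘ e1 = fun y => dJ y.1 y.2 := by
    funext y
    match y with
    | ⟨0, _⟩ => rfl
    | ⟨1, _⟩ => rfl
  have hiso : P.Iso (SMod.dsum X) := by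
    have h2 := h.reindex e1
    rw [he1] at h2
    exact h2.iso (part_isInternal _) hP.1 (dsum_isGraded fun x => (hX x).1)
      (HasHomogBasis.dsum fun x => hasHomogBasis_dsum_omReg _)
  obtain ⟨x, hx⟩ := hdec X hX hiso
  have hempty : ∀ y : J x, False := by
    intro y
    obtain ⟨b, -⟩ := hasHomogBasis_dsum_omReg (k := k) (dJ x)
    exact b.ne_zero y (hx.elim _ _)
  refine ⟨d i₀, ?_⟩
  match x, hempty with
  | 0, h0 => exact (h0 ()).elim
  | 1, h0 =>
    have hu : ∀ i, i = i₀ := fun i => by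
      by_contra hi
      exact h0 ⟨i, hi⟩
    let e2 : Unit ≃ ι := ⟨fun _ => i₀, fun _ => (), fun _ => rfl, fun i => (hu i).symm⟩
    have h3 := (omReg_hasHomogBasis (k := k)).shift (d i₀)
    have h4 : (fun i : Unit => 0 + d i₀) = d ∘ e2 := funext fun i => zero_add _
    rw [h4] at h3
    exact (h.reindex e2).iso (part_isInternal _) hP.1 (IsGraded.shift omReg_isGraded _) h3

end Proj

end VermaCat
end

noncomputable section

namespace VermaCat

open SPoly SerRing

/-! ### Free extensions of superrings -/

section Regular

variable {A B : Type} [Ring A] [Algebra ℚ A] [Ring B] [Algebra ℚ B]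

/-- A graded superring as a supermodule over itself. -/
def regular (ℬ : Deg → Submodule ℚ B) : SMod B where
  carrier := B
  deg := ℬ

/-- A basis over an extension gives a basis over the smaller superring. -/
theorem HasHomogBasis.res {ℬ : Deg → Submodule ℚ B} {φ : A →ₐ[ℚ] B} {N : SMod B}
    (hN : N.IsGraded ℬ) {ι κ : Type} {d : ι → Deg} {c : κ → Deg} (h : HasHomogBasis N d)
    (hφ : HasHomogBasis ((regular ℬ).res φ) c) :
    HasHomogBasis (N.res φ) fun x : κ × ι => c x.1 + d x.2 := by
  obtain ⟨b, hb⟩ := h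
  obtain ⟨g, hg⟩ := hφ
  let i1 : Module A B := Module.compHom B φ.toRingHom
  let i2 : Module A N.carrier := Module.compHom N.carrier φ.toRingHom
  have i3 : IsScalarTower A B N.carrier := ⟨fun a y z => mul_smul (φ a) y z⟩
  let g' : Module.Basis κ A B := g
  let b' : Module.Basis (κ × ι) A N.carrier := g'.smulTower b
  have hb' : ∀ x, b' x = g' x.1 • b x.2 := fun x => Module.Basis.smulTower_apply _ _ _
  refine ⟨b', fun x => ?_⟩
  have h1 := hN.2 _ _ _ (hg x.1) _ (hb x.2)
  exact (congrArg (· ∈ N.deg (c x.1 + d x.2)) (hb' x)).mpr h1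

end Regular

namespace SPoly

variable {α α' β : Type}

/-- A basis for the even parts gives a basis of the superrings. -/
theorem hasHomogBasis_res_map {J : Type} (g : MvPolynomial α ℚ →ₐ[ℚ] MvPolynomial α' ℚ)
    (e : J → MvPolynomial α' ℚ) (E : (J →₀ MvPolynomial α ℚ) ≃ₗ[ℚ] MvPolynomial α' ℚ)
    (hE : ∀ j p, E (Finsupp.single j p) = g p * e j) {dg : α' ⊕ β → Deg} {d : J → Deg}
    (hd : ∀ j, (ofEven (e j) : SPoly α' β) ∈ part dg (d j)) :
    HasHomogBasis ((regular (part dg)).res (map g odd odd_sq : SPoly α β →ₐ[ℚ] SPoly α' β)) d := by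
  classical
  let Λ := ExteriorAlgebra ℚ (β →₀ ℚ)
  -- The exterior algebra is a common tensor factor on which the map is the identity, so the
  -- decomposition `E` of the even parts is tensored with it.
  let F : (J →₀ SPoly α β) ≃ₗ[ℚ] SPoly α' β :=
    (TensorProduct.finsuppLeft ℚ ℚ (MvPolynomial α ℚ) Λ J).symm ≪≫ₗ
      TensorProduct.congr E (LinearEquiv.refl ℚ Λ)
  have hF : ∀ j z, F (Finsupp.single j z) = map g odd odd_sq z * ofEven (e j) := by
    intro j z
    induction z using induction_tmul with
    | zero => simp
    | add y z hy hz => rw [Finsupp.single_add, map_add, hy, hz, map_add, add_mul]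
    | mul a l =>
      have h1 : (map g odd odd_sq (ofEven a * ofOdd l) : SPoly α' β) = ofEven (g a) * ofOdd l := by
        rw [map_mul, map_ofEven]
        congr 1
        have h2 : ((map g odd odd_sq : SPoly α β →ₐ[ℚ] SPoly α' β).comp ofOdd) = ofOdd := by
          refine ExteriorAlgebra.hom_ext (LinearMap.ext fun v => ?_)
          exact map_odd g odd odd_sq v
        exact AlgHom.congr_fun h2 l
      rw [h1, mul_assoc, ← (ofEven_commute (e j) (ofOdd l)).eq, ← mul_assoc, ← map_mul]
      refine Eq.trans ?_ (ofEven_mul_ofOdd (g a * e j) l).symm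
      refine (congrArg (TensorProduct.congr E (LinearEquiv.refl ℚ Λ))
        ((congrArg (TensorProduct.finsuppLeft ℚ ℚ (MvPolynomial α ℚ) Λ J).symm
          (congrArg (Finsupp.single j) (ofEven_mul_ofOdd a l))).trans
          (TensorProduct.finsuppLeft_symm_apply_single j a l))).trans ?_
      refine (TensorProduct.congr_tmul _ _ _ _).trans ?_
      rw [hE]
      rfl
  let F' : ((regular (part dg)).res (map g odd odd_sq : SPoly α β →ₐ[ℚ] SPoly α' β)).carrier
      ≃ₗ[SPoly α β] (J →₀ SPoly α β) :=
    LinearEquiv.symm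
      { F with
        map_smul' := by
          intro a f
          change F (a • f) = map g odd odd_sq a * F f
          induction f using Finsupp.induction_linear with
          | zero => rw [smul_zero, map_zero, mul_zero]
          | add f f' hf hf' => rw [smul_add, map_add, hf, hf', map_add, mul_add]
          | single j z => rw [Finsupp.smul_single, hF, hF, smul_eq_mul, map_mul, mul_assoc] }
  refine ⟨Module.Basis.ofRepr F', fun j => ?_⟩
  have h1 : Module.Basis.ofRepr F' j = F (Finsupp.single j 1) := rfl
  have h2 : Module.Basis.ofRepr F' j = (ofEven (e j) : SPoly α' β) := by
    rw [h1, hF, map_one, one_mul]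
  exact (congrArg (· ∈ part dg (d j)) h2).mpr (hd j)

/-- The parity automorphism. -/
def parityAut : SPoly α β →ₐ[ℚ] SPoly α β :=
  map (AlgHom.id ℚ _) (-odd) fun v => by
    rw [LinearMap.neg_apply, neg_mul_neg, odd_sq]

theorem parityAut_x (a : α) : parityAut (x a : SPoly α β) = x a := map_x _ _ _ _

theorem parityAut_s (b : β) : parityAut (s b : SPoly α β) = -s b := map_odd _ _ _ _

theorem parityAut_parityAut (z : SPoly α β) : parityAut (parityAut z) = z := by
  have h : (parityAut.comp parityAut : SPoly α β →ₐ[ℚ] SPoly α β) = AlgHom.id ℚ _ := by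
    refine algHom_ext fun i => ?_
    rcases i with a | b
    · rw [gen_inl, AlgHom.comp_apply, parityAut_x, parityAut_x]; rfl
    · rw [gen_inr, AlgHom.comp_apply, parityAut_s, map_neg, parityAut_s, neg_neg]; rfl
  exact AlgHom.congr_fun h z

/-- An odd variable commutes with everything up to sign. -/
theorem s_mul (b : β) (z : SPoly α β) : s b * z = parityAut z * s b := by
  induction z using induction_left with
  | one => rw [map_one, one_mul, mul_one]
  | gen_mul i z hz =>
    rw [map_mul, mul_assoc, ← hz, ← mul_assoc, ← mul_assoc]
    congr 1
    rcases i with a | c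
    · rw [gen_inl, parityAut_x, (x_commute a (s b)).eq]
    · rw [gen_inr, parityAut_s, neg_mul, eq_neg_iff_add_eq_zero, s_anticomm]
  | add y z hy hz => rw [mul_add, hy, hz, map_add, add_mul]
  | smul c z hz => rw [mul_smul_comm, hz, map_smul, smul_mul_assoc]

/-- The inclusion of the superring without the last odd variable. -/
def castSuccHom (n : ℕ) : SPoly α (Fin n) →ₐ[ℚ] SPoly α (Fin (n + 1)) :=
  map (AlgHom.id ℚ _) (odd ∘ₗ Finsupp.lmapDomain ℚ ℚ Fin.castSucc) fun _ => odd_sq _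

theorem castSuccHom_x (n : ℕ) (a : α) :
    castSuccHom n (x a : SPoly α (Fin n)) = x a := map_x _ _ _ _

theorem castSuccHom_s (n : ℕ) (i : Fin n) :
    castSuccHom n (s i : SPoly α (Fin n)) = s i.castSucc := by
  rw [castSuccHom, s, map_odd]
  simp [s, Finsupp.mapDomain_single]

section LastVariable

variable (α) (n : ℕ)

/-- The operators by which the odd variables act on `A × A`, seen as `A ⊗ ⋀(s_last)`. -/
def lastOdd (i : Fin (n + 1)) : Module.End ℚ (SPoly α (Fin n) × SPoly α (Fin n)) :=
  -- The pair `(u, v)` stands for `u + s_last * v`. Left multiplication by another odd variable has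
  -- to pass `s_last` to reach `v`, which costs a sign in the second entry.
  Fin.lastCases (LinearMap.inr ℚ _ _ ∘ₗ LinearMap.fst ℚ _ _)
    (fun i => Algebra.lmul ℚ (SPoly α (Fin n) × SPoly α (Fin n)) (s i, -s i)) i

theorem lastOdd_castSucc (i : Fin n) (y : SPoly α (Fin n) × SPoly α (Fin n)) :
    lastOdd α n i.castSucc y = (s i * y.1, -(s i * y.2)) := by
  rw [lastOdd, Fin.lastCases_castSucc]
  exact Prod.ext rfl (neg_mul _ _)

theorem lastOdd_last (y : SPoly α (Fin n) × SPoly α (Fin n)) :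
    lastOdd α n (Fin.last n) y = (0, y.1) := by
  rw [lastOdd, Fin.lastCases_last]
  rfl

theorem lastOdd_anticomm (i j : Fin (n + 1)) :
    lastOdd α n i * lastOdd α n j + lastOdd α n j * lastOdd α n i = 0 := by
  refine LinearMap.ext fun y => ?_
  rw [LinearMap.add_apply, Module.End.mul_apply, Module.End.mul_apply]
  have hs : ∀ (i j : Fin n) (u : SPoly α (Fin n)), s i * (s j * u) + s j * (s i * u) = 0 := by
    intro i j u
    rw [← mul_assoc, ← mul_assoc, ← add_mul, s_anticomm, zero_mul]
  induction i using Fin.lastCases with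
  | last =>
    induction j using Fin.lastCases with
    | last => simp [lastOdd_last]
    | cast j => simp [lastOdd_last, lastOdd_castSucc]
  | cast i =>
    induction j using Fin.lastCases with
    | last => simp [lastOdd_last, lastOdd_castSucc]
    | cast j => simp [lastOdd_castSucc, hs]

/-- The action of `A ⊗ ⋀(s_last)` on `A × A`. -/
def lastRep : SPoly α (Fin (n + 1)) →ₐ[ℚ]
    Module.End ℚ (SPoly α (Fin n) × SPoly α (Fin n)) :=
  lift ((Algebra.lmul ℚ (SPoly α (Fin n) × SPoly α (Fin n))).comp (ofEven.prod ofEven))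
    (Finsupp.linearCombination ℚ (lastOdd α n))
    (linearCombination_sq_eq_zero _ (lastOdd_anticomm α n)) (by
      intro p v
      induction v using Finsupp.induction_linear with
      | zero => rw [map_zero]; exact Commute.zero_right _
      | add v w hv hw => rw [map_add]; exact hv.add_right hw
      | single i c =>
        rw [Finsupp.linearCombination_single]
        refine Commute.smul_right ?_ c
        refine LinearMap.ext fun y => ?_
        rw [Module.End.mul_apply, Module.End.mul_apply]
        change (ofEven p, ofEven p) * lastOdd α n i y = lastOdd α n i ((ofEven p, ofEven p) * y)
        induction i using Fin.lastCases with
        | last => rw [lastOdd_last, lastOdd_last]; exact Prod.ext (mul_zero _) rfl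
        | cast i =>
          rw [lastOdd_castSucc, lastOdd_castSucc]
          refine Prod.ext ?_ ?_
          · exact (ofEven_commute p (s i)).left_comm y.1
          · exact (mul_neg _ _).trans (congrArg _ ((ofEven_commute p (s i)).left_comm y.2)))

theorem lastRep_castSuccHom (a : SPoly α (Fin n)) (y : SPoly α (Fin n) × SPoly α (Fin n)) :
    lastRep α n (castSuccHom n a) y = (a * y.1, parityAut a * y.2) := by
  have h : (lastRep α n).comp (castSuccHom n) =
      (Algebra.lmul ℚ (SPoly α (Fin n) × SPoly α (Fin n))).comp
        ((AlgHom.id ℚ _).prod parityAut) := by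
    refine algHom_ext fun i => LinearMap.ext fun y => ?_
    rcases i with a | b
    · rw [gen_inl, AlgHom.comp_apply, castSuccHom_x, x, lastRep, lift_ofEven]
      change _ = (x a, parityAut (x a)) * y
      rw [parityAut_x]
      rfl
    · rw [gen_inr, AlgHom.comp_apply, castSuccHom_s, s, lastRep, lift_odd,
        Finsupp.linearCombination_single, one_smul, lastOdd_castSucc]
      change _ = (s b, parityAut (s b)) * y
      rw [parityAut_s]
      exact Prod.ext rfl (neg_mul _ _).symm
  exact congrFun (congrArg DFunLike.coe (AlgHom.congr_fun h a)) y

theorem lastRep_last (y : SPoly α (Fin n) × SPoly α (Fin n)) :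
    lastRep α n (s (Fin.last n)) y = (0, y.1) := by
  rw [s, lastRep, lift_odd, Finsupp.linearCombination_single, one_smul, lastOdd_last]

/-- The superring is free on `1, s_last` over the superring without the last odd variable. -/
theorem hasHomogBasis_castSuccHom {dg : α ⊕ Fin (n + 1) → Deg} :
    HasHomogBasis ((regular (part dg)).res (castSuccHom n))
      ![0, dg (Sum.inr (Fin.last n))] := by
  let N := (regular (part dg)).res (castSuccHom (α := α) n)
  let one : N.carrier := (1 : SPoly α (Fin (n + 1)))
  let sl : N.carrier := (s (Fin.last n) : SPoly α (Fin (n + 1)))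
  let v : Fin 2 → N.carrier := ![one, sl]
  have hli : LinearIndependent (SPoly α (Fin n)) v := by
    rw [Fintype.linearIndependent_iff]
    intro g hg
    rw [Fin.sum_univ_two] at hg
    have h1 : castSuccHom n (g 0) * 1 + castSuccHom n (g 1) * s (Fin.last n) = 0 := hg
    -- Acting on `(1, 0)`, which represents the unit, separates the two coefficients: the relation
    -- becomes `(g 0, parityAut (g 1)) = 0`.
    have h2 := congrArg (fun z => lastRep α n z (1, 0)) h1
    simp only [mul_one, map_add, map_mul, LinearMap.add_apply, Module.End.mul_apply,
      lastRep_last, lastRep_castSuccHom, map_zero, LinearMap.zero_apply, mul_zero,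
      Prod.mk_add_mk, add_zero, zero_add, Prod.mk_eq_zero] at h2
    intro i
    match i with
    | 0 => exact h2.1
    | 1 => rw [← parityAut_parityAut (g 1), h2.2, map_zero]
  have hsp : ⊤ ≤ Submodule.span (SPoly α (Fin n)) (Set.range v) := by
    have hr : Set.range v = {one, sl} := by simp [v, Set.pair_comm]
    rw [hr]
    rintro z -
    have key : ∀ z : SPoly α (Fin (n + 1)), ∃ a b : SPoly α (Fin n),
        castSuccHom n a * 1 + castSuccHom n b * s (Fin.last n) = z := by
      intro z
      have hcs : ∀ (y : SPoly α (Fin n)) (z : SPoly α (Fin (n + 1))),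
          (∃ a b : SPoly α (Fin n), castSuccHom n a * 1 + castSuccHom n b * s (Fin.last n) = z) →
          ∃ a b : SPoly α (Fin n), castSuccHom n a * 1 + castSuccHom n b * s (Fin.last n)
            = castSuccHom n y * z := by
        rintro y z ⟨a, b, rfl⟩
        exact ⟨y * a, y * b, by simp only [map_mul, mul_add, mul_assoc]⟩
      have hpar : ∀ a : SPoly α (Fin n),
          parityAut (castSuccHom n a) = castSuccHom n (parityAut a) := by
        intro a
        have h : (parityAut.comp (castSuccHom (α := α) n)) = (castSuccHom n).comp parityAut := by
          refine algHom_ext fun i => ?_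
          rcases i with a | b
          · rw [gen_inl, AlgHom.comp_apply, AlgHom.comp_apply, parityAut_x, castSuccHom_x,
              parityAut_x]
          · rw [gen_inr, AlgHom.comp_apply, AlgHom.comp_apply, parityAut_s, map_neg,
              castSuccHom_s, parityAut_s]
        exact AlgHom.congr_fun h a
      induction z using induction_left with
      | one => exact ⟨1, 0, by simp⟩
      | gen_mul i z hz =>
        rcases i with a | b
        · have := hcs (x a) z hz
          rwa [castSuccHom_x] at this
        · induction b using Fin.lastCases with
          | cast b =>
            have := hcs (s b) z hz
            rwa [castSuccHom_s] at this
          | last =>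
            obtain ⟨a, b, rfl⟩ := hz
            -- Moving `s_last` to the right turns `a` into `parityAut a`, and the summand with `b`
            -- dies because `s_last` has square zero.
            refine ⟨0, parityAut a, ?_⟩
            have hss : (s (Fin.last n) : SPoly α (Fin (n + 1))) * s (Fin.last n) = 0 := odd_sq _
            rw [map_zero, zero_mul, zero_add, gen_inr, mul_one, mul_add, s_mul, hpar, ← mul_assoc,
              s_mul, mul_assoc, hss, mul_zero, add_zero]
      | add y z hy hz =>
        obtain ⟨a, b, rfl⟩ := hy
        obtain ⟨a', b', rfl⟩ := hz
        exact ⟨a + a', b + b', by simp only [map_add, add_mul]; abel⟩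
      | smul c z hz =>
        obtain ⟨a, b, rfl⟩ := hz
        exact ⟨c • a, c • b, by simp only [map_smul, smul_mul_assoc, smul_add]⟩
    rw [Submodule.mem_span_pair]
    exact key z
  refine ⟨Module.Basis.mk hli hsp, fun i => ?_⟩
  have h1 : Module.Basis.mk hli hsp i = v i := Module.Basis.mk_apply hli hsp i
  refine (congrArg (· ∈ part dg _) h1).mpr ?_
  match i with
  | 0 => exact one_mem_part dg
  | 1 => exact gen_mem_part dg (Sum.inr (Fin.last n))

end LastVariable

end SPoly

end VermaCat
end

noncomputable section

namespace VermaCat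

open SPoly SerRing

/-! ### Freeness of `Ω_{k,k+1}` -/

theorem IsGraded.res {A B : Type} [Ring A] [Algebra ℚ A] [Ring B] [Algebra ℚ B]
    {𝒜 : Deg → Submodule ℚ A} {ℬ : Deg → Submodule ℚ B} {φ : A →ₐ[ℚ] B}
    (hφ : ∀ d, ∀ a ∈ 𝒜 d, φ a ∈ ℬ d) {N : SMod B} (hN : N.IsGraded ℬ) :
    (N.res φ).IsGraded 𝒜 :=
  ⟨hN.1, fun d e a ha m hm => hN.2 d e (φ a) (hφ d a ha) m hm⟩

theorem regular_isGraded {α β : Type} (dg : α ⊕ β → Deg) :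
    (regular (part dg)).IsGraded (part dg) :=
  ⟨part_isInternal _, fun _ _ _ ha _ hm => mul_mem_part ha hm⟩

theorem SPoly.pow_mem_part {α β : Type} {dg : α ⊕ β → Deg} {d : Deg} {z : SPoly α β}
    (hz : z ∈ part dg d) (n : ℕ) : z ^ n ∈ part dg (n • d) := by
  induction n with
  | zero => rw [pow_zero, zero_smul]; exact one_mem_part dg
  | succ n ih => rw [pow_succ, succ_nsmul]; exact mul_mem_part ih hz

/-! ### Freeness along φ*: straightening by an automorphism -/

section Theta

variable (k : ℕ)

/-- The span of the odd variables over the polynomials. -/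
def oddSpan : Submodule ℚ (OmFlag k) :=
  Submodule.span ℚ {z | ∃ (p : MvPolynomial (Option (Fin k)) ℚ) (i : Fin (k + 1)),
    z = ofEven p * s i}

variable {k}

theorem s_mem_oddSpan (i : Fin (k + 1)) : (s i : OmFlag k) ∈ oddSpan k :=
  Submodule.subset_span ⟨1, i, by rw [map_one, one_mul]⟩

theorem ofEven_mul_mem_oddSpan (p : MvPolynomial (Option (Fin k)) ℚ) {z : OmFlag k}
    (hz : z ∈ oddSpan k) : ofEven p * z ∈ oddSpan k := by
  induction hz using Submodule.span_induction with
  | mem z hz =>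
    obtain ⟨p', i, rfl⟩ := hz
    exact Submodule.subset_span ⟨p * p', i, by rw [map_mul, mul_assoc]⟩
  | zero => rw [mul_zero]; exact zero_mem _
  | add x y _ _ hx hy => rw [mul_add]; exact add_mem hx hy
  | smul c x _ hx => rw [mul_smul_comm]; exact Submodule.smul_mem _ _ hx

/-- Even polynomials are central, so the claim reduces to the odd variables. It allows the odd
variables to be sent to arbitrary elements of `oddSpan k`. -/
theorem oddSpan_anticomm {y z : OmFlag k} (hy : y ∈ oddSpan k) (hz : z ∈ oddSpan k) :
    y * z + z * y = 0 := by
  induction hy, hz using Submodule.span_induction₂ with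
  | mem_mem y z hy hz =>
    obtain ⟨p, i, rfl⟩ := hy
    obtain ⟨p', j, rfl⟩ := hz
    have h1 := (ofEven_commute p' (s i : OmFlag k)).eq
    have h2 := (ofEven_commute p (s j : OmFlag k)).eq
    have h3 := (ofEven_commute p (ofEven p' : OmFlag k)).eq
    calc ofEven p * s i * (ofEven p' * s j) + ofEven p' * s j * (ofEven p * s i)
        = ofEven p * (s i * ofEven p') * s j + ofEven p' * (s j * ofEven p) * s i := by
          noncomm_ring
      _ = ofEven p * ofEven p' * (s i * s j) + ofEven p' * ofEven p * (s j * s i) := by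
          rw [← h1, ← h2]; noncomm_ring
      _ = 0 := by rw [← h3, ← mul_add, s_anticomm, mul_zero]
  | zero_left y _ => rw [zero_mul, mul_zero, add_zero]
  | zero_right x _ => rw [zero_mul, mul_zero, add_zero]
  | add_left x y z _ _ _ hx hy =>
    rw [add_mul, mul_add, add_add_add_comm, hx, hy, add_zero]
  | add_right x y z _ _ _ hx hy =>
    rw [add_mul, mul_add, add_add_add_comm, hx, hy, add_zero]
  | smul_left c x y _ _ h => rw [smul_mul_assoc, mul_smul_comm, ← smul_add, h, smul_zero]
  | smul_right c x y _ _ h => rw [smul_mul_assoc, mul_smul_comm, ← smul_add, h, smul_zero]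

/-- The algebra endomorphism that fixes the even variables and sends `s i` to `t i`. -/
def oddSubst (t : Fin (k + 1) → OmFlag k) (ht : ∀ i, t i ∈ oddSpan k) : OmFlag k →ₐ[ℚ] OmFlag k :=
  SPoly.map (AlgHom.id ℚ _) (Finsupp.linearCombination ℚ t)
    (linearCombination_sq_eq_zero t fun i j => oddSpan_anticomm (ht i) (ht j))

theorem oddSubst_ofEven (t : Fin (k + 1) → OmFlag k) (ht : ∀ i, t i ∈ oddSpan k)
    (p : MvPolynomial (Option (Fin k)) ℚ) : oddSubst t ht (ofEven p) = ofEven p :=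
  map_ofEven _ _ _ p

theorem oddSubst_s (t : Fin (k + 1) → OmFlag k) (ht : ∀ i, t i ∈ oddSpan k) (i : Fin (k + 1)) :
    oddSubst t ht (s i) = t i := by
  rw [oddSubst, s, map_odd, Finsupp.linearCombination_single, one_smul]

/-- `σ_i + ξ σ_{i+1}`, where `σ_{k+2} = 0`. -/
def phiGen (i : Fin (k + 1)) : OmFlag k :=
  Fin.lastCases (s (Fin.last k)) (fun i => s i.castSucc + xi k * s i.succ) i

theorem phiGen_castSucc (i : Fin k) : phiGen i.castSucc = s i.castSucc + xi k * s i.succ :=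
  Fin.lastCases_castSucc ..

theorem phiGen_last : phiGen (Fin.last k) = s (Fin.last k) := Fin.lastCases_last ..

theorem phiGen_mem (i : Fin (k + 1)) : phiGen i ∈ oddSpan k := by
  induction i using Fin.lastCases with
  | last => rw [phiGen_last]; exact s_mem_oddSpan _
  | cast i =>
    rw [phiGen_castSucc]
    exact add_mem (s_mem_oddSpan _) (ofEven_mul_mem_oddSpan _ (s_mem_oddSpan _))

/-- `∑_j (-ξ)^j σ_{i+j}`. -/
def phiInvGen (i : Fin (k + 1)) : OmFlag k :=
  Fin.reverseInduction (motive := fun _ => OmFlag k) (s (Fin.last k))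
    (fun i t => s i.castSucc - xi k * t) i

theorem phiInvGen_castSucc (i : Fin k) :
    phiInvGen i.castSucc = s i.castSucc - xi k * phiInvGen i.succ :=
  Fin.reverseInduction_castSucc i

theorem phiInvGen_last : phiInvGen (Fin.last k) = s (Fin.last k) := Fin.reverseInduction_last

theorem phiInvGen_mem (i : Fin (k + 1)) : phiInvGen i ∈ oddSpan k := by
  induction i using Fin.reverseInduction with
  | last => rw [phiInvGen_last]; exact s_mem_oddSpan _
  | cast i ih =>
    rw [phiInvGen_castSucc]
    exact sub_mem (s_mem_oddSpan _) (ofEven_mul_mem_oddSpan _ ih)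

variable (k)

/-- The automorphism `σ_i ↦ σ_i + ξ σ_{i+1}` of `Ω_{k,k+1}`. -/
def theta : OmFlag k ≃ₐ[ℚ] OmFlag k :=
  -- The substitution is triangular in the odd variables and fixes the last one, so it is inverted
  -- by downward recursion on the index.
  AlgEquiv.ofAlgHom (oddSubst phiGen phiGen_mem) (oddSubst phiInvGen phiInvGen_mem)
    (algHom_ext fun i => by
      rcases i with a | i
      · rw [gen_inl, x, AlgHom.comp_apply, oddSubst_ofEven, oddSubst_ofEven]; rfl
      · rw [gen_inr, AlgHom.comp_apply, oddSubst_s]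
        change _ = s i
        induction i using Fin.reverseInduction with
        | last => rw [phiInvGen_last, oddSubst_s, phiGen_last]
        | cast i ih =>
          rw [phiInvGen_castSucc, map_sub, map_mul, ih, oddSubst_s, phiGen_castSucc, xi, x,
            oddSubst_ofEven, add_sub_cancel_right])
    (algHom_ext fun i => by
      rcases i with a | i
      · rw [gen_inl, x, AlgHom.comp_apply, oddSubst_ofEven, oddSubst_ofEven]; rfl
      · rw [gen_inr, AlgHom.comp_apply, oddSubst_s]
        change _ = s i
        induction i using Fin.lastCases with
        | last => rw [phiGen_last, oddSubst_s, phiInvGen_last]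
        | cast i =>
          rw [phiGen_castSucc, map_add, map_mul, oddSubst_s, oddSubst_s, xi, x, oddSubst_ofEven,
            phiInvGen_castSucc, xi, x, sub_add_cancel])

theorem theta_ofEven (p : MvPolynomial (Option (Fin k)) ℚ) : theta k (ofEven p) = ofEven p :=
  oddSubst_ofEven _ phiGen_mem p

theorem theta_s (i : Fin (k + 1)) : theta k (s i) = phiGen i := oddSubst_s _ phiGen_mem i

theorem theta_mem_flagPart {d : Deg} {z : OmFlag k} (hz : z ∈ flagPart k d) :
    theta k z ∈ flagPart k d := by
  refine map_mem_part (f := (theta k).toAlgHom) (fun i => ?_) hz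
  rcases i with a | i
  · have := gen_mem_part (flagDeg k) (Sum.inl a)
    rw [gen_inl] at this ⊢
    exact (congrArg (· ∈ _) (theta_ofEven k (MvPolynomial.X a))).mpr this
  · rw [gen_inr]
    refine (congrArg (· ∈ _) (theta_s k i)).mpr ?_
    induction i using Fin.lastCases with
    | last =>
      rw [phiGen_last]
      exact gen_mem_part (flagDeg k) (Sum.inr (Fin.last k))
    | cast i =>
      rw [phiGen_castSucc]
      refine add_mem (gen_mem_part (flagDeg k) (Sum.inr i.castSucc)) ?_
      have h1 := mul_mem_part (xi_mem_flagPart k) (s_mem_flagPart k i.succ _ rfl)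
      have h2 : ((2, 0, 0) + (-2 * (((i.succ : Fin (k + 1)) : ℕ) + 1 : ℤ), 2, 1) : Deg)
          = (-2 * (((i.castSucc : Fin (k + 1)) : ℕ) + 1 : ℤ), 2, 1) := by
        refine Prod.ext ?_ rfl
        change (2 : ℤ) + -2 * (((i.succ : Fin (k + 1)) : ℕ) + 1 : ℤ)
          = -2 * (((i.castSucc : Fin (k + 1)) : ℕ) + 1 : ℤ)
        rw [Fin.val_succ, Fin.val_castSucc]
        push_cast
        ring
      exact (congrArg (fun d => xi k * s i.succ ∈ flagPart k d) h2).mp h1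

/-- The degrees of the superring `ℚ[w_1, …, w_k, ξ, s_1, …, s_k]`. -/
def midDeg : Option (Fin k) ⊕ Fin k → Deg :=
  Sum.elim (fun o => flagDeg k (Sum.inl o)) fun i => flagDeg k (Sum.inr i.castSucc)

/-- The degree of `ξ^n σ_{k+1}^ε`. -/
def phiDeg (y : ℕ × Fin 2) : Deg :=
  y.1 • ((2, 0, 0) : Deg) + ![0, (-2 * ((k : ℤ) + 1), 2, 1)] y.2

/-- The even part is a polynomial ring in `ξ` over the polynomials in the `w_i`, with the powers of
`ξ` as a basis; the odd variables do not change. -/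
theorem hasHomogBasis_rename : HasHomogBasis ((regular (part (midDeg k))).res
    (SPoly.map (MvPolynomial.rename some) odd odd_sq : Om k →ₐ[ℚ] SPoly (Option (Fin k)) (Fin k)))
    fun n : ℕ => n • ((2, 0, 0) : Deg) := by
  let E : (ℕ →₀ MvPolynomial (Fin k) ℚ) ≃ₗ[ℚ] MvPolynomial (Option (Fin k)) ℚ :=
    ((Polynomial.basisMonomials (MvPolynomial (Fin k) ℚ)).repr.symm.restrictScalars ℚ) ≪≫ₗ
      (MvPolynomial.optionEquivLeft ℚ (Fin k)).symm.toLinearEquiv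
  refine hasHomogBasis_res_map (MvPolynomial.rename some) (fun n => MvPolynomial.X none ^ n) E
    (fun n p => ?_) fun n => ?_
  · change (MvPolynomial.optionEquivLeft ℚ (Fin k)).symm
      ((Polynomial.basisMonomials (MvPolynomial (Fin k) ℚ)).repr.symm (Finsupp.single n p)) = _
    rw [Module.Basis.repr_symm_single, Polynomial.coe_basisMonomials, Polynomial.smul_monomial,
      smul_eq_mul, mul_one, ← Polynomial.C_mul_X_pow_eq_monomial, map_mul, map_pow,
      MvPolynomial.optionEquivLeft_symm_X]
    congr 1
    have h : ((MvPolynomial.optionEquivLeft ℚ (Fin k)).symm.toAlgHom.comp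
        (Polynomial.CAlgHom (R := ℚ))) = MvPolynomial.rename some := by
      refine MvPolynomial.algHom_ext fun i => ?_
      rw [MvPolynomial.rename_X]
      exact MvPolynomial.optionEquivLeft_symm_C_X _ _ i
    exact AlgHom.congr_fun h p
  · rw [map_pow]
    exact pow_mem_part (gen_mem_part (midDeg k) (Sum.inl none)) n

theorem castSuccHom_mem_flagPart (d : Deg) (z : SPoly (Option (Fin k)) (Fin k))
    (hz : z ∈ part (midDeg k) d) : castSuccHom k z ∈ flagPart k d := by
  refine map_mem_part (fun i => ?_) hz
  rcases i with a | i
  · rw [gen_inl, castSuccHom_x]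
    exact gen_mem_part (flagDeg k) (Sum.inl a)
  · rw [gen_inr, castSuccHom_s]
    exact gen_mem_part (flagDeg k) (Sum.inr i.castSucc)

/-- `Ω_{k,k+1}` is free over `Ω_k` on the elements `ξ^n σ_{k+1}^ε`. -/
theorem phi_hasHomogBasis : HasHomogBasis ((regular (flagPart k)).res (phi k)) (phiDeg k) := by
  -- This is freeness along the naive inclusion that sends `s_i` to `σ_i`: the powers of `ξ` are
  -- multiplied with `1` and `σ_{k+1}`.
  have h1 := (hasHomogBasis_castSuccHom (Option (Fin k)) k (dg := flagDeg k)).res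
    (IsGraded.res (castSuccHom_mem_flagPart k) (regular_isGraded (flagDeg k)))
    (hasHomogBasis_rename k)
  refine h1.of_iso ?_
  let f := (SPoly.map (MvPolynomial.rename some) odd odd_sq :
    Om k →ₐ[ℚ] SPoly (Option (Fin k)) (Fin k))
  -- The automorphism `theta k` carries the naive inclusion to `φ*`, so it transports the basis
  -- while preserving degrees.
  have hf : ∀ a, theta k (castSuccHom k (f a)) = phi k a := by
    have : ((theta k).toAlgHom.comp ((castSuccHom k).comp f)) = phi k := by
      refine algHom_ext fun i => ?_
      rcases i with a | i
      · rw [gen_inl, phi_x]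
        have e1 : f (x a) = x (some a) := (map_x _ _ _ _).trans (by rw [MvPolynomial.rename_X]; rfl)
        change theta k (castSuccHom k (f (x a))) = _
        rw [e1, castSuccHom_x]
        exact theta_ofEven k _
      · rw [gen_inr, phi_s]
        have e1 : f (s i) = s i := map_odd _ _ _ _
        change theta k (castSuccHom k (f (s i))) = _
        rw [e1, castSuccHom_s, theta_s, phiGen_castSucc]
    exact AlgHom.congr_fun this
  let e : (((regular (flagPart k)).res (castSuccHom k)).res f).carrier ≃ₗ[Om k]
      ((regular (flagPart k)).res (phi k)).carrier :=
    { (theta k).toLinearEquiv with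
      map_smul' := fun a (z : OmFlag k) => by
        change theta k (castSuccHom k (f a) * z) = phi k a * theta k z
        rw [map_mul, hf] }
  refine ⟨e, fun d z => ⟨fun hz => theta_mem_flagPart k hz, fun hz => ?_⟩⟩
  exact mem_of_map_mem (part_isInternal (flagDeg k)) (part_isInternal (flagDeg k))
    (f := (theta k).toLinearEquiv.toLinearMap)
    (fun d x hx => theta_mem_flagPart k hx) (theta k).injective hz

end Theta

/-! ### Freeness along ψ*: adjoining a root -/

section Psi

open Polynomial

variable (k : ℕ)

/-- The even part of `ψ*`. -/
def psiEven : MvPolynomial (Fin (k + 1)) ℚ →ₐ[ℚ] MvPolynomial (Option (Fin k)) ℚ :=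
  MvPolynomial.aeval fun i : Fin (k + 1) => wPoly k (i + 1) + MvPolynomial.X none * wPoly k i

/-- The polynomial `X^n - x_1 X^{n-1} + x_2 X^{n-2} - ⋯`. -/
def wRoot : ℕ → (MvPolynomial (Fin (k + 1)) ℚ)[X]
  | 0 => 1
  | n + 1 => X * wRoot n +
      C ((-1) ^ (n + 1) * (if h : n < k + 1 then MvPolynomial.X ⟨n, h⟩ else 0))

theorem wRoot_monic_natDegree (n : ℕ) : (wRoot k n).Monic ∧ (wRoot k n).natDegree = n := by
  induction n with
  | zero => exact ⟨monic_one, natDegree_one⟩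
  | succ n ih =>
    have h1 : (X * wRoot k n).Monic := monic_X.mul ih.1
    have h2 : (X * wRoot k n).natDegree = n + 1 := by
      rw [monic_X.natDegree_mul ih.1, natDegree_X, ih.2, add_comm]
    rw [wRoot]
    refine ⟨h1.add_of_left ?_, ?_⟩
    · refine degree_C_le.trans_lt ?_
      rw [degree_eq_natDegree h1.ne_zero, h2]
      exact_mod_cast Nat.succ_pos n
    · rw [natDegree_add_C, h2]

theorem wPoly_succ_self : wPoly k (k + 1) = 0 := by
  rw [wPoly, dif_neg (lt_irrefl k)]

/-- The recursion telescopes: in `ξ * (-1)^n w_n + (-1)^(n+1) (w_{n+1} + ξ w_n)` the terms with `ξ`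
cancel. Since `w_{k+1} = 0`, the case `n = k + 1` says that `ξ` is a root of a monic polynomial over
`ℚ[x_1, …, x_{k+1}]`; the lower cases express the `w_n` through `ξ` and the `x_i`. -/
theorem eval₂_wRoot (n : ℕ) (hn : n ≤ k + 1) :
    (wRoot k n).eval₂ (psiEven k).toRingHom (MvPolynomial.X none) = (-1) ^ n * wPoly k n := by
  induction n with
  | zero => rw [wRoot, eval₂_one, wPoly, pow_zero, one_mul]
  | succ n ih =>
    have h1 : n < k + 1 := hn
    have h2 : (psiEven k) (MvPolynomial.X ⟨n, h1⟩)
        = wPoly k (n + 1) + MvPolynomial.X none * wPoly k n := MvPolynomial.aeval_X _ _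
    rw [wRoot, eval₂_add, eval₂_mul, eval₂_X, ih h1.le, eval₂_C, dif_pos h1]
    change _ + psiEven k _ = _
    rw [map_mul, h2, map_pow, map_neg, map_one]
    ring

/-- The map from the adjunction of a root to `ℚ[w_1, …, w_k, ξ]`. -/
def fromRoot : AdjoinRoot (wRoot k (k + 1)) →+* MvPolynomial (Option (Fin k)) ℚ :=
  AdjoinRoot.lift (psiEven k).toRingHom (MvPolynomial.X none) (by
    rw [eval₂_wRoot k _ le_rfl, wPoly_succ_self, mul_zero])

theorem fromRoot_mk (p : (MvPolynomial (Fin (k + 1)) ℚ)[X]) :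
    fromRoot k (AdjoinRoot.mk _ p) = p.eval₂ (psiEven k).toRingHom (MvPolynomial.X none) :=
  AdjoinRoot.lift_mk _ p

/-- The inverse of `fromRoot`. -/
def toRoot : MvPolynomial (Option (Fin k)) ℚ →ₐ[ℚ] AdjoinRoot (wRoot k (k + 1)) :=
  MvPolynomial.aeval fun o => o.elim (AdjoinRoot.root _) fun i =>
    (-1) ^ ((i : ℕ) + 1) * AdjoinRoot.mk _ (wRoot k (i + 1))

theorem toRoot_wPoly (n : ℕ) (hn : n ≤ k + 1) :
    toRoot k (wPoly k n) = (-1) ^ n * AdjoinRoot.mk _ (wRoot k n) := by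
  cases n with
  | zero => rw [wPoly, wRoot, map_one, map_one, pow_zero, one_mul]
  | succ n =>
    by_cases h : n < k
    · rw [wPoly, dif_pos h, toRoot, MvPolynomial.aeval_X]
      rfl
    · obtain rfl : n = k := by omega
      rw [wPoly_succ_self, map_zero, AdjoinRoot.mk_self, mul_zero]

theorem toRoot_psiEven (i : Fin (k + 1)) :
    toRoot k (psiEven k (MvPolynomial.X i)) = AdjoinRoot.of _ (MvPolynomial.X i) := by
  have h1 : toRoot k (MvPolynomial.X none) = AdjoinRoot.root _ := MvPolynomial.aeval_X _ _
  have h2 : (psiEven k) (MvPolynomial.X i)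
        = wPoly k (i + 1) + MvPolynomial.X none * wPoly k i := MvPolynomial.aeval_X _ _
  have h4 : wRoot k ((i : ℕ) + 1) = X * wRoot k i + C ((-1) ^ ((i : ℕ) + 1) * MvPolynomial.X i) := by
    rw [wRoot, dif_pos i.2]
  rw [h2, map_add, map_mul, h1, toRoot_wPoly k (i + 1) i.2, toRoot_wPoly k i i.2.le,
    ← AdjoinRoot.mk_X, ← AdjoinRoot.mk_C, h4]
  have h3 : ((-1 : AdjoinRoot (wRoot k (k + 1))) ^ ((i : ℕ) + 1)) * (-1) ^ ((i : ℕ) + 1) = 1 := by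
    rw [← mul_pow]; simp
  simp only [map_add, map_mul, map_pow, map_neg, map_one]
  linear_combination (AdjoinRoot.mk (wRoot k (k + 1))) (C (MvPolynomial.X i)) * h3

/-- Both composites with `toRoot` are the identity on generators. Hence the even part of `Ω_{k,k+1}`
is obtained from that of `Ω_{k+1}` by adjoining a root of a monic polynomial of degree `k + 1`. -/
theorem fromRoot_bijective : Function.Bijective (fromRoot k) := by
  constructor
  · have h : ((toRoot k).toRingHom.comp (fromRoot k)) = RingHom.id _ := by
      refine AdjoinRoot.ringHom_ext ?_ ?_
      · refine MvPolynomial.ringHom_ext (fun c => ?_) fun i => ?_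
        · change toRoot k (fromRoot k (AdjoinRoot.of _ _)) = AdjoinRoot.of _ _
          rw [← AdjoinRoot.mk_C, fromRoot_mk, eval₂_C]
          change toRoot k (psiEven k (MvPolynomial.C c)) = _
          rw [← MvPolynomial.algebraMap_eq, AlgHom.commutes, AlgHom.commutes]
          rfl
        · change toRoot k (fromRoot k (AdjoinRoot.of _ _)) = AdjoinRoot.of _ _
          rw [← AdjoinRoot.mk_C, fromRoot_mk, eval₂_C]
          exact toRoot_psiEven k i
      · change toRoot k (fromRoot k (AdjoinRoot.root _)) = AdjoinRoot.root _
        rw [← AdjoinRoot.mk_X, fromRoot_mk, eval₂_X]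
        exact MvPolynomial.aeval_X _ _
    exact Function.LeftInverse.injective (g := toRoot k) fun z => RingHom.congr_fun h z
  · have h : ∀ z, fromRoot k (toRoot k z) = z := by
      have h : ((fromRoot k).comp (toRoot k).toRingHom) = RingHom.id _ := by
        refine MvPolynomial.ringHom_ext (fun c => ?_) fun o => ?_
        · change fromRoot k (toRoot k (MvPolynomial.C c)) = MvPolynomial.C c
          rw [← MvPolynomial.algebraMap_eq, AlgHom.commutes]
          exact RingHom.map_rat_algebraMap _ c
        · change fromRoot k (toRoot k (MvPolynomial.X o)) = MvPolynomial.X o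
          rw [toRoot, MvPolynomial.aeval_X]
          cases o with
          | none =>
            change fromRoot k (AdjoinRoot.root _) = _
            rw [← AdjoinRoot.mk_X, fromRoot_mk, eval₂_X]
          | some i =>
            change fromRoot k ((-1) ^ ((i : ℕ) + 1) * AdjoinRoot.mk _ (wRoot k (i + 1))) = _
            rw [map_mul, map_pow, map_neg, map_one, fromRoot_mk, eval₂_wRoot k _ (by omega),
              ← mul_assoc, ← mul_pow, neg_one_mul, neg_neg, one_pow, one_mul, wPoly, dif_pos i.2]
      exact fun z => RingHom.congr_fun h z
    exact Function.RightInverse.surjective h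

/-- `Ω_{k,k+1}` is free over `Ω_{k+1}` on `1, ξ, …, ξ^k`. -/
theorem psi_hasHomogBasis : HasHomogBasis ((regular (flagPart k)).res (psi k))
    fun i : Fin (k + 1) => (i : ℕ) • ((2, 0, 0) : Deg) := by
  obtain ⟨hm, hd⟩ := wRoot_monic_natDegree k (k + 1)
  -- The power basis of the adjoined root is carried to the powers of `ξ`. The odd variables of the
  -- two superrings correspond under `ψ*`, so only the even parts matter.
  let b := (AdjoinRoot.powerBasis' hm).basis
  let f : AdjoinRoot (wRoot k (k + 1)) ≃ₗ[ℚ] MvPolynomial (Option (Fin k)) ℚ :=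
    LinearEquiv.ofBijective (fromRoot k).toAddMonoidHom.toRatLinearMap (fromRoot_bijective k)
  let E := (b.repr.symm.restrictScalars ℚ) ≪≫ₗ f
  have hE : ∀ j p, E (Finsupp.single j p) = psiEven k p * MvPolynomial.X none ^ (j : ℕ) := by
    intro j p
    change fromRoot k (b.repr.symm (Finsupp.single j p)) = _
    rw [Module.Basis.repr_symm_single, PowerBasis.basis_eq_pow, Algebra.smul_def, map_mul, map_pow]
    congr 1
    · change fromRoot k (AdjoinRoot.of _ p) = _
      rw [← AdjoinRoot.mk_C, fromRoot_mk, eval₂_C]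
      rfl
    · change fromRoot k (AdjoinRoot.root _) ^ _ = _
      rw [← AdjoinRoot.mk_X, fromRoot_mk, eval₂_X]
  have h1 := hasHomogBasis_res_map (β := Fin (k + 1)) (psiEven k) _ E hE (dg := flagDeg k)
    (d := fun i => (i : ℕ) • ((2, 0, 0) : Deg)) fun j => by
      rw [map_pow]
      exact pow_mem_part (gen_mem_part (flagDeg k) (Sum.inl none)) j
  exact h1.reindex (finCongr hd.symm)

end Psi

end VermaCat
end

noncomputable section

namespace VermaCat

open SPoly SerRing

/-! ### Supercommutativity -/

namespace SPoly

variable {α β : Type}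

/-- The power of the parity automorphism. -/
def parityPow (p : ZMod 2) (z : SPoly α β) : SPoly α β := if p = 0 then z else parityAut z

theorem parityPow_add (p p' : ZMod 2) (z : SPoly α β) :
    parityPow (p + p') z = parityPow p (parityPow p' z) := by
  have h : ∀ r : ZMod 2, r = 0 ∨ r = 1 := by decide
  have h1 : (1 : ZMod 2) + 1 = 0 := by decide
  have h2 : (1 : ZMod 2) ≠ 0 := by decide
  rcases h p with rfl | rfl <;> rcases h p' with rfl | rfl <;>
    simp [parityPow, h1, parityAut_parityAut]

theorem parityPow_map_add (p : ZMod 2) (y z : SPoly α β) :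
    parityPow p (y + z) = parityPow p y + parityPow p z := by
  unfold parityPow; split_ifs <;> simp

theorem parityPow_map_mul (p : ZMod 2) (y z : SPoly α β) :
    parityPow p (y * z) = parityPow p y * parityPow p z := by
  unfold parityPow; split_ifs <;> simp

theorem parityPow_map_smul (p : ZMod 2) (c : ℚ) (z : SPoly α β) :
    parityPow p (c • z) = c • parityPow p z := by
  unfold parityPow; split_ifs <;> simp

theorem parityPow_one (p : ZMod 2) : parityPow p (1 : SPoly α β) = 1 := by
  unfold parityPow; split_ifs <;> simp

theorem parityPow_parityPow (p : ZMod 2) (z : SPoly α β) : parityPow p (parityPow p z) = z := by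
  unfold parityPow; split_ifs
  · rfl
  · exact parityAut_parityAut z

theorem parityPow_mem_part {dg : α ⊕ β → Deg} (p : ZMod 2) {d : Deg} {z : SPoly α β}
    (hz : z ∈ part dg d) : parityPow p z ∈ part dg d := by
  unfold parityPow; split_ifs
  · exact hz
  · refine map_mem_part (fun i => ?_) hz
    rcases i with a | b
    · rw [gen_inl, parityAut_x]; exact gen_mem_part dg (Sum.inl a)
    · rw [gen_inr, parityAut_s]; exact neg_mem (gen_mem_part dg (Sum.inr b))

/-- Homogeneous elements commute with everything up to sign. -/
theorem mul_eq_parityPow_mul {dg : α ⊕ β → Deg} (h0 : ∀ a, (dg (Sum.inl a)).2.2 = 0)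
    (h1 : ∀ b, (dg (Sum.inr b)).2.2 = 1) {d : Deg} {y : SPoly α β} (hy : y ∈ part dg d)
    (z : SPoly α β) : y * z = parityPow d.2.2 z * y := by
  have hw : ∀ (l : List (α ⊕ β)) (z : SPoly α β),
      word l * z = parityPow (l.map dg).sum.2.2 z * word l := by
    intro l
    induction l with
    | nil => intro z; simp [word, parityPow]
    | cons i l ih =>
      intro z
      rw [word_cons, mul_assoc, ih, ← mul_assoc, List.map_cons, List.sum_cons]
      change gen i * _ * _ = parityPow ((dg i).2.2 + ((l.map dg).sum).2.2) z * _
      rw [parityPow_add, ← mul_assoc]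
      congr 1
      rcases i with a | b
      · rw [h0, gen_inl, (x_commute a _).eq]; simp [parityPow]
      · rw [h1, gen_inr, s_mul]; simp [parityPow]
  induction hy using Submodule.span_induction with
  | mem y hy =>
    obtain ⟨l, rfl, rfl⟩ := hy
    exact hw l z
  | zero => rw [zero_mul, mul_zero]
  | add y y' _ _ hy hy' => rw [add_mul, hy, hy', mul_add]
  | smul c y _ hy => rw [smul_mul_assoc, hy, mul_smul_comm]

end SPoly

theorem flagPart_mul_comm {k : ℕ} {d : Deg} {y : OmFlag k} (hy : y ∈ flagPart k d)
    (z : OmFlag k) : y * z = parityPow d.2.2 z * y := by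
  refine mul_eq_parityPow_mul (dg := flagDeg k) (fun a => ?_) (fun b => rfl) hy z
  cases a <;> rfl

theorem parityAut_ofEven {α β : Type} (p : MvPolynomial α ℚ) :
    parityAut (ofEven p : SPoly α β) = ofEven p := map_ofEven _ _ _ p

theorem phi_parityAut (k : ℕ) (a : Om k) : phi k (parityAut a) = parityAut (phi k a) := by
  have h : (phi k).comp parityAut = parityAut.comp (phi k) := by
    refine algHom_ext fun i => ?_
    rcases i with i | i
    · rw [gen_inl, AlgHom.comp_apply, AlgHom.comp_apply, parityAut_x, phi_x, parityAut_x]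
    · rw [gen_inr, AlgHom.comp_apply, AlgHom.comp_apply, parityAut_s, map_neg, phi_s, map_add,
        map_mul, xi, parityAut_x, parityAut_s, parityAut_s, mul_neg, neg_add]
  exact AlgHom.congr_fun h a

theorem psi_parityAut (k : ℕ) (a : Om (k + 1)) : psi k (parityAut a) = parityAut (psi k a) := by
  have h : (psi k).comp parityAut = parityAut.comp (psi k) := by
    refine algHom_ext fun i => ?_
    rcases i with i | i
    · rw [gen_inl, AlgHom.comp_apply, AlgHom.comp_apply, parityAut_x, psi_x, map_add, map_mul, xi,
        parityAut_x, parityAut_ofEven, parityAut_ofEven]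
    · rw [gen_inr, AlgHom.comp_apply, AlgHom.comp_apply, parityAut_s, map_neg, psi_s, parityAut_s]
  exact AlgHom.congr_fun h a

/-- The coordinates of a homogeneous element in a homogeneous basis are homogeneous. -/
theorem repr_mem {A : Type} [Ring A] [Algebra ℚ A] {𝒜 : Deg → Submodule ℚ A}
    (h𝒜 : DirectSum.IsInternal 𝒜) {M : SMod A} (hM : M.IsGraded 𝒜) {ι : Type} {d : ι → Deg}
    (b : Module.Basis ι A M.carrier) (hb : ∀ i, b i ∈ M.deg (d i)) {e : Deg} {x : M.carrier}
    (hx : x ∈ M.deg e) (i : ι) : b.repr x i ∈ 𝒜 (e - d i) := by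
  have h1 : ∀ (a : A) i, hproj hM.1 e (a • b i) = hproj h𝒜 (e - d i) a • b i := by
    intro a i
    induction a using homogeneous_induction h𝒜 with
    | zero => simp only [zero_smul, map_zero]
    | add a a' ha ha' => simp only [add_smul, map_add, ha, ha']
    | mem c a ha =>
      by_cases he : c = e - d i
      · subst he
        rw [hproj_same _ ha]
        have := hM.2 _ _ a ha _ (hb i)
        rw [sub_add_cancel] at this
        exact hproj_same _ this
      · rw [hproj_ne _ he ha, zero_smul]
        exact hproj_ne _ (fun h => he (by rw [← h, add_sub_cancel_right]))
          (hM.2 _ _ a ha _ (hb i))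
  have h2 : ∀ y i, b.repr (hproj hM.1 e y) i = hproj h𝒜 (e - d i) (b.repr y i) := by
    intro y i
    have hy : y ∈ Submodule.span A (Set.range b) := b.span_eq ▸ Submodule.mem_top
    have h3 : y = ∑ j ∈ (b.repr y).support, b.repr y j • b j := (b.linearCombination_repr y).symm
    conv_lhs => rw [h3]
    rw [map_sum, map_sum, Finsupp.finsetSum_apply]
    simp only [h1, map_smul, Module.Basis.repr_self, Finsupp.smul_single, smul_eq_mul, mul_one]
    rw [Finset.sum_eq_single i]
    · rw [Finsupp.single_eq_same]
    · intro j _ hj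
      exact Finsupp.single_eq_of_ne (Ne.symm hj)
    · intro hi
      rw [Finsupp.notMem_support_iff.mp hi, map_zero, Finsupp.single_zero, Finsupp.coe_zero,
        Pi.zero_apply]
  have h4 := h2 x i
  rw [hproj_same _ hx] at h4
  rw [h4]
  exact hproj_mem _ _ _

/-! ### Induction -/

section Ind

variable {n k : ℕ} {φ : Om n →ₐ[ℚ] OmFlag k} {M : SMod (Om n)}

variable (φ M) in
/-- The projection of `Ω_{k,k+1} ⊗_ℚ M` to the induced supermodule. -/
def indMk : OmFlag k ⊗[ℚ] M.carrier →ₗ[OmFlag k] (M.ind φ (flagPart k)).carrier :=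
  (indRel φ M).mkQ

theorem indMk_surjective : Function.Surjective (indMk φ M) := (indRel φ M).mkQ_surjective

theorem indMk_eq_zero {t : OmFlag k ⊗[ℚ] M.carrier} : indMk φ M t = 0 ↔ t ∈ indRel φ M :=
  Submodule.Quotient.mk_eq_zero _

theorem ind_induction {p : (M.ind φ (flagPart k)).carrier → Prop} (zero : p 0)
    (tmul : ∀ z m, p (indMk φ M (z ⊗ₜ[ℚ] m))) (add : ∀ x y, p x → p y → p (x + y))
    (x : (M.ind φ (flagPart k)).carrier) : p x := by
  obtain ⟨t, rfl⟩ := indMk_surjective x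
  induction t using TensorProduct.induction_on with
  | zero => rw [map_zero]; exact zero
  | tmul z m => exact tmul z m
  | add t t' ht ht' => rw [map_add]; exact add _ _ ht ht'

theorem ind_deg_induction {e : Deg} {p : (M.ind φ (flagPart k)).carrier → Prop} (zero : p 0)
    (tmul : ∀ d d' z m, d + d' = e → z ∈ flagPart k d → m ∈ M.deg d' → p (indMk φ M (z ⊗ₜ[ℚ] m)))
    (add : ∀ x y, p x → p y → p (x + y)) (smul : ∀ (c : ℚ) x, p x → p (c • x))
    {x : (M.ind φ (flagPart k)).carrier} (hx : x ∈ (M.ind φ (flagPart k)).deg e) : p x :=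
  Submodule.span_induction (p := fun x _ => p x)
    (fun x hx => by
      obtain ⟨d, d', h, z, hz, m, hm, rfl⟩ := hx
      exact tmul d d' z m h hz hm)
    zero (fun x y _ _ => add x y) (fun c x _ => smul c x) hx

/-- The defining relations have left factor 1 on one side; multiplying them by `z` gives
balancedness of the tensor product. -/
theorem indMk_mul (z : OmFlag k) (a : Om n) (m : M.carrier) :
    indMk φ M ((z * φ a) ⊗ₜ[ℚ] m) = indMk φ M (z ⊗ₜ[ℚ] (a • m)) := by
  have h1 : indMk φ M (φ a ⊗ₜ[ℚ] m - 1 ⊗ₜ[ℚ] (a • m)) = 0 :=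
    indMk_eq_zero.mpr (Submodule.subset_span ⟨a, m, rfl⟩)
  have h2 := congrArg (z • ·) h1
  simp only [smul_zero, ← map_smul, smul_sub, TensorProduct.smul_tmul', smul_eq_mul, mul_one] at h2
  rwa [map_sub, sub_eq_zero] at h2

theorem smul_indMk (z y : OmFlag k) (m : M.carrier) :
    z • indMk φ M (y ⊗ₜ[ℚ] m) = indMk φ M ((z * y) ⊗ₜ[ℚ] m) := by
  rw [← map_smul, TensorProduct.smul_tmul', smul_eq_mul]

theorem ind_mem_deg {d e : Deg} {z : OmFlag k} (hz : z ∈ flagPart k d) {m : M.carrier}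
    (hm : m ∈ M.deg e) :
    indMk φ M (z ⊗ₜ[ℚ] m) ∈ (M.ind φ (flagPart k)).deg (d + e) :=
  Submodule.subset_span (s := {z | ∃ d' e' : Deg, d' + e' = d + e ∧ ∃ b ∈ flagPart k d',
    ∃ m ∈ M.deg e', z = (indRel φ M).mkQ (b ⊗ₜ[ℚ] m)}) ⟨d, e, rfl, z, hz, m, hm, rfl⟩

theorem ind_smul_mem_deg {d e : Deg} {b : OmFlag k} (hb : b ∈ flagPart k d)
    {x : (M.ind φ (flagPart k)).carrier} (hx : x ∈ (M.ind φ (flagPart k)).deg e) :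
    b • x ∈ (M.ind φ (flagPart k)).deg (d + e) := by
  refine ind_deg_induction (p := fun x => b • x ∈ (M.ind φ (flagPart k)).deg (d + e)) ?_
    (fun d' e' z m h hz hm => ?_) (fun x y hx hy => ?_) (fun c x hx => ?_) hx
  · rw [smul_zero]; exact zero_mem _
  · subst h
    rw [← add_assoc, smul_indMk]
    exact ind_mem_deg (mul_mem_part hb hz) hm
  · rw [smul_add]; exact add_mem hx hy
  · rw [smul_comm]; exact Submodule.smul_mem _ _ hx

/-- A homogeneous basis of `M` gives one of the induced supermodule. -/
theorem HasHomogBasis.ind {ι : Type} {d : ι → Deg} (h : HasHomogBasis M d) :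
    HasHomogBasis (M.ind φ (flagPart k)) d := by
  obtain ⟨b, hb⟩ := h
  let v : ι → (M.ind φ (flagPart k)).carrier := fun j => indMk φ M (1 ⊗ₜ[ℚ] b j)
  let g : M.carrier →ₗ[ℚ] (ι →₀ OmFlag k) :=
    Finsupp.mapRange.linearMap φ.toLinearMap ∘ₗ (b.repr.toLinearMap.restrictScalars ℚ)
  have hg : ∀ a m, g (a • m) = φ a • g m := by
    intro a m
    ext j
    change φ (b.repr (a • m) j) = φ a * φ (b.repr m j)
    rw [map_smul, Finsupp.smul_apply, smul_eq_mul, map_mul]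
  -- The map `z ⊗ m ↦ z * φ(coordinates of m)` respects the relations and sends the candidate basis
  -- to the standard one, which gives linear independence.
  let W : OmFlag k ⊗[ℚ] M.carrier →ₗ[OmFlag k] (ι →₀ OmFlag k) :=
    TensorProduct.AlgebraTensorModule.lift (LinearMap.toSpanSingleton (OmFlag k) _ g)
  have hW : ∀ z m, W (z ⊗ₜ[ℚ] m) = z • g m := fun z m => rfl
  have hker : indRel φ M ≤ LinearMap.ker W := by
    refine Submodule.span_le.mpr ?_
    rintro _ ⟨a, m, rfl⟩
    change W _ = 0
    rw [map_sub, hW, hW, hg, one_smul, sub_self]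
  let W' : (M.ind φ (flagPart k)).carrier →ₗ[OmFlag k] (ι →₀ OmFlag k) := (indRel φ M).liftQ W hker
  have hli : LinearIndependent (OmFlag k) v := by
    refine LinearIndependent.of_comp W' ?_
    have : W' ∘ v = fun j => Finsupp.single j 1 := by
      funext j
      change W (1 ⊗ₜ[ℚ] b j) = _
      rw [hW, one_smul]
      change Finsupp.mapRange φ (map_zero φ) (b.repr (b j)) = _
      rw [Module.Basis.repr_self, Finsupp.mapRange_single, map_one]
    rw [this]
    exact Finsupp.linearIndependent_single_one _ _
  have hsp : ⊤ ≤ Submodule.span (OmFlag k) (Set.range v) := by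
    have h1 : ∀ m : M.carrier,
        indMk φ M (1 ⊗ₜ[ℚ] m) ∈ Submodule.span (OmFlag k) (Set.range v) := by
      intro m
      have hm : m ∈ Submodule.span (Om n) (Set.range b) := b.span_eq ▸ Submodule.mem_top
      induction hm using Submodule.span_induction with
      | mem m hm =>
        obtain ⟨j, rfl⟩ := hm
        exact Submodule.subset_span ⟨j, rfl⟩
      | zero => rw [TensorProduct.tmul_zero, map_zero]; exact zero_mem _
      | add m m' _ _ hm hm' => rw [TensorProduct.tmul_add, map_add]; exact add_mem hm hm'
      | smul a m _ hm =>
        rw [← indMk_mul, one_mul]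
        have h2 := Submodule.smul_mem _ (φ a) hm
        rwa [smul_indMk, mul_one] at h2
    rintro x -
    induction x using ind_induction with
    | zero => exact zero_mem _
    | add x y hx hy => exact add_mem hx hy
    | tmul z m =>
      have h2 := Submodule.smul_mem _ z (h1 m)
      rwa [smul_indMk, mul_one] at h2
  refine ⟨Module.Basis.mk hli hsp, fun j => ?_⟩
  have h1 : Module.Basis.mk hli hsp j = v j := Module.Basis.mk_apply hli hsp j
  refine (congrArg (· ∈ (M.ind φ (flagPart k)).deg (d j)) h1).mpr ?_
  have h2 := ind_mem_deg (φ := φ) (one_mem_part (flagDeg k)) (hb j)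
  rwa [zero_add] at h2

variable {ι : Type} {d : ι → Deg}

/-- Along a free extension, the induced supermodule is a sum of shifts of the given one as a graded
vector space. -/
theorem ind_grIso (hτ : ∀ a, φ (parityAut a) = parityAut (φ a))
    (hφ : ∀ d, ∀ a ∈ omPart n d, φ a ∈ flagPart k d) (hM : M.IsGraded (omPart n))
    (h : HasHomogBasis ((regular (flagPart k)).res φ) d) :
    GrIso (dsum fun i => M.shift (d i)).deg (M.ind φ (flagPart k)).deg := by
  classical
  obtain ⟨b, hb⟩ := h
  have hτ' : ∀ p a, φ (parityPow p a) = parityPow p (φ a) := by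
    intro p a
    unfold parityPow; split_ifs
    · rfl
    · exact hτ a
  let bb : ι → OmFlag k := b
  -- The basis `b` is one for left multiplication by `φ a`, whereas induction balances right
  -- multiplication. Supercommutativity exchanges the two at the cost of the parity automorphism.
  have hcomm : ∀ i a, bb i * φ a = φ (parityPow (d i).2.2 a) * bb i := fun i a => by
    rw [hτ']; exact flagPart_mul_comm (hb i) _
  -- the two maps
  let T : (Π₀ _ : ι, M.carrier) →ₗ[ℚ] (M.ind φ (flagPart k)).carrier :=
    DFinsupp.lsum ℚ fun i => ((indMk φ M).restrictScalars ℚ) ∘ₗ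
      TensorProduct.mk ℚ (OmFlag k) M.carrier (bb i)
  have hT : ∀ i m, T (DFinsupp.single i m) = indMk φ M (bb i ⊗ₜ[ℚ] m) := fun i m =>
    DFinsupp.lsum_single _ _ _ _
  let L : ι → Om n →ₗ[ℚ] M.carrier →ₗ[ℚ] (Π₀ _ : ι, M.carrier) := fun i =>
    LinearMap.mk₂ ℚ (fun a m => DFinsupp.single i (parityPow (d i).2.2 a • m))
      (fun a a' m => by rw [parityPow_map_add, add_smul, DFinsupp.single_add])
      (fun c a m => by rw [parityPow_map_smul, smul_assoc, DFinsupp.single_smul])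
      (fun a m m' => by rw [smul_add, DFinsupp.single_add])
      (fun c a m => by rw [smul_comm, DFinsupp.single_smul])
  let r : OmFlag k →ₗ[ℚ] (ι →₀ Om n) := b.repr.toLinearMap.restrictScalars ℚ
  -- The inverse of `T`: expand `z` in the basis and use that `φ a * b i ⊗ m` equals `b i ⊗
  -- parityPow _ a • m` in the induced module.
  let U : OmFlag k →ₗ[ℚ] M.carrier →ₗ[ℚ] (Π₀ _ : ι, M.carrier) := Finsupp.lsum ℚ L ∘ₗ r
  have hU : ∀ a i m, U (φ a * bb i) m = DFinsupp.single i (parityPow (d i).2.2 a • m) := by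
    intro a i m
    have h1 : r (φ a * bb i) = Finsupp.single i a := by
      change b.repr (a • b i) = _
      rw [map_smul, Module.Basis.repr_self, Finsupp.smul_single, smul_eq_mul, mul_one]
    change Finsupp.lsum ℚ L (r (φ a * bb i)) m = _
    rw [h1, Finsupp.lsum_single]
    rfl
  have hind : ∀ {p : OmFlag k → Prop}, p 0 → (∀ a i, p (φ a * bb i)) →
      (∀ y z, p y → p z → p (y + z)) → ∀ z, p z := by
    intro p h0 h1 h2 z
    have h3 : z = ∑ j ∈ (b.repr z).support, φ (b.repr z j) * bb j :=
      (b.linearCombination_repr z).symm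
    rw [h3]
    exact Finset.sum_induction _ p h2 h0 fun j _ => h1 _ _
  have hUT : ∀ z m, indMk φ M (z ⊗ₜ[ℚ] m) = T (U z m) := by
    intro z m
    refine hind (p := fun z => indMk φ M (z ⊗ₜ[ℚ] m) = T (U z m)) ?_ (fun a i => ?_)
      (fun y z hy hz => ?_) z
    · simp only [TensorProduct.zero_tmul, map_zero, LinearMap.zero_apply]
    · rw [hU, hT, ← indMk_mul, hcomm, parityPow_parityPow]
    · rw [TensorProduct.add_tmul, map_add, hy, hz, map_add, LinearMap.add_apply, map_add]
  have hUmul : ∀ z a m, U (z * φ a) m = U z (a • m) := by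
    intro z a m
    refine hind (p := fun z => U (z * φ a) m = U z (a • m)) ?_ (fun a' i => ?_)
      (fun y z hy hz => ?_) z
    · simp only [zero_mul, map_zero, LinearMap.zero_apply]
    · rw [mul_assoc, hcomm, ← mul_assoc, ← map_mul, hU, hU, parityPow_map_mul,
        parityPow_parityPow, mul_smul]
    · rw [add_mul, map_add, map_add, LinearMap.add_apply, LinearMap.add_apply, hy, hz]
  have hUker : ∀ t ∈ indRel φ M, ∀ z : OmFlag k, TensorProduct.lift U (z • t) = 0 := by
    intro t ht
    induction ht using Submodule.span_induction with
    | mem t ht =>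
      obtain ⟨a, m, rfl⟩ := ht
      intro z
      rw [smul_sub, TensorProduct.smul_tmul', TensorProduct.smul_tmul', map_sub,
        TensorProduct.lift.tmul, TensorProduct.lift.tmul, smul_eq_mul, smul_eq_mul, hUmul, mul_one,
        sub_self]
    | zero => intro z; rw [smul_zero, map_zero]
    | add x y _ _ hx hy => intro z; rw [smul_add, map_add, hx, hy, add_zero]
    | smul c x _ hx => intro z; rw [smul_smul]; exact hx _
  -- Before passing to the quotient, `U` is a left inverse of the lift `T'` of `T`; since `U` kills
  -- the relations, nothing in the image of `T'` is identified with zero.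
  have hTinj : Function.Injective T := by
    let T' : (Π₀ _ : ι, M.carrier) →ₗ[ℚ] OmFlag k ⊗[ℚ] M.carrier :=
      DFinsupp.lsum ℚ fun i => TensorProduct.mk ℚ (OmFlag k) M.carrier (bb i)
    have hT' : ∀ x, T x = indMk φ M (T' x) := by
      have : T = (indMk φ M).restrictScalars ℚ ∘ₗ T' := by
        refine DFinsupp.lhom_ext fun i m => ?_
        rw [hT, LinearMap.comp_apply, DFinsupp.lsum_single]
        rfl
      exact fun x => LinearMap.congr_fun this x
    have hUT' : ∀ x, TensorProduct.lift U (T' x) = x := by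
      have : TensorProduct.lift U ∘ₗ T' = LinearMap.id := by
        refine DFinsupp.lhom_ext fun i m => ?_
        rw [LinearMap.comp_apply, DFinsupp.lsum_single, TensorProduct.mk_apply,
          TensorProduct.lift.tmul]
        have := hU 1 i m
        rwa [map_one, one_mul, parityPow_one, one_smul] at this
      exact fun x => LinearMap.congr_fun this x
    rw [injective_iff_map_eq_zero]
    intro x hx
    rw [hT', indMk_eq_zero] at hx
    have := hUker _ hx 1
    rwa [one_smul, hUT'] at this
  have hTsurj : Function.Surjective T := by
    intro y
    induction y using ind_induction with
    | zero => exact ⟨0, map_zero T⟩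
    | tmul z m => exact ⟨U z m, (hUT z m).symm⟩
    | add y y' hy hy' =>
      obtain ⟨x, rfl⟩ := hy
      obtain ⟨x', rfl⟩ := hy'
      exact ⟨x + x', map_add T x x'⟩
  refine ⟨LinearEquiv.ofBijective T ⟨hTinj, hTsurj⟩, fun e x => ⟨fun hx => ?_, fun hx => ?_⟩⟩
  · let y : Π₀ _ : ι, M.carrier := x
    change T y ∈ _
    have hx' : ∀ i, y i ∈ M.deg (e - d i) := hx
    have hsum : y = ∑ i ∈ y.support, DFinsupp.single i (y i) := (DFinsupp.sum_single (f := y)).symm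
    rw [hsum, map_sum]
    refine sum_mem fun i _ => ?_
    rw [hT]
    have h1 := ind_mem_deg (φ := φ) (hb i) (hx' i)
    rwa [add_sub_cancel] at h1
  -- Homogeneous elements have homogeneous preimages because the coordinates of a homogeneous `z`
  -- are homogeneous; injectivity identifies this preimage with `x`. The grading of the induced
  -- module is only given by spanning sets at this stage, so projections are not available.
  · have h1 : ∀ y ∈ (M.ind φ (flagPart k)).deg e, ∃ x' ∈ (dsum fun i => M.shift (d i)).deg e,
        T x' = y := by
      intro y hy
      refine ind_deg_induction (p := fun y => ∃ x' ∈ (dsum fun i => M.shift (d i)).deg e, T x' = y)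
        ⟨0, zero_mem _, map_zero _⟩ (fun c c' z m h hz hm => ?_) ?_ ?_ hy
      · subst h
        refine ⟨U z m, ?_, (hUT z m).symm⟩
        have hN : ((regular (flagPart k)).res φ).IsGraded (omPart n) :=
          IsGraded.res hφ (regular_isGraded (flagDeg k))
        have h2 := repr_mem (part_isInternal _) hN b hb hz
        change Finsupp.lsum ℚ L (r z) m ∈ _
        rw [Finsupp.lsum_apply, Finsupp.sum, LinearMap.sum_apply]
        refine sum_mem fun i _ => single_mem_dsum (X := fun i => M.shift (d i)) ?_
        change _ ∈ M.deg (c + c' - d i)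
        have h3 := hM.2 _ _ _ (parityPow_mem_part (d i).2.2 (h2 i)) m hm
        rwa [sub_add_eq_add_sub] at h3
      · rintro _ _ ⟨x, hx, rfl⟩ ⟨x', hx', rfl⟩
        exact ⟨x + x', add_mem hx hx', map_add _ _ _⟩
      · rintro c _ ⟨x, hx, rfl⟩
        exact ⟨c • x, Submodule.smul_mem _ _ hx, map_smul _ _ _⟩
    obtain ⟨x', hx', h2⟩ := h1 _ hx
    exact hTinj h2 ▸ hx'

end Ind

end VermaCat
end

noncomputable section

namespace VermaCat

open SPoly SerRing

/-! ### Graded superdimensions of sums of shifts -/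

theorem iso_dsum_reindex {A : Type} [Ring A] [Algebra ℚ A] {ι ι' : Type} (X : ι → SMod A)
    (e : ι ≃ ι') : (dsum X).Iso (dsum fun j => X (e.symm j)) := by
  refine ⟨DFinsupp.domLCongr e, fun c x => ⟨fun hx j => hx _,
    fun hx i => ?_⟩⟩
  have h := hx (e i)
  change (show Π₀ i, (X i).carrier from x) (e.symm (e i)) ∈ (X (e.symm (e i))).deg c at h
  rwa [e.symm_apply_apply] at h

section

variable {R : Type} [CommRing R] [Algebra Kq R] [SerRing R]

/-- Grouping the summands by degree turns the sum into a locally finite sum of shifts of one object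
with the multiplicities counted by `p`. -/
theorem sdim_dsum_shift {A : Type} [Ring A] [Algebra ℚ A] {𝒜 : Deg → Submodule ℚ A} {M : SMod A}
    (hM : Obj (Bd R) 𝒜 M) {ι : Type} {d : ι → Deg} (hfin : ∀ e, {i | d i = e}.Finite)
    (hbd : Bd R fun i j => ∃ (x : ι) (p : ZMod 2), d x = (i, j, p)) {p : R}
    (hp : IsSeries cf p fun e => Nat.card {i // d i = e}) :
    sdim R (dsum fun i => M.shift (d i)).deg = p * sdim R M.deg := by
  obtain ⟨e1, h1⟩ := exists_locIdx_equiv hfin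
  have h2 := iso_dsum_reindex (fun i => M.shift (d i)) e1.symm
  have h3 : (dsum fun x => M.shift (d (e1.symm.symm x)))
      = locSum (fun _ : Fin 1 => M) fun _ e => Nat.card {i // d i = e} := by
    have : (fun x => M.shift (d (e1.symm.symm x))) = fun x => M.shift x.2.1 :=
      funext fun x => congrArg (fun c => M.shift c) (congrFun h1 x)
    rw [this]
    rfl
  rw [h3] at h2
  rw [sdim_locSum (Obj.dsum_shift isBoundedness hM d hfin hbd) _ (fun _ => hM) _ (fun _ => p)
    (fun _ => hp) h2, Finset.univ_unique, Finset.sum_singleton]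

theorem cf_mono (i j : ℤ) (ε : ZMod 2) (a b : ℤ) :
    cf (mono lm i j ε : R) a b = if (i, j) = (a, b) then (-1) ^ ε.val else 0 := by
  have := mono_mul_cf (R := R) i j ε 1 a b
  rw [mul_one, cf_one] at this
  rw [this]
  by_cases h : (i, j) = (a, b)
  · obtain ⟨rfl, rfl⟩ := Prod.mk.inj h
    simp
  · rw [if_neg h, if_neg, mul_zero]
    rintro ⟨h1, h2⟩
    exact h (Prod.ext (by simp only []; omega) (by simp only []; omega))

theorem isSeries_sum_mono {ι : Type} [Fintype ι] (d : ι → Deg) :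
    IsSeries cf (∑ i, mono lm (d i).1 (d i).2.1 (d i).2.2 : R)
      fun e => Nat.card {i // d i = e} := by
  classical
  intro a b
  have hcard : ∀ e, (Nat.card {i // d i = e} : ℚ) = ∑ i, if d i = e then 1 else 0 := by
    intro e
    rw [Nat.card_eq_fintype_card, Fintype.card_subtype, Finset.sum_boole]
  rw [cf_sum, hcard, hcard, ← Finset.sum_sub_distrib]
  refine Finset.sum_congr rfl fun i _ => ?_
  rw [cf_mono]
  generalize d i = e
  obtain ⟨x, y, ε⟩ := e
  simp only [Prod.mk.injEq]
  have h2 : (1 : ZMod 2) ≠ 0 := by decide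
  have h : ∀ r : ZMod 2, r = 0 ∨ r = 1 := by decide
  by_cases hxy : x = a ∧ y = b
  · obtain ⟨rfl, rfl⟩ := hxy
    rcases h ε with rfl | rfl
    · simp [h2.symm]
    · simp [h2, ZMod.val_one]
  · have h3 : ∀ r : ZMod 2, ¬ (x = a ∧ y = b ∧ ε = r) := fun r hr => hxy ⟨hr.1, hr.2.1⟩
    rw [if_neg hxy, if_neg (h3 0), if_neg (h3 1), sub_zero]

theorem exists_isSeries_card {ι : Type} {d : ι → Deg}
    (hbd : Bd R fun i j => ∃ (x : ι) (p : ZMod 2), d x = (i, j, p)) :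
    ∃ p : R, IsSeries cf p fun e => Nat.card {i // d i = e} := by
  obtain ⟨p, hp⟩ := exists_cf (R := R)
    (fun i j => (Nat.card {x // d x = (i, j, 0)} : ℚ) - (Nat.card {x // d x = (i, j, 1)} : ℚ))
    (isBoundedness.mono hbd fun i j h => by
      by_contra h0
      push Not at h0
      have h1 : ∀ p, Nat.card {x // d x = (i, j, p)} = 0 := fun p => by
        have : IsEmpty {x // d x = (i, j, p)} := ⟨fun x => h0 x.1 p x.2⟩
        exact Nat.card_of_isEmpty
      rw [h1, h1, sub_self] at h
      exact h rfl)
  exact ⟨p, hp⟩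

end

/-! ### The degrees of the bases of `Ω_{k,k+1}` -/

section Degrees

variable (k : ℕ)

/-- The degree of `ξ^i`. -/
def psiDeg (i : Fin (k + 1)) : Deg := (i : ℕ) • ((2, 0, 0) : Deg)

theorem psiDeg_eq (i : Fin (k + 1)) : psiDeg k i = (2 * ((i : ℕ) : ℤ), 0, 0) := by
  refine Prod.ext ?_ (Prod.ext ?_ ?_) <;> simp [psiDeg, mul_comm]

theorem phiDeg_zero (n : ℕ) : phiDeg k (n, 0) = (2 * (n : ℤ), 0, 0) := by
  refine Prod.ext ?_ (Prod.ext ?_ ?_) <;> simp [phiDeg, mul_comm]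

theorem phiDeg_one (n : ℕ) : phiDeg k (n, 1) = (2 * (n : ℤ) - 2 * ((k : ℤ) + 1), 2, 1) := by
  refine Prod.ext ?_ (Prod.ext ?_ ?_) <;> simp [phiDeg] <;> ring

theorem le_phiDeg (y : ℕ × Fin 2) : 2 * (y.1 : ℤ) - 2 * ((k : ℤ) + 1) ≤ (phiDeg k y).1 ∧
    0 ≤ (phiDeg k y).2.1 ∧ (phiDeg k y).2.1 ≤ 2 := by
  obtain ⟨n, ε⟩ := y
  match ε with
  | 0 => rw [phiDeg_zero]; simp only []; omega
  | 1 => rw [phiDeg_one]; simp only []; omega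

theorem finite_phiDeg (e : Deg) : {y | phiDeg k y = e}.Finite := by
  refine ((Set.finite_Iic (e.1 + 2 * ((k : ℤ) + 1)).toNat).prod
    (Set.finite_univ (α := Fin 2))).subset ?_
  rintro y rfl
  refine ⟨?_, Set.mem_univ _⟩
  have := (le_phiDeg k y).1
  rw [Set.mem_Iic]
  omega

theorem bd_phiDeg {Bd : (ℤ → ℤ → Prop) → Prop} (hB : IsBoundedness Bd) :
    Bd fun i j => ∃ (y : ℕ × Fin 2) (p : ZMod 2), phiDeg k y = (i, j, p) := by
  refine hB.of_lam ⟨-2 * ((k : ℤ) + 1), 0, 2, ?_⟩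
  rintro i j ⟨y, p, h⟩
  have := le_phiDeg k y
  rw [h] at this
  simp only [] at this
  omega

theorem finite_psiDeg (e : Deg) : {i | psiDeg k i = e}.Finite := Set.toFinite _

theorem bd_psiDeg {Bd : (ℤ → ℤ → Prop) → Prop} (hB : IsBoundedness Bd) :
    Bd fun i j => ∃ (y : Fin (k + 1)) (p : ZMod 2), psiDeg k y = (i, j, p) := by
  refine hB.of_lam ⟨0, 0, 0, ?_⟩
  rintro i j ⟨y, p, h⟩
  rw [psiDeg_eq] at h
  obtain ⟨h1, h2, -⟩ := h
  omega

/-- Separates the exponent 0 of `ξ` from the positive exponents. It is the recursion of a geometric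
series at the level of multiplicities. -/
theorem card_phiDeg (e : Deg) : Nat.card {y // phiDeg k y = e}
    = Nat.card {y // phiDeg k y = e - (2, 0, 0)}
      + Nat.card {ε : Fin 2 // phiDeg k (0, ε) = e} := by
  have hfin1 : Finite {y // phiDeg k y = e - (2, 0, 0)} := finite_phiDeg k _
  have hsucc : ∀ n ε, phiDeg k (n + 1, ε) = phiDeg k (n, ε) + (2, 0, 0) := by
    intro n ε
    rw [phiDeg, phiDeg, succ_nsmul]
    exact add_right_comm _ _ _
  rw [← Nat.card_sum]
  refine Nat.card_congr
    { toFun := fun y => match y with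
        | ⟨(0, ε), h⟩ => Sum.inr ⟨ε, h⟩
        | ⟨(n + 1, ε), h⟩ => Sum.inl ⟨(n, ε), by rw [← h, hsucc, add_sub_cancel_right]⟩
      invFun := fun y => match y with
        | Sum.inr ⟨ε, h⟩ => ⟨(0, ε), h⟩
        | Sum.inl ⟨(n, ε), h⟩ => ⟨(n + 1, ε), by rw [hsucc, h, sub_add_cancel]⟩
      left_inv := ?_
      right_inv := ?_ }
  · rintro ⟨⟨n, ε⟩, h⟩
    cases n <;> rfl
  · rintro (⟨⟨n, ε⟩, h⟩ | ⟨ε, h⟩) <;> rfl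

variable {R : Type} [CommRing R] [Algebra Kq R] [SerRing R]

/-- The Poincaré series of the basis of `Ω_{k,k+1}` over `Ω_k` is
$(1-q^{-2(k+1)}\lambda^2)/(1-q^2)$; the numerator has a minus sign because $\sigma_{k+1}$ is odd.
The denominator is kept on the other side, so that only a recursion for the coefficients has to be
checked. -/
theorem phi_series {p : R} (hp : IsSeries cf p fun e => Nat.card {y // phiDeg k y = e}) :
    (1 - mono lm 2 0 0) * p = 1 + mono lm (-2 * ((k : ℤ) + 1)) 2 1 := by
  have h0 := isSeries_sum_mono (R := R) fun ε : Fin 2 => phiDeg k (0, ε)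
  rw [Fin.sum_univ_two, phiDeg_zero, phiDeg_one] at h0
  have h1 : (mono lm (2 * ((0 : ℕ) : ℤ)) 0 0 : R) = 1 := by simp [mono]
  have h2 : 2 * ((0 : ℕ) : ℤ) - 2 * ((k : ℤ) + 1) = -2 * ((k : ℤ) + 1) := by push_cast; ring
  simp only [h1, h2] at h0
  refine cf_ext fun a b => ?_
  rw [h0 a b, sub_mul, one_mul, cf_sub, mono_mul_cf, hp, hp]
  have h3 : ∀ ε : ZMod 2, ((a, b, ε) : Deg) - (2, 0, 0) = (a - 2, b - 0, ε) := fun ε => by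
    rw [Prod.mk_sub_mk, Prod.mk_sub_mk, sub_zero ε]
  simp only []
  rw [card_phiDeg k (a, b, 0), card_phiDeg k (a, b, 1), h3, h3]
  push_cast
  simp only [ZMod.val_zero, pow_zero, one_mul]
  ring

end Degrees

/-! ### The functors on objects -/

section Functors

variable {Bd : (ℤ → ℤ → Prop) → Prop}

theorem Obj.ind (hB : IsBoundedness Bd) {n k : ℕ} {φ : Om n →ₐ[ℚ] OmFlag k} {M : SMod (Om n)}
    (hτ : ∀ a, φ (parityAut a) = parityAut (φ a))
    (hφ : ∀ d, ∀ a ∈ omPart n d, φ a ∈ flagPart k d) (hM : Obj Bd (omPart n) M) {ι : Type}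
    {d : ι → Deg} (h : HasHomogBasis ((regular (flagPart k)).res φ) d)
    (hfin : ∀ e, {i | d i = e}.Finite)
    (hbd : Bd fun i j => ∃ (x : ι) (p : ZMod 2), d x = (i, j, p)) :
    Obj Bd (flagPart k) (M.ind φ (flagPart k)) := by
  have h1 := ind_grIso hτ hφ hM.1 h
  have h2 := Obj.dsum_shift hB hM d hfin hbd
  refine ⟨⟨h1.isInternal h2.1.1, fun d e a ha m hm => ind_smul_mem_deg ha hm⟩,
    fun e => h1.finite (h2.2.1 e), ?_⟩
  exact hB.mono h2.2.2 fun i j hij => (h1.supp_iff i j).mpr hij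

theorem Obj.res {n k : ℕ} {φ : Om n →ₐ[ℚ] OmFlag k}
    (hφ : ∀ d, ∀ a ∈ omPart n d, φ a ∈ flagPart k d) {N : SMod (OmFlag k)}
    (hN : Obj Bd (flagPart k) N) : Obj Bd (omPart n) (N.res φ) :=
  ⟨IsGraded.res hφ hN.1, hN.2.1, hN.2.2⟩

variable {k : ℕ}

theorem Ffun_obj (hB : IsBoundedness Bd) {M : SMod (Om k)} (hM : Obj Bd (omPart k) M) :
    Obj Bd (omPart (k + 1)) (Ffun k M) :=
  Obj.shift hB (Obj.res (fun _ _ => psi_mem_flagPart k) (Obj.ind hB (phi_parityAut k)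
    (fun _ _ => phi_mem_flagPart k) hM (phi_hasHomogBasis k) (finite_phiDeg k)
    (bd_phiDeg k hB))) _

theorem Efun_obj (hB : IsBoundedness Bd) {M : SMod (Om (k + 1))}
    (hM : Obj Bd (omPart (k + 1)) M) : Obj Bd (omPart k) (Efun k M) :=
  Obj.shift hB (Obj.res (fun _ _ => phi_mem_flagPart k) (Obj.ind hB (psi_parityAut k)
    (fun _ _ => psi_mem_flagPart k) hM (psi_hasHomogBasis k) (finite_psiDeg k)
    (bd_psiDeg k hB))) _

theorem Kfun_obj (hB : IsBoundedness Bd) {M : SMod (Om k)} (hM : Obj Bd (omPart k) M) :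
    Obj Bd (omPart k) (Kfun k M) := Obj.shift hB hM _

theorem isProj_of_hasHomogBasis {M : SMod (Om k)} (hM : Obj Bd (omPart k) M)
    {ι : Type} {d : ι → Deg} (h : HasHomogBasis M d) : IsProj (Obj Bd (omPart k)) M :=
  h.isProj (part_isInternal _) hM

/-- Induction keeps a homogeneous basis, and restriction along `ψ*` multiplies it with the basis of
`Ω_{k,k+1}` over `Ω_{k+1}`. This will show that `F` preserves projectives. -/
theorem Ffun_hasHomogBasis (hB : IsBoundedness Bd) {M : SMod (Om k)} (hM : Obj Bd (omPart k) M)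
    {ι : Type} {d : ι → Deg} (h : HasHomogBasis M d) :
    ∃ (ι' : Type) (d' : ι' → Deg), HasHomogBasis (Ffun k M) d' :=
  ⟨_, _, ((h.ind (φ := phi k)).res (Obj.ind hB (phi_parityAut k)
    (fun _ _ => phi_mem_flagPart k) hM (phi_hasHomogBasis k) (finite_phiDeg k)
    (bd_phiDeg k hB)).1 (psi_hasHomogBasis k)).shift _⟩

theorem Efun_hasHomogBasis (hB : IsBoundedness Bd) {M : SMod (Om (k + 1))}
    (hM : Obj Bd (omPart (k + 1)) M) {ι : Type} {d : ι → Deg} (h : HasHomogBasis M d) :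
    ∃ (ι' : Type) (d' : ι' → Deg), HasHomogBasis (Efun k M) d' :=
  ⟨_, _, ((h.ind (φ := psi k)).res (Obj.ind hB (psi_parityAut k)
    (fun _ _ => psi_mem_flagPart k) hM (psi_hasHomogBasis k) (finite_psiDeg k)
    (bd_psiDeg k hB)).1 (phi_hasHomogBasis k)).shift _⟩

theorem iso_omReg_zero : (omReg 0).Iso ((omSimple 0).shift 0) := by
  refine iso_omSimple_shift omReg_isGraded (v := (1 : Om 0)) (one_mem_part _) (one_ne_zero' (Om 0))
    (fun i => i.elim Fin.elim0 Fin.elim0) fun x => ?_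
  change ∃ c : ℚ, x = c • (1 : Om 0)
  let y : Om 0 := x
  change ∃ c : ℚ, y = c • (1 : Om 0)
  induction y using induction_left with
  | one => exact ⟨1, (one_smul _ _).symm⟩
  | gen_mul i => exact i.elim Fin.elim0 Fin.elim0
  | add y z hy hz =>
    obtain ⟨c, rfl⟩ := hy
    obtain ⟨c', rfl⟩ := hz
    exact ⟨c + c', (add_smul _ _ _).symm⟩
  | smul c y hy =>
    obtain ⟨c', rfl⟩ := hy
    exact ⟨c * c', (mul_smul _ _ _).symm⟩

/-- `Ω_k` is an object of all the categories. -/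
theorem omReg_obj (hB : IsBoundedness Bd) (k : ℕ) : Obj Bd (omPart k) (omReg k) := by
  induction k with
  | zero => exact Obj.iso hB (Obj.shift hB (omSimple_obj hB) 0) iso_omReg_zero.symm
  | succ k ih =>
    -- `Ω_{k,k+1}` is a locally finite sum of shifts of `Ω_k`, hence an object, and `ψ*` embeds
    -- `Ω_{k+1}` in it in each degree. Finiteness and boundedness are inherited.
    have hN : Obj Bd (omPart k) ((regular (flagPart k)).res (phi k)) :=
      Obj.iso hB (Obj.dsum_shift hB ih (phiDeg k) (finite_phiDeg k) (bd_phiDeg k hB))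
        ((hasHomogBasis_dsum_omReg (phiDeg k)).iso (part_isInternal _)
          (dsum_isGraded fun x => IsGraded.shift omReg_isGraded _)
          (IsGraded.res (fun _ _ => phi_mem_flagPart k) (regular_isGraded (flagDeg k)))
          (phi_hasHomogBasis k))
    have hinj : Function.Injective (psi k) := by
      obtain ⟨b, -⟩ := psi_hasHomogBasis k
      rw [injective_iff_map_eq_zero]
      intro a ha
      let y : OmFlag k := b 0
      have h1 : a • b 0 = 0 := by
        change psi k a * y = 0
        rw [ha, zero_mul]
      have h2 := congrArg (fun z => b.repr z 0) h1
      simpa using h2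
    have hle : ∀ d, omPart (k + 1) d ≤ (flagPart k d).comap (psi k).toLinearMap :=
      fun d a ha => psi_mem_flagPart k ha
    refine ⟨omReg_isGraded, fun d => ?_, hB.mono hN.2.2 ?_⟩
    · have hfin : FiniteDimensional ℚ (flagPart k d) := hN.2.1 d
      exact FiniteDimensional.of_injective
        ((psi k).toLinearMap.restrict (p := omPart (k + 1) d) (q := flagPart k d) (hle d))
        fun x y hxy => Subtype.ext (hinj (congrArg Subtype.val hxy))
    · rintro i j ⟨p, hp⟩
      refine ⟨p, fun h => hp ?_⟩
      rw [eq_bot_iff]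
      intro a ha
      have h1 : psi k a ∈ flagPart k (i, j, p) := hle _ ha
      have h2 : flagPart k (i, j, p) = ⊥ := h
      rw [h2, Submodule.mem_bot] at h1
      exact (Submodule.mem_bot ℚ).mpr (hinj (h1.trans (map_zero _).symm))

end Functors

end VermaCat
end

noncomputable section

namespace VermaCat

open SPoly SerRing

/-! ### The effect of the functors on graded superdimensions -/

theorem q_pow_ne_one {n : ℕ} (hn : n ≠ 0) : q ^ n ≠ 1 := by
  intro h
  have h4 : algebraMap (Polynomial ℚ) (RatFunc ℚ) (Polynomial.X ^ n)
      = algebraMap (Polynomial ℚ) (RatFunc ℚ) 1 := by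
    rw [map_pow, RatFunc.algebraMap_X, map_one]; exact h
  have h6 := congrArg Polynomial.natDegree (RatFunc.algebraMap_injective ℚ h4)
  rw [Polynomial.natDegree_X_pow, Polynomial.natDegree_one] at h6
  exact hn h6

theorem qint_ne_zero (n : ℕ) : qint (n + 1) ≠ 0 := by
  rw [qint]
  refine div_ne_zero ?_ q_sub_inv_ne_zero
  intro h
  rw [sub_eq_zero, zpow_neg, ← mul_eq_one_iff_eq_inv₀ (zpow_ne_zero _ q_ne_zero),
    ← zpow_add₀ q_ne_zero] at h
  refine q_pow_ne_one (n := 2 * (n + 1)) (by omega) ?_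
  rw [← h, ← zpow_natCast]
  congr 1
  push_cast
  ring

section

variable (R : Type) [CommRing R] [Algebra Kq R]

theorem bracket_denominator : algebraMap Kq R (q - q⁻¹)⁻¹ * ((qu R : R) - ((qu R)⁻¹ : Rˣ)) = 1 := by
  have h1 : ((qu R : R) - ((qu R)⁻¹ : Rˣ)) = algebraMap Kq R (q - q⁻¹) := by
    simp [qu]
  rw [h1, ← map_mul, inv_mul_cancel₀ q_sub_inv_ne_zero, map_one]

/-- Since $1-q^2=-q(q-q^{-1})$, multiplying by this unit removes the denominator of the bracket and
makes it comparable with geometric series in $q^2$. -/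
theorem bracket_mul_one_sub (u : Rˣ) :
    (1 - (qu R : R) ^ 2) * bracket u = -(qu R : R) * ((u : R) - ((u⁻¹ : Rˣ) : R)) := by
  have hd := bracket_denominator R
  have hx : (qu R : R) * ((qu R)⁻¹ : Rˣ) = 1 := (qu R).mul_inv
  rw [bracket]
  generalize algebraMap Kq R (q - q⁻¹)⁻¹ = d at *
  generalize (qu R : R) = x at *
  generalize (((qu R)⁻¹ : Rˣ) : R) = x' at *
  generalize (u : R) - ((u⁻¹ : Rˣ) : R) = w
  linear_combination (-x * w) * hd - d * w * hx

theorem isUnit_one_sub_sq : IsUnit (1 - (qu R : R) ^ 2) := by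
  have hd := bracket_denominator R
  have hx : (qu R : R) * ((qu R)⁻¹ : Rˣ) = 1 := (qu R).mul_inv
  refine IsUnit.of_mul_eq_one (-((qu R)⁻¹ : Rˣ) * algebraMap Kq R (q - q⁻¹)⁻¹) ?_
  generalize algebraMap Kq R (q - q⁻¹)⁻¹ = d at *
  generalize (qu R : R) = x at *
  generalize (((qu R)⁻¹ : Rˣ) : R) = x' at *
  linear_combination hd + d * x * hx

theorem bracket_qu_zpow (n : ℤ) : bracket (qu R ^ n) = algebraMap Kq R (qint n) := by
  have h : ∀ m : ℤ, ((qu R ^ m : Rˣ) : R) = algebraMap Kq R (q ^ m) := by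
    intro m
    rw [qu, ← map_zpow]
    simp only [Units.coe_map, Units.val_zpow_eq_zpow_val, Units.val_mk0]
    rfl
  rw [bracket, ← zpow_neg, h, h, qint, ← map_sub, ← map_mul, div_eq_inv_mul]

end

section

variable {R : Type} [CommRing R] [Algebra Kq R] [SerRing R]

variable (R) in
/-- The highest weight `λ q⁻¹`. -/
def hw : Rˣ := lm * (qu R)⁻¹

variable (R) in
/-- The coefficient of `F` on the dual canonical basis. -/
def coefF (k : ℕ) : R :=
  bracket (hw R * qu R ^ (-(k : ℤ))) * ((hw R * qu R ^ (-2 * (k : ℤ) - 1) : Rˣ) : R)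

variable (R) in
/-- The coefficient of `E` on the dual canonical basis. -/
def coefE (k : ℕ) : R :=
  bracket (qu R ^ ((k : ℤ) + 1)) * (((hw R)⁻¹ * qu R ^ (2 * (k : ℤ) + 1) : Rˣ) : R)

theorem mono_zero (i j : ℤ) : (mono lm i j 0 : R) = ((qu R ^ i * lm ^ j : Rˣ) : R) := by
  rw [mono, ZMod.val_zero, pow_zero, one_mul]

theorem mono_one (i j : ℤ) : (mono lm i j 1 : R) = -((qu R ^ i * lm ^ j : Rˣ) : R) := by
  have : (1 : ZMod 2).val = 1 := rfl
  rw [mono, this, pow_one, neg_one_mul]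

/-- With $\mu=\lambda q^{-1}$ both sides equal $q^{-k}(1-\lambda^2q^{-2k-2})/(1-q^2)$. After
cancelling the unit $1-q^2$ this is an identity between monomials in $q$, $q^{-k}$, $\lambda$ and
their inverses. -/
theorem phi_coef {k : ℕ} {p : R} (hp : IsSeries cf p fun e => Nat.card {y // phiDeg k y = e}) :
    mono lm (-(k : ℤ)) 0 0 * p = coefF R k := by
  have h1 := phi_series k hp
  refine (isUnit_one_sub_sq R).mul_left_cancel ?_
  rw [coefF, ← mul_assoc (1 - (qu R : R) ^ 2) (bracket _), bracket_mul_one_sub]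
  rw [mono_zero, mono_one] at h1
  rw [mono_zero]
  have e1 : qu R ^ (2 : ℤ) * (lm : Rˣ) ^ (0 : ℤ) = qu R ^ 2 := by
    rw [zpow_zero, mul_one]; rfl
  have e2 : qu R ^ (-2 * ((k : ℤ) + 1)) * (lm : Rˣ) ^ (2 : ℤ)
      = (qu R ^ (-(k : ℤ))) ^ 2 * ((qu R)⁻¹) ^ 2 * lm ^ 2 := by
    rw [← zpow_natCast (qu R ^ (-(k : ℤ))), ← zpow_mul, inv_pow, ← zpow_natCast (qu R), ← zpow_neg,
      ← zpow_add, ← zpow_natCast lm]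
    congr 2
    push_cast
    ring
  have e3 : hw R * qu R ^ (-2 * (k : ℤ) - 1) = lm * (qu R)⁻¹ ^ 2 * (qu R ^ (-(k : ℤ))) ^ 2 := by
    rw [hw, ← zpow_natCast (qu R ^ (-(k : ℤ))), ← zpow_mul, inv_pow, ← zpow_natCast (qu R),
      ← zpow_neg, ← zpow_neg_one, mul_assoc, mul_assoc, ← zpow_add, ← zpow_add]
    congr 2
    push_cast
    ring
  have e4 : (hw R * qu R ^ (-(k : ℤ)))⁻¹ = lm⁻¹ * qu R * (qu R ^ (-(k : ℤ)))⁻¹ := by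
    rw [hw, mul_inv, mul_inv, inv_inv]
  rw [e1, e2] at h1
  rw [e3, e4, hw, zpow_zero, mul_one]
  have hx : (qu R : R) * ((qu R)⁻¹ : Rˣ) = 1 := (qu R).mul_inv
  have hl : ((lm : Rˣ) : R) * (lm⁻¹ : Rˣ) = 1 := Units.mul_inv _
  have ht : ((qu R ^ (-(k : ℤ)) : Rˣ) : R) * ((qu R ^ (-(k : ℤ)))⁻¹ : Rˣ) = 1 := Units.mul_inv _
  simp only [Units.val_mul, Units.val_pow_eq_pow_val] at h1 ⊢
  generalize (qu R : R) = x at *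
  generalize (((qu R)⁻¹ : Rˣ) : R) = x' at *
  generalize ((qu R ^ (-(k : ℤ)) : Rˣ) : R) = t at *
  generalize (((qu R ^ (-(k : ℤ)))⁻¹ : Rˣ) : R) = t' at *
  generalize ((lm : Rˣ) : R) = l at *
  generalize ((lm⁻¹ : Rˣ) : R) = l' at *
  linear_combination t * h1 + l ^ 2 * x' ^ 2 * t ^ 3 * hx
    - t * ((x * x') ^ 2 * (t * t') * hl + (x * x' + 1) * (t * t') * hx + ht)

/-- The shift by $-k$ makes $1+q^2+\dots+q^{2k}$ symmetric, that is, equal to $[k+1]$. -/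
theorem psi_coef (k : ℕ) :
    mono lm (-(k : ℤ)) 0 0 * ∑ i : Fin (k + 1), mono lm (psiDeg k i).1 (psiDeg k i).2.1
      (psiDeg k i).2.2 = bracket (qu R ^ ((k : ℤ) + 1)) := by
  refine (isUnit_one_sub_sq R).mul_left_cancel ?_
  rw [bracket_mul_one_sub]
  have h1 : (1 - (qu R : R) ^ 2) * ∑ i : Fin (k + 1), mono lm (psiDeg k i).1 (psiDeg k i).2.1
      (psiDeg k i).2.2 = 1 - ((qu R ^ ((k : ℤ) + 1) : Rˣ) : R) ^ 2 := by
    have h2 : ∀ i : Fin (k + 1), (mono lm (psiDeg k i).1 (psiDeg k i).2.1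
      (psiDeg k i).2.2 : R) = ((qu R : R) ^ 2) ^ (i : ℕ) := by
      intro i
      rw [psiDeg_eq, mono_zero, zpow_zero, mul_one, zpow_mul, zpow_natCast]
      push_cast
      rfl
    rw [Finset.sum_congr rfl fun i _ => h2 i, Fin.sum_univ_eq_sum_range (fun i => ((qu R : R) ^ 2) ^ i),
      mul_neg_geom_sum, ← pow_mul, mul_comm 2, pow_mul]
    congr 2
  rw [mul_left_comm, h1, mono_zero, zpow_zero, mul_one]
  have e1 : qu R ^ (-(k : ℤ)) = qu R * (qu R ^ ((k : ℤ) + 1))⁻¹ := by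
    rw [← zpow_neg, ← zpow_one_add]; congr 1; ring
  rw [e1]
  have hy : ((qu R ^ ((k : ℤ) + 1) : Rˣ) : R) * ((qu R ^ ((k : ℤ) + 1))⁻¹ : Rˣ) = 1 :=
    Units.mul_inv _
  simp only [Units.val_mul]
  generalize ((qu R ^ ((k : ℤ) + 1) : Rˣ) : R) = y at *
  generalize (((qu R ^ ((k : ℤ) + 1))⁻¹ : Rˣ) : R) = y' at *
  linear_combination (-(qu R : R) * y) * hy

theorem mono_mul_mono (i j a b : ℤ) :
    (mono lm i j 0 : R) * mono lm a b 0 = mono lm (i + a) (j + b) 0 := by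
  rw [mono_zero, mono_zero, mono_zero, ← Units.val_mul, mul_mul_mul_comm, ← zpow_add, ← zpow_add]

variable {k : ℕ}

/-- As a graded vector space the induced module is the sum of the shifts of `M` by the degrees of
the basis over `Ω_k`; restriction along `ψ*` does not change it, and the final shift supplies the
factor $q^{-k}$. -/
theorem sdim_Ffun {M : SMod (Om k)} (hM : Obj (Bd R) (omPart k) M) :
    sdim R (Ffun k M).deg = coefF R k * sdim R M.deg := by
  obtain ⟨p, hp⟩ := exists_isSeries_card (R := R) (bd_phiDeg k isBoundedness)
  have h1 := (ind_grIso (phi_parityAut k) (fun _ _ => phi_mem_flagPart k) hM.1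
    (phi_hasHomogBasis k)).sdim_eq (R := R)
  rw [sdim_dsum_shift hM (finite_phiDeg k) (bd_phiDeg k isBoundedness) hp] at h1
  have h2 := Obj.ind isBoundedness (phi_parityAut k) (fun _ _ => phi_mem_flagPart k) hM
    (phi_hasHomogBasis k) (finite_phiDeg k) (bd_phiDeg k isBoundedness)
  refine (sdim_shift (-(k : ℤ)) 0 0 h2.2.2).trans ?_
  rw [← h1, ← mul_assoc, phi_coef hp]

theorem sdim_Efun {M : SMod (Om (k + 1))} (hM : Obj (Bd R) (omPart (k + 1)) M) :
    sdim R (Efun k M).deg = coefE R k * sdim R M.deg := by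
  have hp := isSeries_sum_mono (R := R) (psiDeg k)
  have h1 : sdim R (SMod.dsum fun i => M.shift (psiDeg k i)).deg
      = sdim R (M.ind (psi k) (flagPart k)).deg :=
    (ind_grIso (psi_parityAut k) (fun _ _ => psi_mem_flagPart k) hM.1
      (psi_hasHomogBasis k)).sdim_eq
  rw [sdim_dsum_shift (d := psiDeg k) hM (finite_psiDeg k) (bd_psiDeg k isBoundedness) hp] at h1
  have h2 := Obj.ind isBoundedness (psi_parityAut k) (fun _ _ => psi_mem_flagPart k) hM
    (psi_hasHomogBasis k) (finite_psiDeg k) (bd_psiDeg k isBoundedness)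
  refine (sdim_shift ((k : ℤ) + 2) (-1) 0 h2.2.2).trans ?_
  rw [← h1, ← mul_assoc]
  congr 1
  -- The shift of `E` is split into $q^{-k}$, which turns the geometric sum into $[k+1]$, and
  -- $q^{2k+2}\lambda^{-1}=\mu^{-1}q^{2k+1}$.
  have e1 : (mono lm ((k : ℤ) + 2) (-1) 0 : R)
      = mono lm (2 * (k : ℤ) + 2) (-1) 0 * mono lm (-(k : ℤ)) 0 0 := by
    rw [mono_mul_mono]
    congr 1
    ring
  have e2 : (hw R)⁻¹ * qu R ^ (2 * (k : ℤ) + 1) = qu R ^ (2 * (k : ℤ) + 2) * lm ^ (-1 : ℤ) := by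
    rw [hw, mul_inv, inv_inv, mul_assoc, ← zpow_one_add, mul_comm, zpow_neg_one]
    congr 2
    ring
  rw [e1, mul_assoc, psi_coef, coefE, e2, mono_zero, mul_comm]

theorem sdim_Kfun {M : SMod (Om k)} (hM : Obj (Bd R) (omPart k) M) :
    sdim R (Kfun k M).deg = ((hw R * qu R ^ (-2 * (k : ℤ)) : Rˣ) : R) * sdim R M.deg := by
  refine (sdim_shift (-2 * (k : ℤ) - 1) 1 0 hM.2.2).trans ?_
  have h : qu R ^ (-2 * (k : ℤ) - 1) * lm ^ (1 : ℤ) = hw R * qu R ^ (-2 * (k : ℤ)) := by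
    rw [hw, zpow_one, mul_comm, mul_assoc, ← zpow_neg_one, ← zpow_add]
    congr 2
    ring
  rw [mono_zero, h]

/-- The graded superdimension of `Ω_k` is the value of the Shapovalov form. -/
theorem sdim_omReg (k : ℕ) : sdim R (omReg k).deg = shap (hw R) k := by
  induction k with
  | zero =>
    rw [iso_omReg_zero.grIso.sdim_eq]
    refine (sdim_shift 0 0 0 (omSimple_obj (Bd := Bd R) isBoundedness).2.2).trans ?_
    rw [sdim_omSimple, mono_zero, shap, qfact]
    simp
  | succ k ih =>
    -- Computing the superdimension of `Ω_{k,k+1}` over both superrings gives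
    -- $[k+1]\,\mathrm{sdim}(\Omega_{k+1})=$ `coefF R k` $\cdot\,\mathrm{sdim}(\Omega_k)$. The
    -- Shapovalov form satisfies the same recursion, and $[k+1]$ is invertible.
    have hu : IsUnit (bracket (qu R ^ ((k : ℤ) + 1))) := by
      rw [bracket_qu_zpow]
      exact (IsUnit.mk0 _ (qint_ne_zero k)).map _
    refine hu.mul_left_cancel ?_
    have h1 : bracket (qu R ^ ((k : ℤ) + 1)) * shap (hw R) (k + 1)
        = coefF R k * shap (hw R) k := by
      rw [bracket_qu_zpow, shap, shap, qfact, Finset.prod_range_succ, Finset.prod_range_succ,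
        ← qfact, mul_inv, map_mul]
      have h2 : algebraMap Kq R (qint ((k : ℤ) + 1)) * algebraMap Kq R (qint ((k : ℤ) + 1))⁻¹ = 1 := by
        rw [← map_mul, mul_inv_cancel₀ (qint_ne_zero k), map_one]
      rw [coefF]
      linear_combination (algebraMap Kq R (qfact k)⁻¹ * (∏ j ∈ Finset.range k,
        ((hw R * qu R ^ (-2 * (j : ℤ) - 1) : Rˣ) : R) * bracket (hw R * qu R ^ (-(j : ℤ)))) *
        (((hw R * qu R ^ (-2 * (k : ℤ) - 1) : Rˣ) : R) * bracket (hw R * qu R ^ (-(k : ℤ))))) * h2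
    rw [h1, ← ih]
    obtain ⟨p, hp⟩ := exists_isSeries_card (R := R) (bd_phiDeg k isBoundedness)
    have hΩ := omReg_obj (Bd := Bd R) isBoundedness
    have e1 : sdim R (flagPart k) = p * sdim R (omReg k).deg := by
      rw [← sdim_dsum_shift (hΩ k) (finite_phiDeg k) (bd_phiDeg k isBoundedness) hp]
      exact (((phi_hasHomogBasis k).iso (part_isInternal _)
        (IsGraded.res (fun _ _ => phi_mem_flagPart k) (regular_isGraded (flagDeg k)))
        (dsum_isGraded fun x => IsGraded.shift omReg_isGraded _)
        (hasHomogBasis_dsum_omReg (phiDeg k))).grIso).sdim_eq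
    have e2 : sdim R (flagPart k) = (∑ i : Fin (k + 1), mono lm (psiDeg k i).1 (psiDeg k i).2.1
        (psiDeg k i).2.2) * sdim R (omReg (k + 1)).deg := by
      rw [← sdim_dsum_shift (hΩ (k + 1)) (finite_psiDeg k) (bd_psiDeg k isBoundedness)
        (isSeries_sum_mono (psiDeg k))]
      exact (((psi_hasHomogBasis k).iso (part_isInternal _)
        (IsGraded.res (fun _ _ => psi_mem_flagPart k) (regular_isGraded (flagDeg k)))
        (dsum_isGraded fun x => IsGraded.shift omReg_isGraded _)
        (hasHomogBasis_dsum_omReg (psiDeg k))).grIso).sdim_eq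
    rw [← psi_coef, mul_assoc, ← e2, e1, ← mul_assoc, phi_coef hp]

end

end VermaCat
end

noncomputable section

namespace VermaCat

open SerRing

/-! ### Verma modules and their duals -/

section

variable {R : Type} [CommRing R] [Algebra Kq R]

theorem ugen_rel {x y : FreeAlgebra Kq UqGen} (h : UqRel x y) :
    RingQuot.mkAlgHom Kq UqRel x = RingQuot.mkAlgHom Kq UqRel y :=
  RingQuot.mkAlgHom_rel Kq h

variable (R) in
/-- The images of the elements of `U_q(sl2)` after extension of scalars. -/
def toOver : FreeAlgebra Kq UqGen →ₐ[Kq] UqOver R :=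
  (Algebra.TensorProduct.includeRight : Uq →ₐ[Kq] UqOver R).comp (RingQuot.mkAlgHom Kq UqRel)

theorem toOver_rel {x y : FreeAlgebra Kq UqGen} (h : UqRel x y) : toOver R x = toOver R y :=
  congrArg (Algebra.TensorProduct.includeRight : Uq →ₐ[Kq] UqOver R) (ugen_rel h)

theorem rgen_Kinv_K : rgen R .Kinv * rgen R .K = 1 := by
  have h := toOver_rel (R := R) .Kinv_K
  rwa [map_mul, map_one] at h

theorem rgen_K_F : rgen R .K * rgen R .F
    = algebraMap Kq R (q ^ 2)⁻¹ • (rgen R .F * rgen R .K) := by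
  have h := toOver_rel (R := R) .K_F
  rwa [map_mul, map_smul, map_mul, ← algebraMap_smul R] at h

theorem rgen_E_F : rgen R .E * rgen R .F
    = rgen R .F * rgen R .E + algebraMap Kq R (q - q⁻¹)⁻¹ • (rgen R .K - rgen R .Kinv) := by
  have h := toOver_rel (R := R) .E_F
  rw [map_sub, map_mul, map_mul, map_smul, map_sub, ← algebraMap_smul R] at h
  exact sub_eq_iff_eq_add'.mp h

/-- A set of vectors stable under the generators spans a subrepresentation. -/
theorem smul_mem_of_rgen {V : Type*} [AddCommGroup V] [Module R V] [Module (UqOver R) V]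
    [IsScalarTower R (UqOver R) V] {N : Submodule R V}
    (h : ∀ g, ∀ x ∈ N, rgen R g • x ∈ N) (a : UqOver R) : ∀ x ∈ N, a • x ∈ N := by
  have h1 : ∀ z : FreeAlgebra Kq UqGen, ∀ x ∈ N, toOver R z • x ∈ N := by
    intro z
    induction z using FreeAlgebra.induction with
    | grade0 r =>
      intro x hx
      rw [AlgHom.commutes, IsScalarTower.algebraMap_apply Kq R (UqOver R), algebraMap_smul]
      exact N.smul_mem _ hx
    | grade1 g => exact h g
    | mul a b ha hb =>
      intro x hx
      rw [map_mul, mul_smul]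
      exact ha _ (hb _ hx)
    | add a b ha hb =>
      intro x hx
      rw [map_add, add_smul]
      exact N.add_mem (ha _ hx) (hb _ hx)
  induction a using TensorProduct.induction_on with
  | zero => intro x _; rw [zero_smul]; exact N.zero_mem
  | tmul r u =>
    intro x hx
    obtain ⟨z, rfl⟩ := RingQuot.mkAlgHom_surjective Kq UqRel u
    have h2 : (r ⊗ₜ[Kq] RingQuot.mkAlgHom Kq UqRel z : UqOver R) = r • toOver R z := by
      change _ = r • ((1 : R) ⊗ₜ[Kq] RingQuot.mkAlgHom Kq UqRel z)
      rw [TensorProduct.smul_tmul', smul_eq_mul, mul_one]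
      rfl
    refine (congrArg (· ∈ N) (congrArg (· • x) h2)).mpr ?_
    rw [smul_assoc]
    exact N.smul_mem _ (h1 z x hx)
  | add a b ha hb =>
    intro x hx
    rw [add_smul]
    exact N.add_mem (ha _ hx) (hb _ hx)

/-- The vector `F^k m_0`. -/
def vermaVec (μ : R) (k : ℕ) : Verma R μ := Submodule.Quotient.mk (rgen R .F ^ k)

theorem rgen_F_smul_vermaVec (μ : R) (k : ℕ) :
    rgen R .F • vermaVec μ k = vermaVec μ (k + 1) := by
  rw [vermaVec, vermaVec, pow_succ', ← smul_eq_mul, Submodule.Quotient.mk_smul]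

theorem smul_vermaVec_zero (μ : R) (a : UqOver R) :
    a • vermaVec μ 0 = Submodule.Quotient.mk a := by
  rw [vermaVec, pow_zero, ← Submodule.Quotient.mk_smul, smul_eq_mul, mul_one]

theorem rgen_E_smul_vermaVec_zero (μ : R) : rgen R .E • vermaVec μ 0 = 0 := by
  rw [smul_vermaVec_zero]
  exact (Submodule.Quotient.mk_eq_zero _).mpr (Ideal.subset_span (Or.inl rfl))

theorem rgen_K_smul_vermaVec_zero (μ : R) : rgen R .K • vermaVec μ 0 = μ • vermaVec μ 0 := by
  rw [← algebraMap_smul (UqOver R) μ, smul_vermaVec_zero, smul_vermaVec_zero]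
  exact (Submodule.Quotient.eq _).mpr (Ideal.subset_span (Or.inr rfl))

theorem smul_comm_over {V : Type*} [AddCommGroup V] [Module R V] [Module (UqOver R) V]
    [IsScalarTower R (UqOver R) V] (a : UqOver R) (r : R) (x : V) : a • r • x = r • a • x := by
  rw [← algebraMap_smul (UqOver R) r x, ← algebraMap_smul (UqOver R) r (a • x), ← mul_smul,
    ← mul_smul, Algebra.commutes]

/-- Only the fact that these are eigenvectors is needed for the spanning argument, so the eigenvalue
is left unspecified; it is recorded as a unit in order to treat the inverse of `K` too. -/
theorem rgen_K_smul_vermaVec (μ : Rˣ) (k : ℕ) : ∃ u : Rˣ,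
    rgen R .K • vermaVec (μ : R) k = (u : R) • vermaVec (μ : R) k := by
  induction k with
  | zero => exact ⟨μ, rgen_K_smul_vermaVec_zero _⟩
  | succ k ih =>
    obtain ⟨u, hu⟩ := ih
    refine ⟨Units.map (algebraMap Kq R).toMonoidHom
      (Units.mk0 _ (inv_ne_zero (pow_ne_zero 2 q_ne_zero))) * u, ?_⟩
    rw [← rgen_F_smul_vermaVec, ← mul_smul, rgen_K_F, smul_assoc, mul_smul, hu, smul_comm_over,
      ← mul_smul]
    rfl

theorem rgen_Kinv_smul_vermaVec (μ : Rˣ) (k : ℕ) : ∃ u : Rˣ,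
    rgen R .Kinv • vermaVec (μ : R) k = (u : R) • vermaVec (μ : R) k := by
  obtain ⟨u, hu⟩ := rgen_K_smul_vermaVec μ k
  refine ⟨u⁻¹, ?_⟩
  have h1 : rgen R .Kinv • rgen R .K • vermaVec (μ : R) k = vermaVec (μ : R) k := by
    rw [← mul_smul, rgen_Kinv_K, one_smul]
  rw [hu, smul_comm_over] at h1
  conv_rhs => rw [← h1]
  rw [← mul_smul, Units.inv_mul, one_smul]

/-- The span contains the cyclic vector, so stability under the generators suffices. For `E` it
follows by induction from $EF=FE+(K-K^{-1})/(q-q^{-1})$. -/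
theorem span_vermaVec (μ : Rˣ) : Submodule.span R (Set.range (vermaVec (μ : R))) = ⊤ := by
  have hv : ∀ k, vermaVec (μ : R) k ∈ Submodule.span R (Set.range (vermaVec (μ : R))) :=
    fun k => Submodule.subset_span ⟨k, rfl⟩
  have hcl : ∀ a : UqOver R,
      (∀ k, a • vermaVec (μ : R) k ∈ Submodule.span R (Set.range (vermaVec (μ : R)))) →
      ∀ x ∈ Submodule.span R (Set.range (vermaVec (μ : R))),
        a • x ∈ Submodule.span R (Set.range (vermaVec (μ : R))) := by
    intro a ha x hx
    induction hx using Submodule.span_induction with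
    | mem x hx => obtain ⟨k, rfl⟩ := hx; exact ha k
    | zero => rw [smul_zero]; exact Submodule.zero_mem _
    | add x y _ _ hx hy => rw [smul_add]; exact Submodule.add_mem _ hx hy
    | smul r x _ hx => rw [smul_comm_over]; exact Submodule.smul_mem _ r hx
  have hF := hcl (rgen R .F) fun k => by rw [rgen_F_smul_vermaVec]; exact hv _
  have hK := hcl (rgen R .K) fun k => by
    obtain ⟨u, hu⟩ := rgen_K_smul_vermaVec μ k
    rw [hu]; exact Submodule.smul_mem _ _ (hv k)
  have hKi := hcl (rgen R .Kinv) fun k => by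
    obtain ⟨u, hu⟩ := rgen_Kinv_smul_vermaVec μ k
    rw [hu]; exact Submodule.smul_mem _ _ (hv k)
  have hE := hcl (rgen R .E) fun k => by
    induction k with
    | zero => rw [rgen_E_smul_vermaVec_zero]; exact Submodule.zero_mem _
    | succ k ih =>
      rw [← rgen_F_smul_vermaVec, ← mul_smul, rgen_E_F, add_smul, mul_smul, smul_assoc, sub_smul]
      exact Submodule.add_mem _ (hF _ ih) (Submodule.smul_mem _ _
        (Submodule.sub_mem _ (hK _ (hv k)) (hKi _ (hv k))))
  refine Submodule.eq_top_iff'.mpr fun x => ?_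
  obtain ⟨a, rfl⟩ := Submodule.Quotient.mk_surjective _ x
  rw [← smul_vermaVec_zero]
  refine smul_mem_of_rgen (fun g => ?_) a _ (hv 0)
  cases g
  exacts [hE, hF, hK, hKi]

theorem qfact_ne_zero (k : ℕ) : qfact k ≠ 0 :=
  Finset.prod_ne_zero_iff.mpr fun i _ => qint_ne_zero i

theorem canon_eq (μ : R) (k : ℕ) :
    canon R μ k = algebraMap Kq R (qfact k)⁻¹ • vermaVec μ k := by
  rw [canon, vermaVec, IsScalarTower.algebraMap_apply Kq R (UqOver R), ← Algebra.smul_def]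
  rfl

theorem vermaVec_eq (μ : R) (k : ℕ) :
    vermaVec μ k = algebraMap Kq R (qfact k) • canon R μ k := by
  rw [canon_eq, ← mul_smul, ← map_mul, mul_inv_cancel₀ (qfact_ne_zero k), map_one, one_smul]

theorem span_canon (μ : Rˣ) : Submodule.span R (Set.range (canon R (μ : R))) = ⊤ := by
  rw [eq_top_iff, ← span_vermaVec μ, Submodule.span_le]
  rintro _ ⟨k, rfl⟩
  rw [vermaVec_eq]
  exact Submodule.smul_mem _ _ (Submodule.subset_span ⟨k, rfl⟩)

/-- The vector $m^0$ of the twisted module is a highest weight vector of weight `μ`, hence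
annihilated by the left ideal defining the Verma module. -/
theorem starRep_eq_zero_of_mem (μ : Rˣ) {a : UqOver R} (ha : a ∈ vermaIdeal R (μ : R)) :
    starRep μ a (Finsupp.single 0 1) = 0 := by
  induction ha using Submodule.span_induction with
  | mem a ha =>
    rcases ha with rfl | rfl
    · rw [starRep_gen]
      exact starE_single_zero μ 1
    · rw [map_sub, AlgHom.commutes, starRep_gen, LinearMap.sub_apply, Module.algebraMap_end_apply]
      change starK μ 1 _ - _ = 0
      rw [starK_single, Finsupp.smul_single, smul_eq_mul, one_mul, mul_one, zpow_one]
      simp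
  | zero => rw [map_zero, LinearMap.zero_apply]
  | add x y _ _ hx hy => rw [map_add, LinearMap.add_apply, hx, hy, add_zero]
  | smul a x _ hx => rw [smul_eq_mul, map_mul, Module.End.mul_apply, hx, map_zero]

/-- The homomorphism from the Verma module to the twisted module that sends `m_0` to `m^0`. -/
def vermaToStar (μ : Rˣ) : Verma R (μ : R) →ₗ[R] (ℕ →₀ R) :=
  ((vermaIdeal R (μ : R)).restrictScalars R).liftQ
    (LinearMap.applyₗ (Finsupp.single 0 1 : ℕ →₀ R) ∘ₗ (starRep μ).toLinearMap)
    (fun _ ha => starRep_eq_zero_of_mem μ ha) ∘ₗ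
  (Submodule.Quotient.restrictScalarsEquiv R (vermaIdeal R (μ : R))).symm.toLinearMap

theorem vermaToStar_mk (μ : Rˣ) (a : UqOver R) :
    vermaToStar μ (Submodule.Quotient.mk a) = starRep μ a (Finsupp.single 0 1) := rfl

theorem vermaToStar_smul (μ : Rˣ) (a : UqOver R) (x : Verma R (μ : R)) :
    vermaToStar μ (a • x) = starRep μ a (vermaToStar μ x) := by
  obtain ⟨b, rfl⟩ := Submodule.Quotient.mk_surjective _ x
  rw [← Submodule.Quotient.mk_smul, vermaToStar_mk, vermaToStar_mk, smul_eq_mul, map_mul,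
    Module.End.mul_apply]

/-- The coefficients of `starF` are the successive factors of the Shapovalov form, so powers of `F`
applied to $m^0$ accumulate the product. -/
theorem vermaToStar_canon (μ : Rˣ) (k : ℕ) :
    vermaToStar μ (canon R (μ : R) k) = Finsupp.single k (shap μ k) := by
  have h : vermaToStar μ (vermaVec (μ : R) k) = Finsupp.single k (∏ j ∈ Finset.range k,
      ((μ * qu R ^ (-2 * (j : ℤ) - 1) : Rˣ) : R) * bracket (μ * qu R ^ (-(j : ℤ)))) := by
    induction k with
    | zero =>
      rw [vermaVec, vermaToStar_mk, pow_zero, map_one, Finset.prod_range_zero, Module.End.one_apply]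
    | succ k ih =>
      rw [← rgen_F_smul_vermaVec, vermaToStar_smul, ih, starRep_gen]
      change starF μ _ = _
      rw [starF_single, Finset.prod_range_succ, mul_comm (bracket _)]
  rw [canon_eq, map_smul, h, Finsupp.smul_single, smul_eq_mul, shap]

/-- The canonical basis vectors as a map from the free module. -/
def canonComb (μ : Rˣ) : (ℕ →₀ R) →ₗ[R] Verma R (μ : R) :=
  Finsupp.linearCombination R (canon R (μ : R))

theorem canonComb_surjective (μ : Rˣ) : Function.Surjective (canonComb μ) := by
  rw [← LinearMap.range_eq_top, canonComb, Finsupp.range_linearCombination, span_canon]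

theorem vermaToStar_canonComb (μ : Rˣ) (c : ℕ →₀ R) (k : ℕ) :
    vermaToStar μ (canonComb μ c) k = c k * shap μ k := by
  induction c using Finsupp.induction_linear with
  | zero => rw [map_zero, map_zero, Finsupp.zero_apply, zero_mul]
  | add f g hf hg => rw [map_add, map_add, Finsupp.add_apply, Finsupp.add_apply, hf, hg, add_mul]
  | single i r =>
    rw [canonComb, Finsupp.linearCombination_single, map_smul, vermaToStar_canon,
      Finsupp.smul_single, smul_eq_mul]
    by_cases h : i = k
    · subst h; rw [Finsupp.single_eq_same, Finsupp.single_eq_same]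
    · rw [Finsupp.single_eq_of_ne' h, Finsupp.single_eq_of_ne' h, zero_mul]

/-- The canonical vectors span, and on them the map is diagonal with nonzero entries in a domain.
The same computation proves their independence in `canonEquiv`. -/
theorem vermaToStar_injective [IsDomain R] (μ : Rˣ) (h : ∀ k, shap μ k ≠ 0) :
    Function.Injective (vermaToStar μ) := by
  refine (injective_iff_map_eq_zero _).mpr fun x hx => ?_
  obtain ⟨c, rfl⟩ := canonComb_surjective μ x
  have : c = 0 := Finsupp.ext fun k => by
    have h1 := vermaToStar_canonComb μ c k
    rw [hx, Finsupp.zero_apply, eq_comm] at h1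
    exact (mul_eq_zero.mp h1).resolve_right (h k)
  rw [this, map_zero]

/-- The canonical basis of the Verma module. -/
def canonEquiv [IsDomain R] (μ : Rˣ) (h : ∀ k, shap μ k ≠ 0) :
    (ℕ →₀ R) ≃ₗ[R] Verma R (μ : R) :=
  LinearEquiv.ofBijective (canonComb μ) ⟨by
    refine (injective_iff_map_eq_zero _).mpr fun c hc => Finsupp.ext fun k => ?_
    have h1 := vermaToStar_canonComb μ c k
    rw [hc, map_zero, Finsupp.zero_apply, eq_comm] at h1
    exact (mul_eq_zero.mp h1).resolve_right (h k), canonComb_surjective μ⟩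

theorem canonEquiv_single [IsDomain R] (μ : Rˣ) (h : ∀ k, shap μ k ≠ 0) (k : ℕ) (r : R) :
    canonEquiv μ h (Finsupp.single k r) = r • canon R (μ : R) k :=
  Finsupp.linearCombination_single R r k

theorem vermaToStar_dualCanon (μ : Rˣ) {k : ℕ} (h : IsUnit (shap μ k)) :
    vermaToStar μ (dualCanon μ k) = Finsupp.single k 1 := by
  rw [dualCanon, map_smul, vermaToStar_canon, Finsupp.smul_single, smul_eq_mul,
    Ring.inverse_mul_cancel _ h]

/-- When the Shapovalov form is invertible the Verma module is the twisted module. -/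
def vermaEquivStar [IsDomain R] (μ : Rˣ) (h : ∀ k, IsUnit (shap μ k)) :
    Verma R (μ : R) ≃ₗ[R] (ℕ →₀ R) :=
  LinearEquiv.ofBijective (vermaToStar μ)
    ⟨vermaToStar_injective μ fun k => (h k).ne_zero, by
      rw [← LinearMap.range_eq_top, eq_top_iff, ← Finsupp.iSup_lsingle_range]
      refine iSup_le fun k => ?_
      rintro _ ⟨r, rfl⟩
      refine ⟨r • dualCanon μ k, ?_⟩
      rw [map_smul, vermaToStar_dualCanon μ (h k), Finsupp.smul_single, smul_eq_mul, mul_one]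
      rfl⟩

/-- The bracket is an invertible multiple of `1 - u²`. -/
theorem associated_bracket (u : Rˣ) : Associated (1 - (u : R) ^ 2) (bracket u) := by
  have hc : algebraMap Kq R (q - q⁻¹)⁻¹ = ((Units.map (algebraMap Kq R).toMonoidHom
    (Units.mk0 _ (inv_ne_zero q_sub_inv_ne_zero)) : Rˣ) : R) := rfl
  refine ⟨-(u⁻¹ * Units.map (algebraMap Kq R).toMonoidHom
    (Units.mk0 _ (inv_ne_zero q_sub_inv_ne_zero))), ?_⟩
  rw [bracket, Units.val_neg, Units.val_mul, ← hc]
  have hu : (u : R) * (u⁻¹ : Rˣ) = 1 := u.mul_inv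
  linear_combination ((u : R) * algebraMap Kq R (q - q⁻¹)⁻¹) * hu

end

/-! ### Nonvanishing and invertibility of the Shapovalov form -/

section

variable {R : Type} [CommRing R] [Algebra Kq R] [SerRing R]

theorem hw_mul_sq (j : ℕ) : (((hw R * qu R ^ (-(j : ℤ)) : Rˣ) : R)) ^ 2
    = ((qu R ^ (-2 * ((j : ℤ) + 1)) * lm ^ (2 : ℤ) : Rˣ) : R) := by
  rw [← Units.val_pow_eq_pow_val]
  congr 1
  rw [hw, mul_assoc, ← zpow_neg_one, ← zpow_add, mul_pow, mul_comm, ← zpow_natCast, ← zpow_mul]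
  congr 2
  push_cast
  ring

/-- Up to units the form is a product of factors $1-\lambda^2q^{-2(j+1)}$, each with constant
coefficient 1. -/
theorem shap_ne_zero (k : ℕ) : shap (hw R) k ≠ 0 := by
  have := SerRing.isDomain R
  refine mul_ne_zero ((IsUnit.mk0 _ (inv_ne_zero (qfact_ne_zero k))).map _).ne_zero
    (Finset.prod_ne_zero_iff.mpr fun j _ => mul_ne_zero (Units.ne_zero _) ?_)
  rw [← (associated_bracket _).ne_zero_iff]
  intro h
  have h1 := congrArg (fun r => cf r 0 0) h
  rw [hw_mul_sq, ← mul_one ((_ : Rˣ) : R)] at h1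
  simp only [cf_sub, cf_unit_mul, cf_one, cf_zero] at h1
  norm_num at h1

end

/-- The factor $1-\lambda^2q^{-2(j+1)}$ is inverted by the series $\sum_n q^{-2(j+1)n}\lambda^{2n}$.
Its $q$-degrees are unbounded below and its $\lambda$-degrees unbounded above, but the support lies
in a cone. -/
theorem isUnit_shap_hat (k : ℕ) : IsUnit (shap (hw HatRing) k) := by
  classical
  refine IsUnit.mul ((IsUnit.mk0 _ (inv_ne_zero (qfact_ne_zero k))).map _)
    ((Finset.prod_induction _ IsUnit (fun _ _ => IsUnit.mul) isUnit_one) fun j _ =>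
      (Units.isUnit _).mul ?_)
  rw [← (associated_bracket _).isUnit_iff, hw_mul_sq]
  obtain ⟨g, hg⟩ := exists_cf (R := HatRing)
    (fun a b => if ∃ n : ℕ, a = -2 * ((j : ℤ) + 1) * n ∧ b = 2 * n then 1 else 0)
    -- With slope `j + 1` the exponents of the geometric series lie on the boundary line of the
    -- cone: $-2(j+1)n+(j+1)\cdot 2n=0$.
    (show ConeBounded _ from ⟨j + 1, 0, 0, fun a b h => by
      obtain ⟨n, rfl, rfl⟩ := (ite_ne_right_iff.mp h).1
      refine ⟨by positivity, ?_⟩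
      push_cast
      nlinarith⟩)
  refine IsUnit.of_mul_eq_one g (cf_ext fun a b => ?_)
  rw [sub_mul, one_mul, cf_sub, cf_unit_mul, cf_one, hg, hg]
  by_cases h0 : a = 0 ∧ b = 0
  · obtain ⟨rfl, rfl⟩ := h0
    rw [if_pos ⟨0, by simp, by simp⟩, if_neg, if_pos ⟨rfl, rfl⟩, sub_zero]
    rintro ⟨n, -, hn⟩
    omega
  · rw [if_neg h0, sub_eq_zero]
    refine if_congr ⟨?_, ?_⟩ rfl rfl
    · rintro ⟨n, rfl, rfl⟩
      -- Away from the bidegree zero the exponent in the geometric series is positive, and lowering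
      -- it by one matches the shifted copy that is subtracted.
      obtain _ | n := n
      · exact (h0 ⟨by simp, by simp⟩).elim
      · exact ⟨n, by push_cast; ring, by push_cast; ring⟩
    · rintro ⟨n, h1, h2⟩
      exact ⟨n + 1, by push_cast; linarith, by push_cast; linarith⟩

end VermaCat
end

noncomputable section

namespace VermaCat

open SerRing

/-! ### The Grothendieck group of projective modules -/

section

variable {R : Type} [CommRing R] [Algebra Kq R] [SerRing R] {k : ℕ}

theorem omReg_isProj {Bd : (ℤ → ℤ → Prop) → Prop} (hB : IsBoundedness Bd) (k : ℕ) :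
    IsProj (Obj Bd (omPart k)) (omReg k) :=
  isProj_of_hasHomogBasis (omReg_obj hB k) omReg_hasHomogBasis

/-- The graded superdimension on the split Grothendieck group. -/
def K0.sdimMap (R : Type) [CommRing R] [Algebra Kq R] [SerRing R] (k : ℕ) :
    K0 (cf : R → ℤ → ℤ → ℚ) (IsProj (Obj (Bd R) (omPart k))) →ₗ[R] R :=
  Submodule.liftQ _ (Finsupp.linearCombination R fun M => sdim R M.1.deg) (by
    rw [Submodule.span_le]
    rintro r ⟨n, M, X, m, p, hp, hi, rfl⟩
    change Finsupp.linearCombination R _ _ = 0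
    simp only [map_sub, map_sum, Finsupp.linearCombination_single, one_smul]
    rw [sdim_locSum M.2.1 (fun j => (X j).1) (fun j => (X j).2.1) m p hp hi, sub_eq_zero]
    rfl)

theorem K0.sdimMap_cls (M : SMod (Om k)) (h : IsProj (Obj (Bd R) (omPart k)) M) :
    K0.sdimMap R k (K0.cls cf _ M h) = sdim R M.deg := by
  refine (Submodule.liftQ_apply _ _ _).trans ?_
  rw [Finsupp.linearCombination_single, one_smul]

/-- A projective object is free on homogeneous generators, that is, a locally finite sum of shifts
of `Ω_k`; the sum relation gives the coefficient. -/
theorem K0.exists_cls_eq_smul (M : SMod (Om k)) (h : IsProj (Obj (Bd R) (omPart k)) M) :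
    ∃ p : R, K0.cls (cf : R → ℤ → ℤ → ℚ) _ M h
      = p • K0.cls cf _ (omReg k) (omReg_isProj isBoundedness k) := by
  obtain ⟨ι, d, hb⟩ := exists_hasHomogBasis isBoundedness (omReg_obj isBoundedness k) h
  obtain ⟨p, hp⟩ := exists_isSeries_card (R := R) (hb.bd isBoundedness h.1)
  have h1 : p • Finsupp.single ⟨omReg k, omReg_isProj isBoundedness k⟩ (1 : R)
      = Finsupp.single (⟨omReg k, omReg_isProj isBoundedness k⟩ :
          {M // IsProj (Obj (Bd R) (omPart k)) M}) p := by
    rw [Finsupp.smul_single, smul_eq_mul, mul_one]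
  refine ⟨p, ?_⟩
  refine (Submodule.Quotient.eq (p := Submodule.span R
    (sumRel cf (IsProj (Obj (Bd R) (omPart k))))) (x := Finsupp.single ⟨M, h⟩ 1)
    (y := p • Finsupp.single ⟨omReg k, omReg_isProj isBoundedness k⟩ 1)).mpr
    (Submodule.subset_span ⟨1, ⟨M, h⟩, fun _ => ⟨omReg k, omReg_isProj isBoundedness k⟩,
      fun _ e => Nat.card {i // d i = e}, fun _ => p, fun _ => hp,
      hb.iso_locSum h.1.1 h.1.2.1, by
        rw [Finset.univ_unique, Finset.sum_singleton, h1]⟩)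

/-- The class of `Ω_k` generates because projectives are graded free. It has no annihilator: the
superdimension sends its multiple by `r` to `r * shap (hw R) k`, and the Shapovalov value is nonzero
in a domain. -/
theorem K0.toSpanSingleton_bijective : Function.Bijective (LinearMap.toSpanSingleton R _
    (K0.cls (cf : R → ℤ → ℤ → ℚ) _ (omReg k)
      (omReg_isProj (isBoundedness (R := R)) k))) := by
  have := SerRing.isDomain R
  constructor
  · refine (injective_iff_map_eq_zero _).mpr fun r hr => ?_
    have h1 := congrArg (K0.sdimMap R k) hr
    rw [LinearMap.toSpanSingleton_apply, map_smul, K0.sdimMap_cls, map_zero, sdim_omReg,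
      smul_eq_mul] at h1
    exact (mul_eq_zero.mp h1).resolve_right (shap_ne_zero k)
  · rw [← LinearMap.range_eq_top, eq_top_iff]
    intro x _
    obtain ⟨f, rfl⟩ := Submodule.Quotient.mk_surjective _ x
    induction f using Finsupp.induction_linear with
    | zero => exact Submodule.zero_mem _
    | add f g hf hg => exact Submodule.add_mem _ (hf trivial) (hg trivial)
    | single M r =>
      obtain ⟨p, hp⟩ := K0.exists_cls_eq_smul M.1 M.2
      have h1 : (Submodule.Quotient.mk (Finsupp.single M r) :
          K0 (cf : R → ℤ → ℤ → ℚ) (IsProj (Obj (Bd R) (omPart k))))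
          = r • K0.cls cf _ M.1 M.2 := by
        refine congrArg Submodule.Quotient.mk
          (a₂ := r • Finsupp.single (⟨M.1, M.2⟩ : {M // IsProj (Obj (Bd R) (omPart k)) M}) 1) ?_
        rw [Finsupp.smul_single, smul_eq_mul, mul_one]
      refine ⟨r * p, ?_⟩
      refine Eq.trans ?_ h1.symm
      rw [LinearMap.toSpanSingleton_apply, hp, mul_smul]
      rfl

/-- The split Grothendieck group is free of rank one on the class of `Ω_k`. -/
def K0.equiv (R : Type) [CommRing R] [Algebra Kq R] [SerRing R] (k : ℕ) :
    K0 (cf : R → ℤ → ℤ → ℚ) (IsProj (Obj (Bd R) (omPart k))) ≃ₗ[R] R :=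
  (LinearEquiv.ofBijective _ K0.toSpanSingleton_bijective).symm

/-- The coordinate of a class is the quotient of superdimensions. It is stated as a product because
the Shapovalov value need not be invertible. -/
theorem K0.equiv_cls_mul (M : SMod (Om k)) (h : IsProj (Obj (Bd R) (omPart k)) M) :
    K0.equiv R k (K0.cls cf _ M h) * shap (hw R) k = sdim R M.deg := by
  have h1 := (LinearEquiv.ofBijective _ (K0.toSpanSingleton_bijective (R := R) (k := k))).apply_symm_apply
    (K0.cls cf _ M h)
  have h2 := congrArg (K0.sdimMap R k) h1
  rw [LinearEquiv.ofBijective_apply, LinearMap.toSpanSingleton_apply, map_smul, K0.sdimMap_cls,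
    K0.sdimMap_cls, sdim_omReg, smul_eq_mul] at h2
  exact h2

end

/-! ### The representations on the Grothendieck groups -/

section

variable {R : Type} [CommRing R] {G : ℕ → Type 1} [∀ k, AddCommGroup (G k)] [∀ k, Module R (G k)]

open Classical in
/-- A direct sum of modules that are free of rank one is a free module. -/
def sumEquiv (e : ∀ k, G k ≃ₗ[R] R) : (⨁ k, G k) ≃ₗ[R] (ℕ →₀ R) :=
  (DFinsupp.mapRange.linearEquiv e).trans (finsuppLequivDFinsupp R).symm

theorem sumEquiv_lof (e : ∀ k, G k ≃ₗ[R] R) (k : ℕ) (x : G k) :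
    sumEquiv e (DirectSum.lof R ℕ G k x) = Finsupp.single k (e k x) := by
  classical
  rw [sumEquiv, LinearEquiv.trans_apply, LinearEquiv.symm_apply_eq]
  have h1 : DFinsupp.mapRange.linearEquiv e (DirectSum.lof R ℕ G k x)
      = DFinsupp.single k (e k x) := by
    change DFinsupp.mapRange.linearEquiv e (DFinsupp.single k x) = _
    exact DFinsupp.mapRange_single (hf := fun i => map_zero (e i))
  rw [h1]
  exact (Finsupp.toDFinsupp_single k (e k x)).symm

/-- Transport of a representation along a linear isomorphism. -/
def conjRep {A V W : Type*} [Ring A] [Algebra R A] [AddCommGroup V] [Module R V] [AddCommGroup W]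
    [Module R W] (e : V ≃ₗ[R] W) (τ : A →ₐ[R] Module.End R W) : A →ₐ[R] Module.End R V :=
  (LinearEquiv.conjAlgEquiv R e.symm).toAlgHom.comp τ

theorem apply_conjRep {A V W : Type*} [Ring A] [Algebra R A] [AddCommGroup V] [Module R V]
    [AddCommGroup W] [Module R W] (e : V ≃ₗ[R] W) (τ : A →ₐ[R] Module.End R W) (a : A) (x : V) :
    e (conjRep e τ a x) = τ a (e x) := by
  change e (e.symm (τ a (e x))) = _
  rw [LinearEquiv.apply_symm_apply]

end

section

variable {R : Type} [CommRing R] [Algebra Kq R] [SerRing R]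

/-- Operators that correspond to the action on the twisted module under the graded superdimension
are induced by the functors. -/
theorem isInducedAction_of_sdim {P : ∀ k, SMod (Om k) → Prop} {G : ℕ → Type 1}
    [∀ k, AddCommGroup (G k)] [∀ k, Module R (G k)] {cls : ∀ k (M : SMod (Om k)), P k M → G k}
    {ρ : UqOver R →ₐ[R] Module.End R (⨁ k, G k)} (hP : ∀ k M, P k M → Obj (Bd R) (omPart k) M)
    (hF : ∀ k M, P k M → P (k + 1) (Ffun k M)) (hE : ∀ k M, P (k + 1) M → P k (Efun k M))
    (hK : ∀ k M, P k M → P k (Kfun k M)) {Ψ : (⨁ k, G k) →ₗ[R] (ℕ →₀ R)}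
    (hΨ : Function.Injective Ψ) (hρ : ∀ a x, Ψ (ρ a x) = starRep (hw R) a (Ψ x))
    (hcls : ∀ k M h, Ψ (DirectSum.lof R ℕ G k (cls k M h)) = Finsupp.single k (sdim R M.deg)) :
    IsInducedAction P G cls ρ := by
  -- Through the injection `Ψ` a class becomes its superdimension times $m^k$, and each functor
  -- multiplies superdimensions by the matrix coefficient of the corresponding generator on the
  -- twisted module.
  refine ⟨fun k M h => ⟨hF k M h, hΨ ?_⟩, fun M h => hΨ ?_, fun k M h => ⟨hE k M h, hΨ ?_⟩,
    fun k M h => ⟨hK k M h, hΨ ?_⟩⟩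
  · rw [hρ, hcls, hcls, starRep_gen, sdim_Ffun (hP k M h), mul_comm]
    exact starF_single _ _ _
  · rw [hρ, hcls, starRep_gen, map_zero]
    exact starE_single_zero _ _
  · rw [hρ, hcls, hcls, starRep_gen, sdim_Efun (hP _ M h), mul_comm]
    exact starE_single_succ _ _ _
  · rw [hρ, hcls, hcls, starRep_gen, sdim_Kfun (hP k M h), mul_comm]
    refine (starK_single _ _ _ _).trans ?_
    rw [zpow_one]

variable (R) in
/-- The Grothendieck groups of the categories of all modules form the twisted module. -/
theorem exists_action_G0 :
    ∃ (ρ : UqOver R →ₐ[R] Module.End R (⨁ k, G0 (cf : R → ℤ → ℤ → ℚ) (Obj (Bd R) (omPart k))))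
      (Φ : (⨁ k, G0 (cf : R → ℤ → ℤ → ℚ) (Obj (Bd R) (omPart k))) ≃ₗ[R] (ℕ →₀ R)),
      IsInducedAction (fun k => Obj (Bd R) (omPart k))
        (fun k => G0 (cf : R → ℤ → ℤ → ℚ) (Obj (Bd R) (omPart k))) (fun _ => G0.cls cf _) ρ ∧
      (∀ a x, Φ (ρ a x) = starRep (hw R) a (Φ x)) ∧
      ∀ k M h, Φ (DirectSum.lof R ℕ (fun k => G0 (cf : R → ℤ → ℤ → ℚ) (Obj (Bd R) (omPart k))) k
        (G0.cls cf _ M h)) = Finsupp.single k (sdim R M.deg) := by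
  have h1 := apply_conjRep (sumEquiv (G0.equiv R)) (starRep (hw R))
  have h2 : ∀ k M h, sumEquiv (G0.equiv R) (DirectSum.lof R ℕ
      (fun k => G0 (cf : R → ℤ → ℤ → ℚ) (Obj (Bd R) (omPart k))) k (G0.cls cf _ M h))
      = Finsupp.single k (sdim R M.deg) := fun _ M h => by
    rw [sumEquiv_lof, G0.equiv_cls]
  exact ⟨conjRep (sumEquiv (G0.equiv R)) (starRep (hw R)), sumEquiv (G0.equiv R),
    isInducedAction_of_sdim (fun _ _ h => h) (fun _ _ => Ffun_obj isBoundedness)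
      (fun _ _ => Efun_obj isBoundedness) (fun _ _ => Kfun_obj isBoundedness)
      (Ψ := (sumEquiv (G0.equiv R)).toLinearMap) (sumEquiv (G0.equiv R)).injective h1 h2, h1, h2⟩

variable (R) in
/-- The split Grothendieck groups of the categories of projective modules form the Verma module. -/
theorem exists_action_K0 :
    ∃ (ρ : UqOver R →ₐ[R]
        Module.End R (⨁ k, K0 (cf : R → ℤ → ℤ → ℚ) (IsProj (Obj (Bd R) (omPart k)))))
      (Φ : (⨁ k, K0 (cf : R → ℤ → ℤ → ℚ) (IsProj (Obj (Bd R) (omPart k))))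
        ≃ₗ[R] Verma R (hw R : R)),
      IsInducedAction (fun k => IsProj (Obj (Bd R) (omPart k)))
        (fun k => K0 (cf : R → ℤ → ℤ → ℚ) (IsProj (Obj (Bd R) (omPart k))))
        (fun _ => K0.cls cf _) ρ ∧
      (∀ a x, Φ (ρ a x) = a • Φ x) ∧
      ∀ k M h, vermaToStar (hw R) (Φ (DirectSum.lof R ℕ
        (fun k => K0 (cf : R → ℤ → ℤ → ℚ) (IsProj (Obj (Bd R) (omPart k)))) k
        (K0.cls cf _ M h))) = Finsupp.single k (sdim R M.deg) := by
  have := SerRing.isDomain R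
  -- The class of `Ω_k` is matched with the canonical vector and the action is transported from the
  -- Verma module. That it is induced by the functors is checked after the injection of the Verma
  -- module into the twisted module.
  let Φ : (⨁ k, K0 (cf : R → ℤ → ℤ → ℚ) (IsProj (Obj (Bd R) (omPart k))))
      ≃ₗ[R] Verma R (hw R : R) := (sumEquiv (K0.equiv R)).trans (canonEquiv (hw R) shap_ne_zero)
  have h1 := apply_conjRep Φ (Algebra.lsmul (A := UqOver R) R R (Verma R (hw R : R)))
  have h2 : ∀ k M h, vermaToStar (hw R) (Φ (DirectSum.lof R ℕ
      (fun k => K0 (cf : R → ℤ → ℤ → ℚ) (IsProj (Obj (Bd R) (omPart k)))) k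
      (K0.cls cf _ M h))) = Finsupp.single k (sdim R M.deg) := fun _ M h => by
    rw [LinearEquiv.trans_apply, sumEquiv_lof, canonEquiv_single, map_smul, vermaToStar_canon,
      Finsupp.smul_single, smul_eq_mul, K0.equiv_cls_mul]
  refine ⟨conjRep Φ (Algebra.lsmul (A := UqOver R) R R (Verma R (hw R : R))), Φ,
    isInducedAction_of_sdim (fun _ _ h => h.1) (fun k _ h => ?_) (fun k _ h => ?_)
      (fun k _ h => ?_) (Ψ := vermaToStar (hw R) ∘ₗ Φ.toLinearMap)
      ((vermaToStar_injective _ shap_ne_zero).comp Φ.injective) (fun a x => ?_) h2, h1, h2⟩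
  -- Projectives are the objects with a homogeneous basis, a property preserved by the functors
  -- because `Ω_{k,k+1}` is free on both sides.
  · obtain ⟨ι, d, hb⟩ := exists_hasHomogBasis isBoundedness (omReg_obj isBoundedness k) h
    obtain ⟨ι', d', hb'⟩ := Ffun_hasHomogBasis isBoundedness h.1 hb
    exact isProj_of_hasHomogBasis (Ffun_obj isBoundedness h.1) hb'
  · obtain ⟨ι, d, hb⟩ := exists_hasHomogBasis isBoundedness (omReg_obj isBoundedness (k + 1)) h
    obtain ⟨ι', d', hb'⟩ := Efun_hasHomogBasis isBoundedness h.1 hb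
    exact isProj_of_hasHomogBasis (Efun_obj isBoundedness h.1) hb'
  · obtain ⟨ι, d, hb⟩ := exists_hasHomogBasis isBoundedness (omReg_obj isBoundedness k) h
    exact isProj_of_hasHomogBasis (Kfun_obj isBoundedness h.1) (hb.shift _)
  · change vermaToStar (hw R) (Φ (conjRep Φ _ a x)) = starRep (hw R) a (vermaToStar (hw R) (Φ x))
    rw [h1, ← vermaToStar_smul]
    rfl

/-- Simple objects are shifts of `S_k`. -/
theorem exists_iso_of_isSimple {k : ℕ} {S : SMod (Om k)} (h : Obj (Bd R) (omPart k) S)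
    (hS : IsSimple S) : ∃ i j ε, S.Iso ((omSimple k).shift (i, j, ε)) ∧
      sdim R S.deg = mono lm i j ε := by
  obtain ⟨⟨i, j, ε⟩, hi⟩ := exists_iso_omSimple_shift h.1 (isBoundedness.cone h.2.2) hS
  refine ⟨i, j, ε, hi, hi.grIso.sdim_eq.trans ((sdim_shift i j ε
    (omSimple_obj (Bd := Bd R) isBoundedness).2.2).trans ?_)⟩
  rw [sdim_omSimple, mul_one]

/-- Indecomposable projective objects are shifts of `Ω_k`. -/
theorem exists_iso_of_isIndec {k : ℕ} {P : SMod (Om k)} (h : IsProj (Obj (Bd R) (omPart k)) P)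
    (hP : IsIndec (Obj (Bd R) (omPart k)) P) : ∃ i j ε, P.Iso ((omReg k).shift (i, j, ε)) ∧
      sdim R P.deg = mono lm i j ε * shap (hw R) k := by
  have hΩ := omReg_obj (Bd := Bd R) isBoundedness k
  obtain ⟨ι, d, hb⟩ := exists_hasHomogBasis isBoundedness hΩ h
  obtain ⟨⟨i, j, ε⟩, hi⟩ := hb.iso_omReg_shift isBoundedness hΩ h.1 hP
  refine ⟨i, j, ε, hi, hi.grIso.sdim_eq.trans ((sdim_shift i j ε hΩ.2.2).trans ?_)⟩
  rw [sdim_omReg]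

end

end VermaCat
end

/-! ### The three isomorphisms of representations -/

theorem mainTheorem1 :
    (∃ (ρ : UqOver LamRing →ₐ[LamRing] Module.End LamRing (⨁ k, K0M k))
        (Φ : (⨁ k, K0M k) ≃ₗ[LamRing] Verma LamRing (muLam : LamRing)),
      IsInducedAction ObjProj K0M (fun k => K0.cls lamCoeff (ObjProj k)) ρ ∧
      (∀ a x, Φ (ρ a x) = a • Φ x) ∧
      (∀ k, ∃ h : ObjProj k (omReg k),
        Φ (DirectSum.lof LamRing ℕ K0M k (K0.cls lamCoeff (ObjProj k) (omReg k) h))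
          = canon LamRing (muLam : LamRing) k) ∧
      (∀ k P (h : ObjProj k P), IsIndec (ObjLam k) P → ∃ i j ε,
        P.Iso ((omReg k).shift (i, j, ε)) ∧
        Φ (DirectSum.lof LamRing ℕ K0M k (K0.cls lamCoeff (ObjProj k) P h))
          = mono lam i j ε • canon LamRing (muLam : LamRing) k)) ∧
    (∃ (ρ : UqOver LamRing →ₐ[LamRing] Module.End LamRing (⨁ k, G0M k))
        (Φ : (⨁ k, G0M k) ≃ₗ[LamRing] (ℕ →₀ LamRing)),
      IsInducedAction ObjLam G0M (fun k => G0.cls lamCoeff (ObjLam k)) ρ ∧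
      (∀ a x, Φ (ρ a x) = starRep muLam a (Φ x)) ∧
      (∀ k, ∃ h : ObjLam k (omSimple k),
        Φ (DirectSum.lof LamRing ℕ G0M k (G0.cls lamCoeff (ObjLam k) (omSimple k) h))
          = (Finsupp.single k 1 : ℕ →₀ LamRing)) ∧
      (∀ k S (h : ObjLam k S), IsSimple S → ∃ i j ε,
        S.Iso ((omSimple k).shift (i, j, ε)) ∧
        Φ (DirectSum.lof LamRing ℕ G0M k (G0.cls lamCoeff (ObjLam k) S h))
          = mono lam i j ε • (Finsupp.single k 1 : ℕ →₀ LamRing))) ∧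
    (∃ (ρ : UqOver HatRing →ₐ[HatRing] Module.End HatRing (⨁ k, G0Hat k))
        (Φ : (⨁ k, G0Hat k) ≃ₗ[HatRing] Verma HatRing (muHat : HatRing)),
      IsInducedAction ObjHat G0Hat (fun k => G0.cls hatCoeff (ObjHat k)) ρ ∧
      (∀ a x, Φ (ρ a x) = a • Φ x) ∧
      (∀ k, ∃ h : ObjHat k (omReg k),
        Φ (DirectSum.lof HatRing ℕ G0Hat k (G0.cls hatCoeff (ObjHat k) (omReg k) h))
          = canon HatRing (muHat : HatRing) k) ∧
      (∀ k P (h : ObjHat k P), IsProj (ObjHat k) P → IsIndec (ObjHat k) P → ∃ i j ε,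
        P.Iso ((omReg k).shift (i, j, ε)) ∧
        Φ (DirectSum.lof HatRing ℕ G0Hat k (G0.cls hatCoeff (ObjHat k) P h))
          = mono lamHat i j ε • canon HatRing (muHat : HatRing) k) ∧
      (∀ k, ∃ h : ObjHat k (omSimple k),
        Φ (DirectSum.lof HatRing ℕ G0Hat k (G0.cls hatCoeff (ObjHat k) (omSimple k) h))
          = dualCanon muHat k) ∧
      (∀ k S (h : ObjHat k S), IsSimple S → ∃ i j ε,
        S.Iso ((omSimple k).shift (i, j, ε)) ∧
        Φ (DirectSum.lof HatRing ℕ G0Hat k (G0.cls hatCoeff (ObjHat k) S h))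
          = mono lamHat i j ε • dualCanon muHat k)) := by
  have := SerRing.isDomain LamRing
  have := SerRing.isDomain HatRing
  refine ⟨?_, ?_, ?_⟩
  · obtain ⟨ρ, Φ, h1, h2, h3⟩ := exists_action_K0 LamRing
    -- Equalities in the Verma module are tested in the twisted module, where the class of `Ω_k` has
    -- coordinate its superdimension, the same as the image of the canonical vector.
    have hinj := vermaToStar_injective (hw LamRing) shap_ne_zero
    refine ⟨ρ, Φ, h1, h2, fun k => ⟨omReg_isProj (SerRing.isBoundedness (R := LamRing)) k, hinj ?_⟩,
      fun k P h hP => ?_⟩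
    · refine (h3 k _ _).trans ?_
      rw [sdim_omReg]
      exact (vermaToStar_canon _ _).symm
    · obtain ⟨i, j, ε, hi, hs⟩ := exists_iso_of_isIndec (R := LamRing) h hP
      refine ⟨i, j, ε, hi, hinj ((h3 k P h).trans ?_)⟩
      refine Eq.trans ?_ (map_smul (vermaToStar (hw LamRing)) _ _).symm
      refine Eq.trans ?_ (congrArg _ (vermaToStar_canon (hw LamRing) k).symm)
      rw [hs, Finsupp.smul_single, smul_eq_mul]
      rfl
  · obtain ⟨ρ, Φ, h1, h2, h3⟩ := exists_action_G0 LamRing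
    refine ⟨ρ, Φ, h1, h2, fun k => ⟨omSimple_obj (SerRing.isBoundedness (R := LamRing)), (h3 k _ _).trans ?_⟩,
      fun k S h hS => ?_⟩
    · rw [sdim_omSimple]
    · obtain ⟨i, j, ε, hi, hs⟩ := exists_iso_of_isSimple (R := LamRing) h hS
      refine ⟨i, j, ε, hi, (h3 k S h).trans ?_⟩
      rw [hs, Finsupp.smul_single, smul_eq_mul, mul_one]
      rfl
  · obtain ⟨ρ, Φ, h1, h2, h3⟩ := exists_action_G0 HatRing
    -- Over the completed ring the embedding of the Verma module in the twisted module is an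
    -- isomorphism, so the identification of the Grothendieck group with the twisted module can be
    -- carried back. It sends $m^k$ to the dual canonical vector.
    let Θ := vermaEquivStar (hw HatRing) isUnit_shap_hat
    have hΘ : ∀ x, vermaToStar (hw HatRing) (Θ.symm x) = x := Θ.apply_symm_apply
    have hinj := vermaToStar_injective (hw HatRing) shap_ne_zero
    refine ⟨ρ, Φ.trans Θ.symm, h1, fun a x => hinj ?_, fun k => ⟨omReg_obj (SerRing.isBoundedness (R := HatRing)) k,
      hinj ?_⟩, fun k P h hP hP' => ?_, fun k => ⟨omSimple_obj (SerRing.isBoundedness (R := HatRing)), hinj ?_⟩,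
      fun k S h hS => ?_⟩
    · refine (hΘ _).trans ((h2 a x).trans (Eq.trans ?_ (vermaToStar_smul (hw HatRing) _ _).symm))
      exact congrArg _ (hΘ _).symm
    · refine (hΘ _).trans ((h3 k _ _).trans ?_)
      rw [sdim_omReg]
      exact (vermaToStar_canon _ _).symm
    · obtain ⟨i, j, ε, hi, hs⟩ := exists_iso_of_isIndec (R := HatRing) hP hP'
      refine ⟨i, j, ε, hi, hinj ((hΘ _).trans ((h3 k P h).trans ?_))⟩
      refine Eq.trans ?_ (map_smul (vermaToStar (hw HatRing)) _ _).symm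
      refine Eq.trans ?_ (congrArg _ (vermaToStar_canon (hw HatRing) k).symm)
      rw [hs, Finsupp.smul_single, smul_eq_mul]
      rfl
    · refine (hΘ _).trans ((h3 k _ _).trans ?_)
      rw [sdim_omSimple]
      exact (vermaToStar_dualCanon (hw HatRing) (isUnit_shap_hat k)).symm
    · obtain ⟨i, j, ε, hi, hs⟩ := exists_iso_of_isSimple (R := HatRing) h hS
      refine ⟨i, j, ε, hi, hinj ((hΘ _).trans ((h3 k S h).trans ?_))⟩
      refine Eq.trans ?_ (map_smul (vermaToStar (hw HatRing)) _ _).symm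
      refine Eq.trans ?_ (congrArg _ (vermaToStar_dualCanon (hw HatRing) (isUnit_shap_hat k)).symm)
      rw [hs, Finsupp.smul_single, smul_eq_mul, mul_one]
      rfl
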